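/- Let $C=(v_1,\dots,v_n)$, $n\ge 2$, be a simple (not self-intersecting) polygonal chain in the plane. $C$ is \emph{threadable} if a continuous family of orientation-preserving rigid motions carries $C$ from one open side of a line $L$ to the other, so that at every time $C$ meets $L$ in no point other than a fixed point $o\in L$ (the hole). For a point $p\in C$ let $H^+(p)$ and $H^-(p)$ be the convex hulls of the parts of $C$ from $v_1$ to $p$ and from $p$ to $v_n$, and let the butterfly $\mathrm{bf}(p)$ be the set of lines that meet $C$ exactly in $p$ and have the part of $C$ before $p$ strictly on one side and the part after $p$ strictly on the other. A non-empty $\mathrm{bf}(p)$ is an open double wedge, bounded by two wing-lines (which coincide if $C$ is straight), and so has a bisecting line. There are a program for a real RAM (unit-cost $+,-,\times,/,\sqrt{\ }$ and comparisons of real numbers; unit-cost increment, decrement and comparison of natural numbers; unit-cost indirect addressing) and a constant $K$ such that, for every such chain, the program, given $n$ and the coordinates of the vertices, halts within $Kn$ steps, and the following hold. 1. It answers correctly whether $C$ is threadable. 2. During the run it maintains the growing upper hull: there are events $v_1=p_0,p_1,\dots,p_m$ in order along $C$ and strictly increasing moments $\tau_0,\dots,\tau_m$ of the run, consecutive ones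 at most $K$ steps apart, such that at the moment $\tau_j$ an array holds the indices of the vertices of $H^+(p)$ other than $p$, in counterclockwise order starting from $p$, for every $p$ strictly between $p_j$ and $p_{j+1}$, and at the moment $\tau_m$ it holds them for $p=p_m$. Either $p_m=v_n$, or all points of $C$ shortly after $p_m$ lie in $H^+(p_m)$. In the same way it maintains the lower hulls $H^-(p)$, as $p$ moves from $v_n$ towards $v_1$. The answer is ``threadable'' if and only if both processes reach the other end of $C$. 3. If $C$ is threadable, the output also contains a list of at most $Kn$ elementary rigid motions that, performed in order, form one continuous rigid motion threading $C$ from $v_1$ in the hole to $v_n$ in the hole: while $p$ is in the hole, $L$ is the bisecting line of $\mathrm{bf}(p)$. In an elementary rigid motion $p$ slides along a part of one edge while the rotation is monotonic, and throughout the interior of that part the two wing-lines of $\mathrm{bf}(p)$ pass through two fixed vertices of $C$ (different from $p$); it is output as the edge, the initial and the final position of $p$ on it, and these two vertices. -/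

import Mathlib

namespace Threading

/-! ### Polygonal chains, threadability, butterflies -/

/-- The `k`-th vertex of a chain with vertices `v 0, …, v (n - 1)` (and `0` for `k ≥ n`). -/
noncomputable def vtx {n : ℕ} (v : Fin n → ℂ) (k : ℕ) : ℂ :=
  if h : k < n then v ⟨k, h⟩ else 0

/-- The parameter of the last point of a chain with `n` vertices. -/
def lastParam (n : ℕ) : ℝ := (n : ℝ) - 1

/-- The piecewise linear parametrization of the chain on `[0, n - 1]`: the parameter `k + t` with
`0 ≤ t ≤ 1` is the point `(1 - t) v_k + t v_{k+1}`. The plane is `ℂ`. -/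
noncomputable def curve {n : ℕ} (v : Fin n → ℂ) (s : ℝ) : ℂ :=
  vtx v ⌊s⌋₊ + ((s - (⌊s⌋₊ : ℝ) : ℝ) : ℂ) * (vtx v (⌊s⌋₊ + 1) - vtx v ⌊s⌋₊)

/-- The chain as a point set. -/
noncomputable def chainSet {n : ℕ} (v : Fin n → ℂ) : Set ℂ :=
  curve v '' Set.Icc 0 (lastParam n)

/-- The chain does not intersect itself (in particular all its edges have positive length). -/
def IsSimpleChain {n : ℕ} (v : Fin n → ℂ) : Prop :=
  Set.InjOn (curve v) (Set.Icc 0 (lastParam n))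

/-- `C` is threadable: there is a continuous family of orientation preserving rigid motions
`z ↦ u t * z + b t` of the plane (`u t` on the unit circle) that carries `C` from one open side of
the real axis to the other one, such that at no time a point of the moving copy of `C` lies on the
real axis, except possibly at the origin. -/
def Threadable (C : Set ℂ) : Prop :=
  ∃ (u : unitInterval → Circle) (b : unitInterval → ℂ), Continuous u ∧ Continuous b ∧
    (∀ z ∈ C, ((u 0 : ℂ) * z + b 0).im < 0) ∧
    (∀ z ∈ C, 0 < ((u 1 : ℂ) * z + b 1).im) ∧
    (∀ t, ∀ z ∈ C, ((u t : ℂ) * z + b t).im = 0 → (u t : ℂ) * z + b t = 0)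

/-- The rigid motion that takes the point `curve v s` to the origin and turns the direction
`exp (i θ)` to the vertical direction `i`. It takes the line through `curve v s` with normal
direction `exp (i θ)` to the real axis. -/
noncomputable def place {n : ℕ} (v : Fin n → ℂ) (s θ : ℝ) (z : ℂ) : ℂ :=
  Complex.I * Complex.exp (-(θ * Complex.I)) * (z - curve v s)

/-- The butterfly at `p = curve v s`: the lines `L` through `p` that meet the chain only in `p` and
properly cross it there. A line is given by the angle `θ` of its normal that points to the side
of the part of the chain before `p`, so this is a `2π`-periodic set of angles. -/
def butterfly {n : ℕ} (v : Fin n → ℂ) (s : ℝ) : Set ℝ :=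
  {θ | (∀ s' ∈ Set.Icc 0 (lastParam n), s' < s → 0 < (place v s θ (curve v s')).im) ∧
       (∀ s' ∈ Set.Icc 0 (lastParam n), s < s' → (place v s θ (curve v s')).im < 0)}

/-- The open interval `(α, β)` of normal angles is (one period of) the butterfly; `α` and `β` are
the normal angles of the two wing-lines, and `(α + β) / 2` is that of the bisecting line. -/
def IsWedge {n : ℕ} (v : Fin n → ℂ) (s α β : ℝ) : Prop :=
  α < β ∧ Set.Ioo α β ⊆ butterfly v s ∧ α ∉ butterfly v s ∧ β ∉ butterfly v s

/-! ### Elementary rigid motions -/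

/-- The finite description of an elementary rigid motion: the point `p` in the hole slides along
the edge from vertex `edge` to vertex `edge + 1`, from parameter `t₀` to parameter `t₁`, while the
two wing-lines of the butterfly at `p` pass through the vertices `wing₁` and `wing₂`. -/
structure Motion where
  edge : ℕ
  t₀ : ℝ
  t₁ : ℝ
  wing₁ : ℕ
  wing₂ : ℕ

noncomputable def Motion.start (m : Motion) : ℝ := m.edge + m.t₀

noncomputable def Motion.finish (m : Motion) : ℝ := m.edge + m.t₁

/-- `m` describes an elementary rigid motion of the chain, in which `θ s` is the normal angle of the
line while the point with parameter `s` is in the hole: a slide along an edge, with a simultaneous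
monotonic rotation, where the line bisects the butterfly and the wing-lines are supported by the
same two vertices all the time. -/
def IsElementary {n : ℕ} (v : Fin n → ℂ) (θ : ℝ → ℝ) (m : Motion) : Prop :=
  m.edge + 1 < n ∧ 0 ≤ m.t₀ ∧ m.t₀ ≤ m.t₁ ∧ m.t₁ ≤ 1 ∧ m.wing₁ < n ∧ m.wing₂ < n ∧
  (MonotoneOn θ (Set.Icc m.start m.finish) ∨ AntitoneOn θ (Set.Icc m.start m.finish)) ∧
  ∀ s ∈ Set.Ioo m.start m.finish, ∃ α β : ℝ, IsWedge v s α β ∧ θ s = (α + β) / 2 ∧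
    vtx v m.wing₁ ≠ curve v s ∧ (place v s α (vtx v m.wing₁)).im = 0 ∧
    vtx v m.wing₂ ≠ curve v s ∧ (place v s β (vtx v m.wing₂)).im = 0

/-- Performed one after the other, the elementary rigid motions of the list `M` thread the chain:
they form one continuous motion `s ↦ place v s (θ s)`, which starts with the first vertex in the
hole and ends with the last one in it. At every moment `s` the line bisects the butterfly; so
only the point with parameter `s` is on the real axis, and it is at the origin. -/
def ThreadsBy {n : ℕ} (v : Fin n → ℂ) (M : List Motion) : Prop :=
  M.head?.map Motion.start = some 0 ∧
  M.getLast?.map Motion.finish = some (lastParam n) ∧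
  M.IsChain (fun m m' => m.finish = m'.start) ∧
  ∃ θ : ℝ → ℝ, ContinuousOn θ (Set.Icc 0 (lastParam n)) ∧
    (∀ s ∈ Set.Icc 0 (lastParam n), ∃ α β : ℝ, IsWedge v s α β ∧ θ s = (α + β) / 2) ∧
    ∀ m ∈ M, IsElementary v θ m

/-! ### A real random access machine with a step count -/

/-- The memory: registers and arrays of natural numbers (counters and indices), and registers and
arrays of real numbers. A program only names finitely many registers and arrays. -/
structure Mem where
  nat : ℕ → ℕ
  real : ℕ → ℝ
  natArr : ℕ → ℕ → ℕ
  realArr : ℕ → ℕ → ℝ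

/-- Elementary instructions; each takes one step. -/
inductive Instr where
  | natConst (r k : ℕ)
  | natCopy (r a : ℕ)
  | natInc (r : ℕ)
  | natDec (r : ℕ)
  | natLoad (r A i : ℕ)
  | natStore (A i r : ℕ)
  | realConst (r : ℕ) (q : ℚ)
  | realCopy (r a : ℕ)
  | realAdd (r a b : ℕ)
  | realSub (r a b : ℕ)
  | realMul (r a b : ℕ)
  | realDiv (r a b : ℕ)
  | realSqrt (r a : ℕ)
  | realLoad (r A i : ℕ)
  | realStore (A i r : ℕ)

noncomputable def Mem.setNat (σ : Mem) (r x : ℕ) : Mem :=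
  { σ with nat := Function.update σ.nat r x }

noncomputable def Mem.setReal (σ : Mem) (r : ℕ) (x : ℝ) : Mem :=
  { σ with real := Function.update σ.real r x }

noncomputable def Mem.setNatArr (σ : Mem) (A i x : ℕ) : Mem :=
  { σ with natArr := Function.update σ.natArr A (Function.update (σ.natArr A) i x) }

noncomputable def Mem.setRealArr (σ : Mem) (A i : ℕ) (x : ℝ) : Mem :=
  { σ with realArr := Function.update σ.realArr A (Function.update (σ.realArr A) i x) }

/-- The effect of an instruction on the memory. In `natLoad`, `natStore`, `realLoad`, `realStore`
the argument `i` names the register that holds the array index. -/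
noncomputable def Instr.apply : Instr → Mem → Mem
  | natConst r k, σ => σ.setNat r k
  | natCopy r a, σ => σ.setNat r (σ.nat a)
  | natInc r, σ => σ.setNat r (σ.nat r + 1)
  | natDec r, σ => σ.setNat r (σ.nat r - 1)
  | natLoad r A i, σ => σ.setNat r (σ.natArr A (σ.nat i))
  | natStore A i r, σ => σ.setNatArr A (σ.nat i) (σ.nat r)
  | realConst r q, σ => σ.setReal r (q : ℝ)
  | realCopy r a, σ => σ.setReal r (σ.real a)
  | realAdd r a b, σ => σ.setReal r (σ.real a + σ.real b)
  | realSub r a b, σ => σ.setReal r (σ.real a - σ.real b)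
  | realMul r a b, σ => σ.setReal r (σ.real a * σ.real b)
  | realDiv r a b, σ => σ.setReal r (σ.real a / σ.real b)
  | realSqrt r a, σ => σ.setReal r (Real.sqrt (σ.real a))
  | realLoad r A i, σ => σ.setReal r (σ.realArr A (σ.nat i))
  | realStore A i r, σ => σ.setRealArr A (σ.nat i) (σ.real r)

/-- Tests on registers; each evaluation takes one step. -/
inductive Test where
  | natLt (a b : ℕ)
  | natEq (a b : ℕ)
  | natNe (a b : ℕ)
  | realLt (a b : ℕ)
  | realLe (a b : ℕ)
  | realEq (a b : ℕ)

def Test.Holds : Test → Mem → Prop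
  | natLt a b, σ => σ.nat a < σ.nat b
  | natEq a b, σ => σ.nat a = σ.nat b
  | natNe a b, σ => σ.nat a ≠ σ.nat b
  | realLt a b, σ => σ.real a < σ.real b
  | realLe a b, σ => σ.real a ≤ σ.real b
  | realEq a b, σ => σ.real a = σ.real b

/-- Programs. -/
inductive Prog where
  | skip
  | instr (c : Instr)
  | seq (P Q : Prog)
  | branch (b : Test) (P Q : Prog)
  | loop (b : Test) (P : Prog)

/-- `Exec P σ tr σ'`: the program `P`, started in the memory `σ`, halts in the memory `σ'`, and `tr`
lists the memory after each single step. The running time is the length of `tr`. -/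
inductive Exec : Prog → Mem → List Mem → Mem → Prop where
  | skip (σ : Mem) : Exec .skip σ [] σ
  | instr (c : Instr) (σ : Mem) : Exec (.instr c) σ [c.apply σ] (c.apply σ)
  | seq {P Q : Prog} {σ σ₁ σ₂ : Mem} {tr₁ tr₂ : List Mem} :
      Exec P σ tr₁ σ₁ → Exec Q σ₁ tr₂ σ₂ → Exec (.seq P Q) σ (tr₁ ++ tr₂) σ₂
  | branchTrue {b : Test} {P Q : Prog} {σ σ₁ : Mem} {tr : List Mem} :
      b.Holds σ → Exec P σ tr σ₁ → Exec (.branch b P Q) σ (σ :: tr) σ₁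
  | branchFalse {b : Test} {P Q : Prog} {σ σ₁ : Mem} {tr : List Mem} :
      ¬ b.Holds σ → Exec Q σ tr σ₁ → Exec (.branch b P Q) σ (σ :: tr) σ₁
  | loopDone {b : Test} {P : Prog} {σ : Mem} :
      ¬ b.Holds σ → Exec (.loop b P) σ [σ] σ
  | loopStep {b : Test} {P : Prog} {σ σ₁ σ₂ : Mem} {tr₁ tr₂ : List Mem} :
      b.Holds σ → Exec P σ tr₁ σ₁ → Exec (.loop b P) σ₁ tr₂ σ₂ →
        Exec (.loop b P) σ (σ :: (tr₁ ++ tr₂)) σ₂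

/-- The initial memory: the number `n` of vertices in the register `0`, their coordinates in the
real arrays `0` and `1`, and `0` everywhere else. -/
noncomputable def inputMem {n : ℕ} (v : Fin n → ℂ) : Mem where
  nat := fun r => if r = 0 then n else 0
  real := fun _ => 0
  natArr := fun _ _ => 0
  realArr := fun A i => if A = 0 then (vtx v i).re else if A = 1 then (vtx v i).im else 0

/-- The output bit (`1` for yes, `0` for no) is in the register `1`. -/
def Mem.answer (σ : Mem) : ℕ := σ.nat 1

/-- The output list of motions: its length is in the register `2`, its entries are in the arrays
`0`, `1`, `2` of natural numbers and `2`, `3` of real numbers. -/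
noncomputable def Mem.motions (σ : Mem) : List Motion :=
  (List.range (σ.nat 2)).map fun i =>
    { edge := σ.natArr 0 i, t₀ := σ.realArr 2 i, t₁ := σ.realArr 3 i,
      wing₁ := σ.natArr 1 i, wing₂ := σ.natArr 2 i }

/-- The entries of the array `A` at the positions from `σ.nat lo` up to, but excluding,
`σ.nat hi`. -/
def Mem.deque (σ : Mem) (A lo hi : ℕ) : List ℕ :=
  (List.range' (σ.nat lo) (σ.nat hi - σ.nat lo)).map (σ.natArr A)

/-! ### Growing hulls -/

/-- `l` lists the vertices of the convex hull of `S`, each one once, in counterclockwise order. -/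
def IsHullList (l : List ℂ) (S : Set ℂ) : Prop :=
  convexHull ℝ {z | z ∈ l} = convexHull ℝ S ∧ l.Nodup ∧
  ∀ a b c : ℂ, [a, b, c].Sublist l → 0 < ((starRingEnd ℂ) (b - a) * (c - a)).im

/-- During the run with the trace `tr`, the hull of the part of the curve `γ` passed so far is
maintained by updates of at most `K` steps each, while the point `p = γ s` moves from `s = 0` to
`s = S`. There are positions `0 = pos 0 ≤ … ≤ pos m = S` of `p` (the events) and moments
`τ 0 < … < τ m` of the run, at most `K` steps apart, such that the array `A` at the moment `τ j`
holds the vertices of the hull of `γ [0, s]` other than `p = γ s`, in counterclockwise order from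
`p`, for all `s` strictly between `pos j` and `pos (j + 1)`; at the moment `τ m` it holds them
for `s = S`. Either `S` is the end `ℓ` of the curve, or there `p` is about to enter the hull. -/
def MaintainsHull {n : ℕ} (v : Fin n → ℂ) (γ : ℝ → ℂ) (ℓ S : ℝ) (K : ℕ) (tr : List Mem)
    (A lo hi : ℕ) : Prop :=
  (∃ (m : ℕ) (τ : ℕ → ℕ) (pos : ℕ → ℝ) (σ : ℕ → Mem),
    pos 0 = 0 ∧ pos m = S ∧ (∀ j < m, pos j ≤ pos (j + 1)) ∧
    (∀ j < m, τ j < τ (j + 1) ∧ τ (j + 1) ≤ τ j + K) ∧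
    (∀ j ≤ m, tr[τ j]? = some (σ j) ∧ ∀ i ∈ (σ j).deque A lo hi, i < n) ∧
    (∀ j < m, ∀ s ∈ Set.Ioo (pos j) (pos (j + 1)),
      IsHullList (γ s :: ((σ j).deque A lo hi).map (vtx v)) (γ '' Set.Icc 0 s)) ∧
    IsHullList (γ S :: ((σ m).deque A lo hi).map (vtx v)) (γ '' Set.Icc 0 S)) ∧
  (S = ℓ ∨ ∃ S' : ℝ, S < S' ∧ S' ≤ ℓ ∧
    ∀ s ∈ Set.Ioc S S', γ s ∈ convexHull ℝ (γ '' Set.Icc 0 S))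

end Threading

/-!
A chain is threadable if and only if every butterfly is non-empty, and this holds if and only if the
chain never enters the convex hull of the part already passed, in neither direction of passage.

*Threadability and butterflies.* During a threading motion consider the signed heights of `v₁`, of a
point `p` and of `vₙ` over the line. The middle one of them changes its sign; when it vanishes, `p`
is in the hole and the line is in the butterfly of `p` (`Threadable.butterfly_nonempty`).
Conversely, let all butterflies be non-empty. On an edge the normals of the lines of the butterfly
are bounded by the extreme arguments of the vectors from `p` to the vertices, taken relative to the
edge and reversed for the vertices passed (`isWedge_frame`). So the bisecting line turns
continuously with `p`, and threads the chain (`threadable_of_butterfly_nonempty`).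

*Butterflies and hulls.* A butterfly line separates `p` from the part of the chain before it, so the
chain does not enter its hull. If it enters the hull in neither direction, then the set of points
with a line that separates the two parts weakly is closed by compactness; and such a line can be
turned into one that separates strictly, and then pushed forward along the chain. Hence this set is
the whole chain (`butterfly_nonempty_of_leavesHulls`).

*Hulls.* The vertices of the hull other than the moving point `p`, in counterclockwise order as seen
from `p`, are kept in a deque. While `p` moves along an edge, two points of the deque can only
become collinear with `p` after the first two or the last two have (`TipMoves.pos`), and then the
first or last vertex has to be removed; the time at which this happens is the zero of a linear
function. At a vertex of the chain, comparing the directions to both ends of the deque decides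
whether the next edge enters the hull, makes the vertex one end of the deque, or leads into the
opposite cone, where the vertex is not needed. There are at most `2 * n + 1` events, since each
vertex is pushed and popped at most once. `Running.step` shows that an event preserves the
invariant, and `exec_passage` gives the result for a complete passage.

*Motions.* In each passage the ends of the deque are points of tangency of the hull, and for each
interval between two events they are written into a log. On the common intervals of both logs, each
wing-line is tangent to the earlier or the later hull; which one is decided by the sign of a
function that is linear along the edge (`Tangents.wings`). With the points of tangency fixed, the
angular velocity of the bisecting line is a quadratic polynomial in the position divided by a
positive function (`isElementary_of_sign`). So a common interval is cut at two zeros of linear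
functions, and each of the three parts at the zeros of a quadratic polynomial, into nine elementary
motions (`body_motions`). As each common interval ends with an entry of one of the logs, there are
linearly many motions (`Merging.exec`).

*The program* is written in a small language of expressions without loops, in which its effect is a
function of the memory. A compiler translates a text of this language into machine instructions
whose number is bounded by a constant (`Code.exec_compile`), and three kinds of loops run such texts
linearly often.
-/

namespace Threading

/-! ### The parametrization of a chain -/

/-- The defining property of the parametrization: it is affine on each edge, end points included. -/
lemma curve_add {n : ℕ} (v : Fin n → ℂ) (k : ℕ) {t : ℝ} (h0 : 0 ≤ t) (h1 : t ≤ 1) :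
    curve v (k + t) = vtx v k + (t : ℂ) * (vtx v (k + 1) - vtx v k) := by
  rcases h1.lt_or_eq with h | rfl
  · have hf : ⌊(k : ℝ) + t⌋₊ = k := by
      rw [Nat.floor_eq_iff (by positivity)]
      exact ⟨by linarith, by linarith⟩
    unfold curve
    rw [hf]
    simp
  · have hf : ⌊(k : ℝ) + 1⌋₊ = k + 1 := by
      rw [show ((k : ℝ) + 1) = ((k + 1 : ℕ) : ℝ) by push_cast; ring, Nat.floor_natCast]
    unfold curve
    rw [hf]
    simp

lemma curve_nat {n : ℕ} (v : Fin n → ℂ) (k : ℕ) : curve v k = vtx v k := by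
  simpa using curve_add v k (le_refl (0 : ℝ)) zero_le_one

lemma lastParam_eq {n : ℕ} (hn : 1 ≤ n) : lastParam n = ((n - 1 : ℕ) : ℝ) := by
  unfold lastParam
  push_cast [Nat.cast_sub hn]
  ring

lemma lastParam_pos {n : ℕ} (hn : 2 ≤ n) : 0 < lastParam n := by
  have : (2 : ℝ) ≤ n := by exact_mod_cast hn
  unfold lastParam
  linarith

lemma natCast_le_lastParam {n k : ℕ} (hk : k < n) : (k : ℝ) ≤ lastParam n := by
  have : ((k + 1 : ℕ) : ℝ) ≤ n := by exact_mod_cast hk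
  unfold lastParam
  push_cast at this
  linarith

lemma natCast_mem_Icc {n k : ℕ} (hk : k < n) : (k : ℝ) ∈ Set.Icc 0 (lastParam n) :=
  ⟨by positivity, natCast_le_lastParam hk⟩

lemma add_one_le_lastParam {n k : ℕ} (hk : k + 1 < n) : (k : ℝ) + 1 ≤ lastParam n := by
  have := natCast_le_lastParam hk
  push_cast at this
  exact this

lemma Icc_edge_subset {n k : ℕ} (hk : k + 1 < n) :
    Set.Icc (k : ℝ) (k + 1) ⊆ Set.Icc 0 (lastParam n) := fun s hs =>
  ⟨le_trans (by positivity) hs.1, hs.2.trans (add_one_le_lastParam hk)⟩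

lemma exists_edge {n : ℕ} (hn : 2 ≤ n) {s : ℝ} (hs : s ∈ Set.Icc 0 (lastParam n)) :
    ∃ k : ℕ, k + 1 < n ∧ (k : ℝ) ≤ s ∧ s ≤ k + 1 := by
  rcases hs.2.lt_or_eq with h | h
  · refine ⟨⌊s⌋₊, ?_, Nat.floor_le hs.1, (Nat.lt_floor_add_one s).le⟩
    have h1 := Nat.floor_le hs.1
    have : ((⌊s⌋₊ + 1 : ℕ) : ℝ) < n := by
      unfold lastParam at h
      push_cast
      linarith
    exact_mod_cast this
  · refine ⟨n - 2, by omega, ?_, ?_⟩ <;>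
    · rw [h, lastParam]
      push_cast [Nat.cast_sub hn]
      linarith

/-- The edge that leaves the point with parameter `s`. -/
lemma exists_edge_right {n : ℕ} {s : ℝ} (hs : 0 ≤ s) (hs' : s < lastParam n) :
    ∃ k : ℕ, k + 1 < n ∧ (k : ℝ) ≤ s ∧ s < k + 1 := by
  refine ⟨⌊s⌋₊, ?_, Nat.floor_le hs, Nat.lt_floor_add_one s⟩
  have h1 := Nat.floor_le hs
  have : ((⌊s⌋₊ + 1 : ℕ) : ℝ) < n := by
    unfold lastParam at hs'
    push_cast
    linarith
  exact_mod_cast this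

/-- The edge that arrives at the point with parameter `s`. -/
lemma exists_edge_left {n : ℕ} {s : ℝ} (hs : 0 < s) (hs' : s ≤ lastParam n) :
    ∃ k : ℕ, k + 1 < n ∧ (k : ℝ) < s ∧ s ≤ k + 1 := by
  have hc : 1 ≤ ⌈s⌉₊ := Nat.one_le_ceil_iff.mpr hs
  have h1 := Nat.ceil_lt_add_one hs.le
  have h2 := Nat.le_ceil s
  refine ⟨⌈s⌉₊ - 1, ?_, ?_, ?_⟩
  · have : ((⌈s⌉₊ : ℕ) : ℝ) < n := by
      unfold lastParam at hs'
      linarith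
    have : ⌈s⌉₊ < n := by exact_mod_cast this
    omega
  · push_cast [Nat.cast_sub hc]
    linarith
  · push_cast [Nat.cast_sub hc]
    linarith

lemma continuousOn_Icc_of_edges {E : Type*} [TopologicalSpace E] {f : ℝ → E} {N : ℕ}
    (h : ∀ k < N, ContinuousOn f (Set.Icc (k : ℝ) (k + 1))) :
    ContinuousOn f (Set.Icc 0 (N : ℝ)) := by
  induction N with
  | zero => simp
  | succ N ih =>
    have h1 := ih fun k hk => h k (by omega)
    have h2 := h N (by omega)
    have := h1.union_of_isClosed h2 isClosed_Icc isClosed_Icc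
    rwa [Set.Icc_union_Icc_eq_Icc (by positivity) (by linarith), ← Nat.cast_succ] at this

lemma curve_eqOn_edge {n : ℕ} (v : Fin n → ℂ) (k : ℕ) :
    Set.EqOn (curve v) (fun s => vtx v k + ((s - k : ℝ) : ℂ) * (vtx v (k + 1) - vtx v k))
      (Set.Icc (k : ℝ) (k + 1)) := by
  intro s hs
  have := curve_add v k (t := s - k) (by linarith [hs.1]) (by linarith [hs.2])
  simpa using this

lemma continuousOn_curve {n : ℕ} (v : Fin n → ℂ) (hn : 1 ≤ n) :
    ContinuousOn (curve v) (Set.Icc 0 (lastParam n)) := by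
  rw [lastParam_eq hn]
  refine continuousOn_Icc_of_edges fun k _ => ?_
  refine ContinuousOn.congr ?_ (curve_eqOn_edge v k)
  fun_prop

lemma vtx_rev {n : ℕ} (v : Fin n → ℂ) {j : ℕ} (hj : j < n) :
    vtx (v ∘ Fin.rev) j = vtx v (n - 1 - j) := by
  unfold vtx
  rw [dif_pos hj, dif_pos (by omega)]
  simp only [Function.comp_apply]
  congr 1
  ext
  simp only [Fin.val_rev]
  omega

lemma curve_rev {n : ℕ} (hn : 2 ≤ n) (v : Fin n → ℂ) {s : ℝ} (hs : s ∈ Set.Icc 0 (lastParam n)) :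
    curve (v ∘ Fin.rev) s = curve v (lastParam n - s) := by
  obtain ⟨k, hk, h1, h2⟩ := exists_edge hn hs
  have e1 := curve_add (v ∘ Fin.rev) k (t := s - k) (by linarith) (by linarith)
  have e2 := curve_add v (n - 2 - k) (t := 1 - (s - k)) (by linarith) (by linarith)
  rw [show (k : ℝ) + (s - k) = s by ring] at e1
  have : ((n - 2 - k : ℕ) : ℝ) + (1 - (s - k)) = lastParam n - s := by
    rw [lastParam, Nat.cast_sub (by omega), Nat.cast_sub hn]
    push_cast
    ring
  rw [this] at e2
  rw [e1, e2, vtx_rev v (by omega), vtx_rev v hk, show n - 1 - k = n - 2 - k + 1 by omega,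
    show n - 1 - (k + 1) = n - 2 - k by omega]
  push_cast
  ring

lemma IsSimpleChain.rev {n : ℕ} (hn : 2 ≤ n) {v : Fin n → ℂ} (hv : IsSimpleChain v) :
    IsSimpleChain (v ∘ Fin.rev) := by
  intro s hs r hr h
  rw [curve_rev hn v hs, curve_rev hn v hr] at h
  have := hv ⟨by linarith [hs.2], by linarith [hs.1]⟩ ⟨by linarith [hr.2], by linarith [hr.1]⟩ h
  linarith

lemma IsSimpleChain.vtx_ne {n : ℕ} {v : Fin n → ℂ} (hv : IsSimpleChain v) {k : ℕ} (hk : k < n)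
    {s : ℝ} (hs : s ∈ Set.Icc 0 (lastParam n)) (h : (k : ℝ) ≠ s) : vtx v k ≠ curve v s := by
  intro e
  rw [← curve_nat] at e
  exact h (hv (natCast_mem_Icc hk) hs e)

lemma IsSimpleChain.edge_ne_zero {n : ℕ} {v : Fin n → ℂ} (hv : IsSimpleChain v) {k : ℕ}
    (hk : k + 1 < n) : vtx v (k + 1) - vtx v k ≠ 0 := by
  rw [sub_ne_zero, ← curve_nat v k]
  exact hv.vtx_ne hk (natCast_mem_Icc (by omega)) (by push_cast; linarith)

/-! ### Heights over a line, and butterflies -/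

/-- The height of `z` in the direction `exp (i θ)`. -/
noncomputable def height (θ : ℝ) (z : ℂ) : ℝ := Real.cos θ * z.re + Real.sin θ * z.im

lemma height_add (θ : ℝ) (z w : ℂ) : height θ (z + w) = height θ z + height θ w := by
  simp only [height, Complex.add_re, Complex.add_im]; ring

lemma height_sub (θ : ℝ) (z w : ℂ) : height θ (z - w) = height θ z - height θ w := by
  simp only [height, Complex.sub_re, Complex.sub_im]; ring

lemma height_real_mul (θ t : ℝ) (z : ℂ) : height θ ((t : ℂ) * z) = t * height θ z := by
  simp [height]; ring

lemma height_add_pi (θ : ℝ) (z : ℂ) : height (θ + Real.pi) z = - height θ z := by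
  simp [height, Real.cos_add_pi, Real.sin_add_pi]; ring

lemma height_eq_re (θ : ℝ) (z : ℂ) :
    height θ z = (Complex.exp (-(θ * Complex.I)) * z).re := by
  rw [← neg_mul, ← Complex.ofReal_neg, Complex.exp_mul_I]
  simp [height, Complex.cos_ofReal_re, Complex.sin_ofReal_re]

lemma continuous_height : Continuous fun p : ℝ × ℂ => height p.1 p.2 := by
  unfold height
  have h1 := Complex.continuous_re
  have h2 := Complex.continuous_im
  fun_prop

lemma place_im {n : ℕ} (v : Fin n → ℂ) (s θ : ℝ) (z : ℂ) :
    (place v s θ z).im = height θ z - height θ (curve v s) := by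
  rw [← height_sub, height_eq_re, place, mul_assoc, Complex.I_mul_im]

lemma convex_height_gt (θ c : ℝ) : Convex ℝ {z : ℂ | c < height θ z} := by
  refine convex_halfSpace_gt ⟨fun z w => height_add θ z w, fun t z => ?_⟩ c
  simpa using height_real_mul θ t z

lemma height_curve_add {n : ℕ} (v : Fin n → ℂ) (θ : ℝ) (k : ℕ) {t : ℝ} (h0 : 0 ≤ t)
    (h1 : t ≤ 1) : height θ (curve v (k + t)) =
      (1 - t) * height θ (vtx v k) + t * height θ (vtx v (k + 1)) := by
  rw [curve_add v k h0 h1, height_add, height_real_mul, height_sub]; ring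

lemma mem_butterfly_iff {n : ℕ} {v : Fin n → ℂ} {s θ : ℝ} : θ ∈ butterfly v s ↔
    (∀ r ∈ Set.Icc 0 (lastParam n), r < s → height θ (curve v s) < height θ (curve v r)) ∧
    (∀ r ∈ Set.Icc 0 (lastParam n), s < r → height θ (curve v r) < height θ (curve v s)) := by
  simp only [butterfly, Set.mem_ofPred_eq, place_im, sub_pos, sub_neg]

lemma mem_butterfly_rev {n : ℕ} (hn : 2 ≤ n) {v : Fin n → ℂ} {s θ : ℝ}
    (hs : s ∈ Set.Icc 0 (lastParam n)) (h : θ ∈ butterfly v s) :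
    θ + Real.pi ∈ butterfly (v ∘ Fin.rev) (lastParam n - s) := by
  rw [mem_butterfly_iff] at h ⊢
  have hs' : lastParam n - s ∈ Set.Icc 0 (lastParam n) := ⟨by linarith [hs.2], by linarith [hs.1]⟩
  simp only [height_add_pi, neg_lt_neg_iff]
  constructor <;> intro r hr hrs <;> rw [curve_rev hn v hr, curve_rev hn v hs', sub_sub_cancel]
  · exact h.2 _ ⟨by linarith [hr.2], by linarith [hr.1]⟩ (by linarith)
  · exact h.1 _ ⟨by linarith [hr.2], by linarith [hr.1]⟩ (by linarith)

/-- As the height is affine on edges, it suffices to look at the vertices before the point. -/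
lemma height_lt_of_vtx {n : ℕ} {v : Fin n → ℂ} {s θ : ℝ} (hs : s ∈ Set.Icc 0 (lastParam n))
    (h : ∀ i : ℕ, i < n → (i : ℝ) < s → height θ (curve v s) < height θ (vtx v i))
    {r : ℝ} (hr : 0 ≤ r) (hrs : r < s) : height θ (curve v s) < height θ (curve v r) := by
  obtain ⟨k, hk, h1, h2⟩ := exists_edge_right hr (hrs.trans_le hs.2)
  have hr' : r = k + (r - k) := by ring
  have e := height_curve_add v θ k (t := r - k) (by linarith) (by linarith)
  rw [← hr'] at e
  have hvk := h k (by omega) (by linarith)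
  rcases le_or_gt ((k : ℝ) + 1) s with hks | hks
  · have hvk1 : height θ (curve v s) ≤ height θ (vtx v (k + 1)) := by
      rcases hks.lt_or_eq with h' | h'
      · exact (h (k + 1) hk (by push_cast; exact h')).le
      · rw [← h', ← curve_nat]; push_cast; exact le_rfl
    rw [e]
    nlinarith
  · have e' := height_curve_add v θ k (t := s - k) (by linarith) (by linarith)
    rw [show (k : ℝ) + (s - k) = s by ring] at e'
    rw [e'] at hvk
    have : height θ (vtx v (k + 1)) < height θ (vtx v k) := by
      by_contra hc
      push Not at hc
      nlinarith
    rw [e, e']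
    nlinarith

/-- Whether a line belongs to a butterfly can be decided at the vertices. -/
lemma mem_butterfly_of_vtx {n : ℕ} (hn : 2 ≤ n) {v : Fin n → ℂ} {s θ : ℝ}
    (hs : s ∈ Set.Icc 0 (lastParam n))
    (h : ∀ i : ℕ, i < n → (i : ℝ) < s → height θ (curve v s) < height θ (vtx v i))
    (h' : ∀ i : ℕ, i < n → s < i → height θ (vtx v i) < height θ (curve v s)) :
    θ ∈ butterfly v s := by
  rw [mem_butterfly_iff]
  refine ⟨fun r hr hrs => height_lt_of_vtx hs h hr.1 hrs, fun r hr hrs => ?_⟩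
  have hs' : lastParam n - s ∈ Set.Icc 0 (lastParam n) := ⟨by linarith [hs.2], by linarith [hs.1]⟩
  have hr' : lastParam n - r ∈ Set.Icc 0 (lastParam n) := ⟨by linarith [hr.2], by linarith [hr.1]⟩
  have := height_lt_of_vtx (v := v ∘ Fin.rev) (θ := θ + Real.pi) hs' ?_ hr'.1 (by linarith)
  · rw [curve_rev hn v hs', curve_rev hn v hr'] at this
    simpa [height_add_pi] using this
  · intro i hi his
    rw [curve_rev hn v hs', vtx_rev v hi]
    simp only [height_add_pi, neg_lt_neg_iff, sub_sub_cancel]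
    refine h' _ (by omega) ?_
    rw [Nat.cast_sub (by omega), Nat.cast_sub (by omega)]
    unfold lastParam at his
    push_cast
    linarith

lemma butterfly_vtx_before {n : ℕ} {v : Fin n → ℂ} {s θ : ℝ} (h : θ ∈ butterfly v s) {i : ℕ}
    (hi : i < n) (his : (i : ℝ) < s) : height θ (curve v s) < height θ (vtx v i) := by
  rw [← curve_nat]
  exact (mem_butterfly_iff.1 h).1 _ (natCast_mem_Icc hi) his

lemma butterfly_vtx_after {n : ℕ} {v : Fin n → ℂ} {s θ : ℝ} (h : θ ∈ butterfly v s) {i : ℕ}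
    (hi : i < n) (his : s < i) : height θ (vtx v i) < height θ (curve v s) := by
  rw [← curve_nat]
  exact (mem_butterfly_iff.1 h).2 _ (natCast_mem_Icc hi) his

/-! ### A threading motion passes every point through the hole -/

/-- Every unit vector is the normal of a height function. -/
lemma exists_angle {u : ℂ} (hu : ‖u‖ = 1) :
    ∃ θ : ℝ, ∀ z : ℂ, height θ z = (starRingEnd ℂ u * z).re := by
  refine ⟨u.arg, fun z => ?_⟩
  have h0 : u ≠ 0 := by
    rintro rfl
    simp at hu
  simp [height, Complex.cos_arg h0, Complex.sin_arg, hu]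

/-- The middle one of three numbers. The sign of the middle one of the heights of the two ends and
of a point `p` of the chain changes only when `p` passes the line with the ends on different
sides. -/
noncomputable def middle (a b c : ℝ) : ℝ := max (min a b) (min c (max a b))

lemma middle_eq_zero {a b c : ℝ} (h : middle a b c = 0) :
    (a = 0 ∧ b * c ≤ 0) ∨ (b = 0 ∧ a * c ≤ 0) ∨ (c = 0 ∧ a * b ≤ 0) := by
  unfold middle at h
  rcases le_total a b with h1 | h1 <;> rcases le_total c a with h2 | h2 <;>
    rcases le_total c b with h3 | h3 <;> simp [h1, h2, h3] at h <;>
    first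
      | exact Or.inl ⟨h, by nlinarith⟩
      | exact Or.inr (Or.inl ⟨h, by nlinarith⟩)
      | exact Or.inr (Or.inr ⟨h, by nlinarith⟩)

lemma exists_zero_of_mul_nonpos {f : ℝ → ℝ} {a b : ℝ} (hab : a ≤ b)
    (hf : ContinuousOn f (Set.Icc a b)) (h : f a * f b ≤ 0) : ∃ c ∈ Set.Icc a b, f c = 0 := by
  rcases le_total (f a) 0 with h1 | h1
  · rcases h1.lt_or_eq with h1 | h1
    · exact intermediate_value_Icc hab hf ⟨h1.le, by nlinarith⟩
    · exact ⟨a, ⟨le_rfl, hab⟩, h1⟩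
  · rcases h1.lt_or_eq with h1 | h1
    · exact intermediate_value_Icc' hab hf ⟨by nlinarith, h1.le⟩
    · exact ⟨a, ⟨le_rfl, hab⟩, h1.symm⟩

/-- A threadable chain has a butterfly line at each of its points `p`. During the motion the middle
one of the heights of `p` and of the two ends changes its sign. When it vanishes, `p` is in the hole
and the ends are on different sides of the line, because a point of the chain in the hole is unique.
-/
theorem Threadable.butterfly_nonempty {n : ℕ} (hn : 2 ≤ n) {v : Fin n → ℂ} (hv : IsSimpleChain v)
    (h : Threadable (chainSet v)) {s : ℝ} (hs : s ∈ Set.Icc 0 (lastParam n)) :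
    (butterfly v s).Nonempty := by
  obtain ⟨u, b, hu, hb, hstart, hend, hline⟩ := h
  have hl := (lastParam_pos hn).le
  have hγ := continuousOn_curve v (by omega : 1 ≤ n)
  set ℓ := lastParam n with hℓ
  -- `f t r` is the height of the point with parameter `r` at the time `t`
  set f : unitInterval → ℝ → ℝ := fun t r => ((u t : ℂ) * curve v r + b t).im with hf
  have hmem : ∀ r ∈ Set.Icc 0 ℓ, curve v r ∈ chainSet v := fun r hr => ⟨r, hr, rfl⟩
  have h0 : (0 : ℝ) ∈ Set.Icc 0 ℓ := ⟨le_rfl, hl⟩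
  have h1 : ℓ ∈ Set.Icc 0 ℓ := ⟨hl, le_rfl⟩
  have hft : ∀ r, Continuous fun t => f t r := by
    intro r
    have : Continuous fun t => (u t : ℂ) := continuous_subtype_val.comp hu
    exact Complex.continuous_im.comp ((this.mul continuous_const).add hb)
  have hfr : ∀ t, ContinuousOn (f t) (Set.Icc 0 ℓ) := fun t =>
    Complex.continuous_im.comp_continuousOn ((continuousOn_const.mul hγ).add continuousOn_const)
  have huniq : ∀ t, ∀ r ∈ Set.Icc 0 ℓ, ∀ r' ∈ Set.Icc 0 ℓ, f t r = 0 → f t r' = 0 → r = r' := by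
    intro t r hr r' hr' e e'
    have e1 := hline t _ (hmem r hr) e
    have e2 := hline t _ (hmem r' hr') e'
    have : (u t : ℂ) * curve v r = (u t : ℂ) * curve v r' := by
      linear_combination e1 - e2
    exact hv hr hr' (mul_left_cancel₀ (Circle.coe_ne_zero _) this)
  -- the middle height is negative at the beginning and positive at the end
  obtain ⟨t, ht⟩ : ∃ t, middle (f t 0) (f t s) (f t ℓ) = 0 := by
    have hc : Continuous fun t => middle (f t 0) (f t s) (f t ℓ) := by
      unfold middle
      exact ((hft 0).min (hft s)).max ((hft ℓ).min ((hft 0).max (hft s)))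
    refine mem_range_of_exists_le_of_exists_ge hc ⟨0, ?_⟩ ⟨1, ?_⟩
    · have a1 : f 0 0 < 0 := hstart _ (hmem 0 h0)
      have a2 : f 0 s < 0 := hstart _ (hmem s hs)
      unfold middle
      exact max_le (min_le_of_left_le a1.le) (min_le_of_right_le (max_le a1.le a2.le))
    · have a1 : 0 < f 1 0 := hend _ (hmem 0 h0)
      have a2 : 0 < f 1 s := hend _ (hmem s hs)
      unfold middle
      exact le_max_of_le_left (le_min a1.le a2.le)
  have hsub : ∀ {x y : ℝ}, 0 ≤ x → y ≤ ℓ → Set.Icc x y ⊆ Set.Icc 0 ℓ :=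
    fun hx hy => Set.Icc_subset_Icc hx hy
  -- if an end is in the hole, then the other two heights have different signs, and the chain would
  -- be in the hole a second time between them, unless `s` is that end
  have key : f t s = 0 ∧ f t 0 * f t ℓ ≤ 0 := by
    rcases middle_eq_zero ht with ⟨e, e'⟩ | ⟨e, e'⟩ | ⟨e, e'⟩
    · obtain ⟨c, hc, hc'⟩ := exists_zero_of_mul_nonpos hs.2 ((hfr t).mono (hsub hs.1 le_rfl)) e'
      have := huniq t 0 h0 c (hsub hs.1 le_rfl hc) e hc'
      have : s = 0 := le_antisymm (by linarith [hc.1]) hs.1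
      subst this
      exact ⟨e, by rw [e]; simp⟩
    · exact ⟨e, e'⟩
    · obtain ⟨c, hc, hc'⟩ := exists_zero_of_mul_nonpos hs.1 ((hfr t).mono (hsub le_rfl hs.2)) e'
      have := huniq t ℓ h1 c (hsub le_rfl hs.2 hc) e hc'
      have : s = ℓ := le_antisymm hs.2 (by linarith [hc.2])
      rw [this]
      exact ⟨e, by rw [e]; simp⟩
  obtain ⟨hs0, hends⟩ := key
  have hne : ∀ r ∈ Set.Icc 0 ℓ, r ≠ s → f t r ≠ 0 := fun r hr hrs e =>
    hrs (huniq t r hr s hs e hs0)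
  -- on either side of `s` the height does not change its sign
  have hsame : ∀ r r', r ∈ Set.Icc 0 ℓ → r' ∈ Set.Icc 0 ℓ → r ≤ r' →
      (s < r ∨ r' < s) → 0 < f t r * f t r' := by
    intro r r' hr hr' hrr hcase
    by_contra hc
    obtain ⟨c, hc, hc'⟩ := exists_zero_of_mul_nonpos hrr ((hfr t).mono (hsub hr.1 hr'.2))
      (not_lt.1 hc)
    refine hne c (hsub hr.1 hr'.2 hc) ?_ hc'
    rcases hcase with h | h
    · linarith [hc.1]
    · linarith [hc.2]
  -- the orientation of the line for which the part before `s` is on the positive side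
  obtain ⟨ε, hε, hbef, haft⟩ : ∃ ε : ℝ, |ε| = 1 ∧ (∀ r ∈ Set.Icc 0 ℓ, r < s → 0 < ε * f t r) ∧
      (∀ r ∈ Set.Icc 0 ℓ, s < r → ε * f t r < 0) := by
    have hb0 : ∀ r ∈ Set.Icc 0 ℓ, r < s → 0 < f t 0 * f t r := fun r hr hrs =>
      hsame 0 r h0 hr hr.1 (Or.inr hrs)
    have ha0 : ∀ r ∈ Set.Icc 0 ℓ, s < r → 0 < f t r * f t ℓ := fun r hr hrs =>
      hsame r ℓ hr h1 hr.2 (Or.inl hrs)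
    have hsgn : (0 ≤ f t 0 ∧ f t ℓ ≤ 0) ∨ (f t 0 ≤ 0 ∧ 0 ≤ f t ℓ) := by
      rcases mul_nonpos_iff.1 hends with h | h <;> tauto
    rcases hsgn with ⟨e1, e2⟩ | ⟨e1, e2⟩
    · exact ⟨1, by simp, fun r hr hrs => by nlinarith [hb0 r hr hrs],
        fun r hr hrs => by nlinarith [ha0 r hr hrs]⟩
    · exact ⟨-1, by simp, fun r hr hrs => by nlinarith [hb0 r hr hrs],
        fun r hr hrs => by nlinarith [ha0 r hr hrs]⟩
  obtain ⟨θ, hθ⟩ := exists_angle (u := starRingEnd ℂ ((ε : ℂ) * (-Complex.I) * u t)) (by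
    simp [hε, Circle.norm_coe])
  have hval : ∀ r, height θ (curve v r) - height θ (curve v s) = ε * f t r := by
    intro r
    have e : f t r = f t r - f t s := by rw [hs0, sub_zero]
    rw [e, ← height_sub, hθ]
    simp [hf]
    ring
  refine ⟨θ, mem_butterfly_iff.2 ⟨fun r hr hrs => ?_, fun r hr hrs => ?_⟩⟩
  · linarith [hval r, hbef r hr hrs]
  · linarith [hval r, haft r hr hrs]

/-! ### Chains that never enter their own hulls -/

/-- A butterfly line separates the point from the hull of the part of the chain before it. -/
lemma curve_notMem_convexHull_of_butterfly {n : ℕ} {v : Fin n → ℂ} {r s : ℝ}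
    (hrs : r < s) (hs : s ≤ lastParam n) (h : (butterfly v s).Nonempty) :
    curve v s ∉ convexHull ℝ (curve v '' Set.Icc 0 r) := by
  obtain ⟨θ, hθ⟩ := h
  intro hm
  have : convexHull ℝ (curve v '' Set.Icc 0 r) ⊆ {z | height θ (curve v s) < height θ z} := by
    refine convexHull_min ?_ (convex_height_gt θ _)
    rintro _ ⟨x, hx, rfl⟩
    exact (mem_butterfly_iff.1 hθ).1 x ⟨hx.1, by linarith [hx.2]⟩ (by linarith [hx.2])
  exact lt_irrefl (height θ (curve v s)) (Set.mem_ofPred.1 (this hm))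

/-- At no vertex does the edge that starts there enter the hull of the chain up to that vertex. -/
def LeavesHulls {n : ℕ} (w : Fin n → ℂ) (N : ℕ) : Prop :=
  ∀ k < N, ∀ t ∈ Set.Ioc (0 : ℝ) 1, curve w (k + t) ∉ convexHull ℝ (curve w '' Set.Icc 0 k)

/-- A chain whose edges leave the hulls at their initial vertices never meets an earlier hull. If a
point of an edge were in the hull of the chain up to an earlier point of the same edge, then it
would also be in the hull `H` of the chain up to the initial vertex `P` of the edge: some point of
`H` lies on the ray from `P` beyond it. -/
lemma LeavesHulls.notMem {n : ℕ} {w : Fin n → ℂ} (h : LeavesHulls w (n - 1)) {r s : ℝ}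
    (h0 : 0 ≤ r) (hrs : r < s) (hs : s ≤ lastParam n) :
    curve w s ∉ convexHull ℝ (curve w '' Set.Icc 0 r) := by
  obtain ⟨k, hk, hks, hsk⟩ := exists_edge_left (h0.trans_lt hrs) hs
  have hσ := h k (by omega) (s - k) ⟨by linarith, by linarith⟩
  rw [show (k : ℝ) + (s - k) = s by ring] at hσ
  rcases le_or_gt r k with hrk | hrk
  · exact fun hm => hσ (convexHull_mono (Set.image_mono (Set.Icc_subset_Icc_right hrk)) hm)
  intro hm
  set H := convexHull ℝ (curve w '' Set.Icc 0 (k : ℝ)) with hH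
  have hp0 : vtx w k ∈ H := by
    rw [← curve_nat]
    exact subset_convexHull _ _ ⟨k, ⟨by positivity, le_rfl⟩, rfl⟩
  have er := curve_add w k (t := r - k) (by linarith) (by linarith)
  have es := curve_add w k (t := s - k) (by linarith) (by linarith)
  rw [show (k : ℝ) + (r - k) = r by ring] at er
  rw [show (k : ℝ) + (s - k) = s by ring] at es
  set d := vtx w (k + 1) - vtx w k with hd
  have hsub : convexHull ℝ (curve w '' Set.Icc 0 r) ⊆ convexHull ℝ (insert (curve w r) H) := by
    refine convexHull_min ?_ (convex_convexHull ℝ _)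
    rintro _ ⟨x, hx, rfl⟩
    rcases le_or_gt x k with hxk | hxk
    · exact subset_convexHull _ _ (Or.inr (subset_convexHull _ _ ⟨x, ⟨hx.1, hxk⟩, rfl⟩))
    · have ex := curve_add w k (t := x - k) (by linarith) (by linarith [hx.2])
      rw [show (k : ℝ) + (x - k) = x by ring] at ex
      refine segment_subset_convexHull (x := vtx w k) (y := curve w r) (Or.inr hp0) (Or.inl rfl)
        ⟨1 - (x - k) / (r - k), (x - k) / (r - k), ?_, ?_, by ring, ?_⟩
      · rw [sub_nonneg, div_le_one (by linarith)]
        linarith [hx.2]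
      · exact div_nonneg (by linarith) (by linarith)
      · rw [ex, er]
        have : ((r - k : ℝ) : ℂ) ≠ 0 := by
          exact_mod_cast (sub_pos.2 hrk).ne'
        have h3 : (((x - k) / (r - k) : ℝ) : ℂ) * ((r - k : ℝ) : ℂ) = ((x - k : ℝ) : ℂ) := by
          push_cast at this ⊢
          field_simp
        simp only [Complex.real_smul, Complex.ofReal_sub, Complex.ofReal_one] at *
        linear_combination d * h3
  have hm' := hsub hm
  rw [convexHull_insert ⟨_, hp0⟩, (convex_convexHull ℝ _).convexHull_eq] at hm'
  simp only [convexJoin_singleton_left, Set.mem_iUnion] at hm'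
  obtain ⟨z, hz, a, b, ha, hb, hab, e⟩ := hm'
  have hd0 : d ≠ 0 := by
    intro h0
    rw [h0, mul_zero, add_zero] at es
    exact hσ (es ▸ hp0)
  -- `z` is on the ray from the vertex `k` through `curve w s`, not before `curve w s`
  have hbne : b ≠ 0 := by
    rintro rfl
    have ha1 : a = 1 := by linarith
    subst ha1
    simp only [one_smul, zero_smul, add_zero, er, es, add_right_inj] at e
    have := mul_right_cancel₀ hd0 e
    have : r - k = s - k := by exact_mod_cast this
    linarith
  have hb0 : 0 < b := lt_of_le_of_ne hb (Ne.symm hbne)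
  set τ := (s - r) / b + (r - k) with hτ
  have hsr : s - r ≤ (s - r) / b := by
    rw [le_div_iff₀ hb0]
    nlinarith
  have hzτ : z = vtx w k + (τ : ℂ) * d := by
    have hbc : (b : ℂ) ≠ 0 := by exact_mod_cast hbne
    have hac : (a : ℂ) = 1 - b := by
      rw [← Complex.ofReal_one, ← hab]; push_cast; ring
    rw [er, es] at e
    simp only [Complex.real_smul] at e
    rw [hτ]
    push_cast at e ⊢
    apply mul_left_cancel₀ hbc
    rw [hac] at e
    field_simp
    linear_combination e
  have hτ0 : 0 < τ := by linarith
  apply hσ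
  refine (convex_convexHull ℝ _).segment_subset hp0 hz
    ⟨1 - (s - k) / τ, (s - k) / τ, ?_, ?_, by ring, ?_⟩
  · rw [sub_nonneg, div_le_one hτ0]
    linarith
  · exact div_nonneg (by linarith) hτ0.le
  · have : (((s - k) / τ : ℝ) : ℂ) * (τ : ℂ) = ((s - k : ℝ) : ℂ) := by
      rw [← Complex.ofReal_mul]
      field_simp
    rw [hzτ, es]
    simp only [Complex.real_smul, Complex.ofReal_sub, Complex.ofReal_one] at *
    linear_combination d * this

/-! ### Butterflies of chains that never enter their own hulls -/

/-- The line through `curve v s` with normal angle `θ` weakly separates the part of the chain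
before that point from the part after it. -/
def WeaklySeparates {n : ℕ} (v : Fin n → ℂ) (s θ : ℝ) : Prop :=
  (∀ r ∈ Set.Icc 0 s, height θ (curve v s) ≤ height θ (curve v r)) ∧
  (∀ r ∈ Set.Icc s (lastParam n), height θ (curve v r) ≤ height θ (curve v s))

lemma weaklySeparates_of_mem_butterfly {n : ℕ} {v : Fin n → ℂ} {s θ : ℝ}
    (hs : s ∈ Set.Icc 0 (lastParam n)) (h : θ ∈ butterfly v s) : WeaklySeparates v s θ := by
  rw [mem_butterfly_iff] at h
  constructor <;> intro r hr
  · rcases hr.2.lt_or_eq with h' | rfl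
    · exact (h.1 r ⟨hr.1, h'.le.trans hs.2⟩ h').le
    · exact le_rfl
  · rcases hr.1.lt_or_eq with h' | rfl
    · exact (h.2 r ⟨hs.1.trans h'.le, hr.2⟩ h').le
    · exact le_rfl

lemma height_rotate (θ δ : ℝ) (z : ℂ) : height (θ + δ) z =
    Real.cos δ * height θ z + Real.sin δ * height (θ + Real.pi / 2) z := by
  simp only [height, Real.cos_add, Real.sin_add, Real.cos_pi_div_two, Real.sin_pi_div_two]
  ring

/-- Two orthogonal heights are coordinates. -/
lemma eq_of_height {θ : ℝ} {z w : ℂ} (h : height θ z = height θ w)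
    (h' : height (θ + Real.pi / 2) z = height (θ + Real.pi / 2) w) : z = w := by
  simp only [height, Real.cos_add_pi_div_two, Real.sin_add_pi_div_two] at h h'
  have := Real.sin_sq_add_cos_sq θ
  apply Complex.ext
  · linear_combination Real.cos θ * h - Real.sin θ * h' - (z.re - w.re) * this
  · linear_combination Real.sin θ * h + Real.cos θ * h' - (z.im - w.im) * this

/-- Finitely many vectors of a closed half plane lie in a common open half plane with almost the
same normal, if those on its boundary all point in the same direction. -/
lemma exists_rotation_pos {ι : Type*} (J : Finset ι) (z : ι → ℂ) (θ : ℝ)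
    (h : ∀ i ∈ J, 0 ≤ height θ (z i)) (hne : ∀ i ∈ J, z i ≠ 0)
    (hopp : ∀ i ∈ J, ∀ j ∈ J, height θ (z i) = 0 → height θ (z j) = 0 →
      0 < height (θ + Real.pi / 2) (z i) → ¬ height (θ + Real.pi / 2) (z j) < 0) :
    ∃ θ', ∀ i ∈ J, 0 < height θ' (z i) := by
  -- `ε` is the direction of rotation that moves the vectors of the boundary into the half plane
  obtain ⟨ε, hε, hside⟩ : ∃ ε : ℝ, |ε| = 1 ∧
      ∀ i ∈ J, height θ (z i) = 0 → 0 < ε * height (θ + Real.pi / 2) (z i) := by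
    by_cases hex : ∃ j ∈ J, height θ (z j) = 0 ∧ height (θ + Real.pi / 2) (z j) < 0
    · obtain ⟨j, hj, hj0, hj1⟩ := hex
      refine ⟨-1, by simp, fun i hi hi0 => ?_⟩
      have h1 : ¬ 0 < height (θ + Real.pi / 2) (z i) := fun h1 => hopp i hi j hj hi0 hj0 h1 hj1
      have h2 : height (θ + Real.pi / 2) (z i) ≠ 0 := fun h2 =>
        hne i hi (eq_of_height (θ := θ) (by simpa [height] using hi0) (by simpa [height] using h2))
      have := lt_of_le_of_ne (not_lt.1 h1) h2
      linarith
    · push Not at hex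
      refine ⟨1, by simp, fun i hi hi0 => ?_⟩
      have h2 : height (θ + Real.pi / 2) (z i) ≠ 0 := fun h2 =>
        hne i hi (eq_of_height (θ := θ) (by simpa [height] using hi0) (by simpa [height] using h2))
      have := lt_of_le_of_ne (hex i hi hi0) (Ne.symm h2)
      linarith
  have hev : ∀ᶠ δ : ℝ in nhdsWithin 0 (Set.Ioi 0), ∀ i ∈ J, 0 < height (θ + ε * δ) (z i) := by
    rw [Filter.eventually_all_finset]
    intro i hi
    rcases (h i hi).lt_or_eq with hp | hz
    · have hc : Continuous fun δ : ℝ => height (θ + ε * δ) (z i) := by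
        unfold height
        fun_prop
      have : ∀ᶠ δ : ℝ in nhds 0, 0 < height (θ + ε * δ) (z i) :=
        hc.continuousAt.eventually_const_lt (by simpa using hp)
      exact this.filter_mono nhdsWithin_le_nhds
    · have hpi : Set.Ioo (0 : ℝ) Real.pi ∈ nhdsWithin (0 : ℝ) (Set.Ioi 0) :=
        Ioo_mem_nhdsGT Real.pi_pos
      filter_upwards [hpi] with δ hδ
      have hs := Real.sin_pos_of_pos_of_lt_pi hδ.1 hδ.2
      have hsd := hside i hi hz.symm
      rw [height_rotate, ← hz, mul_zero, zero_add]
      rcases (abs_eq zero_le_one).1 hε with rfl | rfl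
      · rw [one_mul] at hsd ⊢
        positivity
      · rw [neg_one_mul, Real.sin_neg]
        nlinarith
  obtain ⟨δ, hδ⟩ := hev.exists
  exact ⟨_, hδ⟩

/-- A weakly separating line can be turned into a butterfly line, when no point of the chain is in
the hull of a part before it or after it: otherwise the line contains two further vertices, and one
of the three points is between the two others. -/
lemma butterfly_nonempty_of_weaklySeparates {n : ℕ} (hn : 2 ≤ n) {v : Fin n → ℂ}
    (hv : IsSimpleChain v)
    (hplus : ∀ r s : ℝ, 0 ≤ r → r < s → s ≤ lastParam n →
      curve v s ∉ convexHull ℝ (curve v '' Set.Icc 0 r))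
    (hminus : ∀ r s : ℝ, 0 ≤ r → r < s → s ≤ lastParam n →
      curve v r ∉ convexHull ℝ (curve v '' Set.Icc s (lastParam n)))
    {s θ : ℝ} (hs : s ∈ Set.Icc 0 (lastParam n)) (h : WeaklySeparates v s θ) :
    (butterfly v s).Nonempty := by
  classical
  set p := curve v s with hp
  set J : Finset ℕ := (Finset.range n).filter fun i : ℕ => (i : ℝ) ≠ s with hJ
  set z : ℕ → ℂ := fun i => if (i : ℝ) < s then vtx v i - p else p - vtx v i with hz
  have hJn : ∀ i ∈ J, i < n ∧ ((i : ℝ) < s ∨ s < i) := by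
    intro i hi
    simp only [hJ, Finset.mem_filter, Finset.mem_range] at hi
    exact ⟨hi.1, lt_or_gt_of_ne hi.2⟩
  have hzb : ∀ i : ℕ, (i : ℝ) < s → z i = vtx v i - p := fun i hi => if_pos hi
  have hza : ∀ i : ℕ, s < (i : ℝ) → z i = p - vtx v i := fun i hi => if_neg (not_lt.2 hi.le)
  have hinB : ∀ i : ℕ, ∀ x : ℝ, (i : ℝ) ≤ x → vtx v i ∈ convexHull ℝ (curve v '' Set.Icc 0 x) :=
    fun i x hx => subset_convexHull _ _ ⟨i, ⟨by positivity, hx⟩, curve_nat v i⟩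
  have hinA : ∀ i : ℕ, ∀ x : ℝ, i < n → x ≤ i →
      vtx v i ∈ convexHull ℝ (curve v '' Set.Icc x (lastParam n)) :=
    fun i x hi hx => subset_convexHull _ _ ⟨i, ⟨hx, natCast_le_lastParam hi⟩, curve_nat v i⟩
  have hpB : p ∈ convexHull ℝ (curve v '' Set.Icc 0 s) :=
    subset_convexHull _ _ ⟨s, ⟨hs.1, le_rfl⟩, rfl⟩
  have hpA : p ∈ convexHull ℝ (curve v '' Set.Icc s (lastParam n)) :=
    subset_convexHull _ _ ⟨s, ⟨le_rfl, hs.2⟩, rfl⟩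
  -- no positive combination of two of the vectors vanishes
  have hcomb : ∀ i ∈ J, ∀ j ∈ J, ∀ x y : ℝ, 0 < x → 0 < y →
      (x : ℂ) * z i + (y : ℂ) * z j ≠ 0 := by
    have hmid : ∀ {a b q : ℂ} {x y : ℝ} {S : Set ℂ}, 0 < x → 0 < y → a ∈ convexHull ℝ S →
        b ∈ convexHull ℝ S → (x : ℂ) * (a - q) + (y : ℂ) * (b - q) = 0 → q ∈ convexHull ℝ S := by
      intro a b q x y S hx hy ha hb e
      refine (convex_convexHull ℝ S).segment_subset ha hb
        ⟨x / (x + y), y / (x + y), by positivity, by positivity, by field_simp, ?_⟩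
      have : ((x : ℂ) + y) ≠ 0 := by exact_mod_cast (add_pos hx hy).ne'
      simp only [Complex.real_smul, Complex.ofReal_div, Complex.ofReal_add]
      field_simp
      linear_combination e
    have hopp : ∀ i j : ℕ, i < n → j < n → (i : ℝ) < s → s < j → ∀ x y : ℝ, 0 < x → 0 < y →
        (x : ℂ) * (vtx v i - p) + (y : ℂ) * (p - vtx v j) ≠ 0 := by
      intro i j hi hj his hjs x y hx hy e
      rcases lt_trichotomy x y with hxy | rfl | hxy
      · refine hplus s j hs.1 hjs (natCast_le_lastParam hj) ?_
        rw [curve_nat]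
        exact hmid (q := vtx v j) (a := vtx v i) (b := p) hx (sub_pos.2 hxy)
          (hinB i s his.le) hpB (by push_cast; linear_combination e)
      · have : (x : ℂ) ≠ 0 := by exact_mod_cast hx.ne'
        have e2 : vtx v i = vtx v j := by
          apply mul_left_cancel₀ this
          linear_combination e
        rw [← curve_nat v j] at e2
        exact hv.vtx_ne hi (natCast_mem_Icc hj) (by linarith) e2
      · refine hminus i s (by positivity) his hs.2 ?_
        rw [curve_nat]
        exact hmid (q := vtx v i) (a := vtx v j) (b := p) hy (sub_pos.2 hxy)
          (hinA j s hj hjs.le) hpA (by push_cast; linear_combination -e)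
    intro i hi j hj x y hx hy e
    obtain ⟨hin, hi'⟩ := hJn i hi
    obtain ⟨hjn, hj'⟩ := hJn j hj
    rcases hi' with hi' | hi' <;> rcases hj' with hj' | hj'
    · rw [hzb i hi', hzb j hj'] at e
      rcases le_total (i : ℝ) j with hij | hij
      · exact hplus j s (by positivity) hj' hs.2 (hmid hx hy (hinB i j hij) (hinB j j le_rfl) e)
      · exact hplus i s (by positivity) hi' hs.2 (hmid hx hy (hinB i i le_rfl) (hinB j i hij) e)
    · rw [hzb i hi', hza j hj'] at e
      exact hopp i j hin hjn hi' hj' x y hx hy e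
    · rw [hza i hi', hzb j hj'] at e
      exact hopp j i hjn hin hj' hi' y x hy hx (by linear_combination e)
    · rw [hza i hi', hza j hj'] at e
      have e' : (x : ℂ) * (vtx v i - p) + (y : ℂ) * (vtx v j - p) = 0 := by linear_combination -e
      rcases le_total (i : ℝ) j with hij | hij
      · exact hminus s i hs.1 hi' (natCast_le_lastParam hin)
          (hmid hx hy (hinA i i hin le_rfl) (hinA j i hjn hij) e')
      · exact hminus s j hs.1 hj' (natCast_le_lastParam hjn)
          (hmid hx hy (hinA i j hin hij) (hinA j j hjn le_rfl) e')
  have hrot : ∃ θ', ∀ i ∈ J, 0 < height θ' (z i) := by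
    refine exists_rotation_pos J z θ ?_ ?_ ?_
    · intro i hi
      obtain ⟨hin, hi' | hi'⟩ := hJn i hi
      · rw [hzb i hi', height_sub, ← curve_nat v i]
        linarith [h.1 i ⟨by positivity, hi'.le⟩]
      · rw [hza i hi', height_sub, ← curve_nat v i]
        linarith [h.2 i ⟨hi'.le, natCast_le_lastParam hin⟩]
    · intro i hi
      obtain ⟨hin, hi' | hi'⟩ := hJn i hi
      · rw [hzb i hi', sub_ne_zero]
        exact hv.vtx_ne hin hs hi'.ne
      · rw [hza i hi', sub_ne_zero]
        exact (hv.vtx_ne hin hs hi'.ne').symm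
    · intro i hi j hj h1 h2 h3 h4
      refine hcomb i hi j hj (- height (θ + Real.pi / 2) (z j)) (height (θ + Real.pi / 2) (z i))
        (by linarith) h3 (eq_of_height (θ := θ) ?_ ?_)
      · rw [height_add, height_real_mul, height_real_mul, h1, h2]
        simp [height]
      · rw [height_add, height_real_mul, height_real_mul]
        simp [height]
        ring
  obtain ⟨θ', hθ'⟩ := hrot
  refine ⟨θ', mem_butterfly_of_vtx hn hs (fun i hi his => ?_) (fun i hi his => ?_)⟩
  · have := hθ' i (by simp [hJ, hi, his.ne])
    rw [hzb i his, height_sub] at this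
    linarith
  · have := hθ' i (by simp [hJ, hi, his.ne'])
    rw [hza i his, height_sub] at this
    linarith

lemma continuous_curve_clamp {n : ℕ} (hn : 1 ≤ n) (v : Fin n → ℂ) :
    Continuous fun s => curve v (max 0 (min s (lastParam n))) := by
  have hl : 0 ≤ lastParam n := by rw [lastParam_eq hn]; positivity
  exact (continuousOn_curve v hn).comp_continuous (by fun_prop)
    fun s => ⟨le_max_left _ _, max_le hl (min_le_right _ _)⟩

lemma clamp_eq {ℓ s : ℝ} (hs : s ∈ Set.Icc 0 ℓ) : max 0 (min s ℓ) = s := by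
  rw [min_eq_left hs.2, max_eq_right hs.1]

/-- The weakly separating pairs of a parameter and a unit normal form a compact set, because the two
parts of the chain are parametrized over `[0, 1]` continuously in the parameter that separates
them. -/
lemma isClosed_weaklySeparates {n : ℕ} (hn : 2 ≤ n) (v : Fin n → ℂ) :
    IsClosed ({s | ∃ θ, WeaklySeparates v s θ} ∩ Set.Icc 0 (lastParam n)) := by
  have hl := (lastParam_pos hn).le
  set ℓ := lastParam n with hℓ
  -- the parametrization, extended continuously to the real line
  set γ : ℝ → ℂ := fun s => curve v (max 0 (min s ℓ)) with hγ
  have hγc : Continuous γ := continuous_curve_clamp (by omega) v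
  have hγe : ∀ s ∈ Set.Icc 0 ℓ, γ s = curve v s := fun s hs => by simp only [hγ, clamp_eq hs]
  set g : ℂ → ℂ → ℝ := fun u z => (starRingEnd ℂ u * z).re with hg
  have hgc : Continuous fun x : ℂ × ℂ => g x.1 x.2 := by
    have h1 := Complex.continuous_re
    have h2 := Complex.continuous_conj
    simp only [hg]
    fun_prop
  set K : Set (ℝ × ℂ) := (Set.Icc 0 ℓ ×ˢ Metric.sphere 0 1) ∩
    ⋂ q ∈ Set.Icc (0 : ℝ) 1, {x | g x.2 (γ x.1) ≤ g x.2 (γ (q * x.1))} ∩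
      {x | g x.2 (γ (x.1 + q * (ℓ - x.1))) ≤ g x.2 (γ x.1)} with hK
  have hKc : IsCompact K := by
    refine (isCompact_Icc.prod (isCompact_sphere 0 1)).inter_right ?_
    refine isClosed_biInter fun q _ => IsClosed.inter ?_ ?_
    · exact isClosed_le (hgc.comp (continuous_snd.prodMk (hγc.comp continuous_fst)))
        (hgc.comp (continuous_snd.prodMk (hγc.comp (by fun_prop))))
    · exact isClosed_le (hgc.comp (continuous_snd.prodMk (hγc.comp (by fun_prop))))
        (hgc.comp (continuous_snd.prodMk (hγc.comp continuous_fst)))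
  convert (hKc.image continuous_fst).isClosed using 1
  ext s
  constructor
  · rintro ⟨⟨θ, hθ⟩, hs⟩
    refine ⟨(s, Complex.exp (θ * Complex.I)), ⟨⟨hs, ?_⟩, ?_⟩, rfl⟩
    · simp [Complex.norm_exp_ofReal_mul_I]
    have hgθ : ∀ z, g (Complex.exp (θ * Complex.I)) z = height θ z := by
      intro z
      rw [height_eq_re, hg]
      simp only [← Complex.exp_conj]
      simp
    simp only [Set.mem_iInter]
    intro q hq
    have h1 : q * s ∈ Set.Icc 0 s := ⟨mul_nonneg hq.1 hs.1, by nlinarith [hq.1, hq.2, hs.1]⟩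
    have h2 : s + q * (ℓ - s) ∈ Set.Icc s ℓ :=
      ⟨by nlinarith [hq.1, hs.2], by nlinarith [hq.2, hs.2]⟩
    refine ⟨?_, ?_⟩
    · show g _ (γ s) ≤ g _ (γ (q * s))
      rw [hgθ, hgθ, hγe s hs, hγe _ ⟨h1.1, h1.2.trans hs.2⟩]
      exact hθ.1 _ h1
    · show g _ (γ (s + q * (ℓ - s))) ≤ g _ (γ s)
      rw [hgθ, hgθ, hγe s hs, hγe _ ⟨hs.1.trans h2.1, h2.2⟩]
      exact hθ.2 _ h2
  · rintro ⟨⟨s', u⟩, ⟨⟨hs, hu⟩, hx⟩, rfl⟩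
    simp only [Set.mem_iInter] at hx
    refine ⟨?_, hs⟩
    have hs' : s' ∈ Set.Icc 0 ℓ := hs
    obtain ⟨θ, hθ⟩ := exists_angle (u := u) (by simpa using hu)
    refine ⟨θ, fun r hr => ?_, fun r hr => ?_⟩
    · rcases hr.1.lt_or_eq with h0 | h0
      · have hpos : 0 < s' := h0.trans_le hr.2
        have := (hx (r / s') ⟨by positivity, (div_le_one hpos).2 hr.2⟩).1
        replace this : g u (γ s') ≤ g u (γ (r / s' * s')) := this
        rw [div_mul_cancel₀ _ hpos.ne', hγe _ hs', hγe _ ⟨hr.1, hr.2.trans hs'.2⟩] at this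
        rw [hθ, hθ]
        exact this
      · have := (hx 0 ⟨le_rfl, zero_le_one⟩).1
        replace this : g u (γ s') ≤ g u (γ (0 * s')) := this
        rw [zero_mul, hγe _ hs', hγe _ ⟨le_rfl, hl⟩] at this
        rw [hθ, hθ, ← h0]
        exact this
    · rcases hr.2.lt_or_eq with h0 | h0
      · have hpos : 0 < ℓ - s' := by linarith [hr.1]
        have := (hx ((r - s') / (ℓ - s')) ⟨div_nonneg (by linarith [hr.1]) hpos.le,
          (div_le_one hpos).2 (by linarith [hr.2])⟩).2
        replace this : g u (γ (s' + (r - s') / (ℓ - s') * (ℓ - s'))) ≤ g u (γ s') := this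
        rw [div_mul_cancel₀ _ hpos.ne', add_sub_cancel, hγe _ hs',
          hγe _ ⟨hs'.1.trans hr.1, hr.2⟩] at this
        rw [hθ, hθ]
        exact this
      · have := (hx 1 ⟨zero_le_one, le_rfl⟩).2
        replace this : g u (γ (s' + 1 * (ℓ - s'))) ≤ g u (γ s') := this
        rw [one_mul, add_sub_cancel, hγe _ hs', hγe _ ⟨hl, le_rfl⟩] at this
        rw [hθ, hθ, h0]
        exact this

/-- A butterfly line can be pushed forward along the edge. -/
lemma butterfly_eventually {n : ℕ} (hn : 2 ≤ n) {v : Fin n → ℂ} {s θ : ℝ} (h0 : 0 ≤ s)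
    (h1 : s < lastParam n) (h : θ ∈ butterfly v s) :
    ∀ᶠ s' in nhdsWithin s (Set.Ioi s), s' ≤ lastParam n ∧ θ ∈ butterfly v s' := by
  obtain ⟨k, hk, hks, hsk⟩ := exists_edge_right h0 h1
  have hs : s ∈ Set.Icc 0 (lastParam n) := ⟨h0, h1.le⟩
  have hγc := continuous_curve_clamp (by omega) v
  have hc : Continuous fun s' => height θ (curve v (max 0 (min s' (lastParam n)))) :=
    continuous_height.comp (continuous_const.prodMk hγc)
  have hev : ∀ᶠ s' in nhdsWithin s (Set.Ioi s), ∀ i ∈ Finset.range n, s < i →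
      height θ (vtx v i) < height θ (curve v (max 0 (min s' (lastParam n)))) := by
    rw [Filter.eventually_all_finset]
    intro i hi
    by_cases hsi : s < i
    · have := butterfly_vtx_after h (Finset.mem_range.1 hi) hsi
      have : ∀ᶠ s' in nhds s,
          height θ (vtx v i) < height θ (curve v (max 0 (min s' (lastParam n)))) :=
        hc.continuousAt.eventually_const_lt (by simpa only [clamp_eq hs] using this)
      exact (this.filter_mono nhdsWithin_le_nhds).mono fun _ h _ => h
    · exact Filter.Eventually.of_forall fun _ h => absurd h hsi
  filter_upwards [hev, Ioo_mem_nhdsGT hsk] with s' h2 hs'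
  have hle : s' ≤ lastParam n := by linarith [hs'.2, add_one_le_lastParam hk]
  have hs'm : s' ∈ Set.Icc 0 (lastParam n) := ⟨h0.trans hs'.1.le, hle⟩
  rw [clamp_eq hs'm] at h2
  refine ⟨hle, mem_butterfly_of_vtx hn hs'm (fun i hi his => ?_) (fun i hi his => ?_)⟩
  · have hik : i < k + 1 := by
      have : (i : ℝ) < ((k + 1 : ℕ) : ℝ) := by push_cast; linarith [hs'.2]
      exact_mod_cast this
    have hik' : (i : ℝ) ≤ k := by exact_mod_cast Nat.lt_succ_iff.1 hik
    have h3 := (mem_butterfly_iff.1 h).2 s' hs'm hs'.1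
    rcases (hik'.trans hks).lt_or_eq with h4 | h4
    · exact h3.trans (butterfly_vtx_before h hi h4)
    · rwa [← curve_nat v i, h4]
  · exact h2 i (Finset.mem_range.2 hi) (hs'.1.trans his)

/-- Every linear functional of the plane is a multiple of a height. -/
lemma exists_height_eq (f : StrongDual ℝ ℂ) : ∃ θ c : ℝ, 0 ≤ c ∧ ∀ z, f z = c * height θ z := by
  have hf : ∀ z : ℂ, f z = f 1 * z.re + f Complex.I * z.im := by
    intro z
    have : z = z.re • (1 : ℂ) + z.im • Complex.I := by
      apply Complex.ext <;> simp
    conv_lhs => rw [this]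
    rw [map_add, map_smul, map_smul, smul_eq_mul, smul_eq_mul]
    ring
  set w : ℂ := ⟨f 1, f Complex.I⟩ with hw
  refine ⟨w.arg, ‖w‖, norm_nonneg _, fun z => ?_⟩
  rw [hf, height]
  have h1 := Complex.norm_mul_cos_arg w
  have h2 := Complex.norm_mul_sin_arg w
  have h1' : f 1 = w.re := rfl
  have h2' : f Complex.I = w.im := rfl
  rw [h1', h2', ← h1, ← h2]
  ring

/-- At the first vertex a butterfly line is obtained by separating it from the hull of the others.
-/
lemma butterfly_zero_nonempty {n : ℕ} (hn : 2 ≤ n) {v : Fin n → ℂ}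
    (h : curve v 0 ∉ convexHull ℝ (curve v '' Set.Icc 1 (lastParam n))) :
    (butterfly v 0).Nonempty := by
  set S : Set ℂ := vtx v '' (Finset.Ico 1 n : Finset ℕ) with hS
  have hSsub : S ⊆ curve v '' Set.Icc 1 (lastParam n) := by
    rintro _ ⟨i, hi, rfl⟩
    have hi' := Finset.mem_Ico.1 (Finset.mem_coe.1 hi)
    exact ⟨i, ⟨by exact_mod_cast hi'.1, natCast_le_lastParam hi'.2⟩, curve_nat v i⟩
  have hc : IsCompact (convexHull ℝ S) :=
    ((Finset.finite_toSet _).image _).isCompact_convexHull ℝ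
  obtain ⟨f, u, hf, hf'⟩ := geometric_hahn_banach_point_closed (convex_convexHull ℝ S) hc.isClosed
    (fun hm => h (convexHull_mono hSsub hm))
  obtain ⟨θ, c, hc0, hθ⟩ := exists_height_eq f
  refine ⟨θ + Real.pi, mem_butterfly_of_vtx hn ⟨le_rfl, (lastParam_pos hn).le⟩
    (fun i _ hi0 => absurd hi0 (by simp)) (fun i hi hi0 => ?_)⟩
  have hi1 : 1 ≤ i := by exact_mod_cast (Nat.cast_pos.1 hi0 : 0 < i)
  have := hf' (vtx v i) (subset_convexHull _ _
    ⟨i, Finset.mem_coe.2 (Finset.mem_Ico.2 ⟨hi1, hi⟩), rfl⟩)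
  rw [height_add_pi, height_add_pi]
  rw [hθ] at hf this
  nlinarith

/-- If neither direction of passage ever enters the hull of the passed part, then there is a
butterfly line at each point. The points with a weakly separating line form a closed set that
contains the first vertex; each such point has a butterfly line, which can be pushed forward, so the
set is the whole chain. -/
theorem butterfly_nonempty_of_leavesHulls {n : ℕ} (hn : 2 ≤ n) {v : Fin n → ℂ}
    (hv : IsSimpleChain v) (h : LeavesHulls v (n - 1)) (h' : LeavesHulls (v ∘ Fin.rev) (n - 1))
    {s : ℝ} (hs : s ∈ Set.Icc 0 (lastParam n)) : (butterfly v s).Nonempty := by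
  have hl := (lastParam_pos hn).le
  have hplus : ∀ r s : ℝ, 0 ≤ r → r < s → s ≤ lastParam n →
      curve v s ∉ convexHull ℝ (curve v '' Set.Icc 0 r) := fun r s hr hrs hs => h.notMem hr hrs hs
  have hminus : ∀ r s : ℝ, 0 ≤ r → r < s → s ≤ lastParam n →
      curve v r ∉ convexHull ℝ (curve v '' Set.Icc s (lastParam n)) := by
    intro r s hr hrs hs
    have := h'.notMem (r := lastParam n - s) (s := lastParam n - r) (by linarith) (by linarith)
      (by linarith)
    rw [curve_rev hn v ⟨by linarith, by linarith⟩, sub_sub_cancel] at this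
    refine fun hm => this (convexHull_mono ?_ hm)
    rintro _ ⟨x, hx, rfl⟩
    refine ⟨lastParam n - x, ⟨by linarith [hx.2], by linarith [hx.1]⟩, ?_⟩
    rw [curve_rev hn v ⟨by linarith [hx.2], by linarith [hx.1]⟩, sub_sub_cancel]
  have hstrict := fun {s θ : ℝ} (hs : s ∈ Set.Icc 0 (lastParam n)) (h : WeaklySeparates v s θ) =>
    butterfly_nonempty_of_weaklySeparates hn hv hplus hminus hs h
  have hsub : Set.Icc 0 (lastParam n) ⊆ {s | ∃ θ, WeaklySeparates v s θ} := by
    refine (isClosed_weaklySeparates hn v).Icc_subset_of_forall_mem_nhdsWithin ?_ ?_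
    · obtain ⟨θ, hθ⟩ := butterfly_zero_nonempty hn fun hm =>
        hminus 0 1 le_rfl one_pos (by simpa using add_one_le_lastParam (k := 0) (by omega)) hm
      exact ⟨θ, weaklySeparates_of_mem_butterfly ⟨le_rfl, hl⟩ hθ⟩
    · rintro x ⟨⟨θ, hx⟩, hx0, hx1⟩
      obtain ⟨θ', hθ'⟩ := hstrict ⟨hx0, hx1.le⟩ hx
      filter_upwards [butterfly_eventually hn hx0 hx1 hθ', self_mem_nhdsWithin] with y hy hxy
      exact ⟨θ', weaklySeparates_of_mem_butterfly ⟨hx0.trans (Set.mem_Ioi.1 hxy).le, hy.1⟩ hy.2⟩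
  obtain ⟨θ, hθ⟩ := hsub hs
  exact hstrict hs hθ

/-! ### Wedges and their bisectors -/

/-- A wedge is determined by any of its elements. -/
lemma IsWedge.eq_of_mem {n : ℕ} {v : Fin n → ℂ} {s α β α' β' x : ℝ} (h : IsWedge v s α β)
    (h' : IsWedge v s α' β') (hx : x ∈ Set.Ioo α β) (hx' : x ∈ Set.Ioo α' β') :
    α = α' ∧ β = β' := by
  obtain ⟨-, h1, h2, h3⟩ := h
  obtain ⟨-, h1', h2', h3'⟩ := h'
  constructor
  · rcases lt_trichotomy α α' with h | h | h
    · exact absurd (h1 ⟨h, hx'.1.trans hx.2⟩) h2'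
    · exact h
    · exact absurd (h1' ⟨h, hx.1.trans hx'.2⟩) h2
  · rcases lt_trichotomy β β' with h | h | h
    · exact absurd (h1' ⟨hx'.1.trans hx.2, h⟩) h3
    · exact h
    · exact absurd (h1 ⟨hx.1.trans hx'.2, h⟩) h3'

lemma height_eq_norm_mul_cos (ω : ℝ) (z : ℂ) : height ω z = ‖z‖ * Real.cos (z.arg - ω) := by
  rw [height, Real.cos_sub, ← Complex.norm_mul_cos_arg z, ← Complex.norm_mul_sin_arg z]
  ring

/-- The vector from `curve v s` to the vertex `i` in coordinates in which the edge `k` points in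
the positive direction, turned by `π` for the vertices up to `k`. For `s` on the edge `k` a line
belongs to the butterfly if all these vectors are strictly on the same side of it. -/
noncomputable def frame {n : ℕ} (v : Fin n → ℂ) (k i : ℕ) (s : ℝ) : ℂ :=
  (if i ≤ k then -1 else 1) *
    ((vtx v i - curve v s) * (starRingEnd ℂ) (vtx v (k + 1) - vtx v k))

/-- `φ` is the angle of the direction opposite to that of the edge `k`. -/
def IsEdgeAngle {n : ℕ} (v : Fin n → ℂ) (k : ℕ) (φ : ℝ) : Prop :=
  vtx v k - vtx v (k + 1) = ‖vtx v (k + 1) - vtx v k‖ * Complex.exp (φ * Complex.I)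

lemma exists_isEdgeAngle {n : ℕ} (v : Fin n → ℂ) (k : ℕ) : ∃ φ, IsEdgeAngle v k φ := by
  refine ⟨(vtx v k - vtx v (k + 1)).arg, ?_⟩
  rw [IsEdgeAngle, norm_sub_rev, Complex.norm_mul_exp_arg_mul_I]

lemma IsEdgeAngle.add_int {n : ℕ} {v : Fin n → ℂ} {k : ℕ} {φ : ℝ} (h : IsEdgeAngle v k φ)
    (m : ℤ) : IsEdgeAngle v k (φ + m * (2 * Real.pi)) := by
  rw [IsEdgeAngle, h]
  congr 1
  push_cast
  rw [add_mul, show (m : ℂ) * (2 * Real.pi) * Complex.I = m * (2 * Real.pi * Complex.I) by ring,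
    Complex.exp_periodic.int_mul m]

lemma IsEdgeAngle.height_add {n : ℕ} {v : Fin n → ℂ} {k : ℕ} {φ : ℝ} (h : IsEdgeAngle v k φ)
    (ω : ℝ) (z : ℂ) : ‖vtx v (k + 1) - vtx v k‖ * height (φ + ω) z =
      - height ω (z * (starRingEnd ℂ) (vtx v (k + 1) - vtx v k)) := by
  have e : (starRingEnd ℂ) (vtx v (k + 1) - vtx v k) =
      - (‖vtx v (k + 1) - vtx v k‖ * Complex.exp (-(φ * Complex.I))) := by
    rw [show vtx v (k + 1) - vtx v k = -(vtx v k - vtx v (k + 1)) by ring, map_neg, h, map_mul,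
      ← Complex.exp_conj]
    simp
  rw [e, height_eq_re, height_eq_re]
  rw [show Complex.exp (-(ω * Complex.I)) *
      (z * -(‖vtx v (k + 1) - vtx v k‖ * Complex.exp (-(φ * Complex.I)))) =
      -((‖vtx v (k + 1) - vtx v k‖ : ℂ) *
        (Complex.exp (-((φ + ω : ℝ) * Complex.I)) * z)) by
    push_cast
    rw [show -((φ + ω : ℂ) * Complex.I) = -(ω * Complex.I) + -(φ * Complex.I) by ring,
      Complex.exp_add]
    ring]
  rw [Complex.neg_re, Complex.re_ofReal_mul, neg_neg]

section Edge

variable {n : ℕ} {v : Fin n → ℂ} {k : ℕ} {s : ℝ}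

lemma curve_sub_vtx (hs : s ∈ Set.Icc (k : ℝ) (k + 1)) :
    curve v s - vtx v k = ((s - k : ℝ) : ℂ) * (vtx v (k + 1) - vtx v k) := by
  rw [curve_eqOn_edge v k hs]
  ring

lemma frame_self (hs : s ∈ Set.Icc (k : ℝ) (k + 1)) :
    frame v k k s = (((s - k) * Complex.normSq (vtx v (k + 1) - vtx v k) : ℝ) : ℂ) := by
  have := curve_sub_vtx (v := v) hs
  rw [frame, if_pos le_rfl, show vtx v k - curve v s = -(curve v s - vtx v k) by ring, this,
    Complex.ofReal_mul, ← Complex.mul_conj]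
  ring

lemma frame_succ (hs : s ∈ Set.Icc (k : ℝ) (k + 1)) :
    frame v k (k + 1) s =
      (((k + 1 - s) * Complex.normSq (vtx v (k + 1) - vtx v k) : ℝ) : ℂ) := by
  have := curve_sub_vtx (v := v) hs
  rw [frame, if_neg (by omega), show vtx v (k + 1) - curve v s =
    (vtx v (k + 1) - vtx v k) - (curve v s - vtx v k) by ring, this,
    Complex.ofReal_mul, ← Complex.mul_conj]
  push_cast
  ring

lemma arg_frame_self (hs : s ∈ Set.Icc (k : ℝ) (k + 1)) : (frame v k k s).arg = 0 := by
  rw [frame_self hs, Complex.arg_ofReal_of_nonneg]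
  exact mul_nonneg (by linarith [hs.1]) (Complex.normSq_nonneg _)

lemma arg_frame_succ (hs : s ∈ Set.Icc (k : ℝ) (k + 1)) : (frame v k (k + 1) s).arg = 0 := by
  rw [frame_succ hs, Complex.arg_ofReal_of_nonneg]
  exact mul_nonneg (by linarith [hs.2]) (Complex.normSq_nonneg _)

lemma frame_ne_zero (hv : IsSimpleChain v) (hk : k + 1 < n) (hs : s ∈ Set.Icc (k : ℝ) (k + 1))
    {i : ℕ} (hi : i < n) (his : (i : ℝ) ≠ s) : frame v k i s ≠ 0 := by
  rw [frame]
  refine mul_ne_zero (by split_ifs <;> simp) (mul_ne_zero ?_ ?_)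
  · exact sub_ne_zero.2 (hv.vtx_ne hi (Icc_edge_subset hk hs) his)
  · exact (map_ne_zero _).2 (hv.edge_ne_zero hk)

lemma IsEdgeAngle.height_frame {φ : ℝ} (h : IsEdgeAngle v k φ) (ω : ℝ) (i : ℕ) (s : ℝ) :
    height ω (frame v k i s) = ‖vtx v (k + 1) - vtx v k‖ * ((if i ≤ k then 1 else -1) *
      (height (φ + ω) (vtx v i) - height (φ + ω) (curve v s))) := by
  have := h.height_add ω (vtx v i - curve v s)
  rw [height_sub] at this
  unfold frame
  split_ifs
  · rw [one_mul, this]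
    simp [height]
    ring
  · rw [one_mul]
    linarith

/-- On the edge `k` the butterfly is given by the vectors of the frame: all of them must have a
positive height. -/
lemma IsEdgeAngle.mem_butterfly_iff {φ : ℝ} (h : IsEdgeAngle v k φ) (hv : IsSimpleChain v)
    (hk : k + 1 < n) (hs : s ∈ Set.Icc (k : ℝ) (k + 1)) (ω : ℝ) :
    φ + ω ∈ butterfly v s ↔ ∀ i < n, (i : ℝ) ≠ s → 0 < height ω (frame v k i s) := by
  have hd : 0 < ‖vtx v (k + 1) - vtx v k‖ := norm_pos_iff.2 (hv.edge_ne_zero hk)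
  have hsm := Icc_edge_subset hk hs
  have hlow : ∀ i : ℕ, i ≤ k → (i : ℝ) ≠ s → (i : ℝ) < s := fun i hi his =>
    lt_of_le_of_ne (le_trans (by exact_mod_cast hi) hs.1) his
  have hhigh : ∀ i : ℕ, ¬ i ≤ k → (i : ℝ) ≠ s → s < (i : ℝ) := fun i hi his =>
    lt_of_le_of_ne (hs.2.trans (by exact_mod_cast (not_le.1 hi))) his.symm
  constructor
  · intro hb i hi his
    rw [h.height_frame]
    refine mul_pos hd ?_
    split_ifs with hik
    · linarith [butterfly_vtx_before hb hi (hlow i hik his)]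
    · linarith [butterfly_vtx_after hb hi (hhigh i hik his)]
  · intro hf
    refine mem_butterfly_of_vtx (by omega) hsm (fun i hi his => ?_) (fun i hi his => ?_)
    · have := hf i hi his.ne
      rw [h.height_frame] at this
      have hik : i ≤ k := by
        by_contra hc
        have : ((k + 1 : ℕ) : ℝ) ≤ i := by exact_mod_cast (not_le.1 hc)
        push_cast at this
        linarith [hs.2]
      rw [if_pos hik] at this
      linarith [pos_of_mul_pos_right this hd.le]
    · have := hf i hi his.ne'
      rw [h.height_frame] at this
      have hik : ¬ i ≤ k := by
        intro hc
        have : (i : ℝ) ≤ k := by exact_mod_cast hc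
        linarith [hs.1]
      rw [if_neg hik] at this
      linarith [pos_of_mul_pos_right this hd.le]

/-- One of the two end points of the edge `k` is different from `curve v s`. -/
lemma exists_endpoint_ne (k : ℕ) (s : ℝ) : ∃ j : ℕ, (j = k ∨ j = k + 1) ∧ (j : ℝ) ≠ s := by
  by_cases h : (k : ℝ) = s
  · exact ⟨k + 1, Or.inr rfl, by push_cast; linarith⟩
  · exact ⟨k, Or.inl rfl, h⟩

/-- All the vectors of the frame are in a common open half plane, and in the slit plane. -/
lemma exists_arg_window {φ : ℝ} (h : IsEdgeAngle v k φ) (hv : IsSimpleChain v)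
    (hk : k + 1 < n) (hs : s ∈ Set.Icc (k : ℝ) (k + 1)) {θ : ℝ} (hθ : θ ∈ butterfly v s) :
    ∃ (m : ℤ) (ω : ℝ), θ + m * (2 * Real.pi) = φ + ω ∧
      ∀ i < n, |(frame v k i s).arg - ω| < Real.pi / 2 := by
  have hpi := Real.pi_pos
  set ω := toIocMod Real.two_pi_pos (-Real.pi) (θ - φ) with hω
  have hωm : ω ∈ Set.Ioc (-Real.pi) (-Real.pi + 2 * Real.pi) :=
    toIocMod_mem_Ioc Real.two_pi_pos (-Real.pi) (θ - φ)
  have hωe : ω = θ - φ - toIocDiv Real.two_pi_pos (-Real.pi) (θ - φ) * (2 * Real.pi) := by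
    rw [hω, toIocMod, zsmul_eq_mul]
  set m := toIocDiv Real.two_pi_pos (-Real.pi) (θ - φ)
  have hcos : ∀ i < n, (i : ℝ) ≠ s → 0 < Real.cos ((frame v k i s).arg - ω) := by
    intro i hi his
    have := (h.mem_butterfly_iff hv hk hs (θ - φ)).1 (by rwa [add_sub_cancel]) i hi his
    rw [height_eq_norm_mul_cos] at this
    have := pos_of_mul_pos_right this (norm_nonneg _)
    rw [hωe]
    rwa [show (frame v k i s).arg - (θ - φ - m * (2 * Real.pi)) =
      (frame v k i s).arg - (θ - φ) + m * (2 * Real.pi) by ring, Real.cos_add_int_mul_two_pi]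
  have harg0 : ∀ j : ℕ, j = k ∨ j = k + 1 → (frame v k j s).arg = 0 := by
    rintro j (rfl | rfl)
    · exact arg_frame_self hs
    · exact arg_frame_succ hs
  -- one of the vectors of the frame points in the positive direction
  have hω2 : |ω| < Real.pi / 2 := by
    obtain ⟨j, hj, hjs⟩ := exists_endpoint_ne k s
    have := hcos j (by omega) hjs
    rw [harg0 j hj, zero_sub, Real.cos_neg] at this
    by_contra hc
    rcases le_abs.1 (not_lt.1 hc) with h | h
    · linarith [Real.cos_nonpos_of_pi_div_two_le_of_le h (by linarith [hωm.2])]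
    · have := Real.cos_nonpos_of_pi_div_two_le_of_le h (by linarith [hωm.1])
      rw [Real.cos_neg] at this
      linarith
  refine ⟨-m, ω, by rw [hωe]; push_cast; ring, fun i hi => ?_⟩
  by_cases his : (i : ℝ) = s
  · have : i = k ∨ i = k + 1 := by
      have h1 : (k : ℝ) ≤ i := by rw [his]; exact hs.1
      have h2 : (i : ℝ) ≤ ((k + 1 : ℕ) : ℝ) := by rw [his]; push_cast; exact hs.2
      have h1' : k ≤ i := by exact_mod_cast h1
      have h2' : i ≤ k + 1 := by exact_mod_cast h2
      omega
    rw [harg0 i this, zero_sub, abs_neg]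
    exact hω2
  · have hc := hcos i hi his
    have h1 := Complex.neg_pi_lt_arg (frame v k i s)
    have h2 := Complex.arg_le_pi (frame v k i s)
    obtain ⟨h3, h4⟩ := abs_lt.1 hω2
    rw [abs_lt]
    constructor
    · by_contra hh
      have := Real.cos_nonpos_of_pi_div_two_le_of_le
        (x := -((frame v k i s).arg - ω)) (by linarith) (by linarith)
      rw [Real.cos_neg] at this
      linarith
    · by_contra hh
      have := Real.cos_nonpos_of_pi_div_two_le_of_le
        (x := (frame v k i s).arg - ω) (by linarith) (by linarith)
      linarith

lemma frame_mem_slitPlane (hv : IsSimpleChain v) (hk : k + 1 < n)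
    (hs : s ∈ Set.Icc (k : ℝ) (k + 1)) (hb : (butterfly v s).Nonempty) {i : ℕ} (hi : i < n)
    (his : (i : ℝ) ≠ s) : frame v k i s ∈ Complex.slitPlane := by
  obtain ⟨φ, h⟩ := exists_isEdgeAngle v k
  obtain ⟨θ, hθ⟩ := hb
  obtain ⟨m, ω, -, hω⟩ := exists_arg_window h hv hk hs hθ
  rw [Complex.mem_slitPlane_iff_arg]
  refine ⟨fun hpi => ?_, frame_ne_zero hv hk hs hi his⟩
  have h1 := abs_lt.1 (hω i hi)
  have h2 := abs_lt.1 (hω k (by omega))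
  rw [hpi] at h1
  rw [arg_frame_self hs] at h2
  linarith [h1.2, h2.1]

/-- The largest argument of the vectors of the frame. -/
noncomputable def maxArg {n : ℕ} (v : Fin n → ℂ) (k : ℕ) (s : ℝ) : ℝ :=
  (insert k (Finset.range n)).sup' (Finset.insert_nonempty _ _) fun i => (frame v k i s).arg

/-- The smallest argument of the vectors of the frame. -/
noncomputable def minArg {n : ℕ} (v : Fin n → ℂ) (k : ℕ) (s : ℝ) : ℝ :=
  (insert k (Finset.range n)).inf' (Finset.insert_nonempty _ _) fun i => (frame v k i s).arg

lemma mem_insert_range_iff {n k i : ℕ} (hk : k + 1 < n) :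
    i ∈ insert k (Finset.range n) ↔ i < n := by
  simp only [Finset.mem_insert, Finset.mem_range]
  omega

lemma maxArg_eq (hk : k + 1 < n) {w : ℕ} (hw : w < n)
    (h : ∀ i < n, (frame v k i s).arg ≤ (frame v k w s).arg) :
    maxArg v k s = (frame v k w s).arg :=
  le_antisymm (Finset.sup'_le _ _ fun i hi => h i ((mem_insert_range_iff hk).1 hi))
    (Finset.le_sup' (fun i => (frame v k i s).arg) ((mem_insert_range_iff hk).2 hw))

lemma minArg_eq (hk : k + 1 < n) {w : ℕ} (hw : w < n)
    (h : ∀ i < n, (frame v k w s).arg ≤ (frame v k i s).arg) :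
    minArg v k s = (frame v k w s).arg :=
  le_antisymm (Finset.inf'_le (fun i => (frame v k i s).arg) ((mem_insert_range_iff hk).2 hw))
    (Finset.le_inf' _ _ fun i hi => h i ((mem_insert_range_iff hk).1 hi))

/-- If the argument of some vector of the frame is `a`, then that of a non-zero one is. -/
lemma exists_frame_arg_eq (hk : k + 1 < n) (hs : s ∈ Set.Icc (k : ℝ) (k + 1)) {i : ℕ}
    (hi : i < n) : ∃ j < n, (j : ℝ) ≠ s ∧ (frame v k j s).arg = (frame v k i s).arg := by
  by_cases his : (i : ℝ) = s
  · obtain ⟨j, hj, hjs⟩ := exists_endpoint_ne k s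
    have hik : i = k ∨ i = k + 1 := by
      have h1 : (k : ℝ) ≤ i := by rw [his]; exact hs.1
      have h2 : (i : ℝ) ≤ ((k + 1 : ℕ) : ℝ) := by rw [his]; push_cast; exact hs.2
      have h1' : k ≤ i := by exact_mod_cast h1
      have h2' : i ≤ k + 1 := by exact_mod_cast h2
      omega
    refine ⟨j, by omega, hjs, ?_⟩
    rcases hj with rfl | rfl <;> rcases hik with rfl | rfl <;>
      simp only [arg_frame_self hs, arg_frame_succ hs]
  · exact ⟨i, hi, his, rfl⟩

/-- On the edge `k` the normals of the wing-lines are orthogonal to the vectors of the frame with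
the extreme arguments. -/
theorem isWedge_frame {φ : ℝ} (h : IsEdgeAngle v k φ) (hv : IsSimpleChain v)
    (hk : k + 1 < n) (hs : s ∈ Set.Icc (k : ℝ) (k + 1)) (hb : (butterfly v s).Nonempty) :
    IsWedge v s (φ - Real.pi / 2 + maxArg v k s) (φ + Real.pi / 2 + minArg v k s) := by
  obtain ⟨θ, hθ⟩ := hb
  obtain ⟨m, ω, -, hω⟩ := exists_arg_window h hv hk hs hθ
  obtain ⟨i, hi, hmax⟩ := Finset.exists_mem_eq_sup' (Finset.insert_nonempty k (Finset.range n))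
    fun i => (frame v k i s).arg
  obtain ⟨j, hj, hmin⟩ := Finset.exists_mem_eq_inf' (Finset.insert_nonempty k (Finset.range n))
    fun i => (frame v k i s).arg
  rw [mem_insert_range_iff hk] at hi hj
  change maxArg v k s = _ at hmax
  change minArg v k s = _ at hmin
  have hnot : ∀ i < n, ∀ ω' : ℝ, Real.cos ((frame v k i s).arg - ω') = 0 →
      φ + ω' ∉ butterfly v s := by
    intro i hi ω' hω' hm
    obtain ⟨j, hj, hjs, e⟩ := exists_frame_arg_eq (v := v) hk hs hi
    have := (h.mem_butterfly_iff hv hk hs ω').1 hm j hj hjs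
    rw [height_eq_norm_mul_cos, e, hω', mul_zero] at this
    exact lt_irrefl _ this
  refine ⟨?_, ?_, ?_, ?_⟩
  · rw [hmax, hmin]
    linarith [(abs_lt.1 (hω i hi)).2, (abs_lt.1 (hω j hj)).1]
  · intro x hx
    have := (h.mem_butterfly_iff hv hk hs (x - φ)).2 ?_
    · rwa [add_sub_cancel] at this
    intro i hi his
    rw [height_eq_norm_mul_cos]
    have h1 : (frame v k i s).arg ≤ maxArg v k s :=
      Finset.le_sup' (fun i => (frame v k i s).arg) ((mem_insert_range_iff hk).2 hi)
    have h2 : minArg v k s ≤ (frame v k i s).arg :=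
      Finset.inf'_le (fun i => (frame v k i s).arg) ((mem_insert_range_iff hk).2 hi)
    refine mul_pos (norm_pos_iff.2 (frame_ne_zero hv hk hs hi his))
      (Real.cos_pos_of_mem_Ioo ⟨?_, ?_⟩)
    · linarith [hx.2]
    · linarith [hx.1]
  · have := hnot i hi (maxArg v k s - Real.pi / 2) (by rw [hmax, sub_sub_cancel]; simp)
    rwa [show φ - Real.pi / 2 + maxArg v k s = φ + (maxArg v k s - Real.pi / 2) by ring]
  · have := hnot j hj (minArg v k s + Real.pi / 2) (by
      rw [hmin, sub_add_cancel_left, Real.cos_neg]; simp)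
    rwa [show φ + Real.pi / 2 + minArg v k s = φ + (minArg v k s + Real.pi / 2) by ring]

/-- The butterfly consists of a single wedge, up to multiples of `2π`. -/
lemma exists_mem_wedge {φ : ℝ} (h : IsEdgeAngle v k φ) (hv : IsSimpleChain v)
    (hk : k + 1 < n) (hs : s ∈ Set.Icc (k : ℝ) (k + 1)) {θ : ℝ} (hθ : θ ∈ butterfly v s) :
    ∃ m : ℤ, θ + m * (2 * Real.pi) ∈
      Set.Ioo (φ - Real.pi / 2 + maxArg v k s) (φ + Real.pi / 2 + minArg v k s) := by
  obtain ⟨m, ω, e, hω⟩ := exists_arg_window h hv hk hs hθ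
  refine ⟨m, ?_⟩
  rw [e]
  obtain ⟨i, hi, hmax⟩ := Finset.exists_mem_eq_sup' (Finset.insert_nonempty k (Finset.range n))
    fun i => (frame v k i s).arg
  obtain ⟨j, hj, hmin⟩ := Finset.exists_mem_eq_inf' (Finset.insert_nonempty k (Finset.range n))
    fun i => (frame v k i s).arg
  rw [mem_insert_range_iff hk] at hi hj
  rw [maxArg, minArg, hmax, hmin]
  constructor
  · linarith [(abs_lt.1 (hω i hi)).2]
  · linarith [(abs_lt.1 (hω j hj)).1]

lemma continuousOn_arg_frame (hv : IsSimpleChain v) (hk : k + 1 < n)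
    (hb : ∀ s ∈ Set.Icc (k : ℝ) (k + 1), (butterfly v s).Nonempty) {i : ℕ} (hi : i < n) :
    ContinuousOn (fun s => (frame v k i s).arg) (Set.Icc (k : ℝ) (k + 1)) := by
  by_cases hik : i = k
  · subst hik
    exact continuousOn_const.congr fun s hs => arg_frame_self hs
  by_cases hik' : i = k + 1
  · subst hik'
    exact continuousOn_const.congr fun s hs => arg_frame_succ hs
  have hc : ContinuousOn (fun s => frame v k i s) (Set.Icc (k : ℝ) (k + 1)) := by
    unfold frame
    have := (continuousOn_curve v (by omega)).mono (Icc_edge_subset hk)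
    exact continuousOn_const.mul ((continuousOn_const.sub this).mul continuousOn_const)
  intro s hs
  refine (Complex.continuousAt_arg (frame_mem_slitPlane hv hk hs (hb s hs) hi ?_)).comp_continuousWithinAt
    (hc s hs)
  rintro rfl
  have h1 : k ≤ i := by exact_mod_cast hs.1
  have h2 : i ≤ k + 1 := by exact_mod_cast hs.2
  omega

end Edge

/-- The bisecting lines of the butterflies have normal angles that depend continuously on the
parameter along the whole chain. -/
theorem exists_bisector {n : ℕ} (hn : 2 ≤ n) {v : Fin n → ℂ} (hv : IsSimpleChain v)
    (hb : ∀ s ∈ Set.Icc 0 (lastParam n), (butterfly v s).Nonempty) :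
    ∃ (θ : ℝ → ℝ) (φ : ℕ → ℝ), ContinuousOn θ (Set.Icc 0 (lastParam n)) ∧
      ∀ k, k + 1 < n → IsEdgeAngle v k (φ k) ∧ ∀ s ∈ Set.Icc (k : ℝ) (k + 1),
        θ s = φ k + (maxArg v k s + minArg v k s) / 2 := by
  have hbk : ∀ k, k + 1 < n → ∀ s ∈ Set.Icc (k : ℝ) (k + 1), (butterfly v s).Nonempty :=
    fun k hk s hs => hb s (Icc_edge_subset hk hs)
  -- the wedges at a common vertex of two edges agree up to a multiple of `2π`; the angle of the
  -- second edge is chosen such that they are equal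
  have step : ∀ (k : ℕ) (φ : ℝ), ∃ φ', k + 2 < n → IsEdgeAngle v k φ →
      IsEdgeAngle v (k + 1) φ' ∧
      φ' + (maxArg v (k + 1) (k + 1 : ℕ) + minArg v (k + 1) (k + 1 : ℕ)) / 2 =
        φ + (maxArg v k (k + 1 : ℕ) + minArg v k (k + 1 : ℕ)) / 2 := by
    intro k φ
    by_cases hk : k + 2 < n
    swap
    · exact ⟨0, fun h => absurd h hk⟩
    by_cases hφ : IsEdgeAngle v k φ
    swap
    · exact ⟨0, fun _ h => absurd h hφ⟩
    have hs : ((k + 1 : ℕ) : ℝ) ∈ Set.Icc (k : ℝ) (k + 1) := ⟨by push_cast; linarith, by simp⟩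
    have hs' : ((k + 1 : ℕ) : ℝ) ∈ Set.Icc ((k + 1 : ℕ) : ℝ) ((k + 1 : ℕ) + 1) :=
      ⟨le_rfl, by linarith⟩
    have hw := isWedge_frame hφ hv (by omega) hs (hbk k (by omega) _ hs)
    obtain ⟨φ₁, hφ₁⟩ := exists_isEdgeAngle v (k + 1)
    obtain ⟨x, hx⟩ := Set.nonempty_Ioo.2 hw.1
    obtain ⟨m, hm⟩ := exists_mem_wedge hφ₁ hv hk hs' (hw.2.1 hx)
    have hφ₂ := hφ₁.add_int (-m)
    refine ⟨φ₁ + (-m : ℤ) * (2 * Real.pi), fun _ _ => ⟨hφ₂, ?_⟩⟩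
    have hw' := isWedge_frame hφ₂ hv hk hs' (hbk (k + 1) hk _ hs')
    have := hw.eq_of_mem hw' hx
      ⟨by push_cast at hm ⊢; linarith [hm.1], by push_cast at hm ⊢; linarith [hm.2]⟩
    linarith [this.1, this.2]
  choose f hf using step
  obtain ⟨φ₀, hφ₀⟩ := exists_isEdgeAngle v 0
  let φ : ℕ → ℝ := fun k => Nat.rec φ₀ f k
  have hφ : ∀ k, k + 1 < n → IsEdgeAngle v k (φ k) := by
    intro k
    induction k with
    | zero => exact fun _ => hφ₀
    | succ k ih => exact fun hk => (hf k (φ k) hk (ih (by omega))).1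
  have hφs : ∀ k, k + 2 < n → φ (k + 1) +
      (maxArg v (k + 1) (k + 1 : ℕ) + minArg v (k + 1) (k + 1 : ℕ)) / 2 =
        φ k + (maxArg v k (k + 1 : ℕ) + minArg v k (k + 1 : ℕ)) / 2 :=
    fun k hk => (hf k (φ k) hk (hφ k (by omega))).2
  -- the last vertex is treated as a point of the edge `n - 2`
  set Θ : ℕ → ℝ → ℝ := fun k s => φ k + (maxArg v k s + minArg v k s) / 2 with hΘ
  have hθ : ∀ k, k + 1 < n → ∀ s ∈ Set.Icc (k : ℝ) (k + 1), Θ (min ⌊s⌋₊ (n - 2)) s = Θ k s := by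
    intro k hk s hs
    rcases hs.2.lt_or_eq with h | h
    · have : ⌊s⌋₊ = k := (Nat.floor_eq_iff (le_trans (by positivity) hs.1)).2 ⟨hs.1, h⟩
      rw [this, min_eq_left (by omega)]
    · have hs1 : s = ((k + 1 : ℕ) : ℝ) := by push_cast; exact h
      have : ⌊s⌋₊ = k + 1 := by rw [hs1, Nat.floor_natCast]
      rw [this]
      rcases (by omega : k + 2 < n ∨ n = k + 2) with h | h
      · rw [min_eq_left (by omega), hs1]
        exact hφs k h
      · rw [h, min_eq_right (by omega)]
        rfl
  refine ⟨fun s => Θ (min ⌊s⌋₊ (n - 2)) s, φ, ?_, fun k hk => ⟨hφ k hk, hθ k hk⟩⟩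
  rw [lastParam_eq (by omega)]
  refine continuousOn_Icc_of_edges fun k hk => ?_
  refine ContinuousOn.congr ?_ (hθ k (by omega))
  have hcont := fun i (hi : i ∈ insert k (Finset.range n)) => continuousOn_arg_frame hv
    (by omega : k + 1 < n) (hbk k (by omega)) ((mem_insert_range_iff (by omega)).1 hi)
  have h1 : ContinuousOn (maxArg v k) (Set.Icc (k : ℝ) (k + 1)) :=
    ContinuousOn.finset_sup'_apply _ hcont
  have h2 : ContinuousOn (minArg v k) (Set.Icc (k : ℝ) (k + 1)) :=
    ContinuousOn.finset_inf'_apply _ hcont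
  exact continuousOn_const.add ((h1.add h2).div_const 2)

lemma exists_wedge_of_bisector {n : ℕ} (hn : 2 ≤ n) {v : Fin n → ℂ} (hv : IsSimpleChain v)
    (hb : ∀ s ∈ Set.Icc 0 (lastParam n), (butterfly v s).Nonempty) {θ : ℝ → ℝ} {φ : ℕ → ℝ}
    (h : ∀ k, k + 1 < n → IsEdgeAngle v k (φ k) ∧ ∀ s ∈ Set.Icc (k : ℝ) (k + 1),
        θ s = φ k + (maxArg v k s + minArg v k s) / 2) {s : ℝ}
    (hs : s ∈ Set.Icc 0 (lastParam n)) : ∃ α β : ℝ, IsWedge v s α β ∧ θ s = (α + β) / 2 := by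
  obtain ⟨k, hk, h1, h2⟩ := exists_edge hn hs
  refine ⟨_, _, isWedge_frame (h k hk).1 hv hk ⟨h1, h2⟩ (hb s hs), ?_⟩
  rw [(h k hk).2 s ⟨h1, h2⟩]
  ring

/-- The bisecting lines thread the chain: they determine a rotation that depends continuously on the
point in the hole. -/
theorem threadable_of_butterfly_nonempty {n : ℕ} (hn : 2 ≤ n) {v : Fin n → ℂ}
    (hv : IsSimpleChain v) (hb : ∀ s ∈ Set.Icc 0 (lastParam n), (butterfly v s).Nonempty) :
    Threadable (chainSet v) := by
  obtain ⟨θ, φ, hθc, hθ⟩ := exists_bisector hn hv hb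
  have hl := (lastParam_pos hn).le
  have hmem : ∀ s ∈ Set.Icc 0 (lastParam n), θ s ∈ butterfly v s := by
    intro s hs
    obtain ⟨α, β, hw, e⟩ := exists_wedge_of_bisector hn hv hb hθ hs
    exact hw.2.1 ⟨by linarith [hw.1], by linarith [hw.1]⟩
  set ℓ := lastParam n with hℓ
  set c : ℝ → ℝ := fun x => max 0 (min x ℓ) with hc
  have hcm : ∀ x, c x ∈ Set.Icc 0 ℓ := fun x => ⟨le_max_left _ _, max_le hl (min_le_right _ _)⟩
  have hcc : Continuous c := by fun_prop
  -- the parameter in the hole is `c (T t)`; before and after the passage the chain is lifted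
  set T : unitInterval → ℝ := fun t => (ℓ + 2) * t - 1 with hT
  have hTc : Continuous T := by fun_prop
  have hθ' : Continuous fun t => θ (c (T t)) :=
    (hθc.comp_continuous hcc hcm).comp hTc
  have hγ' : Continuous fun t => curve v (c (T t)) :=
    (continuous_curve_clamp (by omega) v).comp hTc
  set u : unitInterval → Circle := fun t => Circle.exp (Real.pi / 2 - θ (c (T t))) with hu
  have huc : Continuous u := Circle.exp.continuous.comp (continuous_const.sub hθ')
  have huc' : Continuous fun t => (u t : ℂ) := continuous_subtype_val.comp huc
  have hue : ∀ t, (u t : ℂ) = Complex.I * Complex.exp (-(θ (c (T t)) * Complex.I)) := by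
    intro t
    rw [hu, Circle.coe_exp]
    push_cast
    rw [sub_mul, Complex.exp_sub, Complex.exp_pi_div_two_mul_I, Complex.exp_neg]
    rfl
  set b : unitInterval → ℂ := fun t =>
    -(u t * curve v (c (T t))) + ((T t - c (T t) : ℝ) : ℂ) * Complex.I with hbd
  have hval : ∀ t z, ((u t : ℂ) * z + b t).im =
      height (θ (c (T t))) z - height (θ (c (T t))) (curve v (c (T t))) + (T t - c (T t)) := by
    intro t z
    rw [← place_im, place, ← hue, hbd]
    simp
    ring
  have hside : ∀ t, ∀ r ∈ Set.Icc 0 ℓ,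
      (r < c (T t) → 0 < height (θ (c (T t))) (curve v r) -
        height (θ (c (T t))) (curve v (c (T t)))) ∧
      (c (T t) < r → height (θ (c (T t))) (curve v r) -
        height (θ (c (T t))) (curve v (c (T t))) < 0) := by
    intro t r hr
    have := mem_butterfly_iff.1 (hmem _ (hcm (T t)))
    exact ⟨fun h => sub_pos.2 (this.1 r hr h), fun h => sub_neg.2 (this.2 r hr h)⟩
  have hlow : ∀ t, T t < 0 → ∀ z ∈ chainSet v, ((u t : ℂ) * z + b t).im < 0 := by
    rintro t ht _ ⟨r, hr, rfl⟩
    rw [hval]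
    have hc0 : c (T t) = 0 := by
      simp only [hc]
      rw [min_eq_left (by linarith), max_eq_left ht.le]
    have := (hside t r hr).2
    rw [hc0] at this ⊢
    rcases hr.1.lt_or_eq with h | rfl
    · linarith [this h]
    · linarith
  have hhigh : ∀ t, ℓ < T t → ∀ z ∈ chainSet v, 0 < ((u t : ℂ) * z + b t).im := by
    rintro t ht _ ⟨r, hr, rfl⟩
    rw [hval]
    have hc0 : c (T t) = ℓ := by
      simp only [hc]
      rw [min_eq_right ht.le, max_eq_right hl]
    have := (hside t r hr).1
    rw [hc0] at this ⊢
    rcases hr.2.lt_or_eq with h | rfl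
    · linarith [this h]
    · linarith
  refine ⟨u, b, huc, ?_, hlow 0 ?_, hhigh 1 ?_, ?_⟩
  · exact ((huc'.mul hγ').neg).add
      ((Complex.continuous_ofReal.comp (hTc.sub (hcc.comp hTc))).mul continuous_const)
  · simp [hT]
  · simp [hT]
    linarith
  · intro t z hz e
    have h0 : 0 ≤ T t := not_lt.1 fun h => (hlow t h z hz).ne e
    have h1 : T t ≤ ℓ := not_lt.1 fun h => (hhigh t h z hz).ne' e
    have hcT : c (T t) = T t := clamp_eq ⟨h0, h1⟩
    obtain ⟨r, hr, rfl⟩ := hz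
    rw [hval] at e
    have hr' := hside t r hr
    have : r = c (T t) := by
      rcases lt_trichotomy r (c (T t)) with h | h | h
      · linarith [hr'.1 h]
      · exact h
      · linarith [hr'.2 h]
    rw [hbd]
    simp only
    rw [← this, show T t - r = 0 by rw [this, hcT, sub_self]]
    simp

/-! ### Convex position and points on a ray -/

/-- Twice the signed area of the triangle `a b c`; it is positive if `a`, `b`, `c` are in
counterclockwise order. -/
noncomputable def orient (a b c : ℂ) : ℝ :=
  (b.re - a.re) * (c.im - a.im) - (b.im - a.im) * (c.re - a.re)

lemma orient_eq (a b c : ℂ) : orient a b c = ((starRingEnd ℂ) (b - a) * (c - a)).im := by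
  simp [orient]
  ring

/-- The point of the line `P Q` with parameter `t`. -/
noncomputable def along (P Q : ℂ) (t : ℝ) : ℂ := P + (t : ℂ) * (Q - P)

lemma along_re (P Q : ℂ) (t : ℝ) : (along P Q t).re = P.re + t * (Q.re - P.re) := by
  simp [along]

lemma along_im (P Q : ℂ) (t : ℝ) : (along P Q t).im = P.im + t * (Q.im - P.im) := by
  simp [along]

lemma along_zero (P Q : ℂ) : along P Q 0 = P := by simp [along]

lemma along_one (P Q : ℂ) : along P Q 1 = Q := by simp [along]

lemma orient_along (P Q a b : ℂ) (t : ℝ) :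
    orient (along P Q t) a b = (1 - t) * orient P a b + t * orient Q a b := by
  simp only [orient, along_re, along_im]
  ring

lemma orient_self_left (a b : ℂ) : orient a a b = 0 := by
  simp [orient]

lemma orient_self_right (a b : ℂ) : orient a b b = 0 := by
  simp only [orient]
  ring

lemma orient_self_outer (a b : ℂ) : orient a b a = 0 := by
  simp [orient]

lemma orient_rotate (a b c : ℂ) : orient b c a = orient a b c := by
  simp only [orient]
  ring

lemma orient_swap (a b c : ℂ) : orient a c b = - orient a b c := by
  simp only [orient]
  ring

lemma mem_convex_of_combination {C : Set ℂ} (hC : Convex ℝ C) {x y z p : ℂ} {α β γ : ℝ}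
    (hx : x ∈ C) (hy : y ∈ C) (hz : z ∈ C) (hα : 0 ≤ α) (hβ : 0 ≤ β) (hγ : 0 ≤ γ)
    (hs : 0 < α + β + γ) (hre : α * (x.re - p.re) + β * (y.re - p.re) + γ * (z.re - p.re) = 0)
    (him : α * (x.im - p.im) + β * (y.im - p.im) + γ * (z.im - p.im) = 0) : p ∈ C := by
  have := hC.sum_mem (t := Finset.univ) (w := ![α / (α + β + γ), β / (α + β + γ), γ / (α + β + γ)])
    (z := ![x, y, z]) ?_ ?_ ?_
  · convert this using 1
    simp only [Fin.sum_univ_three, Matrix.cons_val_zero, Matrix.cons_val_one, Matrix.cons_val]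
    apply Complex.ext
    · simp only [Complex.add_re, Complex.real_smul, Complex.re_ofReal_mul]
      field_simp
      linear_combination -hre
    · simp only [Complex.add_im, Complex.real_smul, Complex.im_ofReal_mul]
      field_simp
      linear_combination -him
  · intro i _
    fin_cases i <;> simp <;> positivity
  · simp only [Fin.sum_univ_three, Matrix.cons_val_zero, Matrix.cons_val_one, Matrix.cons_val]
    field_simp
  · intro i _
    fin_cases i <;> simp [hx, hy, hz]

/-- The moment at which the point moving from `P` to `Q` crosses the line `a b`. -/
noncomputable def popTime (P Q a b : ℂ) : ℝ := orient P a b / (orient P a b - orient Q a b)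

/-! ### The hull while its tip moves along an edge -/

/-- The list `D` describes the hull of a chain with the part `S` up to the vertex `P`, while the
last point moves along the edge from `P` to `Q`, from the moment `t₀` until it crosses the line
through two neighbours in `D`. The points of `D` are in convex position, they are seen from the
moving point in counterclockwise order, and together with it they span the hull. -/
structure TipMoves (S : Set ℂ) (P Q : ℂ) (D : List ℂ) (t₀ : ℝ) : Prop where
  ne : D ≠ []
  triple : ∀ a b c : ℂ, [a, b, c].Sublist D → 0 < orient a b c
  start : ∀ a b : ℂ, [a, b].Sublist D →
    0 ≤ orient P a b ∧ (orient P a b = 0 → 0 < orient Q a b)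
  now : ∀ a b : ℂ, [a, b].Sublist D → 0 ≤ orient (along P Q t₀) a b
  sub : ∀ z ∈ D, z ∈ S
  base : P ∈ S
  nonneg : 0 ≤ t₀
  le_one : t₀ ≤ 1
  cover : ∀ t ∈ Set.Icc t₀ 1, 0 < t → S ⊆ convexHull ℝ (insert (along P Q t) {z | z ∈ D})
  leave : ∀ t ∈ Set.Ioc (0 : ℝ) 1, along P Q t ∉ convexHull ℝ S

/-- The first two points of `D` are about to become collinear with the moving point. -/
def PopsFront (P Q : ℂ) (D : List ℂ) (t : ℝ) : Prop :=
  ∃ a b l, D = a :: b :: l ∧ orient Q a b ≤ 0 ∧ 0 < orient P Q a ∧ t = popTime P Q a b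

/-- The last two points of `D` are about to become collinear with the moving point. -/
def PopsBack (P Q : ℂ) (D : List ℂ) (t : ℝ) : Prop :=
  ∃ a b l, D = l ++ [a, b] ∧ orient Q a b ≤ 0 ∧ orient P Q b < 0 ∧ t = popTime P Q a b

lemma popTime_spec {P Q a b : ℂ} (h : 0 ≤ orient P a b)
    (h' : orient P a b = 0 → 0 < orient Q a b) (hQ : orient Q a b ≤ 0) :
    0 < orient P a b ∧ 0 < popTime P Q a b ∧ popTime P Q a b ≤ 1 ∧
      ∀ t, orient (along P Q t) a b =
        (popTime P Q a b - t) * (orient P a b - orient Q a b) := by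
  have h0 : 0 < orient P a b := lt_of_le_of_ne h fun e => by linarith [h' e.symm]
  have h1 : 0 < orient P a b - orient Q a b := by linarith
  refine ⟨h0, div_pos h0 h1, (div_le_one h1).2 (by linarith), fun t => ?_⟩
  rw [orient_along, popTime]
  field_simp
  ring

lemma exists_append_of_pair_sublist {a b : ℂ} {D : List ℂ} (h : [a, b].Sublist D) :
    ∃ l₁ l₂ l₃, D = l₁ ++ a :: (l₂ ++ b :: l₃) := by
  obtain ⟨r₁, r₂, rfl, h1, h2⟩ := List.cons_sublist_iff.1 h
  obtain ⟨s, t, rfl⟩ := List.append_of_mem h1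
  obtain ⟨s', t', rfl⟩ := List.append_of_mem (List.singleton_sublist.1 h2)
  exact ⟨s, t ++ s', t', by simp⟩

lemma eq_cons_cons_of_pair_sublist {a b : ℂ} {D : List ℂ} (h : [a, b].Sublist D)
    (h1 : ∀ c, ¬ [c, a, b].Sublist D) (h2 : ∀ c, ¬ [a, c, b].Sublist D) :
    ∃ l, D = a :: b :: l := by
  obtain ⟨l₁, l₂, l₃, rfl⟩ := exists_append_of_pair_sublist h
  rcases l₁ with _ | ⟨c, l₁⟩
  · rcases l₂ with _ | ⟨c, l₂⟩
    · exact ⟨l₃, rfl⟩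
    · exact absurd (by simp) (h2 c)
  · refine absurd ?_ (h1 c)
    simp only [List.cons_append, List.cons_sublist_cons]
    refine List.Sublist.trans ?_ (List.sublist_append_right _ _)
    simp

lemma eq_append_pair_of_pair_sublist {a b : ℂ} {D : List ℂ} (h : [a, b].Sublist D)
    (h1 : ∀ c, ¬ [a, b, c].Sublist D) (h2 : ∀ c, ¬ [a, c, b].Sublist D) :
    ∃ l, D = l ++ [a, b] := by
  obtain ⟨l₁, l₂, l₃, rfl⟩ := exists_append_of_pair_sublist h
  rcases l₂ with _ | ⟨c, l₂⟩
  · rcases l₃ with _ | ⟨c, l₃⟩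
    · exact ⟨l₁, rfl⟩
    · exact absurd (List.Sublist.trans (by simp) (List.sublist_append_right _ _)) (h1 c)
  · exact absurd (List.Sublist.trans (by simp) (List.sublist_append_right _ _)) (h2 c)

/-- If `p` is on the line `a b` and `P` is to the left of it, then the position of `p` relative to
`a` and `b` can be read off from the direction of the ray from `P` through `p`. -/
lemma collinear_coordinates {P Q a b : ℂ} {t : ℝ} (h0 : 0 < orient P a b)
    (h : orient (along P Q t) a b = 0) :
    ∃ l : ℝ, l * orient P a b = t * orient P Q a ∧ (1 + l) * orient P a b = t * orient P Q b ∧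
      (along P Q t).re = a.re + l * (a.re - b.re) ∧
      (along P Q t).im = a.im + l * (a.im - b.im) := by
  refine ⟨t * orient P Q a / orient P a b, by field_simp, ?_, ?_, ?_⟩
  · rw [add_mul, div_mul_cancel₀ _ h0.ne']
    rw [orient_along] at h
    simp only [orient] at h ⊢
    linear_combination h
  · rw [← mul_right_inj' h0.ne']
    field_simp
    rw [orient_along] at h
    simp only [orient, along_re] at h ⊢
    linear_combination (P.re - a.re) * h
  · rw [← mul_right_inj' h0.ne']
    field_simp
    rw [orient_along] at h
    simp only [orient, along_im] at h ⊢
    linear_combination (P.im - a.im) * h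

/-- Before the first pop the moving point sees the list in counterclockwise order. The first pair
of points of the list that becomes collinear with it consists of neighbours at one of the ends:
the moving point meets the line outside of the segment between the two points, as it does not
enter the hull, and a further point of the list beyond or between them would have been aligned
earlier. -/
theorem TipMoves.pos {S : Set ℂ} {P Q : ℂ} {D : List ℂ} {t₀ t : ℝ} (h : TipMoves S P Q D t₀)
    (ht0 : 0 < t) (ht1 : t ≤ 1) (hF : ∀ T, PopsFront P Q D T → t < T)
    (hB : ∀ T, PopsBack P Q D T → t < T) {a b : ℂ} (hab : [a, b].Sublist D) :
    0 < orient (along P Q t) a b := by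
  classical
  by_contra hneg
  rw [not_lt] at hneg
  set B : Finset (ℂ × ℂ) := (D.toFinset ×ˢ D.toFinset).filter fun x =>
    [x.1, x.2].Sublist D ∧ orient (along P Q t) x.1 x.2 ≤ 0 with hBdef
  have hmemB : ∀ x y, [x, y].Sublist D → orient (along P Q t) x y ≤ 0 → (x, y) ∈ B := by
    intro x y hxy hle
    simp only [hBdef, Finset.mem_filter, Finset.mem_product, List.mem_toFinset]
    exact ⟨⟨hxy.subset (by simp), hxy.subset (by simp)⟩, hxy, hle⟩
  obtain ⟨⟨x, y⟩, hxyB, hmin⟩ := Finset.exists_min_image B (fun x => popTime P Q x.1 x.2)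
    ⟨(a, b), hmemB a b hab hneg⟩
  simp only [hBdef, Finset.mem_filter] at hxyB
  obtain ⟨-, hxy, hle⟩ := hxyB
  -- the line through a bad pair is crossed at its pop time, not after `t`
  have hspec : ∀ x y, [x, y].Sublist D → orient (along P Q t) x y ≤ 0 →
      orient Q x y ≤ 0 ∧ popTime P Q x y ≤ t := by
    intro x y hxy hle
    obtain ⟨h1, h2⟩ := h.start x y hxy
    have hQ : orient Q x y ≤ 0 := by
      by_contra hc
      rw [orient_along] at hle
      nlinarith
    obtain ⟨h3, -, -, h4⟩ := popTime_spec h1 h2 hQ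
    rw [h4 t] at hle
    exact ⟨hQ, by nlinarith⟩
  obtain ⟨hQ, hTt⟩ := hspec x y hxy hle
  obtain ⟨hF0, hT0, hT1, hf⟩ := popTime_spec (h.start x y hxy).1 (h.start x y hxy).2 hQ
  set T := popTime P Q x y with hT
  have hall : ∀ c d, [c, d].Sublist D → 0 ≤ orient (along P Q T) c d := by
    intro c d hcd
    obtain ⟨h1, h2⟩ := h.start c d hcd
    by_cases hc : orient (along P Q t) c d ≤ 0
    · have h3 := hmin (c, d) (hmemB c d hcd hc)
      obtain ⟨h4, -, -, h5⟩ := popTime_spec h1 h2 (hspec c d hcd hc).1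
      rw [h5]
      exact mul_nonneg (by simp only at h3; linarith) (by linarith [(hspec c d hcd hc).1])
    · rw [orient_along] at hc ⊢
      have h6 : t * ((1 - T) * orient P c d + T * orient Q c d) =
        (t - T) * orient P c d + T * ((1 - t) * orient P c d + t * orient Q c d) := by ring
      have h7 : 0 ≤ t * ((1 - T) * orient P c d + T * orient Q c d) := by
        rw [h6]
        exact add_nonneg (mul_nonneg (by linarith) h1) (mul_nonneg hT0.le (by linarith))
      exact nonneg_of_mul_nonneg_right h7 ht0
  have hzero : orient (along P Q T) x y = 0 := by rw [hf]; ring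
  obtain ⟨l, hl1, hl2, hre, him⟩ := collinear_coordinates hF0 hzero
  rcases lt_or_ge 0 l with hl | hl
  · -- the moving point is beyond `x`
    have hfirst : ∃ r, D = x :: y :: r := by
      refine eq_cons_cons_of_pair_sublist hxy (fun c hc => ?_) (fun c hc => ?_)
      · have h1 := hall c x (List.Sublist.trans (by simp) hc)
        have h2 := h.triple _ _ _ hc
        have : orient (along P Q T) c x = - (l * orient c x y) := by
          simp only [orient, hre, him]
          ring
        nlinarith
      · have h1 := hall x c (List.Sublist.trans (by simp) hc)
        have h2 := h.triple _ _ _ hc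
        have : orient (along P Q T) x c = - (l * orient x c y) := by
          simp only [orient, hre, him]
          ring
        nlinarith
    obtain ⟨r, hr⟩ := hfirst
    have : 0 < orient P Q x := by
      have : 0 < T * orient P Q x := by rw [← hl1]; positivity
      exact pos_of_mul_pos_right this hT0.le
    linarith [hF T ⟨x, y, r, hr, hQ, this, rfl⟩]
  rcases lt_or_ge (1 + l) 0 with hl' | hl'
  · -- the moving point is beyond `y`
    have hlast : ∃ r, D = r ++ [x, y] := by
      refine eq_append_pair_of_pair_sublist hxy (fun c hc => ?_) (fun c hc => ?_)
      · have h1 := hall y c (List.Sublist.trans (by simp) hc)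
        have h2 := h.triple _ _ _ hc
        have : orient (along P Q T) y c = (1 + l) * orient x y c := by
          simp only [orient, hre, him]
          ring
        nlinarith
      · have h1 := hall c y (List.Sublist.trans (by simp) hc)
        have h2 := h.triple _ _ _ hc
        have : orient (along P Q T) c y = (1 + l) * orient x c y := by
          simp only [orient, hre, him]
          ring
        nlinarith
    obtain ⟨r, hr⟩ := hlast
    have : orient P Q y < 0 := by
      have : T * orient P Q y < 0 := by rw [← hl2]; exact mul_neg_of_neg_of_pos hl' hF0
      by_contra hc
      nlinarith
    linarith [hB T ⟨x, y, r, hr, hQ, this, rfl⟩]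
  · -- the moving point is between `x` and `y`
    refine h.leave T ⟨hT0, hT1⟩ ?_
    have hx := subset_convexHull ℝ S (h.sub x (hxy.subset (by simp)))
    have hy := subset_convexHull ℝ S (h.sub y (hxy.subset (by simp)))
    refine mem_convex_of_combination (convex_convexHull ℝ S) hx hy hy hl' (neg_nonneg.2 hl) le_rfl
      (by linarith) ?_ ?_
    · rw [hre]; ring
    · rw [him]; ring

/-- A list in convex position that is seen counterclockwise from `p`, and whose points span the
convex hull of `T` together with `p`, is the list of the vertices of this hull other than `p`. -/
lemma isHullList_of_pos {S : Set ℂ} {p : ℂ} {D : List ℂ} {T : Set ℂ}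
    (htriple : ∀ a b c : ℂ, [a, b, c].Sublist D → 0 < orient a b c)
    (hpos : ∀ a b, [a, b].Sublist D → 0 < orient p a b) (hp : p ∉ D)
    (hDS : ∀ z ∈ D, z ∈ S) (hcover : S ⊆ convexHull ℝ (insert p {z | z ∈ D}))
    (hST : S ⊆ T) (hTS : T ⊆ convexHull ℝ (insert p S)) (hpT : p ∈ T) :
    IsHullList (p :: D) T := by
  have hset : {z | z ∈ p :: D} = insert p {z | z ∈ D} := by
    ext z
    simp
  refine ⟨?_, ?_, ?_⟩
  · rw [hset]
    apply le_antisymm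
    · refine convexHull_mono ?_
      rintro z (rfl | hz)
      · exact hpT
      · exact hST (hDS z hz)
    · refine convexHull_min (hTS.trans ?_) (convex_convexHull ℝ _)
      refine convexHull_min ?_ (convex_convexHull ℝ _)
      rintro z (rfl | hz)
      · exact subset_convexHull _ _ (Or.inl rfl)
      · exact hcover hz
  · refine List.nodup_cons.2 ⟨hp, ?_⟩
    refine List.pairwise_iff_forall_sublist.2 fun {a b} hab e => ?_
    have := hpos a b hab
    rw [e, orient_self_right] at this
    exact lt_irrefl _ this
  · intro a b c habc
    rw [← orient_eq]
    rcases List.sublist_cons_iff.1 habc with h | ⟨r, hr, h⟩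
    · exact htriple a b c h
    · simp only [List.cons.injEq] at hr
      obtain ⟨rfl, rfl⟩ := hr
      exact hpos b c h

lemma TipMoves.notMem {S : Set ℂ} {P Q : ℂ} {D : List ℂ} {t₀ t : ℝ} (h : TipMoves S P Q D t₀)
    (ht0 : 0 < t) (ht1 : t ≤ 1) : along P Q t ∉ D := fun hm =>
  h.leave t ⟨ht0, ht1⟩ (subset_convexHull _ _ (h.sub _ hm))

/-- Before the first pop time the list is the hull, because no pair of its points becomes collinear
with the moving point. -/
theorem TipMoves.isHullList {S T : Set ℂ} {P Q : ℂ} {D : List ℂ} {t₀ t : ℝ}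
    (h : TipMoves S P Q D t₀) (ht0 : 0 < t) (htt : t₀ ≤ t) (ht1 : t ≤ 1)
    (hF : ∀ T, PopsFront P Q D T → t < T) (hB : ∀ T, PopsBack P Q D T → t < T) (hST : S ⊆ T)
    (hTS : T ⊆ convexHull ℝ (insert (along P Q t) S)) (hpT : along P Q t ∈ T) :
    IsHullList (along P Q t :: D) T :=
  isHullList_of_pos h.triple (fun _ _ hab => h.pos ht0 ht1 hF hB hab) (h.notMem ht0 ht1)
    h.sub (h.cover t ⟨htt, ht1⟩ ht0) hST hTS hpT

/-- At the first pop time all pairs of points of the list are still weakly ordered. -/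
lemma TipMoves.nonneg_at {S : Set ℂ} {P Q : ℂ} {D : List ℂ} {t₀ T : ℝ} (h : TipMoves S P Q D t₀)
    (hT1 : T ≤ 1) (hF : ∀ T', PopsFront P Q D T' → T ≤ T')
    (hB : ∀ T', PopsBack P Q D T' → T ≤ T') {a b : ℂ} (hT0 : 0 < T) (hab : [a, b].Sublist D) :
    0 ≤ orient (along P Q T) a b := by
  by_contra hc
  obtain ⟨h1, h2⟩ := h.start a b hab
  have hQ : orient Q a b ≤ 0 := by
    by_contra hQ
    rw [orient_along] at hc
    exact hc (add_nonneg (mul_nonneg (by linarith) h1) (mul_nonneg hT0.le (by linarith)))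
  obtain ⟨h3, h4, h5, h6⟩ := popTime_spec h1 h2 hQ
  have hlt : popTime P Q a b < T := by
    rw [h6] at hc
    by_contra hge
    exact hc (mul_nonneg (by linarith) (by linarith))
  have := h.pos h4 h5 (fun T' hT' => hlt.trans_le (hF T' hT'))
    (fun T' hT' => hlt.trans_le (hB T' hT')) hab
  rw [h6] at this
  simp at this

/-- The position at the time `T` stays in the hull spanned with a later position: the ray from it
through `P` meets the hull of the list, and it is between that point and the later position. -/
lemma along_mem_convexHull {P Q : ℂ} {D : List ℂ} {T t : ℝ} (hT : 0 < T) (hTt : T ≤ t)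
    (hne : D ≠ []) (hP : P ∈ convexHull ℝ (insert (along P Q T) {z | z ∈ D})) :
    along P Q T ∈ convexHull ℝ (insert (along P Q t) {z | z ∈ D}) := by
  obtain ⟨y, hy⟩ := List.exists_mem_of_ne_nil D hne
  have ht : 0 < t := hT.trans_le hTt
  rw [convexHull_insert ⟨y, hy⟩] at hP
  simp only [convexJoin_singleton_left, Set.mem_iUnion] at hP
  obtain ⟨x, hx, μ, ν, hμ, hν, hμν, e⟩ := hP
  have hx' : x ∈ convexHull ℝ (insert (along P Q t) {z | z ∈ D}) :=
    convexHull_mono (Set.subset_insert _ _) hx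
  have hp : along P Q t ∈ convexHull ℝ (insert (along P Q t) {z | z ∈ D}) :=
    subset_convexHull _ _ (Or.inl rfl)
  have hre := congrArg Complex.re e
  have him := congrArg Complex.im e
  simp only [Complex.add_re, Complex.add_im, Complex.real_smul, Complex.re_ofReal_mul,
    Complex.im_ofReal_mul, along_re, along_im] at hre him
  have hμ' : μ = 1 - ν := by linarith
  subst hμ'
  refine mem_convex_of_combination (convex_convexHull ℝ _) hx' hp hp (α := (t - T) * ν) (β := T)
    (γ := 0) (mul_nonneg (by linarith) hν) hT.le le_rfl ?_ ?_ ?_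
  · have := mul_nonneg (sub_nonneg.2 hTt) hν
    linarith
  · simp only [along_re]
    linear_combination (t - T) * hre
  · simp only [along_im]
    linear_combination (t - T) * him

/-- The list after a pop still describes the hull, when the removed point `z` is on the segment
between the moving point and a remaining one. -/
lemma TipMoves.pop {S : Set ℂ} {P Q : ℂ} {D D' : List ℂ} {t₀ T : ℝ} {z : ℂ}
    (h : TipMoves S P Q D t₀) (hT0 : 0 < T) (hT1 : T ≤ 1) (htT : t₀ ≤ T)
    (hF : ∀ T', PopsFront P Q D T' → T ≤ T') (hB : ∀ T', PopsBack P Q D T' → T ≤ T')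
    (hne : D' ≠ []) (hsub : D'.Sublist D) (hD : ∀ x ∈ D, x = z ∨ x ∈ D')
    (hz : z ∈ convexHull ℝ (insert (along P Q T) {x | x ∈ D'})) : TipMoves S P Q D' T where
  ne := hne
  triple a b c habc := h.triple a b c (habc.trans hsub)
  start a b hab := h.start a b (hab.trans hsub)
  now a b hab := h.nonneg_at hT1 hF hB hT0 (hab.trans hsub)
  sub x hx := h.sub x (hsub.subset hx)
  base := h.base
  nonneg := hT0.le
  le_one := hT1
  leave := h.leave
  cover t ht _ := by
    have h1 : S ⊆ convexHull ℝ (insert (along P Q T) {x | x ∈ D'}) := by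
      refine (h.cover T ⟨htT, hT1⟩ hT0).trans (convexHull_min ?_ (convex_convexHull ℝ _))
      rintro x (rfl | hx)
      · exact subset_convexHull _ _ (Or.inl rfl)
      · rcases hD x hx with rfl | hx
        · exact hz
        · exact subset_convexHull _ _ (Or.inr hx)
    refine h1.trans (convexHull_min ?_ (convex_convexHull ℝ _))
    rintro x (rfl | hx)
    · exact along_mem_convexHull hT0 ht.1 hne (h1 h.base)
    · exact subset_convexHull _ _ (Or.inr hx)

lemma TipMoves.le_popTime {S : Set ℂ} {P Q a b : ℂ} {D : List ℂ} {t₀ : ℝ}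
    (h : TipMoves S P Q D t₀) (hab : [a, b].Sublist D) (hQ : orient Q a b ≤ 0) :
    t₀ ≤ popTime P Q a b := by
  obtain ⟨h1, h2⟩ := h.start a b hab
  obtain ⟨h3, -, -, h6⟩ := popTime_spec h1 h2 hQ
  have := h.now a b hab
  rw [h6] at this
  by_contra hc
  nlinarith

/-- At a pop at the front the first point is on the segment from the moving point to the second one,
so it is no vertex any more. -/
theorem TipMoves.popFront {S : Set ℂ} {P Q : ℂ} {D : List ℂ} {t₀ T : ℝ}
    (h : TipMoves S P Q D t₀) (hp : PopsFront P Q D T) (hB : ∀ T', PopsBack P Q D T' → T ≤ T') :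
    t₀ ≤ T ∧ 0 < T ∧ T ≤ 1 ∧ TipMoves S P Q D.tail T := by
  obtain ⟨a, b, l, rfl, hQ, ha, rfl⟩ := hp
  have hab : [a, b].Sublist (a :: b :: l) := by simp
  have hle := h.le_popTime hab hQ
  obtain ⟨h1, h2⟩ := h.start a b hab
  obtain ⟨h3, h4, h5, h6⟩ := popTime_spec h1 h2 hQ
  refine ⟨hle, h4, h5, ?_⟩
  have hF : ∀ T', PopsFront P Q (a :: b :: l) T' → popTime P Q a b ≤ T' := by
    rintro T' ⟨a', b', l', e, -, -, rfl⟩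
    simp only [List.cons.injEq] at e
    rw [← e.1, ← e.2.1]
  refine h.pop (z := a) h4 h5 hle hF hB (by simp) (List.sublist_cons_self _ _) (by simp) ?_
  obtain ⟨m, hm1, -, hre, him⟩ := collinear_coordinates h3 (t := popTime P Q a b)
    (by rw [h6]; ring)
  have hm : 0 ≤ m := by
    have : 0 ≤ m * orient P a b := by rw [hm1]; positivity
    exact nonneg_of_mul_nonneg_left this h3
  have hp := subset_convexHull ℝ (insert (along P Q (popTime P Q a b)) {x | x ∈ b :: l})
    (Or.inl rfl)
  have hb := subset_convexHull ℝ (insert (along P Q (popTime P Q a b)) {x | x ∈ b :: l})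
    (Or.inr (List.mem_cons_self : b ∈ b :: l))
  refine mem_convex_of_combination (convex_convexHull ℝ _) hp hb hb zero_le_one hm le_rfl
    (by linarith) ?_ ?_
  · rw [hre]; ring
  · rw [him]; ring

/-- At a pop at the back the last point is on the segment from the moving point to the last but one,
so it is no vertex any more. -/
theorem TipMoves.popBack {S : Set ℂ} {P Q : ℂ} {D : List ℂ} {t₀ T : ℝ}
    (h : TipMoves S P Q D t₀) (hp : PopsBack P Q D T) (hF : ∀ T', PopsFront P Q D T' → T ≤ T') :
    t₀ ≤ T ∧ 0 < T ∧ T ≤ 1 ∧ TipMoves S P Q D.dropLast T := by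
  obtain ⟨a, b, l, rfl, hQ, ha, rfl⟩ := hp
  have hab : [a, b].Sublist (l ++ [a, b]) := by simp
  have hle := h.le_popTime hab hQ
  obtain ⟨h1, h2⟩ := h.start a b hab
  obtain ⟨h3, h4, h5, h6⟩ := popTime_spec h1 h2 hQ
  refine ⟨hle, h4, h5, ?_⟩
  have hB : ∀ T', PopsBack P Q (l ++ [a, b]) T' → popTime P Q a b ≤ T' := by
    rintro T' ⟨a', b', l', e, -, -, rfl⟩
    have := List.append_inj_right' e rfl
    simp only [List.cons.injEq, and_true] at this
    rw [← this.1, ← this.2]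
  have hdl : (l ++ [a, b]).dropLast = l ++ [a] := by
    rw [List.dropLast_append_of_ne_nil (by simp)]
    rfl
  rw [hdl]
  refine h.pop (z := b) h4 h5 hle hF hB (by simp) (by simp) (by simp; tauto) ?_
  obtain ⟨m, -, hm2, hre, him⟩ := collinear_coordinates h3 (t := popTime P Q a b)
    (by rw [h6]; ring)
  have hm : 1 + m ≤ 0 := by
    have : (1 + m) * orient P a b < 0 := by
      rw [hm2]
      exact mul_neg_of_pos_of_neg h4 ha
    by_contra hc
    nlinarith
  have hp := subset_convexHull ℝ (insert (along P Q (popTime P Q a b)) {x | x ∈ l ++ [a]})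
    (Or.inl rfl)
  have hb := subset_convexHull ℝ (insert (along P Q (popTime P Q a b)) {x | x ∈ l ++ [a]})
    (Or.inr (show a ∈ l ++ [a] by simp))
  refine mem_convex_of_combination (convex_convexHull ℝ _) hp hb hb zero_le_one
    (β := -(1 + m)) (by linarith) le_rfl (by linarith) ?_ ?_
  · rw [hre]; ring
  · rw [him]; ring

/-! ### The hull when its tip turns at a vertex -/

/-- The list `D` describes the hull of a part `T` of a chain that ends in `Q`. -/
structure TipRests (T : Set ℂ) (Q : ℂ) (D : List ℂ) : Prop where
  ne : D ≠ []
  triple : ∀ a b c : ℂ, [a, b, c].Sublist D → 0 < orient a b c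
  pos : ∀ a b : ℂ, [a, b].Sublist D → 0 < orient Q a b
  sub : ∀ z ∈ D, z ∈ T
  base : Q ∈ T
  cover : T ⊆ convexHull ℝ (insert Q {z | z ∈ D})
  notMem : Q ∉ D

/-- If no pop is due up to the end of the edge, then the moving point arrives there as a vertex. -/
theorem TipMoves.rests {S T : Set ℂ} {P Q : ℂ} {D : List ℂ} {t₀ : ℝ} (h : TipMoves S P Q D t₀)
    (hF : ∀ T, PopsFront P Q D T → 1 < T) (hB : ∀ T, PopsBack P Q D T → 1 < T) (hST : S ⊆ T)
    (hTS : T ⊆ convexHull ℝ (insert Q S)) (hpT : Q ∈ T) : TipRests T Q D where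
  ne := h.ne
  triple := h.triple
  pos a b hab := by
    have := h.pos one_pos le_rfl hF hB hab
    rwa [along_one] at this
  sub z hz := hST (h.sub z hz)
  base := hpT
  cover := by
    have := h.cover 1 ⟨h.le_one, le_rfl⟩ one_pos
    rw [along_one] at this
    refine hTS.trans (convexHull_min ?_ (convex_convexHull ℝ _))
    rintro x (rfl | hx)
    · exact subset_convexHull _ _ (Or.inl rfl)
    · exact this hx
  notMem := by
    have := h.notMem one_pos le_rfl
    rwa [along_one] at this

theorem TipRests.isHullList {T : Set ℂ} {Q : ℂ} {D : List ℂ} (h : TipRests T Q D) :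
    IsHullList (Q :: D) T :=
  isHullList_of_pos h.triple h.pos h.notMem h.sub h.cover subset_rfl
    ((subset_convexHull _ _).trans (convexHull_mono (Set.subset_insert _ _))) h.base

/-- The chain enters its hull when it leaves `Q` in the direction of `R`. -/
def EntersHull (T : Set ℂ) (Q R : ℂ) : Prop :=
  ∃ δ : ℝ, 0 < δ ∧ δ ≤ 1 ∧ ∀ t ∈ Set.Ioc 0 δ, along Q R t ∈ convexHull ℝ T

lemma head_eq_or_sublist {a q : ℂ} {D : List ℂ} (ha : D.head? = some a) (hq : q ∈ D) :
    q = a ∨ [a, q].Sublist D := by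
  cases D with
  | nil => simp at ha
  | cons x D =>
    simp only [List.head?_cons, Option.some.injEq] at ha
    subst ha
    rcases List.mem_cons.1 hq with h | h
    · exact Or.inl h
    · exact Or.inr (by simpa using h)

lemma last_eq_or_sublist {b q : ℂ} {D : List ℂ} (hb : D.getLast? = some b) (hq : q ∈ D) :
    q = b ∨ [q, b].Sublist D := by
  obtain ⟨l, rfl⟩ := List.getLast?_eq_some_iff.1 hb
  rcases List.mem_append.1 hq with h | h
  · exact Or.inr (List.Sublist.append (List.singleton_sublist.2 h) (List.Sublist.refl [b]))
  · exact Or.inl (by simpa using h)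

section Turn

variable {T : Set ℂ} {Q R a b : ℂ} {D : List ℂ}

lemma TipRests.head_cases (h : TipRests T Q D) (ha : D.head? = some a) {q : ℂ} (hq : q ∈ D) :
    q = a ∨ 0 < orient Q a q :=
  (head_eq_or_sublist ha hq).imp_right (h.pos a q)

lemma TipRests.last_cases (h : TipRests T Q D) (hb : D.getLast? = some b) {q : ℂ} (hq : q ∈ D) :
    q = b ∨ 0 < orient Q q b :=
  (last_eq_or_sublist hb hq).imp_right (h.pos q b)

lemma TipRests.head_last (h : TipRests T Q D) (ha : D.head? = some a) (hb : D.getLast? = some b) :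
    a = b ∨ 0 < orient Q a b :=
  h.last_cases hb (List.mem_of_mem_head? ha)

/-- The side of the direction `R` on which a point `q` of the cone of `a` and `b` is. -/
lemma orient_cone (Q R a b q : ℂ) : orient Q a b * orient Q q R =
    orient Q q b * orient Q a R + orient Q a q * orient Q b R := by
  simp only [orient]
  ring

/-- If the hull is on one side of the ray from `Q` to `R`, then the ray leaves the hull. -/
lemma TipRests.leave_of_side (h : TipRests T Q D) (hQR : Q ≠ R) {ε : ℝ}
    (hside : ∀ q ∈ D, 0 < ε * orient Q q R) {t : ℝ} (ht : t ∈ Set.Ioc (0 : ℝ) 1) :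
    along Q R t ∉ convexHull ℝ T := by
  intro hm
  have hm' := convexHull_min h.cover (convex_convexHull ℝ _) hm
  obtain ⟨y, hy⟩ := List.exists_mem_of_ne_nil D h.ne
  rw [convexHull_insert ⟨y, hy⟩] at hm'
  simp only [convexJoin_singleton_left, Set.mem_iUnion] at hm'
  obtain ⟨x, hx, μ, ν, hμ, hν, hμν, e⟩ := hm'
  have hx' : 0 < ε * orient Q x R := by
    have hc : Convex ℝ {z : ℂ | 0 < ε * orient Q z R} := by
      intro z hz w hw α β hα hβ hαβ
      simp only [Set.mem_ofPred_eq] at hz hw ⊢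
      have hβ' : β = 1 - α := by linarith
      have : ε * orient Q (α • z + β • w) R = α * (ε * orient Q z R) + β * (ε * orient Q w R) := by
        subst hβ'
        simp only [orient, Complex.add_re, Complex.add_im, Complex.real_smul,
          Complex.re_ofReal_mul, Complex.im_ofReal_mul]
        ring
      rw [this]
      rcases hα.lt_or_eq with h0 | h0
      · have := mul_pos h0 hz
        have := mul_nonneg hβ hw.le
        linarith
      · have h1 : β = 1 := by linarith
        rw [← h0, h1]
        linarith
    exact convexHull_min (fun q hq => hside q hq) hc hx
  have hre := congrArg Complex.re e
  have him := congrArg Complex.im e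
  simp only [Complex.add_re, Complex.add_im, Complex.real_smul, Complex.re_ofReal_mul,
    Complex.im_ofReal_mul, along_re, along_im] at hre him
  have hμ' : μ = 1 - ν := by linarith
  subst hμ'
  have h0 : ν * (ε * orient Q x R) = 0 := by
    simp only [orient]
    linear_combination ε * (R.im - Q.im) * hre - ε * (R.re - Q.re) * him
  have hν0 : ν = 0 := by
    rcases mul_eq_zero.1 h0 with h | h
    · exact h
    · exact absurd h hx'.ne'
  subst hν0
  apply hQR
  apply Complex.ext
  · have : t * (R.re - Q.re) = 0 := by linear_combination -hre
    have := (mul_eq_zero.1 this).resolve_left ht.1.ne'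
    linarith
  · have : t * (R.im - Q.im) = 0 := by linear_combination -him
    have := (mul_eq_zero.1 this).resolve_left ht.1.ne'
    linarith

/-- The whole hull is strictly on the right of the new edge: `Q` remains a vertex, and is the first
one seen from the moving point. -/
theorem TipRests.pushFront (h : TipRests T Q D) (ha : D.head? = some a)
    (hb : D.getLast? = some b) (hca : 0 < orient Q a R) (hcb : 0 < orient Q b R) :
    TipMoves T Q R (Q :: D) 0 := by
  have hside : ∀ q ∈ D, 0 < orient Q q R := by
    intro q hq
    rcases h.head_cases ha hq with rfl | h1
    · exact hca
    rcases h.last_cases hb hq with rfl | h2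
    · exact hcb
    rcases h.head_last ha hb with rfl | h3
    · rw [orient_swap] at h2
      linarith
    have := orient_cone Q R a b q
    have : 0 < orient Q a b * orient Q q R := by rw [this]; positivity
    exact pos_of_mul_pos_right this h3.le
  refine ⟨by simp, ?_, ?_, ?_, ?_, h.base, le_rfl, zero_le_one, ?_, fun t ht =>
    h.leave_of_side (R := R) (ε := 1) ?_ (by simpa using hside) ht⟩
  · intro x y z hs
    rcases List.sublist_cons_iff.1 hs with hs | ⟨r, hr, hs⟩
    · exact h.triple x y z hs
    · simp only [List.cons.injEq] at hr
      obtain ⟨rfl, rfl⟩ := hr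
      exact h.pos y z hs
  · intro x y hs
    rcases List.sublist_cons_iff.1 hs with hs | ⟨r, hr, hs⟩
    · have := h.pos x y hs
      exact ⟨this.le, fun e => absurd e this.ne'⟩
    · simp only [List.cons.injEq] at hr
      obtain ⟨rfl, rfl⟩ := hr
      refine ⟨by rw [orient_self_left], fun _ => ?_⟩
      have := hside y (hs.subset (by simp))
      rwa [← orient_rotate]
  · intro x y hs
    rw [along_zero]
    rcases List.sublist_cons_iff.1 hs with hs | ⟨r, hr, hs⟩
    · exact (h.pos x y hs).le
    · simp only [List.cons.injEq] at hr
      obtain ⟨rfl, rfl⟩ := hr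
      rw [orient_self_left]
  · intro z hz
    rcases List.mem_cons.1 hz with rfl | hz
    · exact h.base
    · exact h.sub z hz
  · intro t _ _
    refine h.cover.trans (convexHull_mono ?_)
    rintro x (rfl | hx)
    · exact Or.inr List.mem_cons_self
    · exact Or.inr (List.mem_cons_of_mem _ hx)
  · rintro rfl
    rw [orient_self_outer] at hca
    exact lt_irrefl _ hca

/-- The whole hull is strictly on the left of the new edge: `Q` remains a vertex, and is the last
one seen from the moving point. -/
theorem TipRests.pushBack (h : TipRests T Q D) (ha : D.head? = some a)
    (hb : D.getLast? = some b) (hca : orient Q a R < 0) (hcb : orient Q b R < 0) :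
    TipMoves T Q R (D ++ [Q]) 0 := by
  have hside : ∀ q ∈ D, orient Q q R < 0 := by
    intro q hq
    rcases h.head_cases ha hq with rfl | h1
    · exact hca
    rcases h.last_cases hb hq with rfl | h2
    · exact hcb
    rcases h.head_last ha hb with rfl | h3
    · rw [orient_swap] at h2
      linarith
    have e := orient_cone Q R a b q
    by_contra hc
    have h4 := mul_nonneg h3.le (not_lt.1 hc)
    have h5 := mul_pos h2 (neg_pos.2 hca)
    have h6 := mul_pos h1 (neg_pos.2 hcb)
    linarith
  have hsplit : ∀ {l : List ℂ} {y : ℂ}, (l ++ [y]).Sublist (D ++ [Q]) →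
      (l ++ [y]).Sublist D ∨ (y = Q ∧ l.Sublist D) := by
    intro l y hs
    obtain ⟨l₁, l₂, e, h1, h2⟩ := List.sublist_append_iff.1 hs
    rcases List.sublist_singleton.1 h2 with rfl | rfl
    · rw [List.append_nil] at e
      exact Or.inl (e ▸ h1)
    · obtain ⟨rfl, e2⟩ := List.append_inj' e rfl
      exact Or.inr ⟨by simpa using e2, h1⟩
  refine ⟨by simp, ?_, ?_, ?_, ?_, h.base, le_rfl, zero_le_one, ?_, fun t ht =>
    h.leave_of_side (R := R) (ε := -1) ?_ (by simpa using hside) ht⟩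
  · intro x y z hs
    rcases hsplit (l := [x, y]) hs with hs' | ⟨rfl, hs'⟩
    · exact h.triple x y z hs'
    · have := h.pos x y hs'
      rwa [orient_rotate]
  · intro x y hs
    rcases hsplit (l := [x]) hs with hs' | ⟨rfl, hs'⟩
    · have := h.pos x y hs'
      exact ⟨this.le, fun e => absurd e this.ne'⟩
    · refine ⟨by rw [orient_self_outer], fun _ => ?_⟩
      have := hside x (hs'.subset (by simp))
      rw [orient_swap] at this
      rw [← orient_rotate, ← orient_rotate] at this
      rw [← orient_rotate]
      linarith
  · intro x y hs
    rw [along_zero]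
    rcases hsplit (l := [x]) hs with hs' | ⟨rfl, hs'⟩
    · exact (h.pos x y hs').le
    · rw [orient_self_outer]
  · intro z hz
    rcases List.mem_append.1 hz with hz | hz
    · exact h.sub z hz
    · rw [List.mem_singleton.1 hz]
      exact h.base
  · intro t _ _
    refine h.cover.trans (convexHull_mono ?_)
    rintro x (rfl | hx)
    · exact Or.inr (by simp)
    · exact Or.inr (List.mem_append_left _ hx)
  · rintro rfl
    rw [orient_self_outer] at hca
    exact lt_irrefl _ hca

/-- `Q` is no vertex any more if it is spanned by the moving point and the list. -/
lemma TipRests.moves_of_mem (h : TipRests T Q D)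
    (hQ : ∀ t ∈ Set.Ioc (0 : ℝ) 1, Q ∈ convexHull ℝ (insert (along Q R t) {z | z ∈ D}))
    (hleave : ∀ t ∈ Set.Ioc (0 : ℝ) 1, along Q R t ∉ convexHull ℝ T) : TipMoves T Q R D 0 where
  ne := h.ne
  triple := h.triple
  start x y hs := ⟨(h.pos x y hs).le, fun e => absurd e (h.pos x y hs).ne'⟩
  now x y hs := by rw [along_zero]; exact (h.pos x y hs).le
  sub := h.sub
  base := h.base
  nonneg := le_rfl
  le_one := zero_le_one
  leave := hleave
  cover t ht ht0 := by
    refine h.cover.trans (convexHull_min ?_ (convex_convexHull ℝ _))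
    rintro x (rfl | hx)
    · exact hQ t ⟨ht0, ht.2⟩
    · exact subset_convexHull _ _ (Or.inr hx)

/-- Points on the ray from `Q` to `a`: a multiple of `a - Q` from the orientation and the
scalar product. -/
lemma parallel_coordinates {Q a R : ℂ} (h : orient Q a R = 0) :
    ((a.re - Q.re) ^ 2 + (a.im - Q.im) ^ 2) * (R.re - Q.re) =
      ((a.re - Q.re) * (R.re - Q.re) + (a.im - Q.im) * (R.im - Q.im)) * (a.re - Q.re) ∧
    ((a.re - Q.re) ^ 2 + (a.im - Q.im) ^ 2) * (R.im - Q.im) =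
      ((a.re - Q.re) * (R.re - Q.re) + (a.im - Q.im) * (R.im - Q.im)) * (a.im - Q.im) := by
  simp only [orient] at h
  constructor
  · linear_combination -(a.im - Q.im) * h
  · linear_combination (a.re - Q.re) * h

lemma normSq_pos_of_ne {Q a : ℂ} (h : Q ≠ a) : 0 < (a.re - Q.re) ^ 2 + (a.im - Q.im) ^ 2 := by
  by_contra hc
  apply h
  have h1 := sq_nonneg (a.re - Q.re)
  have h2 := sq_nonneg (a.im - Q.im)
  have h3 : (a.re - Q.re) ^ 2 = 0 := by linarith
  have h4 : (a.im - Q.im) ^ 2 = 0 := by linarith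
  apply Complex.ext
  · linarith [pow_eq_zero_iff (two_ne_zero) |>.1 h3]
  · linarith [pow_eq_zero_iff (two_ne_zero) |>.1 h4]

/-- The new edge leads straight away from the first vertex `a`, so `Q` is between `a` and the moving
point. The moving point is outside of the hull, which is on one side of the line and meets it in
nothing beyond `Q`. -/
theorem TipRests.straight_of_parallel (h : TipRests T Q D) (ha : D.head? = some a) (hQR : Q ≠ R)
    (hca : orient Q a R = 0)
    (he : (a.re - Q.re) * (R.re - Q.re) + (a.im - Q.im) * (R.im - Q.im) ≤ 0) :
    TipMoves T Q R D 0 := by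
  have haD : a ∈ D := List.mem_of_mem_head? ha
  have hQa : Q ≠ a := fun e => h.notMem (e ▸ haD)
  have hN := normSq_pos_of_ne hQa
  have hM := normSq_pos_of_ne hQR
  obtain ⟨e1, e2⟩ := parallel_coordinates hca
  set N := (a.re - Q.re) ^ 2 + (a.im - Q.im) ^ 2 with hNdef
  set e := (a.re - Q.re) * (R.re - Q.re) + (a.im - Q.im) * (R.im - Q.im) with hedef
  have he' : e < 0 := by
    refine lt_of_le_of_ne he fun h0 => ?_
    rw [h0, zero_mul] at e1 e2
    have h1 := (mul_eq_zero.1 e1).resolve_left hN.ne'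
    have h2 := (mul_eq_zero.1 e2).resolve_left hN.ne'
    rw [h1, h2] at hM
    simp at hM
  refine h.moves_of_mem (fun t ht => ?_) (fun t ht hm => ?_)
  · have hp := subset_convexHull ℝ (insert (along Q R t) {z | z ∈ D}) (Or.inl rfl)
    have hb := subset_convexHull ℝ (insert (along Q R t) {z | z ∈ D}) (Or.inr haD)
    have ht0 := ht.1
    refine mem_convex_of_combination (convex_convexHull ℝ _) hp hb hb hN.le
      (β := -(t * e)) (γ := 0) (by nlinarith) le_rfl (by nlinarith) ?_ ?_
    · rw [along_re]
      linear_combination t * e1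
    · rw [along_im]
      linear_combination t * e2
  · have hm' := convexHull_min h.cover (convex_convexHull ℝ _) hm
    -- the lexicographic half plane on the left of the ray from `Q` to `a`
    set C : Set ℂ := {z | 0 ≤ orient Q a z ∧ (orient Q a z = 0 →
      0 ≤ (a.re - Q.re) * (z.re - Q.re) + (a.im - Q.im) * (z.im - Q.im))} with hC
    have hCc : Convex ℝ C := by
      rintro z ⟨hz1, hz2⟩ w ⟨hw1, hw2⟩ α β hα hβ hαβ
      have hβ' : β = 1 - α := by linarith
      have h1 : orient Q a (α • z + β • w) = α * orient Q a z + β * orient Q a w := by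
        subst hβ'
        simp only [orient, Complex.add_re, Complex.add_im, Complex.real_smul,
          Complex.re_ofReal_mul, Complex.im_ofReal_mul]
        ring
      have hp1 := mul_nonneg hα hz1
      have hp2 := mul_nonneg hβ hw1
      refine ⟨by rw [h1]; linarith, fun h0 => ?_⟩
      rw [h1] at h0
      have hz3 : 0 ≤ α * ((a.re - Q.re) * (z.re - Q.re) + (a.im - Q.im) * (z.im - Q.im)) := by
        rcases mul_eq_zero.1 (by linarith : α * orient Q a z = 0) with h3 | h3
        · rw [h3, zero_mul]
        · exact mul_nonneg hα (hz2 h3)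
      have hw3 : 0 ≤ β * ((a.re - Q.re) * (w.re - Q.re) + (a.im - Q.im) * (w.im - Q.im)) := by
        rcases mul_eq_zero.1 (by linarith : β * orient Q a w = 0) with h3 | h3
        · rw [h3, zero_mul]
        · exact mul_nonneg hβ (hw2 h3)
      simp only [Complex.add_re, Complex.add_im, Complex.real_smul, Complex.re_ofReal_mul,
        Complex.im_ofReal_mul]
      have : (a.re - Q.re) * (α * z.re + β * w.re - Q.re) +
          (a.im - Q.im) * (α * z.im + β * w.im - Q.im) =
          α * ((a.re - Q.re) * (z.re - Q.re) + (a.im - Q.im) * (z.im - Q.im)) +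
          β * ((a.re - Q.re) * (w.re - Q.re) + (a.im - Q.im) * (w.im - Q.im)) := by
        subst hβ'
        ring
      linarith
    have hsub : insert Q {z | z ∈ D} ⊆ C := by
      rintro z (rfl | hz)
      · exact ⟨by rw [orient_self_outer], fun _ => by simp⟩
      · rcases h.head_cases ha hz with rfl | h1
        · refine ⟨by rw [orient_self_right], fun _ => ?_⟩
          rw [hNdef] at hN
          linarith
        · exact ⟨h1.le, fun h0 => absurd h0 h1.ne'⟩
    have hin := (convexHull_min hsub hCc hm').2 ?_
    · rw [along_re, along_im] at hin
      have : t * e < 0 := mul_neg_of_pos_of_neg ht.1 he'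
      rw [hedef] at this
      linarith
    · have : orient Q a (along Q R t) = t * orient Q a R := by
        simp only [orient, along_re, along_im]
        ring
      rw [this, hca, mul_zero]

/-- The new edge leads into the cone opposite to the hull, so `Q` is in the triangle of the moving
point and the first and last vertices. -/
theorem TipRests.straight_of_opposite (h : TipRests T Q D) (ha : D.head? = some a)
    (hb : D.getLast? = some b) (hca : orient Q a R < 0) (hcb : 0 ≤ orient Q b R) :
    TipMoves T Q R D 0 := by
  have haD : a ∈ D := List.mem_of_mem_head? ha
  have hbD : b ∈ D := List.mem_of_mem_getLast? hb
  rcases h.head_last ha hb with rfl | hab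
  · linarith
  refine h.moves_of_mem (fun t ht => ?_) (fun t ht hm => ?_)
  · have hp := subset_convexHull ℝ (insert (along Q R t) {z | z ∈ D}) (Or.inl rfl)
    have ha' := subset_convexHull ℝ (insert (along Q R t) {z | z ∈ D}) (Or.inr haD)
    have hb' := subset_convexHull ℝ (insert (along Q R t) {z | z ∈ D}) (Or.inr hbD)
    have ht0 := ht.1
    refine mem_convex_of_combination (convex_convexHull ℝ _) hp ha' hb' hab.le
      (β := t * orient Q b R) (γ := -(t * orient Q a R)) (by positivity) (by nlinarith)
      (by nlinarith) ?_ ?_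
    · rw [along_re]
      simp only [orient]
      ring
    · rw [along_im]
      simp only [orient]
      ring
  · have hm' := convexHull_min h.cover (convex_convexHull ℝ _) hm
    have hCc : Convex ℝ {z | 0 ≤ orient Q a z} := by
      rintro z hz w hw α β hα hβ hαβ
      simp only [Set.mem_ofPred_eq] at hz hw ⊢
      have hβ' : β = 1 - α := by linarith
      have h1 : orient Q a (α • z + β • w) = α * orient Q a z + β * orient Q a w := by
        subst hβ'
        simp only [orient, Complex.add_re, Complex.add_im, Complex.real_smul,
          Complex.re_ofReal_mul, Complex.im_ofReal_mul]
        ring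
      rw [h1]
      have hp1 := mul_nonneg hα hz
      have hp2 := mul_nonneg hβ hw
      linarith
    have hsub : insert Q {z | z ∈ D} ⊆ {z | 0 ≤ orient Q a z} := by
      rintro z (rfl | hz)
      · exact (orient_self_outer _ _).ge
      · rcases h.head_cases ha hz with rfl | h1
        · exact (orient_self_right _ _).ge
        · exact h1.le
    have hin : 0 ≤ orient Q a (along Q R t) := convexHull_min hsub hCc hm'
    have : orient Q a (along Q R t) = t * orient Q a R := by
      simp only [orient, along_re, along_im]
      ring
    rw [this] at hin
    nlinarith [ht.1]

/-- A direction that is a nonnegative combination of the directions to two vertices of the list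
leads into the hull. -/
lemma TipRests.enters_of_combination (h : TipRests T Q D) (ha : a ∈ D) (hb : b ∈ D)
    {F α β : ℝ} (hF : 0 < F) (hα : 0 ≤ α) (hβ : 0 ≤ β)
    (hre : F * (R.re - Q.re) = α * (a.re - Q.re) + β * (b.re - Q.re))
    (him : F * (R.im - Q.im) = α * (a.im - Q.im) + β * (b.im - Q.im)) : EntersHull T Q R := by
  refine ⟨F / (F + α + β), by positivity, (div_le_one (by positivity)).2 (by linarith),
    fun t ht => ?_⟩
  have ha' := subset_convexHull ℝ T (h.sub a ha)
  have hb' := subset_convexHull ℝ T (h.sub b hb)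
  have hQ := subset_convexHull ℝ T h.base
  have ht0 := ht.1
  have ht1 : t * (F + α + β) ≤ F := (le_div_iff₀ (by positivity)).1 ht.2
  have htF : 0 < t * F := mul_pos ht0 hF
  refine mem_convex_of_combination (convex_convexHull ℝ _) ha' hb' hQ (α := t * α) (β := t * β)
    (γ := F - t * α - t * β) (by positivity) (by positivity) (by linarith) (by linarith) ?_ ?_
  · rw [along_re]
    linear_combination -t * hre
  · rw [along_im]
    linear_combination -t * him

/-- The new edge leads along the first side of the hull. -/
theorem TipRests.enters_of_parallel (h : TipRests T Q D) (ha : D.head? = some a)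
    (hca : orient Q a R = 0)
    (he : 0 < (a.re - Q.re) * (R.re - Q.re) + (a.im - Q.im) * (R.im - Q.im)) :
    EntersHull T Q R := by
  have haD : a ∈ D := List.mem_of_mem_head? ha
  have hQa : Q ≠ a := fun e => h.notMem (e ▸ haD)
  obtain ⟨e1, e2⟩ := parallel_coordinates hca
  exact h.enters_of_combination haD haD (normSq_pos_of_ne hQa) he.le le_rfl
    (by linear_combination e1) (by linear_combination e2)

/-- The new edge leads into the cone of the hull, or along its last side. -/
theorem TipRests.enters_of_between (h : TipRests T Q D) (ha : D.head? = some a)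
    (hb : D.getLast? = some b) (hca : 0 < orient Q a R) (hcb : orient Q b R ≤ 0) :
    EntersHull T Q R := by
  rcases h.head_last ha hb with rfl | hab
  · linarith
  refine h.enters_of_combination (List.mem_of_mem_head? ha) (List.mem_of_mem_getLast? hb) hab
    (neg_nonneg.2 hcb) hca.le ?_ ?_ <;>
  · simp only [orient]
    ring

end Turn

/-- At the beginning of the chain the hull is the first vertex. -/
lemma tipMoves_singleton {P Q : ℂ} (h : P ≠ Q) : TipMoves {P} P Q [P] 0 where
  ne := by simp
  triple a b c hs := by simpa using hs.length_le
  start a b hs := by simpa using hs.length_le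
  now a b hs := by simpa using hs.length_le
  sub := by simp
  base := rfl
  nonneg := le_rfl
  le_one := zero_le_one
  cover t _ _ := by
    rintro _ rfl
    exact subset_convexHull _ _ (Or.inr (by simp))
  leave t ht := by
    rw [convexHull_singleton, Set.mem_singleton_iff]
    intro e
    have : (t : ℂ) * (Q - P) = 0 := by
      rw [along] at e
      linear_combination e
    rcases mul_eq_zero.1 this with h0 | h0
    · exact ht.1.ne' (by exact_mod_cast h0)
    · exact h (sub_eq_zero.1 h0).symm

/-! ### A small language on top of the machine -/

/-- Expressions for natural numbers; `arr A i` is the entry of the array `A` at the position `i`. -/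
inductive NatExpr where
  | reg (r : ℕ)
  | const (k : ℕ)
  | succ (e : NatExpr)
  | pred (e : NatExpr)
  | arr (A : ℕ) (i : NatExpr)

/-- Expressions for real numbers. -/
inductive RealExpr where
  | reg (r : ℕ)
  | const (q : ℚ)
  | arr (A : ℕ) (i : NatExpr)
  | add (a b : RealExpr)
  | sub (a b : RealExpr)
  | mul (a b : RealExpr)
  | div (a b : RealExpr)
  | sqrt (a : RealExpr)

/-- Comparisons of expressions. -/
inductive Cond where
  | natLt (a b : NatExpr)
  | natEq (a b : NatExpr)
  | realLt (a b : RealExpr)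
  | realLe (a b : RealExpr)
  | realEq (a b : RealExpr)

/-- Programs without loops, whose instructions evaluate expressions. -/
inductive Code where
  | skip
  | nset (r : ℕ) (e : NatExpr)
  | rset (r : ℕ) (e : RealExpr)
  | nput (A : ℕ) (i e : NatExpr)
  | rput (A : ℕ) (i : NatExpr) (e : RealExpr)
  | seq (C D : Code)
  | ite (c : Cond) (C D : Code)

/-- The registers below this bound are the variables of a program, those above it hold intermediate
results in the evaluation of expressions. -/
def numVars : ℕ := 64

/-- The value of an expression. -/
def NatExpr.eval : NatExpr → Mem → ℕ
  | reg r, σ => σ.nat r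
  | const k, _ => k
  | succ e, σ => e.eval σ + 1
  | pred e, σ => e.eval σ - 1
  | arr A i, σ => σ.natArr A (i.eval σ)

/-- The value of an expression. -/
noncomputable def RealExpr.eval : RealExpr → Mem → ℝ
  | reg r, σ => σ.real r
  | const q, _ => (q : ℝ)
  | arr A i, σ => σ.realArr A (i.eval σ)
  | add a b, σ => a.eval σ + b.eval σ
  | sub a b, σ => a.eval σ - b.eval σ
  | mul a b, σ => a.eval σ * b.eval σ
  | div a b, σ => a.eval σ / b.eval σ
  | sqrt a, σ => Real.sqrt (a.eval σ)

/-- The truth of a comparison. -/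
def Cond.Holds : Cond → Mem → Prop
  | natLt a b, σ => a.eval σ < b.eval σ
  | natEq a b, σ => a.eval σ = b.eval σ
  | realLt a b, σ => a.eval σ < b.eval σ
  | realLe a b, σ => a.eval σ ≤ b.eval σ
  | realEq a b, σ => a.eval σ = b.eval σ

open Classical in
/-- The effect of a program on the variables and arrays. -/
noncomputable def Code.den : Code → Mem → Mem
  | skip, σ => σ
  | nset r e, σ => σ.setNat r (e.eval σ)
  | rset r e, σ => σ.setReal r (e.eval σ)
  | nput A i e, σ => σ.setNatArr A (i.eval σ) (e.eval σ)
  | rput A i e, σ => σ.setRealArr A (i.eval σ) (e.eval σ)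
  | seq C D, σ => D.den (C.den σ)
  | ite c C D, σ => if c.Holds σ then C.den σ else D.den σ

/-- All registers that occur are variables. -/
def NatExpr.Valid : NatExpr → Bool
  | reg r => decide (r < numVars)
  | const _ => true
  | succ e => e.Valid
  | pred e => e.Valid
  | arr _ i => i.Valid

/-- All registers are variables. -/
def RealExpr.Valid : RealExpr → Bool
  | reg r => decide (r < numVars)
  | const _ => true
  | arr _ i => i.Valid
  | add a b => a.Valid && b.Valid
  | sub a b => a.Valid && b.Valid
  | mul a b => a.Valid && b.Valid
  | div a b => a.Valid && b.Valid
  | sqrt a => a.Valid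

/-- All registers are variables. -/
def Cond.Valid : Cond → Bool
  | natLt a b => a.Valid && b.Valid
  | natEq a b => a.Valid && b.Valid
  | realLt a b => a.Valid && b.Valid
  | realLe a b => a.Valid && b.Valid
  | realEq a b => a.Valid && b.Valid

/-- All registers are variables. -/
def Code.Valid : Code → Bool
  | skip => true
  | nset r e => decide (r < numVars) && e.Valid
  | rset r e => decide (r < numVars) && e.Valid
  | nput _ i e => i.Valid && e.Valid
  | rput _ i e => i.Valid && e.Valid
  | seq C D => C.Valid && D.Valid
  | ite c C D => c.Valid && C.Valid && D.Valid

/-! ### Compilation -/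

/-- Instructions that put the value of the expression into the register `t`. -/
def NatExpr.compile : NatExpr → ℕ → List Instr
  | reg r, t => [.natCopy t r]
  | const k, t => [.natConst t k]
  | succ e, t => e.compile t ++ [.natInc t]
  | pred e, t => e.compile t ++ [.natDec t]
  | arr A i, t => i.compile t ++ [.natLoad t A t]

/-- Instructions that put the value of the expression into the register `t`; they change no real
register below `t`. -/
def RealExpr.compile : RealExpr → ℕ → List Instr
  | reg r, t => [.realCopy t r]
  | const q, t => [.realConst t q]
  | arr A i, t => i.compile numVars ++ [.realLoad t A numVars]
  | add a b, t => a.compile t ++ (b.compile (t + 1) ++ [.realAdd t t (t + 1)])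
  | sub a b, t => a.compile t ++ (b.compile (t + 1) ++ [.realSub t t (t + 1)])
  | mul a b, t => a.compile t ++ (b.compile (t + 1) ++ [.realMul t t (t + 1)])
  | div a b, t => a.compile t ++ (b.compile (t + 1) ++ [.realDiv t t (t + 1)])
  | sqrt a, t => a.compile t ++ [.realSqrt t t]

/-- Compilation of a comparison: the instructions that compute both sides. -/
def Cond.compile : Cond → List Instr
  | natLt a b => a.compile numVars ++ b.compile (numVars + 1)
  | natEq a b => a.compile numVars ++ b.compile (numVars + 1)
  | realLt a b => a.compile numVars ++ b.compile (numVars + 1)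
  | realLe a b => a.compile numVars ++ b.compile (numVars + 1)
  | realEq a b => a.compile numVars ++ b.compile (numVars + 1)

/-- The test that follows `Cond.compile`. -/
def Cond.test : Cond → Test
  | natLt _ _ => .natLt numVars (numVars + 1)
  | natEq _ _ => .natEq numVars (numVars + 1)
  | realLt _ _ => .realLt numVars (numVars + 1)
  | realLe _ _ => .realLe numVars (numVars + 1)
  | realEq _ _ => .realEq numVars (numVars + 1)

/-- The instructions of the list, one after the other. -/
def Prog.block : List Instr → Prog
  | [] => .skip
  | c :: l => .seq (.instr c) (block l)

/-- Compilation of a program without loops. -/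
def Code.compile : Code → Prog
  | skip => .skip
  | nset r e => .block (e.compile numVars ++ [.natCopy r numVars])
  | rset r e => .block (e.compile numVars ++ [.realCopy r numVars])
  | nput A i e => .block (i.compile (numVars + 1) ++
      (e.compile numVars ++ [.natStore A (numVars + 1) numVars]))
  | rput A i e => .block (i.compile (numVars + 1) ++
      (e.compile numVars ++ [.realStore A (numVars + 1) numVars]))
  | seq C D => .seq C.compile D.compile
  | ite c C D => .seq (.block c.compile) (.branch c.test C.compile D.compile)

/-- A bound for the number of steps. -/
def Code.cost : Code → ℕ
  | skip => 0
  | nset _ e => (e.compile numVars).length + 1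
  | rset _ e => (e.compile numVars).length + 1
  | nput _ i e => (i.compile (numVars + 1)).length + ((e.compile numVars).length + 1)
  | rput _ i e => (i.compile (numVars + 1)).length + ((e.compile numVars).length + 1)
  | seq C D => C.cost + D.cost
  | ite c C D => c.compile.length + 1 + (C.cost + D.cost)

/-- The memory after a list of instructions. -/
noncomputable def runBlock : List Instr → Mem → Mem
  | [], σ => σ
  | c :: l, σ => runBlock l (c.apply σ)

lemma runBlock_append (l l' : List Instr) (σ : Mem) :
    runBlock (l ++ l') σ = runBlock l' (runBlock l σ) := by
  induction l generalizing σ with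
  | nil => rfl
  | cons c l ih => exact ih _

lemma exec_block (l : List Instr) (σ : Mem) :
    ∃ tr, Exec (.block l) σ tr (runBlock l σ) ∧ tr.length = l.length := by
  induction l generalizing σ with
  | nil => exact ⟨[], .skip σ, rfl⟩
  | cons c l ih =>
    obtain ⟨tr, h, hl⟩ := ih (c.apply σ)
    exact ⟨[c.apply σ] ++ tr, .seq (.instr c σ) h, by simp [hl]⟩

/-- The two memories agree, except possibly in registers that hold intermediate results. -/
structure Agree (σ ρ : Mem) : Prop where
  nat : ∀ r < numVars, σ.nat r = ρ.nat r
  real : ∀ r < numVars, σ.real r = ρ.real r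
  natArr : σ.natArr = ρ.natArr
  realArr : σ.realArr = ρ.realArr

lemma Agree.refl (σ : Mem) : Agree σ σ := ⟨fun _ _ => rfl, fun _ _ => rfl, rfl, rfl⟩

/-- The compiled expression leaves its value in the register `t`, and changes no other register of
natural numbers. -/
lemma NatExpr.runBlock_compile {σ ρ : Mem} (h : Agree σ ρ) {t : ℕ} (ht : numVars ≤ t) :
    ∀ e : NatExpr, e.Valid = true → Agree (runBlock (e.compile t) σ) ρ ∧
      (runBlock (e.compile t) σ).nat t = e.eval ρ ∧
      (∀ r, r ≠ t → (runBlock (e.compile t) σ).nat r = σ.nat r) ∧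
      (runBlock (e.compile t) σ).real = σ.real := by
  have set_t : ∀ {σ' : Mem} (x : ℕ), Agree σ' ρ → (∀ r, r ≠ t → σ'.nat r = σ.nat r) →
      σ'.real = σ.real → Agree (σ'.setNat t x) ρ ∧ (σ'.setNat t x).nat t = x ∧
      (∀ r, r ≠ t → (σ'.setNat t x).nat r = σ.nat r) ∧ (σ'.setNat t x).real = σ.real := by
    intro σ' x h1 h2 h3
    refine ⟨⟨fun r hr => ?_, h1.real, h1.natArr, h1.realArr⟩, by simp [Mem.setNat],
      fun r hr => ?_, h3⟩
    · rw [← h1.nat r hr]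
      simp [Mem.setNat, Function.update_of_ne (by omega : r ≠ t)]
    · rw [← h2 r hr]
      simp [Mem.setNat, Function.update_of_ne hr]
  intro e
  induction e with
  | reg r =>
    intro hv
    simp only [NatExpr.Valid, decide_eq_true_eq] at hv
    have := set_t (σ' := σ) (σ.nat r) h (fun _ _ => rfl) rfl
    rw [NatExpr.eval, ← h.nat r hv]
    exact this
  | const k => exact fun _ => set_t (σ' := σ) k h (fun _ _ => rfl) rfl
  | succ e ih =>
    intro hv
    obtain ⟨h1, h2, h3, h4⟩ := ih hv
    simp only [NatExpr.compile, runBlock_append, NatExpr.eval, ← h2]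
    exact set_t _ h1 h3 h4
  | pred e ih =>
    intro hv
    obtain ⟨h1, h2, h3, h4⟩ := ih hv
    simp only [NatExpr.compile, runBlock_append, NatExpr.eval, ← h2]
    exact set_t _ h1 h3 h4
  | arr A e ih =>
    intro hv
    obtain ⟨h1, h2, h3, h4⟩ := ih hv
    simp only [NatExpr.compile, runBlock_append, NatExpr.eval, ← h2, ← h1.natArr]
    exact set_t _ h1 h3 h4

lemma RealExpr.runBlock_compile {ρ : Mem} : ∀ (e : RealExpr) (σ : Mem) (t : ℕ), Agree σ ρ →
    numVars ≤ t → e.Valid = true → Agree (runBlock (e.compile t) σ) ρ ∧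
      (runBlock (e.compile t) σ).real t = e.eval ρ ∧
      (∀ r < t, (runBlock (e.compile t) σ).real r = σ.real r) ∧
      (∀ r, r ≠ numVars → (runBlock (e.compile t) σ).nat r = σ.nat r) := by
  have set_t : ∀ {σ σ' : Mem} {t : ℕ} (x : ℝ), numVars ≤ t → Agree σ' ρ →
      (∀ r < t, σ'.real r = σ.real r) → (∀ r, r ≠ numVars → σ'.nat r = σ.nat r) →
      Agree (σ'.setReal t x) ρ ∧ (σ'.setReal t x).real t = x ∧
      (∀ r < t, (σ'.setReal t x).real r = σ.real r) ∧
      (∀ r, r ≠ numVars → (σ'.setReal t x).nat r = σ.nat r) := by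
    intro σ σ' t x ht h1 h2 h3
    refine ⟨⟨h1.nat, fun r hr => ?_, h1.natArr, h1.realArr⟩, by simp [Mem.setReal],
      fun r hr => ?_, h3⟩
    · rw [← h1.real r hr]
      simp [Mem.setReal, Function.update_of_ne (by omega : r ≠ t)]
    · rw [← h2 r hr]
      simp [Mem.setReal, Function.update_of_ne (by omega : r ≠ t)]
  have binary : ∀ {a b : RealExpr} {σ : Mem} {t : ℕ} (f : ℝ → ℝ → ℝ) (c : Instr),
      (∀ σ : Mem, c.apply σ = σ.setReal t (f (σ.real t) (σ.real (t + 1)))) → Agree σ ρ →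
      numVars ≤ t →
      (∀ (σ : Mem) (t : ℕ), Agree σ ρ → numVars ≤ t → Agree (runBlock (a.compile t) σ) ρ ∧
        (runBlock (a.compile t) σ).real t = a.eval ρ ∧
        (∀ r < t, (runBlock (a.compile t) σ).real r = σ.real r) ∧
        (∀ r, r ≠ numVars → (runBlock (a.compile t) σ).nat r = σ.nat r)) →
      (∀ (σ : Mem) (t : ℕ), Agree σ ρ → numVars ≤ t → Agree (runBlock (b.compile t) σ) ρ ∧
        (runBlock (b.compile t) σ).real t = b.eval ρ ∧
        (∀ r < t, (runBlock (b.compile t) σ).real r = σ.real r) ∧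
        (∀ r, r ≠ numVars → (runBlock (b.compile t) σ).nat r = σ.nat r)) →
      let σ' := runBlock (a.compile t ++ (b.compile (t + 1) ++ [c])) σ
      Agree σ' ρ ∧ σ'.real t = f (a.eval ρ) (b.eval ρ) ∧ (∀ r < t, σ'.real r = σ.real r) ∧
        (∀ r, r ≠ numVars → σ'.nat r = σ.nat r) := by
    intro a b σ t f c hc h ht iha ihb
    obtain ⟨h1, h2, h3, h4⟩ := iha σ t h ht
    obtain ⟨k1, k2, k3, k4⟩ := ihb _ (t + 1) h1 (by omega)
    simp only [runBlock_append]
    have hlast : ∀ σ : Mem, runBlock [c] σ = c.apply σ := fun _ => rfl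
    rw [hlast, hc, k2, k3 t (by omega), h2]
    exact set_t _ ht k1 (fun r hr => (k3 r (by omega)).trans (h3 r hr))
      (fun r hr => (k4 r hr).trans (h4 r hr))
  intro e
  induction e with
  | reg r =>
    intro σ t h ht hv
    simp only [RealExpr.Valid, decide_eq_true_eq] at hv
    have := set_t (σ := σ) (σ' := σ) (σ.real r) ht h (fun _ _ => rfl) (fun _ _ => rfl)
    rw [RealExpr.eval, ← h.real r hv]
    exact this
  | const q =>
    intro σ t h ht _
    exact set_t (σ := σ) (σ' := σ) (q : ℝ) ht h (fun _ _ => rfl) (fun _ _ => rfl)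
  | arr A i =>
    intro σ t h ht hv
    obtain ⟨h1, h2, h3, h4⟩ := i.runBlock_compile h (le_refl numVars) hv
    simp only [RealExpr.compile, runBlock_append, RealExpr.eval, ← h2, ← h1.realArr]
    exact set_t _ ht h1 (fun r _ => by rw [h4]) h3
  | add a b iha ihb =>
    intro σ t h ht hv
    simp only [RealExpr.Valid, Bool.and_eq_true] at hv
    exact binary (· + ·) _ (fun _ => rfl) h ht (fun σ t h ht => iha σ t h ht hv.1)
      (fun σ t h ht => ihb σ t h ht hv.2)
  | sub a b iha ihb =>
    intro σ t h ht hv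
    simp only [RealExpr.Valid, Bool.and_eq_true] at hv
    exact binary (· - ·) _ (fun _ => rfl) h ht (fun σ t h ht => iha σ t h ht hv.1)
      (fun σ t h ht => ihb σ t h ht hv.2)
  | mul a b iha ihb =>
    intro σ t h ht hv
    simp only [RealExpr.Valid, Bool.and_eq_true] at hv
    exact binary (· * ·) _ (fun _ => rfl) h ht (fun σ t h ht => iha σ t h ht hv.1)
      (fun σ t h ht => ihb σ t h ht hv.2)
  | div a b iha ihb =>
    intro σ t h ht hv
    simp only [RealExpr.Valid, Bool.and_eq_true] at hv
    exact binary (· / ·) _ (fun _ => rfl) h ht (fun σ t h ht => iha σ t h ht hv.1)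
      (fun σ t h ht => ihb σ t h ht hv.2)
  | sqrt a ih =>
    intro σ t h ht hv
    obtain ⟨h1, h2, h3, h4⟩ := ih σ t h ht hv
    simp only [RealExpr.compile, runBlock_append, RealExpr.eval, ← h2]
    exact set_t _ ht h1 h3 h4

lemma Cond.runBlock_compile {σ ρ : Mem} (h : Agree σ ρ) (c : Cond) (hv : c.Valid = true) :
    Agree (runBlock c.compile σ) ρ ∧ (c.test.Holds (runBlock c.compile σ) ↔ c.Holds ρ) := by
  have natCase : ∀ a b : NatExpr, a.Valid = true → b.Valid = true →
      let σ' := runBlock (a.compile numVars ++ b.compile (numVars + 1)) σ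
      Agree σ' ρ ∧ σ'.nat numVars = a.eval ρ ∧ σ'.nat (numVars + 1) = b.eval ρ := by
    intro a b ha hb
    obtain ⟨h1, h2, h3, h4⟩ := a.runBlock_compile h (le_refl numVars) ha
    obtain ⟨k1, k2, k3, k4⟩ := b.runBlock_compile h1 (by omega : numVars ≤ numVars + 1) hb
    simp only [runBlock_append]
    exact ⟨k1, (k3 _ (by omega)).trans h2, k2⟩
  have realCase : ∀ a b : RealExpr, a.Valid = true → b.Valid = true →
      let σ' := runBlock (a.compile numVars ++ b.compile (numVars + 1)) σ
      Agree σ' ρ ∧ σ'.real numVars = a.eval ρ ∧ σ'.real (numVars + 1) = b.eval ρ := by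
    intro a b ha hb
    obtain ⟨h1, h2, h3, h4⟩ := a.runBlock_compile σ _ h (le_refl numVars) ha
    obtain ⟨k1, k2, k3, k4⟩ := b.runBlock_compile _ _ h1 (by omega : numVars ≤ numVars + 1) hb
    simp only [runBlock_append]
    exact ⟨k1, (k3 _ (by omega)).trans h2, k2⟩
  cases c with
  | natLt a b =>
    simp only [Cond.Valid, Bool.and_eq_true] at hv
    obtain ⟨h1, h2, h3⟩ := natCase a b hv.1 hv.2
    exact ⟨h1, by simp only [Cond.test, Test.Holds, Cond.Holds, Cond.compile, h2, h3]⟩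
  | natEq a b =>
    simp only [Cond.Valid, Bool.and_eq_true] at hv
    obtain ⟨h1, h2, h3⟩ := natCase a b hv.1 hv.2
    exact ⟨h1, by simp only [Cond.test, Test.Holds, Cond.Holds, Cond.compile, h2, h3]⟩
  | realLt a b =>
    simp only [Cond.Valid, Bool.and_eq_true] at hv
    obtain ⟨h1, h2, h3⟩ := realCase a b hv.1 hv.2
    exact ⟨h1, by simp only [Cond.test, Test.Holds, Cond.Holds, Cond.compile, h2, h3]⟩
  | realLe a b =>
    simp only [Cond.Valid, Bool.and_eq_true] at hv
    obtain ⟨h1, h2, h3⟩ := realCase a b hv.1 hv.2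
    exact ⟨h1, by simp only [Cond.test, Test.Holds, Cond.Holds, Cond.compile, h2, h3]⟩
  | realEq a b =>
    simp only [Cond.Valid, Bool.and_eq_true] at hv
    obtain ⟨h1, h2, h3⟩ := realCase a b hv.1 hv.2
    exact ⟨h1, by simp only [Cond.test, Test.Holds, Cond.Holds, Cond.compile, h2, h3]⟩

/-- A compiled code runs to its end within its cost, and has the effect of `Code.den` up to the
registers of intermediate results. -/
theorem Code.exec_compile : ∀ (C : Code) {σ ρ : Mem}, Agree σ ρ → C.Valid = true →
    ∃ tr σ', Exec C.compile σ tr σ' ∧ tr.length ≤ C.cost ∧ Agree σ' (C.den ρ) := by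
  intro C
  induction C with
  | skip => exact fun h _ => ⟨[], _, .skip _, by simp, h⟩
  | nset r e =>
    intro σ ρ h hv
    simp only [Code.Valid, Bool.and_eq_true, decide_eq_true_eq] at hv
    obtain ⟨h1, h2, h3, h4⟩ := e.runBlock_compile h (le_refl numVars) hv.2
    obtain ⟨tr, ht, hl⟩ := exec_block (e.compile numVars ++ [.natCopy r numVars]) σ
    refine ⟨tr, _, ht, by simp [hl, Code.cost], ?_⟩
    rw [runBlock_append]
    refine ⟨fun r' hr' => ?_, h1.real, h1.natArr, h1.realArr⟩
    simp only [runBlock, Instr.apply, Mem.setNat, Code.den, Function.update_apply, h2]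
    split_ifs
    · rfl
    · exact h1.nat r' hr'
  | rset r e =>
    intro σ ρ h hv
    simp only [Code.Valid, Bool.and_eq_true, decide_eq_true_eq] at hv
    obtain ⟨h1, h2, h3, h4⟩ := e.runBlock_compile σ _ h (le_refl numVars) hv.2
    obtain ⟨tr, ht, hl⟩ := exec_block (e.compile numVars ++ [.realCopy r numVars]) σ
    refine ⟨tr, _, ht, by simp [hl, Code.cost], ?_⟩
    rw [runBlock_append]
    refine ⟨h1.nat, fun r' hr' => ?_, h1.natArr, h1.realArr⟩
    simp only [runBlock, Instr.apply, Mem.setReal, Code.den, Function.update_apply, h2]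
    split_ifs
    · rfl
    · exact h1.real r' hr'
  | nput A i e =>
    intro σ ρ h hv
    simp only [Code.Valid, Bool.and_eq_true] at hv
    obtain ⟨h1, h2, h3, h4⟩ := i.runBlock_compile h (by omega : numVars ≤ numVars + 1) hv.1
    obtain ⟨k1, k2, k3, k4⟩ := e.runBlock_compile h1 (le_refl numVars) hv.2
    obtain ⟨tr, ht, hl⟩ := exec_block (i.compile (numVars + 1) ++
      (e.compile numVars ++ [.natStore A (numVars + 1) numVars])) σ
    refine ⟨tr, _, ht, by simp [hl, Code.cost], ?_⟩
    rw [runBlock_append, runBlock_append]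
    refine ⟨k1.nat, k1.real, ?_, k1.realArr⟩
    simp only [runBlock, Instr.apply, Mem.setNatArr, Code.den]
    rw [k2, k3 _ (by omega), h2, k1.natArr]
  | rput A i e =>
    intro σ ρ h hv
    simp only [Code.Valid, Bool.and_eq_true] at hv
    obtain ⟨h1, h2, h3, h4⟩ := i.runBlock_compile h (by omega : numVars ≤ numVars + 1) hv.1
    obtain ⟨k1, k2, k3, k4⟩ := e.runBlock_compile _ _ h1 (le_refl numVars) hv.2
    obtain ⟨tr, ht, hl⟩ := exec_block (i.compile (numVars + 1) ++
      (e.compile numVars ++ [.realStore A (numVars + 1) numVars])) σ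
    refine ⟨tr, _, ht, by simp [hl, Code.cost], ?_⟩
    rw [runBlock_append, runBlock_append]
    refine ⟨k1.nat, k1.real, k1.natArr, ?_⟩
    simp only [runBlock, Instr.apply, Mem.setRealArr, Code.den]
    rw [k2, k4 _ (by omega), h2, k1.realArr]
  | seq C D ihC ihD =>
    intro σ ρ h hv
    simp only [Code.Valid, Bool.and_eq_true] at hv
    obtain ⟨tr, σ₁, e1, l1, h1⟩ := ihC h hv.1
    obtain ⟨tr', σ₂, e2, l2, h2⟩ := ihD h1 hv.2
    exact ⟨tr ++ tr', σ₂, .seq e1 e2, by simp only [List.length_append, Code.cost]; omega, h2⟩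
  | ite c C D ihC ihD =>
    intro σ ρ h hv
    simp only [Code.Valid, Bool.and_eq_true] at hv
    obtain ⟨h1, h2⟩ := c.runBlock_compile h hv.1.1
    obtain ⟨tr, et, hl⟩ := exec_block c.compile σ
    by_cases hc : c.Holds ρ
    · obtain ⟨tr', σ₂, e2, l2, h3⟩ := ihC h1 hv.1.2
      refine ⟨_, σ₂, .seq et (.branchTrue (h2.2 hc) e2), ?_, ?_⟩
      · simp only [List.length_append, List.length_cons, Code.cost]
        omega
      · simpa only [Code.den, if_pos hc] using h3
    · obtain ⟨tr', σ₂, e2, l2, h3⟩ := ihD h1 hv.2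
      refine ⟨_, σ₂, .seq et (.branchFalse (fun h => hc (h2.1 h)) e2), ?_, ?_⟩
      · simp only [List.length_append, List.length_cons, Code.cost]
        omega
      · simpa only [Code.den, if_neg hc] using h3

/-! ### Loops -/

lemma natLt_holds_iff {σ ρ : Mem} (h : Agree σ ρ) {a b : ℕ} (ha : a < numVars)
    (hb : b < numVars) : (Test.natLt a b).Holds σ ↔ ρ.nat a < ρ.nat b := by
  simp only [Test.Holds, h.nat a ha, h.nat b hb]

/-- A loop with `m` rounds. At the moments `τ j` of its trace the test of the loop is evaluated for
the `j`-th time. -/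
theorem exec_loop {C : Code} (hC : C.Valid = true) {a b : ℕ} (ha : a < numVars)
    (hb : b < numVars) (m : ℕ) : ∀ {σ ρ : Mem}, Agree σ ρ →
    (∀ j < m, (C.den^[j] ρ).nat a < (C.den^[j] ρ).nat b) →
    ¬ (C.den^[m] ρ).nat a < (C.den^[m] ρ).nat b →
    ∃ tr σ', Exec (.loop (.natLt a b) C.compile) σ tr σ' ∧ tr.length ≤ (m + 1) * (C.cost + 1) ∧
      Agree σ' (C.den^[m] ρ) ∧ ∃ (τ : ℕ → ℕ) (s : ℕ → Mem), τ 0 = 0 ∧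
        (∀ j ≤ m, tr[τ j]? = some (s j) ∧ Agree (s j) (C.den^[j] ρ)) ∧
        ∀ j < m, τ j < τ (j + 1) ∧ τ (j + 1) ≤ τ j + (C.cost + 1) := by
  induction m with
  | zero =>
    intro σ ρ h _ hm
    refine ⟨[σ], σ, .loopDone fun hc => hm ((natLt_holds_iff h ha hb).1 hc), by simp, h,
      fun _ => 0, fun _ => σ, rfl, fun j hj => ?_, fun j hj => absurd hj (by omega)⟩
    obtain rfl : j = 0 := by omega
    exact ⟨rfl, h⟩
  | succ m ih =>
    intro σ ρ h hlt hm
    obtain ⟨tr₁, σ₁, e1, l1, h1⟩ := C.exec_compile h hC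
    obtain ⟨tr₂, σ₂, e2, l2, h2, τ, s, hτ0, hs, hτ⟩ := ih h1
      (fun j hj => hlt (j + 1) (by omega)) hm
    refine ⟨_, σ₂, .loopStep ((natLt_holds_iff h ha hb).2 (hlt 0 (by omega))) e1 e2, ?_, h2,
      fun j => if j = 0 then 0 else tr₁.length + 1 + τ (j - 1),
      fun j => if j = 0 then σ else s (j - 1), rfl, fun j hj => ?_, fun j hj => ?_⟩
    · simp only [List.length_cons, List.length_append]
      linarith
    · rcases j with _ | j
      · exact ⟨rfl, h⟩
      · obtain ⟨h3, h4⟩ := hs j (by omega)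
        refine ⟨?_, h4⟩
        simp only [Nat.add_eq_zero_iff, one_ne_zero, and_false, if_false, Nat.add_sub_cancel]
        rw [show tr₁.length + 1 + τ j = (tr₁.length + τ j) + 1 by ring, List.getElem?_cons_succ,
          List.getElem?_append_right (by omega), Nat.add_sub_cancel_left]
        exact h3
    · rcases j with _ | j
      · simp [hτ0]
        omega
      · have := hτ j (by omega)
        simp only [Nat.add_eq_zero_iff, one_ne_zero, and_false, if_false, Nat.add_sub_cancel]
        omega

/-- A loop whose rounds preserve an invariant and decrease a measure. -/
lemma exists_rounds {f : Mem → Mem} {I : Mem → Prop} {a b : ℕ} {μ : Mem → ℕ}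
    (h : ∀ σ, I σ → σ.nat a < σ.nat b → I (f σ) ∧ μ (f σ) < μ σ) : ∀ {ρ : Mem}, I ρ →
    ∃ m ≤ μ ρ, (∀ j < m, (f^[j] ρ).nat a < (f^[j] ρ).nat b) ∧
      ¬ (f^[m] ρ).nat a < (f^[m] ρ).nat b ∧ ∀ j ≤ m, I (f^[j] ρ) := by
  intro ρ hρ
  induction hk : μ ρ using Nat.strong_induction_on generalizing ρ with
  | _ k ih =>
    subst hk
    by_cases hc : ρ.nat a < ρ.nat b
    · obtain ⟨h1, h2⟩ := h ρ hρ hc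
      obtain ⟨m, hm, h3, h4, h5⟩ := ih _ h2 h1 rfl
      refine ⟨m + 1, by omega, fun j hj => ?_, h4, fun j hj => ?_⟩
      · rcases j with _ | j
        · exact hc
        · exact h3 j (by omega)
      · rcases j with _ | j
        · exact hρ
        · exact h5 j (by omega)
    · refine ⟨0, Nat.zero_le _, fun j hj => absurd hj (by omega), hc, fun j hj => ?_⟩
      obtain rfl : j = 0 := by omega
      exact hρ

/-! ### Reading the memory -/

section Simp

variable (σ : Mem) (r r' A A' i : ℕ)

lemma setNat_nat (x : ℕ) : (σ.setNat r x).nat r' = if r' = r then x else σ.nat r' := by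
  simp [Mem.setNat, Function.update_apply]

lemma setReal_real (x : ℝ) : (σ.setReal r x).real r' = if r' = r then x else σ.real r' := by
  simp [Mem.setReal, Function.update_apply]

lemma setNatArr_natArr (x : ℕ) : (σ.setNatArr A i x).natArr A' =
    if A' = A then Function.update (σ.natArr A) i x else σ.natArr A' := by
  simp only [Mem.setNatArr, Function.update_apply]

lemma setRealArr_realArr (x : ℝ) : (σ.setRealArr A i x).realArr A' =
    if A' = A then Function.update (σ.realArr A) i x else σ.realArr A' := by
  simp only [Mem.setRealArr, Function.update_apply]

lemma setNat_real (x : ℕ) : (σ.setNat r x).real = σ.real := rfl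
lemma setNat_natArr (x : ℕ) : (σ.setNat r x).natArr = σ.natArr := rfl
lemma setNat_realArr (x : ℕ) : (σ.setNat r x).realArr = σ.realArr := rfl
lemma setReal_nat (x : ℝ) : (σ.setReal r x).nat = σ.nat := rfl
lemma setReal_natArr (x : ℝ) : (σ.setReal r x).natArr = σ.natArr := rfl
lemma setReal_realArr (x : ℝ) : (σ.setReal r x).realArr = σ.realArr := rfl
lemma setNatArr_nat (x : ℕ) : (σ.setNatArr A i x).nat = σ.nat := rfl
lemma setNatArr_real (x : ℕ) : (σ.setNatArr A i x).real = σ.real := rfl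
lemma setNatArr_realArr (x : ℕ) : (σ.setNatArr A i x).realArr = σ.realArr := rfl
lemma setRealArr_nat (x : ℝ) : (σ.setRealArr A i x).nat = σ.nat := rfl
lemma setRealArr_real (x : ℝ) : (σ.setRealArr A i x).real = σ.real := rfl
lemma setRealArr_natArr (x : ℝ) : (σ.setRealArr A i x).natArr = σ.natArr := rfl

end Simp

/-! ### The program that grows the hulls -/

/-- The point with the index `i` in the input. -/
noncomputable def Mem.point (σ : Mem) (i : ℕ) : ℂ := ⟨σ.realArr 0 i, σ.realArr 1 i⟩

/-- The orientation of three input points. -/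
def orientExpr (p q r : NatExpr) : RealExpr :=
  .sub (.mul (.sub (.arr 0 q) (.arr 0 p)) (.sub (.arr 1 r) (.arr 1 p)))
    (.mul (.sub (.arr 1 q) (.arr 1 p)) (.sub (.arr 0 r) (.arr 0 p)))

/-- The scalar product of the vectors from the input point `p` to `q` and `r`. -/
def dotExpr (p q r : NatExpr) : RealExpr :=
  .add (.mul (.sub (.arr 0 q) (.arr 0 p)) (.sub (.arr 0 r) (.arr 0 p)))
    (.mul (.sub (.arr 1 q) (.arr 1 p)) (.sub (.arr 1 r) (.arr 1 p)))

/-- The expression for `popTime`. -/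
def popTimeExpr (p q a b : NatExpr) : RealExpr :=
  .div (orientExpr p a b) (.sub (orientExpr p a b) (orientExpr q a b))

lemma eval_orientExpr (p q r : NatExpr) (σ : Mem) : (orientExpr p q r).eval σ =
    orient (σ.point (p.eval σ)) (σ.point (q.eval σ)) (σ.point (r.eval σ)) := rfl

lemma eval_popTimeExpr (p q a b : NatExpr) (σ : Mem) : (popTimeExpr p q a b).eval σ =
    popTime (σ.point (p.eval σ)) (σ.point (q.eval σ)) (σ.point (a.eval σ))
      (σ.point (b.eval σ)) := rfl

lemma eval_dotExpr (p q r : NatExpr) (σ : Mem) : (dotExpr p q r).eval σ =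
    ((σ.point (q.eval σ)).re - (σ.point (p.eval σ)).re) *
      ((σ.point (r.eval σ)).re - (σ.point (p.eval σ)).re) +
    ((σ.point (q.eval σ)).im - (σ.point (p.eval σ)).im) *
      ((σ.point (r.eval σ)).im - (σ.point (p.eval σ)).im) := rfl

/-- A finite sequence of programs. -/
def Code.list : List Code → Code
  | [] => .skip
  | C :: l => .seq C (list l)

namespace Grow

/-- The index of the vertex `k + i` in the order of the passage; the register `7` holds `k`, and the
array `5` the order. -/
def vertex (i : ℕ) : NatExpr := .arr 5 (Nat.rec (.reg 7) (fun _ e => .succ e) i)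

/-- The first entry of the deque. -/
def front : NatExpr := .arr 3 (.reg 3)

/-- The second entry of the deque. -/
def second : NatExpr := .arr 3 (.succ (.reg 3))

/-- The last entry of the deque. -/
def back : NatExpr := .arr 3 (.pred (.reg 4))

/-- The last entry but one of the deque. -/
def secondBack : NatExpr := .arr 3 (.pred (.pred (.reg 4)))

/-- Set the register `2` to the time of the next pop at the front. -/
def nextFront : Code :=
  .ite (.realLe (orientExpr (vertex 1) front second) (.const 0))
    (.ite (.realLt (.const 0) (orientExpr (vertex 0) (vertex 1) front))
      (.rset 2 (popTimeExpr (vertex 0) (vertex 1) front second)) .skip) .skip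

/-- Set the register `3` to the time of the next pop at the back. -/
def nextBack : Code :=
  .ite (.realLe (orientExpr (vertex 1) secondBack back) (.const 0))
    (.ite (.realLt (orientExpr (vertex 0) (vertex 1) back) (.const 0))
      (.rset 3 (popTimeExpr (vertex 0) (vertex 1) secondBack back)) .skip) .skip

/-- The times of the next pops at both ends, and the smaller one of them; the value `2` stands for
no pop. -/
def nextEvent : Code := .list [.rset 2 (.const 2), .rset 3 (.const 2),
  .ite (.natLt (.succ (.reg 3)) (.reg 4)) (.list [nextFront, nextBack]) .skip,
  .ite (.realLt (.reg 3) (.reg 2)) (.rset 4 (.reg 3)) (.rset 4 (.reg 2))]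

/-- Append an entry to the log: the edge, the initial position (the register `1`), the final
position (the register `4`), and the two ends of the deque. Then move to the final position. -/
def record : Code := .list [
  .rput 4 (.reg 10) (.add (.reg 0) (.reg 1)), .rput 5 (.reg 10) (.add (.reg 0) (.reg 4)),
  .rput 6 (.reg 10) (.reg 0), .nput 6 (.reg 10) (.reg 7), .nput 7 (.reg 10) front,
  .nput 8 (.reg 10) back, .nset 10 (.succ (.reg 10)), .rset 1 (.reg 4)]

/-- Remove the first entry of the deque and of its copy. -/
def popFront : Code := .list [.nset 3 (.succ (.reg 3)), .nset 5 (.reg 3)]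

/-- Remove the last entry of the deque and of its copy. -/
def popBack : Code := .list [.nset 4 (.pred (.reg 4)), .nset 6 (.reg 4)]

/-- Put the final vertex of the current edge in front of the deque and of its copy. -/
def pushFront : Code := .list [.nset 3 (.pred (.reg 3)), .nset 5 (.reg 3),
  .nput 3 (.reg 3) (vertex 1), .nput 4 (.reg 3) (vertex 1)]

/-- Append the final vertex of the current edge to the deque and to its copy. -/
def pushBack : Code := .list [.nput 3 (.reg 4) (vertex 1), .nput 4 (.reg 4) (vertex 1),
  .nset 4 (.succ (.reg 4)), .nset 6 (.reg 4)]

/-- Go on to the next edge. -/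
def nextEdge : Code := .list [.nset 7 (.succ (.reg 7)), .rset 0 (.add (.reg 0) (.const 1)),
  .rset 1 (.const 0)]

/-- End the passage. -/
def halt : Code := .nset 8 (.const 0)

/-- Update the deque at a vertex, or halt if the chain enters its hull there. -/
def turn : Code :=
  .ite (.realEq (orientExpr (vertex 1) front (vertex 2)) (.const 0))
    (.ite (.realLt (.const 0) (dotExpr (vertex 1) front (vertex 2))) halt nextEdge)
    (.ite (.realLt (orientExpr (vertex 1) front (vertex 2)) (.const 0))
      (.ite (.realLe (.const 0) (orientExpr (vertex 1) back (vertex 2))) nextEdge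
        (.seq pushBack nextEdge))
      (.ite (.realLe (orientExpr (vertex 1) back (vertex 2)) (.const 0)) halt
        (.seq pushFront nextEdge)))

/-- The event at the final vertex of the current edge. -/
def arrive : Code := .list [.rset 4 (.const 1), record,
  .ite (.natEq (.succ (.succ (.reg 7))) (.reg 0)) (.seq halt (.nset 9 (.succ (.reg 9)))) turn]

/-- The event in which an end of the deque ceases to be a vertex of the hull. -/
def pop : Code := .list [record,
  .ite (.realLe (.reg 2) (.reg 3)) popFront popBack]

/-- One event of the passage of the chain. The deque is in the array `3` between the registers `3`
and `4`, and a copy of it is in the array `4` between the registers `5` and `6`. The last point of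
the passed part of the chain is on the edge in the register `7` (which is also in the real register
`0`) at the parameter in the real register `1`. The register `8` is `1` until the passage ends, the
register `9` counts the passages of the whole chain, and the register `10` the log entries. -/
def body : Code := .list [nextEvent, .ite (.realLt (.const 1) (.reg 4)) arrive pop]

lemma body_valid : body.Valid = true := by decide

end Grow

/-! ### Deques -/

/-- The entries of `f` at the positions from `lo` up to, but excluding, `hi`. -/
def slice {α : Type*} (f : ℕ → α) (lo hi : ℕ) : List α := (List.range' lo (hi - lo)).map f

section Slice

variable {α : Type*} (f : ℕ → α) {lo hi : ℕ}

lemma slice_cons (h : lo < hi) : slice f lo hi = f lo :: slice f (lo + 1) hi := by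
  rw [slice, show hi - lo = (hi - (lo + 1)) + 1 by omega, List.range'_succ]
  rfl

lemma slice_snoc (h : lo < hi) : slice f lo hi = slice f lo (hi - 1) ++ [f (hi - 1)] := by
  rw [slice, show hi - lo = (hi - 1 - lo) + 1 by omega, List.range'_concat, List.map_append, slice]
  simp only [one_mul, List.map_cons, List.map_nil]
  rw [show lo + (hi - 1 - lo) = hi - 1 by omega]

lemma slice_update {i : ℕ} (x : α) (h : i < lo ∨ hi ≤ i) :
    slice (Function.update f i x) lo hi = slice f lo hi := by
  refine List.map_congr_left fun j hj => ?_
  rw [List.mem_range'_1] at hj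
  exact Function.update_of_ne (by omega) _ _

lemma slice_push_front (x : α) (h : 0 < lo) (h' : lo ≤ hi) :
    slice (Function.update f (lo - 1) x) (lo - 1) hi = x :: slice f lo hi := by
  rw [slice_cons _ (by omega), slice_update _ _ (by omega), Function.update_self,
    Nat.sub_add_cancel h]

lemma slice_push_back (x : α) (h : lo ≤ hi) :
    slice (Function.update f hi x) lo (hi + 1) = slice f lo hi ++ [x] := by
  rw [slice_snoc _ (by omega), Nat.add_sub_cancel, slice_update _ _ (by omega),
    Function.update_self]

lemma slice_head (h : lo < hi) : (slice f lo hi).head? = some (f lo) := by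
  rw [slice_cons f h]
  rfl

lemma slice_getLast (h : lo < hi) : (slice f lo hi).getLast? = some (f (hi - 1)) := by
  rw [slice_snoc f h]
  simp

lemma slice_tail (h : lo < hi) : (slice f lo hi).tail = slice f (lo + 1) hi := by
  rw [slice_cons f h, List.tail_cons]

lemma slice_dropLast (h : lo < hi) : (slice f lo hi).dropLast = slice f lo (hi - 1) := by
  rw [slice_snoc f h, List.dropLast_concat]

lemma slice_length : (slice f lo hi).length = hi - lo := by
  simp [slice]

end Slice

lemma deque_eq_slice (σ : Mem) (A lo hi : ℕ) :
    σ.deque A lo hi = slice (σ.natArr A) (σ.nat lo) (σ.nat hi) := rfl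

lemma popsFront_slice_iff {P Q : ℂ} {f : ℕ → ℂ} {lo hi : ℕ} {T : ℝ} :
    PopsFront P Q (slice f lo hi) T ↔ lo + 1 < hi ∧ orient Q (f lo) (f (lo + 1)) ≤ 0 ∧
      0 < orient P Q (f lo) ∧ T = popTime P Q (f lo) (f (lo + 1)) := by
  constructor
  · rintro ⟨a, b, l, e, h1, h2, h3⟩
    have hl : lo + 1 < hi := by
      have := congrArg List.length e
      simp only [slice_length, List.length_cons] at this
      omega
    rw [slice_cons f (by omega), slice_cons f hl] at e
    simp only [List.cons.injEq] at e
    obtain ⟨rfl, rfl, -⟩ := e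
    exact ⟨hl, h1, h2, h3⟩
  · rintro ⟨hl, h1, h2, h3⟩
    exact ⟨_, _, _, by rw [slice_cons f (by omega), slice_cons f hl], h1, h2, h3⟩

lemma popsBack_slice_iff {P Q : ℂ} {f : ℕ → ℂ} {lo hi : ℕ} {T : ℝ} :
    PopsBack P Q (slice f lo hi) T ↔ lo + 1 < hi ∧ orient Q (f (hi - 1 - 1)) (f (hi - 1)) ≤ 0 ∧
      orient P Q (f (hi - 1)) < 0 ∧ T = popTime P Q (f (hi - 1 - 1)) (f (hi - 1)) := by
  constructor
  · rintro ⟨a, b, l, e, h1, h2, h3⟩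
    have hl : lo + 1 < hi := by
      have := congrArg List.length e
      simp only [slice_length, List.length_append, List.length_cons, List.length_nil] at this
      omega
    rw [slice_snoc f (by omega), slice_snoc f (by omega : lo < hi - 1), List.append_assoc] at e
    have := List.append_inj_right' e rfl
    simp only [List.cons_append, List.nil_append, List.cons.injEq, and_true] at this
    obtain ⟨rfl, rfl⟩ := this
    exact ⟨hl, h1, h2, h3⟩
  · rintro ⟨hl, h1, h2, h3⟩
    exact ⟨_, _, slice f lo (hi - 1 - 1), by
      rw [slice_snoc f (by omega), slice_snoc f (by omega : lo < hi - 1), List.append_assoc]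
      rfl, h1, h2, h3⟩

/-! ### Logs -/

/-- An entry of the log: while the moving point passes the positions between `first` and `last` on
the edge `edge`, the hull of the passed part of the chain has the neighbours `front` and `back` of
that point. -/
structure Entry where
  first : ℝ
  last : ℝ
  edgeReal : ℝ
  edge : ℕ
  front : ℕ
  back : ℕ

/-- The log is kept in the arrays `4`, `5`, `6` of real and `6`, `7`, `8` of natural numbers. -/
noncomputable def Mem.log (σ : Mem) (x : ℕ) : Entry :=
  ⟨σ.realArr 4 x, σ.realArr 5 x, σ.realArr 6 x, σ.natArr 6 x, σ.natArr 7 x, σ.natArr 8 x⟩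

/-- The entry is correct for the chain `w`, which passes the vertices of `v` in the order `I`. -/
structure Entry.Correct {n : ℕ} (v w : Fin n → ℂ) (I : ℕ → ℕ) (e : Entry) : Prop where
  edge_lt : e.edge + 1 < n
  edgeReal_eq : e.edgeReal = e.edge
  le_first : (e.edge : ℝ) ≤ e.first
  first_le : e.first ≤ e.last
  last_le : e.last ≤ e.edge + 1
  front_eq : ∃ j ≤ e.edge, e.front = I j
  back_eq : ∃ j ≤ e.edge, e.back = I j
  tangent : ∀ s ∈ Set.Ioo e.first e.last, ∀ i ≤ e.edge,
    0 ≤ orient (curve w s) (vtx v e.front) (vtx w i) ∧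
    0 ≤ orient (curve w s) (vtx w i) (vtx v e.back)

/-- The final position of the entry before `x`, or `0` for the first entry, which is `c`. -/
noncomputable def logEnd (L : ℕ → Entry) (c x : ℕ) : ℝ := if x = c then 0 else (L (x - 1)).last

/-- The entries from `c` to `N` describe the passage of the chain up to the position `pos`. -/
structure LogCorrect {n : ℕ} (v w : Fin n → ℂ) (I : ℕ → ℕ) (c : ℕ) (L₀ L : ℕ → Entry) (N : ℕ)
    (pos : ℝ) : Prop where
  le : c ≤ N
  old : ∀ x < c, L x = L₀ x
  correct : ∀ x, c ≤ x → x < N → (L x).Correct v w I ∧ (L x).first = logEnd L c x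
  pos_eq : pos = logEnd L c N

lemma LogCorrect.push {n : ℕ} {v w : Fin n → ℂ} {I : ℕ → ℕ} {c : ℕ} {L₀ L : ℕ → Entry} {N : ℕ}
    {pos : ℝ} (h : LogCorrect v w I c L₀ L N pos) {e : Entry} (he : e.Correct v w I)
    (hpos : e.first = pos) : LogCorrect v w I c L₀ (Function.update L N e) (N + 1) e.last := by
  have hc := h.le
  have hend : ∀ x ≤ N, logEnd (Function.update L N e) c x = logEnd L c x := by
    intro x hx
    unfold logEnd
    split_ifs with hxc
    · rfl
    · by_cases hx0 : x - 1 = N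
      · omega
      · rw [Function.update_of_ne hx0]
  refine ⟨by omega, fun x hx => ?_, fun x hx hxN => ?_, ?_⟩
  · rw [Function.update_of_ne (by omega), h.old x hx]
  · rcases (by omega : x < N ∨ x = N) with hlt | rfl
    · rw [Function.update_of_ne (by omega), hend x hlt.le]
      exact h.correct x hx hlt
    · rw [Function.update_self, hend x le_rfl]
      exact ⟨he, hpos.trans h.pos_eq⟩
  · rw [logEnd, if_neg (by omega), Nat.add_sub_cancel, Function.update_self]

/-! ### What a program changes -/

/-- The registers and arrays that a program may change: those of natural numbers are tagged with
`0` and `2`, those of real numbers with `1` and `3`. -/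
def Code.writes : Code → List (ℕ × ℕ)
  | skip => []
  | nset r _ => [(0, r)]
  | rset r _ => [(1, r)]
  | nput A _ _ => [(2, A)]
  | rput A _ _ => [(3, A)]
  | seq C D => C.writes ++ D.writes
  | ite _ C D => C.writes ++ D.writes

lemma Code.den_frame (C : Code) (σ : Mem) :
    (∀ r, (0, r) ∉ C.writes → (C.den σ).nat r = σ.nat r) ∧
    (∀ r, (1, r) ∉ C.writes → (C.den σ).real r = σ.real r) ∧
    (∀ r, (2, r) ∉ C.writes → (C.den σ).natArr r = σ.natArr r) ∧
    (∀ r, (3, r) ∉ C.writes → (C.den σ).realArr r = σ.realArr r) := by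
  induction C generalizing σ with
  | skip => simp [Code.den]
  | nset r e => simp +contextual [Code.den, Code.writes, Mem.setNat]
  | rset r e => simp +contextual [Code.den, Code.writes, Mem.setReal]
  | nput A i e => simp +contextual [Code.den, Code.writes, Mem.setNatArr]
  | rput A i e => simp +contextual [Code.den, Code.writes, Mem.setRealArr]
  | seq C D ihC ihD =>
    simp only [Code.writes, List.mem_append, not_or]
    obtain ⟨c1, c2, c3, c4⟩ := ihC σ
    obtain ⟨d1, d2, d3, d4⟩ := ihD (C.den σ)
    exact ⟨fun r h => (d1 r h.2).trans (c1 r h.1), fun r h => (d2 r h.2).trans (c2 r h.1),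
      fun r h => (d3 r h.2).trans (c3 r h.1), fun r h => (d4 r h.2).trans (c4 r h.1)⟩
  | ite c C D ihC ihD =>
    simp only [Code.writes, List.mem_append, not_or, Code.den]
    obtain ⟨c1, c2, c3, c4⟩ := ihC σ
    obtain ⟨d1, d2, d3, d4⟩ := ihD σ
    split_ifs
    · exact ⟨fun r h => c1 r h.1, fun r h => c2 r h.1, fun r h => c3 r h.1, fun r h => c4 r h.1⟩
    · exact ⟨fun r h => d1 r h.2, fun r h => d2 r h.2, fun r h => d3 r h.2, fun r h => d4 r h.2⟩

section Frame

variable {C : Code} {r : ℕ} (σ : Mem)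

lemma Code.den_nat (h : (0, r) ∉ C.writes) : (C.den σ).nat r = σ.nat r := (C.den_frame σ).1 r h

lemma Code.den_real (h : (1, r) ∉ C.writes) : (C.den σ).real r = σ.real r :=
  (C.den_frame σ).2.1 r h

lemma Code.den_natArr (h : (2, r) ∉ C.writes) : (C.den σ).natArr r = σ.natArr r :=
  (C.den_frame σ).2.2.1 r h

lemma Code.den_realArr (h : (3, r) ∉ C.writes) : (C.den σ).realArr r = σ.realArr r :=
  (C.den_frame σ).2.2.2 r h

end Frame

/-- The data that never change: the vertices of `v` and the order `I` in which they are passed. -/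
structure Env {n : ℕ} (v : Fin n → ℂ) (I : ℕ → ℕ) (σ : Mem) : Prop where
  count : σ.nat 0 = n
  zero : σ.nat 12 = 0
  point : σ.point = vtx v
  order : ∀ j < n, σ.natArr 5 j = I j

lemma Env.den {n : ℕ} {v : Fin n → ℂ} {I : ℕ → ℕ} {σ : Mem} (h : Env v I σ) {C : Code}
    (hC : ∀ x ∈ [(0, 0), (0, 12), (2, 5), (3, 0), (3, 1)], x ∉ C.writes) : Env v I (C.den σ) where
  count := (C.den_nat σ (hC _ (by simp))).trans h.count
  zero := (C.den_nat σ (hC _ (by simp))).trans h.zero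
  point := by
    rw [← h.point]
    funext i
    simp only [Mem.point]
    rw [C.den_realArr σ (hC _ (by simp)), C.den_realArr σ (hC _ (by simp))]
  order j hj := by
    rw [C.den_natArr σ (hC _ (by simp))]
    exact h.order j hj

namespace Grow

/-- The points of the deque. -/
noncomputable def points (σ : Mem) : List ℂ :=
  slice (fun i => σ.point (σ.natArr 3 i)) (σ.nat 3) (σ.nat 4)

/-- The vertex `k + i` in the order of the passage, for the current edge `k`. -/
noncomputable def ahead (σ : Mem) (i : ℕ) : ℂ := σ.point (σ.natArr 5 (σ.nat 7 + i))

lemma popsFront_points_iff {σ : Mem} {P Q : ℂ} {T : ℝ} : PopsFront P Q (points σ) T ↔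
    σ.nat 3 + 1 < σ.nat 4 ∧
      orient Q (σ.point (σ.natArr 3 (σ.nat 3))) (σ.point (σ.natArr 3 (σ.nat 3 + 1))) ≤ 0 ∧
      0 < orient P Q (σ.point (σ.natArr 3 (σ.nat 3))) ∧
      T = popTime P Q (σ.point (σ.natArr 3 (σ.nat 3))) (σ.point (σ.natArr 3 (σ.nat 3 + 1))) :=
  popsFront_slice_iff

lemma popsBack_points_iff {σ : Mem} {P Q : ℂ} {T : ℝ} : PopsBack P Q (points σ) T ↔
    σ.nat 3 + 1 < σ.nat 4 ∧ orient Q (σ.point (σ.natArr 3 (σ.nat 4 - 1 - 1)))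
        (σ.point (σ.natArr 3 (σ.nat 4 - 1))) ≤ 0 ∧
      orient P Q (σ.point (σ.natArr 3 (σ.nat 4 - 1))) < 0 ∧
      T = popTime P Q (σ.point (σ.natArr 3 (σ.nat 4 - 1 - 1)))
        (σ.point (σ.natArr 3 (σ.nat 4 - 1))) :=
  popsBack_slice_iff

lemma setReal_real_self (σ : Mem) (r : ℕ) : σ.setReal r (σ.real r) = σ := by
  simp [Mem.setReal]

lemma nextFront_spec (σ : Mem) (h2 : σ.real 2 = 2) (hlt : σ.nat 3 + 1 < σ.nat 4) :
    ∃ x, nextFront.den σ = σ.setReal 2 x ∧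
      (PopsFront (ahead σ 0) (ahead σ 1) (points σ) x ∨
        x = 2 ∧ ∀ T, ¬ PopsFront (ahead σ 0) (ahead σ 1) (points σ) T) := by
  simp only [popsFront_points_iff, ahead, add_zero, nextFront, Code.den, Cond.Holds,
    eval_orientExpr, eval_popTimeExpr, RealExpr.eval, NatExpr.eval, vertex, front, second,
    Rat.cast_zero]
  split_ifs with h h'
  · exact ⟨_, rfl, Or.inl ⟨hlt, h, h', rfl⟩⟩
  · exact ⟨2, by rw [← h2, setReal_real_self], Or.inr ⟨rfl, fun T hT => h' hT.2.2.1⟩⟩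
  · exact ⟨2, by rw [← h2, setReal_real_self], Or.inr ⟨rfl, fun T hT => h hT.2.1⟩⟩

lemma nextBack_spec (σ : Mem) (h3 : σ.real 3 = 2) (hlt : σ.nat 3 + 1 < σ.nat 4) :
    ∃ y, nextBack.den σ = σ.setReal 3 y ∧
      (PopsBack (ahead σ 0) (ahead σ 1) (points σ) y ∨
        y = 2 ∧ ∀ T, ¬ PopsBack (ahead σ 0) (ahead σ 1) (points σ) T) := by
  simp only [popsBack_points_iff, ahead, add_zero, nextBack, Code.den, Cond.Holds,
    eval_orientExpr, eval_popTimeExpr, RealExpr.eval, NatExpr.eval, vertex, back, secondBack,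
    Rat.cast_zero]
  split_ifs with h h'
  · exact ⟨_, rfl, Or.inl ⟨hlt, h, h', rfl⟩⟩
  · exact ⟨2, by rw [← h3, setReal_real_self], Or.inr ⟨rfl, fun T hT => h' hT.2.2.1⟩⟩
  · exact ⟨2, by rw [← h3, setReal_real_self], Or.inr ⟨rfl, fun T hT => h hT.2.1⟩⟩

/-- The next pops at the front and at the back are at the times `x` and `y`. A pop that is not due
on this edge gets the time `2`, beyond the end of the edge at `1`. -/
lemma nextEvent_spec (σ : Mem) : ∃ x y : ℝ,
    nextEvent.den σ = ((σ.setReal 2 x).setReal 3 y).setReal 4 (min x y) ∧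
    (PopsFront (ahead σ 0) (ahead σ 1) (points σ) x ∨
      x = 2 ∧ ∀ T, ¬ PopsFront (ahead σ 0) (ahead σ 1) (points σ) T) ∧
    (PopsBack (ahead σ 0) (ahead σ 1) (points σ) y ∨
      y = 2 ∧ ∀ T, ¬ PopsBack (ahead σ 0) (ahead σ 1) (points σ) T) := by
  have hlast : ∀ (ρ : Mem),
      (Code.ite (.realLt (.reg 3) (.reg 2)) (.rset 4 (.reg 3)) (.rset 4 (.reg 2))).den ρ =
        ρ.setReal 4 (min (ρ.real 2) (ρ.real 3)) := by
    intro ρ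
    by_cases h : ρ.real 3 < ρ.real 2
    · rw [min_eq_right h.le]
      exact if_pos h
    · rw [min_eq_left (not_lt.1 h)]
      exact if_neg h
  set ρ := (σ.setReal 2 ((2 : ℚ) : ℝ)).setReal 3 ((2 : ℚ) : ℝ) with hρ
  have hden : nextEvent.den σ =
      (Code.ite (.realLt (.reg 3) (.reg 2)) (.rset 4 (.reg 3)) (.rset 4 (.reg 2))).den
        ((Code.ite (.natLt (.succ (.reg 3)) (.reg 4)) (.list [nextFront, nextBack]) .skip).den
          ρ) := rfl
  have h2 : ρ.real 2 = 2 := by simp [hρ, setReal_real]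
  have h3 : ρ.real 3 = 2 := by simp [hρ, setReal_real]
  rw [hden, hlast]
  by_cases hlt : σ.nat 3 + 1 < σ.nat 4
  · obtain ⟨x, hx, hx'⟩ := nextFront_spec ρ h2 hlt
    obtain ⟨y, hy, hy'⟩ := nextBack_spec (ρ.setReal 2 x) (by simp [setReal_real, h3]) hlt
    have hin : (Code.ite (.natLt (.succ (.reg 3)) (.reg 4))
        (.list [nextFront, nextBack]) .skip).den ρ = (σ.setReal 2 x).setReal 3 y := by
      have : (Code.ite (.natLt (.succ (.reg 3)) (.reg 4))
        (.list [nextFront, nextBack]) .skip).den ρ = nextBack.den (nextFront.den ρ) := if_pos hlt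
      rw [this, hx, hy, hρ]
      simp only [Mem.setReal, Mem.mk.injEq, and_true, true_and]
      funext r
      simp only [Function.update_apply]
      split_ifs <;> rfl
    refine ⟨x, y, ?_, hx', hy'⟩
    rw [hin]
    simp [setReal_real]
  · have hin : (Code.ite (.natLt (.succ (.reg 3)) (.reg 4))
        (.list [nextFront, nextBack]) .skip).den ρ = ρ := if_neg hlt
    refine ⟨2, 2, ?_, Or.inr ⟨rfl, fun T hT => hlt (popsFront_points_iff.1 hT).1⟩,
      Or.inr ⟨rfl, fun T hT => hlt (popsBack_points_iff.1 hT).1⟩⟩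
    rw [hin, h2, h3, hρ]
    norm_num

end Grow

/-! ### The hull list is correct after each event -/

lemma exists_of_mem_slice {α : Type*} {f : ℕ → α} {lo hi : ℕ} {y : α} (h : y ∈ slice f lo hi) :
    ∃ x, lo ≤ x ∧ x < hi ∧ f x = y := by
  obtain ⟨x, hx, rfl⟩ := List.mem_map.1 h
  rw [List.mem_range'_1] at hx
  exact ⟨x, by omega, by omega, rfl⟩

lemma convex_orient (p a : ℂ) : Convex ℝ {z | 0 ≤ orient p a z} := by
  intro x hx y hy α β hα hβ hαβ
  simp only [Set.mem_ofPred_eq, orient] at hx hy ⊢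
  simp only [Complex.real_smul, Complex.add_re, Complex.add_im, Complex.mul_re, Complex.mul_im,
    Complex.ofReal_re, Complex.ofReal_im, zero_mul, sub_zero, add_zero]
  obtain rfl : β = 1 - α := by linarith
  nlinarith [mul_nonneg hα hx, mul_nonneg hβ hy]

/-- The first and the last point of the list are seen from the moving point in the extreme
directions. -/
lemma TipMoves.tangent {S : Set ℂ} {P Q : ℂ} {D : List ℂ} {t₀ t : ℝ} (h : TipMoves S P Q D t₀)
    (ht0 : 0 < t) (htt : t₀ ≤ t) (ht1 : t ≤ 1) (hF : ∀ T, PopsFront P Q D T → t < T)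
    (hB : ∀ T, PopsBack P Q D T → t < T) {a b : ℂ} (ha : D.head? = some a)
    (hb : D.getLast? = some b) {z : ℂ} (hz : z ∈ S) :
    0 ≤ orient (along P Q t) a z ∧ 0 ≤ orient (along P Q t) z b := by
  have hcov := h.cover t ⟨htt, ht1⟩ ht0 hz
  have hswap : ∀ z, orient (along P Q t) z b = - orient (along P Q t) b z := fun z =>
    orient_swap _ _ _
  constructor
  · refine convexHull_min ?_ (convex_orient (along P Q t) a) hcov
    rintro x (rfl | hx)
    · exact (orient_self_outer _ _).ge
    · rcases head_eq_or_sublist ha hx with rfl | hs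
      · exact (orient_self_right _ _).ge
      · exact (h.pos ht0 ht1 hF hB hs).le
  · have hconv : Convex ℝ {z | 0 ≤ orient (along P Q t) z b} := by
      intro x hx y hy α β hα hβ hαβ
      simp only [Set.mem_ofPred_eq, orient] at hx hy ⊢
      simp only [Complex.real_smul, Complex.add_re, Complex.add_im, Complex.mul_re,
        Complex.mul_im, Complex.ofReal_re, Complex.ofReal_im, zero_mul, sub_zero, add_zero]
      obtain rfl : β = 1 - α := by linarith
      nlinarith [mul_nonneg hα hx, mul_nonneg hβ hy]
    refine convexHull_min ?_ hconv hcov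
    rintro x (rfl | hx)
    · exact (orient_self_left _ _).ge
    · rcases last_eq_or_sublist hb hx with rfl | hs
      · exact (orient_self_right _ _).ge
      · exact (h.pos ht0 ht1 hF hB hs).le

section Passed

variable {n : ℕ} (w : Fin n → ℂ) (k : ℕ)

/-- The part of the chain up to the vertex `k`. -/
noncomputable def passed : Set ℂ := curve w '' Set.Icc 0 (k : ℝ)

lemma vtx_mem_passed {i : ℕ} (h : i ≤ k) : vtx w i ∈ passed w k :=
  ⟨i, ⟨by positivity, by exact_mod_cast h⟩, curve_nat w i⟩

lemma curve_along {t : ℝ} (h0 : 0 ≤ t) (h1 : t ≤ 1) :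
    curve w (k + t) = along (vtx w k) (vtx w (k + 1)) t := curve_add w k h0 h1

lemma passed_subset {t : ℝ} (h0 : 0 ≤ t) : passed w k ⊆ curve w '' Set.Icc 0 (k + t) :=
  Set.image_mono (Set.Icc_subset_Icc_right (by linarith))

lemma subset_convexHull_passed {t : ℝ} (h1 : t ≤ 1) :
    curve w '' Set.Icc 0 (k + t) ⊆
      convexHull ℝ (insert (along (vtx w k) (vtx w (k + 1)) t) (passed w k)) := by
  rintro _ ⟨s, ⟨hs0, hs1⟩, rfl⟩
  rcases le_or_gt s k with hk | hk
  · exact subset_convexHull _ _ (Or.inr ⟨s, ⟨hs0, hk⟩, rfl⟩)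
  · have ht : 0 < t := by linarith
    have hP : vtx w k ∈ convexHull ℝ
        (insert (along (vtx w k) (vtx w (k + 1)) t) (passed w k)) :=
      subset_convexHull _ _ (Or.inr (vtx_mem_passed w k le_rfl))
    have hp : along (vtx w k) (vtx w (k + 1)) t ∈ convexHull ℝ
        (insert (along (vtx w k) (vtx w (k + 1)) t) (passed w k)) :=
      subset_convexHull _ _ (Or.inl rfl)
    have hs : curve w s = along (vtx w k) (vtx w (k + 1)) (s - k) := by
      rw [← curve_along w k (by linarith) (by linarith)]
      congr 1
      ring
    rw [hs]
    refine mem_convex_of_combination (convex_convexHull ℝ _) (α := t - (s - k)) (β := s - k)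
      (γ := 0) hP hp hp (by linarith) (by linarith) le_rfl (by linarith) ?_ ?_ <;>
    · simp only [along_re, along_im]
      ring

lemma curve_mem_image {t : ℝ} (h0 : 0 ≤ t) (h1 : t ≤ 1) :
    along (vtx w k) (vtx w (k + 1)) t ∈ curve w '' Set.Icc 0 (k + t) :=
  ⟨k + t, ⟨by positivity, le_rfl⟩, curve_along w k h0 h1⟩

end Passed

namespace Grow

variable {n : ℕ} (v w : Fin n → ℂ) (I : ℕ → ℕ) (c : ℕ) (L₀ : ℕ → Entry)

/-- The invariant of the passage of the chain `w`, apart from the hull itself. -/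
structure State (σ : Mem) : Prop where
  env : Env v I σ
  lo_eq : σ.nat 5 = σ.nat 3
  hi_eq : σ.nat 6 = σ.nat 4
  arr_eq : σ.natArr 4 = σ.natArr 3
  edge_eq : σ.real 0 = σ.nat 7
  edge_lt : σ.nat 7 + 1 < n
  lt : σ.nat 3 < σ.nat 4
  /-- The deque begins at the position `n`, and its front moves by at most one position per edge. -/
  room : n ≤ σ.nat 3 + σ.nat 7
  entries : ∀ x, σ.nat 3 ≤ x → x < σ.nat 4 → ∃ j ≤ σ.nat 7, σ.natArr 3 x = I j
  leaves : LeavesHulls w (σ.nat 7 + 1)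
  log : LogCorrect v w I c L₀ σ.log (σ.nat 10) (σ.real 0 + σ.real 1)

section Record

variable (σ : Mem)

lemma record_nat (r : ℕ) :
    (record.den σ).nat r = if r = 10 then σ.nat 10 + 1 else σ.nat r := by
  simp [record, Code.list, Code.den, setNat_nat, NatExpr.eval, setReal_nat, setRealArr_nat,
    setNatArr_nat]

lemma record_real (r : ℕ) : (record.den σ).real r = if r = 1 then σ.real 4 else σ.real r := by
  simp [record, Code.list, Code.den, setNat_real, setReal_real, setRealArr_real, RealExpr.eval,
    setNatArr_real]

lemma record_natArr {A : ℕ} (h6 : A ≠ 6) (h7 : A ≠ 7) (h8 : A ≠ 8) :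
    (record.den σ).natArr A = σ.natArr A :=
  record.den_natArr σ (by simp [record, Code.writes, Code.list, h6, h7, h8])

lemma record_point : (record.den σ).point = σ.point := by
  funext i
  simp only [Mem.point]
  rw [record.den_realArr σ (by decide), record.den_realArr σ (by decide)]

lemma record_log : (record.den σ).log = Function.update σ.log (σ.nat 10)
    ⟨σ.real 0 + σ.real 1, σ.real 0 + σ.real 4, σ.real 0, σ.nat 7, σ.natArr 3 (σ.nat 3),
      σ.natArr 3 (σ.nat 4 - 1)⟩ := by
  funext x
  by_cases hx : x = σ.nat 10
  · subst hx
    simp [Mem.log, record, Code.list, Code.den, setNat_realArr, setReal_realArr, setRealArr_realArr,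
      setNatArr_realArr, setNat_natArr, setReal_natArr, setRealArr_natArr, setNatArr_natArr,
      setNatArr_nat, setRealArr_nat, setRealArr_real, NatExpr.eval, RealExpr.eval,
      front, back]
  · simp [Mem.log, record, Code.list, Code.den, setNat_realArr, setReal_realArr, setRealArr_realArr,
      setNatArr_realArr, setNat_natArr, setReal_natArr, setRealArr_natArr, setNatArr_natArr,
      setNatArr_nat, setRealArr_nat, NatExpr.eval, hx]

end Record

variable {v w I c L₀}

/-- Passing an event at the position `T` on the current edge. -/
lemma State.record {σ : Mem} (h : State v w I c L₀ σ) (x y : ℝ) {T : ℝ}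
    (hm : TipMoves (passed w (σ.nat 7)) (vtx w (σ.nat 7)) (vtx w (σ.nat 7 + 1)) (points σ)
      (σ.real 1)) (hT : σ.real 1 ≤ T) (hT1 : T ≤ 1)
    (hF : ∀ T', PopsFront (vtx w (σ.nat 7)) (vtx w (σ.nat 7 + 1)) (points σ) T' → T ≤ T')
    (hB : ∀ T', PopsBack (vtx w (σ.nat 7)) (vtx w (σ.nat 7 + 1)) (points σ) T' → T ≤ T') :
    State v w I c L₀ (record.den (((σ.setReal 2 x).setReal 3 y).setReal 4 T)) := by
  set ρ := ((σ.setReal 2 x).setReal 3 y).setReal 4 T with hρ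
  have hnat : ∀ r, (Grow.record.den ρ).nat r = if r = 10 then σ.nat 10 + 1 else σ.nat r :=
    record_nat ρ
  have hreal : ∀ r, (Grow.record.den ρ).real r = if r = 1 then T else ρ.real r := by
    intro r
    rw [record_real]
    simp [hρ, setReal_real]
  have hr0 : ρ.real 0 = σ.real 0 := by simp [hρ, setReal_real]
  have hr1 : ρ.real 1 = σ.real 1 := by simp [hρ, setReal_real]
  have hr4 : ρ.real 4 = T := by simp [hρ, setReal_real]
  have h3 : (Grow.record.den ρ).natArr 3 = σ.natArr 3 :=
    record_natArr ρ (by decide) (by decide) (by decide)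
  have h4 : (Grow.record.den ρ).natArr 4 = σ.natArr 4 :=
    record_natArr ρ (by decide) (by decide) (by decide)
  have henv : Env v I ρ := ⟨h.env.count, h.env.zero, h.env.point, h.env.order⟩
  have hlog : (Grow.record.den ρ).log = _ := record_log ρ
  rw [hr0, hr1, hr4] at hlog
  constructor
  · exact henv.den (by decide)
  · simpa [hnat] using h.lo_eq
  · simpa [hnat] using h.hi_eq
  · rw [h3, h4, h.arr_eq]
  · simpa [hnat, hreal, hr0] using h.edge_eq
  · simpa [hnat] using h.edge_lt
  · simpa [hnat] using h.lt
  · simpa [hnat] using h.room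
  · simpa [hnat, h3] using h.entries
  · simpa [hnat] using h.leaves
  · rw [hlog, hnat, hreal, hreal]
    simp only [if_true, zero_ne_one, if_false, hr0]
    refine h.log.push (e := ⟨σ.real 0 + σ.real 1, σ.real 0 + T, σ.real 0, ρ.nat 7,
      ρ.natArr 3 (ρ.nat 3), ρ.natArr 3 (ρ.nat 4 - 1)⟩) ?_ rfl
    have h7 : ρ.nat 7 = σ.nat 7 := rfl
    have hlt := h.lt
    have h0 := hm.nonneg
    constructor
    · exact h.edge_lt
    · exact h.edge_eq
    · simp only [h7, h.edge_eq]
      linarith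
    · simp only
      linarith
    · simp only [h7, h.edge_eq]
      linarith
    · exact h.entries _ le_rfl h.lt
    · exact h.entries (σ.nat 4 - 1) (by omega) (by omega)
    · intro s hs i hi
      simp only [h.edge_eq] at hs
      have e : s = (σ.nat 7 : ℕ) + (s - (σ.nat 7 : ℕ)) := by ring
      rw [e, curve_along w _ (by linarith [hs.1]) (by linarith [hs.2]), ← h.env.point]
      exact hm.tangent (by linarith [hs.1]) (by linarith [hs.1]) (by linarith [hs.2])
        (fun T' hT' => by linarith [hF T' hT', hs.2]) (fun T' hT' => by linarith [hB T' hT', hs.2])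
        (slice_head _ h.lt) (slice_getLast _ h.lt) (vtx_mem_passed w _ hi)

end Grow
namespace Grow

variable {n : ℕ} {v w : Fin n → ℂ} {I : ℕ → ℕ} {c : ℕ} {L₀ : ℕ → Entry} {σ : Mem}

lemma State.popFront (h : State v w I c L₀ σ) (hlt : σ.nat 3 + 1 < σ.nat 4) :
    State v w I c L₀ (popFront.den σ) ∧ points (popFront.den σ) = (points σ).tail := by
  refine ⟨⟨h.env.den (by decide), ?_, ?_, ?_, ?_, ?_, ?_, ?_, ?_, ?_, ?_⟩, (slice_tail _ h.lt).symm⟩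
  · rfl
  · exact h.hi_eq
  · exact h.arr_eq
  · exact h.edge_eq
  · exact h.edge_lt
  · exact hlt
  · exact h.room.trans (Nat.add_le_add_right (Nat.le_succ _) _)
  · exact fun x hx hx' => h.entries x ((Nat.le_succ _).trans hx) hx'
  · exact h.leaves
  · exact h.log

lemma State.popBack (h : State v w I c L₀ σ) (hlt : σ.nat 3 + 1 < σ.nat 4) :
    State v w I c L₀ (popBack.den σ) ∧ points (popBack.den σ) = (points σ).dropLast := by
  refine ⟨⟨h.env.den (by decide), ?_, ?_, ?_, ?_, ?_, ?_, ?_, ?_, ?_, ?_⟩,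
    (slice_dropLast _ h.lt).symm⟩
  · exact h.lo_eq
  · rfl
  · exact h.arr_eq
  · exact h.edge_eq
  · exact h.edge_lt
  · exact (by omega : σ.nat 3 < σ.nat 4 - 1)
  · exact h.room
  · exact fun x hx (hx' : x < σ.nat 4 - 1) => h.entries x hx (by omega)
  · exact h.leaves
  · exact h.log

lemma nextEdge_nat (σ : Mem) (r : ℕ) :
    (nextEdge.den σ).nat r = if r = 7 then σ.nat 7 + 1 else σ.nat r := by
  simp [nextEdge, Code.list, Code.den, setNat_nat, setReal_nat, NatExpr.eval]

lemma nextEdge_real (σ : Mem) (r : ℕ) : (nextEdge.den σ).real r =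
    if r = 1 then 0 else if r = 0 then σ.real 0 + 1 else σ.real r := by
  simp [nextEdge, Code.list, Code.den, setNat_real, setReal_real, RealExpr.eval]

lemma pushFront_nat (σ : Mem) (r : ℕ) : (pushFront.den σ).nat r =
    if r = 5 then σ.nat 3 - 1 else if r = 3 then σ.nat 3 - 1 else σ.nat r := by
  simp [pushFront, Code.list, Code.den, setNat_nat, setNatArr_nat, NatExpr.eval]

lemma pushFront_natArr (σ : Mem) (A : ℕ) : (pushFront.den σ).natArr A =
    if A = 4 then Function.update (σ.natArr 4) (σ.nat 3 - 1) (σ.natArr 5 (σ.nat 7 + 1)) else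
      if A = 3 then Function.update (σ.natArr 3) (σ.nat 3 - 1) (σ.natArr 5 (σ.nat 7 + 1)) else
        σ.natArr A := by
  simp [pushFront, Code.list, Code.den, setNat_nat, setNat_natArr, setNatArr_nat, NatExpr.eval,
    setNatArr_natArr, vertex]

lemma pushBack_nat (σ : Mem) (r : ℕ) : (pushBack.den σ).nat r =
    if r = 6 then σ.nat 4 + 1 else if r = 4 then σ.nat 4 + 1 else σ.nat r := by
  simp [pushBack, Code.list, Code.den, setNat_nat, setNatArr_nat, NatExpr.eval]

lemma pushBack_natArr (σ : Mem) (A : ℕ) : (pushBack.den σ).natArr A =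
    if A = 4 then Function.update (σ.natArr 4) (σ.nat 4) (σ.natArr 5 (σ.nat 7 + 1)) else
      if A = 3 then Function.update (σ.natArr 3) (σ.nat 4) (σ.natArr 5 (σ.nat 7 + 1)) else
        σ.natArr A := by
  simp [pushBack, Code.list, Code.den, setNat_nat, setNat_natArr, setNatArr_nat, NatExpr.eval,
    setNatArr_natArr, vertex]

lemma leavesHulls_succ {k : ℕ} (h : LeavesHulls w k) {t₀ : ℝ} {D : List ℂ}
    (hm : TipMoves (passed w k) (vtx w k) (vtx w (k + 1)) D t₀) : LeavesHulls w (k + 1) := by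
  intro j hj t ht
  rcases (by omega : j < k ∨ j = k) with hj | rfl
  · exact h j hj t ht
  · rw [curve_along w j ht.1.le ht.2]
    exact hm.leave t ht

/-- Going on to the next edge, after a vertex has been added to the deque at either end, or not. -/
lemma State.nextEdge (h : State v w I c L₀ σ) {τ : Mem} (he : Env v I τ) (h5 : τ.nat 5 = τ.nat 3)
    (h6 : τ.nat 6 = τ.nat 4) (h4 : τ.natArr 4 = τ.natArr 3) (h7 : τ.nat 7 = σ.nat 7)
    (h0 : τ.real 0 = σ.real 0) (h10 : τ.nat 10 = σ.nat 10) (hlog : τ.log = σ.log)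
    (hlt : τ.nat 3 < τ.nat 4) (h3 : σ.nat 3 ≤ τ.nat 3 + 1)
    (hent : ∀ x, τ.nat 3 ≤ x → x < τ.nat 4 → ∃ j ≤ σ.nat 7 + 1, τ.natArr 3 x = I j)
    (h1 : σ.real 1 = 1) (hk : σ.nat 7 + 2 < n) {D : List ℂ}
    (hm : TipMoves (passed w (σ.nat 7 + 1)) (vtx w (σ.nat 7 + 1)) (vtx w (σ.nat 7 + 2)) D 0) :
    State v w I c L₀ (nextEdge.den τ) := by
  have hlog' : (Grow.nextEdge.den τ).log = τ.log := rfl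
  have harr : (Grow.nextEdge.den τ).natArr = τ.natArr := rfl
  have hr := h.room
  refine ⟨he.den (by decide), ?_, ?_, ?_, ?_, ?_, ?_, ?_, ?_, ?_, ?_⟩
  · simpa [nextEdge_nat] using h5
  · simpa [nextEdge_nat] using h6
  · simpa only [harr] using h4
  · simp [nextEdge_nat, nextEdge_real, h7, h0, h.edge_eq]
  · simp [nextEdge_nat, h7]
    omega
  · simpa [nextEdge_nat] using hlt
  · simp [nextEdge_nat, h7]
    omega
  · simpa [nextEdge_nat, harr, h7] using hent
  · simp only [nextEdge_nat, if_true, h7]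
    exact leavesHulls_succ h.leaves hm
  · have := h.log
    simp only [hlog', nextEdge_nat, nextEdge_real, hlog, h10, h0]
    rw [h1] at this
    simpa using this

/-- The four cases at a vertex. -/
lemma turn_cases (σ : Mem) {a b Q R : ℂ} (ha : σ.point (σ.natArr 3 (σ.nat 3)) = a)
    (hb : σ.point (σ.natArr 3 (σ.nat 4 - 1)) = b) (hQ : ahead σ 1 = Q) (hR : ahead σ 2 = R) :
    (turn.den σ = halt.den σ ∧ (orient Q a R = 0 ∧
        0 < (a.re - Q.re) * (R.re - Q.re) + (a.im - Q.im) * (R.im - Q.im) ∨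
      0 < orient Q a R ∧ orient Q b R ≤ 0)) ∨
    (turn.den σ = nextEdge.den σ ∧ (orient Q a R = 0 ∧
        (a.re - Q.re) * (R.re - Q.re) + (a.im - Q.im) * (R.im - Q.im) ≤ 0 ∨
      orient Q a R < 0 ∧ 0 ≤ orient Q b R)) ∨
    (turn.den σ = nextEdge.den (pushBack.den σ) ∧ orient Q a R < 0 ∧ orient Q b R < 0) ∨
    (turn.den σ = nextEdge.den (pushFront.den σ) ∧ 0 < orient Q a R ∧ 0 < orient Q b R) := by
  have hca : (orientExpr (vertex 1) front (vertex 2)).eval σ = orient Q a R := by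
    rw [eval_orientExpr, ← ha, ← hQ, ← hR]
    rfl
  have hcb : (orientExpr (vertex 1) back (vertex 2)).eval σ = orient Q b R := by
    rw [eval_orientExpr, ← hb, ← hQ, ← hR]
    rfl
  have hd : (dotExpr (vertex 1) front (vertex 2)).eval σ =
      (a.re - Q.re) * (R.re - Q.re) + (a.im - Q.im) * (R.im - Q.im) := by
    rw [eval_dotExpr, ← ha, ← hQ, ← hR]
    rfl
  simp only [turn, Code.den, Cond.Holds, hca, hcb, hd, RealExpr.eval, Rat.cast_zero]
  split_ifs with h1 h2 h3 h4 h5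
  · exact Or.inl ⟨rfl, Or.inl ⟨h1, h2⟩⟩
  · exact Or.inr (Or.inl ⟨rfl, Or.inl ⟨h1, not_lt.1 h2⟩⟩)
  · exact Or.inr (Or.inl ⟨rfl, Or.inr ⟨h3, h4⟩⟩)
  · exact Or.inr (Or.inr (Or.inl ⟨rfl, h3, not_le.1 h4⟩))
  · exact Or.inl ⟨rfl, Or.inr ⟨lt_of_le_of_ne (not_lt.1 h3) (Ne.symm h1), h5⟩⟩
  · exact Or.inr (Or.inr (Or.inr ⟨rfl, lt_of_le_of_ne (not_lt.1 h3) (Ne.symm h1), not_le.1 h5⟩))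

end Grow
namespace Grow

variable {n : ℕ} {v w : Fin n → ℂ} {I : ℕ → ℕ} {c : ℕ} {L₀ : ℕ → Entry} {b B : ℕ} {σ : Mem}

/-- `w` passes the vertices of `v` in the order `I`. -/
def Order (v w : Fin n → ℂ) (I : ℕ → ℕ) : Prop := ∀ j < n, I j < n ∧ vtx w j = vtx v (I j)

/-- The position of the moving point. -/
noncomputable def pos (σ : Mem) : ℝ := σ.real 0 + σ.real 1

variable (v w I c L₀ b B) in
/-- The moving point is on the current edge. -/
structure Running (σ : Mem) : Prop where
  state : State v w I c L₀ σ
  run : σ.nat 8 = 1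
  passes : σ.nat 9 = b
  moves : TipMoves (passed w (σ.nat 7)) (vtx w (σ.nat 7)) (vtx w (σ.nat 7 + 1)) (points σ)
    (σ.real 1)
  budget : σ.nat 10 + 2 * (n - σ.nat 7) + (σ.nat 4 - σ.nat 3) ≤ B

variable (v w I c L₀ b B) in
/-- The passage has ended at the final vertex of the current edge. -/
structure Halted (σ : Mem) : Prop where
  state : State v w I c L₀ σ
  run : σ.nat 8 = 0
  arrived : σ.real 1 = 1
  rests : TipRests (passed w (σ.nat 7 + 1)) (vtx w (σ.nat 7 + 1)) (points σ)
  outcome : (σ.nat 9 = b + 1 ∧ σ.nat 7 + 2 = n) ∨ (σ.nat 9 = b ∧ σ.nat 7 + 2 < n ∧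
    EntersHull (passed w (σ.nat 7 + 1)) (vtx w (σ.nat 7 + 1)) (vtx w (σ.nat 7 + 2)))
  budget : σ.nat 10 ≤ B

/-- A bound for the number of events to come. -/
def measure (n : ℕ) (σ : Mem) : ℕ :=
  if σ.nat 8 = 0 then 0 else 2 * (n - σ.nat 7) + (σ.nat 4 - σ.nat 3)

lemma State.ahead (h : State v w I c L₀ σ) (hw : Order v w I) {i : ℕ} (hi : σ.nat 7 + i < n) :
    ahead σ i = vtx w (σ.nat 7 + i) := by
  rw [Grow.ahead, h.env.point, h.env.order _ hi, (hw _ hi).2]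

lemma points_congr {τ : Mem} (h3 : τ.nat 3 = σ.nat 3) (h4 : τ.nat 4 = σ.nat 4)
    (hp : τ.point = σ.point) (ha : τ.natArr 3 = σ.natArr 3) : points τ = points σ := by
  rw [points, points, h3, h4, hp, ha]

lemma Running.isHullList (h : Running v w I c L₀ b B σ) {T : ℝ} (hT1 : T ≤ 1)
    (hF : ∀ T', PopsFront (vtx w (σ.nat 7)) (vtx w (σ.nat 7 + 1)) (points σ) T' → T ≤ T')
    (hB : ∀ T', PopsBack (vtx w (σ.nat 7)) (vtx w (σ.nat 7 + 1)) (points σ) T' → T ≤ T') :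
    ∀ s ∈ Set.Ioo (pos σ) (σ.real 0 + T),
      IsHullList (curve w s :: points σ) (curve w '' Set.Icc 0 s) := by
  intro s hs
  rw [pos, h.state.edge_eq] at hs
  have h0 := h.moves.nonneg
  obtain ⟨t, rfl⟩ : ∃ t, s = (σ.nat 7 : ℕ) + t := ⟨s - (σ.nat 7 : ℕ), by ring⟩
  have ht : σ.real 1 < t := by linarith [hs.1]
  have htT : t < T := by linarith [hs.2]
  rw [curve_along w _ (by linarith) (by linarith)]
  exact h.moves.isHullList (by linarith) ht.le (by linarith)
    (fun T' hT' => htT.trans_le (hF T' hT')) (fun T' hT' => htT.trans_le (hB T' hT'))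
    (passed_subset w _ (by linarith)) (subset_convexHull_passed w _ (by linarith))
    (curve_mem_image w _ (by linarith) (by linarith))

lemma State.halt (h : State v w I c L₀ σ) : State v w I c L₀ (halt.den σ) :=
  ⟨h.env.den (by decide), h.lo_eq, h.hi_eq, h.arr_eq, h.edge_eq, h.edge_lt, h.lt, h.room,
    h.entries, h.leaves, h.log⟩

lemma State.halt_count (h : State v w I c L₀ σ) :
    State v w I c L₀ ((Code.seq Grow.halt (.nset 9 (.succ (.reg 9)))).den σ) :=
  ⟨h.env.den (by decide), h.lo_eq, h.hi_eq, h.arr_eq, h.edge_eq, h.edge_lt, h.lt, h.room,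
    h.entries, h.leaves, h.log⟩

/-- The step at a vertex which is not the last one. -/
lemma State.turn (h : State v w I c L₀ σ) (hv : IsSimpleChain w) (hw : Order v w I)
    (hk : σ.nat 7 + 2 < n) (h8 : σ.nat 8 = 1) (h9 : σ.nat 9 = b) (h1 : σ.real 1 = 1)
    (hr : TipRests (passed w (σ.nat 7 + 1)) (vtx w (σ.nat 7 + 1)) (points σ))
    (hB : σ.nat 10 + 2 * (n - σ.nat 7) + (σ.nat 4 - σ.nat 3) ≤ B + 1) :
    (Running v w I c L₀ b B (turn.den σ) ∨ Halted v w I c L₀ b B (turn.den σ)) ∧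
      measure n (turn.den σ) < 2 * (n - σ.nat 7) + (σ.nat 4 - σ.nat 3) ∧
      pos (turn.den σ) = σ.real 0 + 1 := by
  have hlt := h.lt
  have hroom := h.room
  have ha := slice_head (fun i => σ.point (σ.natArr 3 i)) h.lt
  have hb := slice_getLast (fun i => σ.point (σ.natArr 3 i)) h.lt
  have hQ := h.ahead hw h.edge_lt
  have hR := h.ahead hw hk
  have hQR : vtx w (σ.nat 7 + 1) ≠ vtx w (σ.nat 7 + 2) := fun e =>
    hv.edge_ne_zero (k := σ.nat 7 + 1) hk (sub_eq_zero.2 e.symm)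
  have hnew : σ.point (σ.natArr 5 (σ.nat 7 + 1)) = vtx w (σ.nat 7 + 1) := hQ
  have hord : σ.natArr 5 (σ.nat 7 + 1) = I (σ.nat 7 + 1) := h.env.order _ h.edge_lt
  have hentries : ∀ x, σ.nat 3 ≤ x → x < σ.nat 4 → ∃ j ≤ σ.nat 7 + 1, σ.natArr 3 x = I j :=
    fun x hx hx' => (h.entries x hx hx').imp fun j hj => ⟨hj.1.trans (Nat.le_succ _), hj.2⟩
  have hhalt : EntersHull (passed w (σ.nat 7 + 1)) (vtx w (σ.nat 7 + 1)) (vtx w (σ.nat 7 + 2)) →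
      (Running v w I c L₀ b B (Grow.halt.den σ) ∨ Halted v w I c L₀ b B (Grow.halt.den σ)) ∧
      measure n (Grow.halt.den σ) < 2 * (n - σ.nat 7) + (σ.nat 4 - σ.nat 3) ∧
      pos (Grow.halt.den σ) = σ.real 0 + 1 := fun hE =>
    ⟨Or.inr ⟨h.halt, rfl, h1, hr, Or.inr ⟨h9, hk, hE⟩,
      (by omega : σ.nat 10 ≤ B)⟩, by
        have : measure n (Grow.halt.den σ) = 0 := rfl
        omega, by rw [← h1]; rfl⟩
  have hnext : ∀ {τ : Mem} {D : List ℂ}, τ.nat 8 = 1 → τ.nat 9 = b → τ.nat 7 = σ.nat 7 →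
      τ.nat 10 = σ.nat 10 → τ.real 0 = σ.real 0 → τ.nat 4 - τ.nat 3 ≤ σ.nat 4 - σ.nat 3 + 1 →
      State v w I c L₀ (Grow.nextEdge.den τ) → points τ = D →
      TipMoves (passed w (σ.nat 7 + 1)) (vtx w (σ.nat 7 + 1)) (vtx w (σ.nat 7 + 2)) D 0 →
      (Running v w I c L₀ b B (Grow.nextEdge.den τ) ∨
        Halted v w I c L₀ b B (Grow.nextEdge.den τ)) ∧
      measure n (Grow.nextEdge.den τ) < 2 * (n - σ.nat 7) + (σ.nat 4 - σ.nat 3) ∧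
      pos (Grow.nextEdge.den τ) = σ.real 0 + 1 := by
    intro τ D t8 t9 t7 t10 t0 td hs hp hm
    have hpts : points (Grow.nextEdge.den τ) = D := by
      rw [← hp]
      refine points_congr ?_ ?_ rfl rfl <;> simp [nextEdge_nat]
    refine ⟨Or.inl ⟨hs, by simpa [nextEdge_nat] using t8, by simpa [nextEdge_nat] using t9, ?_, ?_⟩,
      ?_, ?_⟩
    · rw [hpts]
      simpa [nextEdge_nat, nextEdge_real, t7] using hm
    · simp [nextEdge_nat, t7, t10]
      omega
    -- a new edge lowers the measure by two, and at most one vertex is pushed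
    · simp [measure, nextEdge_nat, t8, t7]
      omega
    · simp [pos, nextEdge_real, t0]
  rcases turn_cases σ rfl rfl hQ hR with ⟨e, hc⟩ | ⟨e, hc⟩ | ⟨e, hc⟩ | ⟨e, hc⟩
  · rw [e]
    rcases hc with ⟨hc, hd⟩ | ⟨hc, hd⟩
    · exact hhalt (hr.enters_of_parallel ha hc hd)
    · exact hhalt (hr.enters_of_between ha hb hc hd)
  · rw [e]
    have hm : TipMoves (passed w (σ.nat 7 + 1)) (vtx w (σ.nat 7 + 1)) (vtx w (σ.nat 7 + 2))
        (points σ) 0 := by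
      rcases hc with ⟨hc, hd⟩ | ⟨hc, hd⟩
      · exact hr.straight_of_parallel ha hQR hc hd
      · exact hr.straight_of_opposite ha hb hc hd
    exact hnext h8 h9 rfl rfl rfl (by omega) (h.nextEdge h.env h.lo_eq h.hi_eq h.arr_eq rfl rfl rfl
      rfl hlt (by omega) hentries h1 hk hm) rfl hm
  · rw [e]
    have hm := hr.pushBack ha hb hc.1 hc.2
    refine hnext (by simpa [pushBack_nat] using h8) (by simpa [pushBack_nat] using h9)
      (by simp [pushBack_nat]) (by simp [pushBack_nat]) rfl (by simp [pushBack_nat]; omega)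
      (h.nextEdge (h.env.den (by decide)) (by simpa [pushBack_nat] using h.lo_eq)
        (by simp [pushBack_nat]) ?_ (by simp [pushBack_nat]) rfl (by simp [pushBack_nat]) ?_
        (by simp [pushBack_nat]; omega) (by simp [pushBack_nat]) ?_ h1 hk hm) ?_ hm
    · simp [pushBack_natArr, h.arr_eq]
    · funext x
      simp [Mem.log, pushBack_natArr]
      exact ⟨rfl, rfl, rfl⟩
    · intro x hx hx'
      simp only [pushBack_nat, pushBack_natArr] at hx hx' ⊢
      simp only [Nat.reduceEqDiff, if_true, if_false] at hx hx' ⊢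
      by_cases hxe : x = σ.nat 4
      · exact ⟨_, le_rfl, by rw [hxe, Function.update_self, hord]⟩
      · rw [Function.update_of_ne hxe]
        exact hentries x hx (by omega)
    · have := slice_push_back (fun i => σ.point (σ.natArr 3 i)) (vtx w (σ.nat 7 + 1)) hlt.le
      rw [points, points, ← this]
      simp only [pushBack_nat, pushBack_natArr]
      simp only [Nat.reduceEqDiff, if_true, if_false]
      congr 1
      funext i
      rw [Function.update_apply, Function.update_apply]
      split_ifs
      · exact hnew
      · rfl
  · rw [e]
    have hm := hr.pushFront ha hb hc.1 hc.2
    refine hnext (by simpa [pushFront_nat] using h8) (by simpa [pushFront_nat] using h9)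
      (by simp [pushFront_nat]) (by simp [pushFront_nat]) rfl (by simp [pushFront_nat]; omega)
      (h.nextEdge (h.env.den (by decide)) (by simp [pushFront_nat])
        (by simpa [pushFront_nat] using h.hi_eq) ?_ (by simp [pushFront_nat]) rfl
        (by simp [pushFront_nat]) ?_ (by simp [pushFront_nat]; omega)
        (by simp [pushFront_nat]; omega) ?_ h1 hk hm) ?_ hm
    · simp [pushFront_natArr, h.arr_eq]
    · funext x
      simp [Mem.log, pushFront_natArr]
      exact ⟨rfl, rfl, rfl⟩
    · intro x hx hx'
      simp only [pushFront_nat, pushFront_natArr] at hx hx' ⊢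
      simp only [Nat.reduceEqDiff, if_true, if_false] at hx hx' ⊢
      by_cases hxe : x = σ.nat 3 - 1
      · exact ⟨_, le_rfl, by rw [hxe, Function.update_self, hord]⟩
      · rw [Function.update_of_ne hxe]
        exact hentries x (by omega) hx'
    · have := slice_push_front (fun i => σ.point (σ.natArr 3 i)) (vtx w (σ.nat 7 + 1))
        (by omega) hlt.le
      rw [points, points, ← this]
      simp only [pushFront_nat, pushFront_natArr]
      simp only [Nat.reduceEqDiff, if_true, if_false]
      congr 1
      funext i
      rw [Function.update_apply, Function.update_apply]
      split_ifs
      · exact hnew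
      · rfl

lemma setReal_setReal (σ : Mem) (r : ℕ) (x y : ℝ) : (σ.setReal r x).setReal r y = σ.setReal r y := by
  simp [Mem.setReal]

/-- Every event preserves the invariant, and between two events the deque is the hull. -/
theorem Running.step (h : Running v w I c L₀ b B σ) (hv : IsSimpleChain w) (hw : Order v w I) :
    (Running v w I c L₀ b B (body.den σ) ∨ Halted v w I c L₀ b B (body.den σ)) ∧
      measure n (body.den σ) < measure n σ ∧ pos σ ≤ pos (body.den σ) ∧
      ∀ s ∈ Set.Ioo (pos σ) (pos (body.den σ)),
        IsHullList (curve w s :: points σ) (curve w '' Set.Icc 0 s) := by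
  obtain ⟨x, y, he, hx, hy⟩ := nextEvent_spec σ
  have hs := h.state
  have hlt := hs.lt
  have hk := hs.edge_lt
  have hbud := h.budget
  have hμ : measure n σ = 2 * (n - σ.nat 7) + (σ.nat 4 - σ.nat 3) := by simp [measure, h.run]
  have hP := hs.ahead hw (i := 0) (by omega)
  have hQ := hs.ahead hw hs.edge_lt
  rw [add_zero] at hP
  rw [hP, hQ] at hx hy
  by_cases hxy : 1 < min x y
  · -- no pop before the end of the edge
    have hF : ∀ T, PopsFront (vtx w (σ.nat 7)) (vtx w (σ.nat 7 + 1)) (points σ) T → 1 < T := by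
      intro T hT
      rcases hx with hx | ⟨-, hx⟩
      · obtain rfl : T = x := by
          rw [popsFront_points_iff] at hT hx
          rw [hT.2.2.2, hx.2.2.2]
        exact lt_of_lt_of_le hxy (min_le_left _ _)
      · exact absurd hT (hx T)
    have hB : ∀ T, PopsBack (vtx w (σ.nat 7)) (vtx w (σ.nat 7 + 1)) (points σ) T → 1 < T := by
      intro T hT
      rcases hy with hy | ⟨-, hy⟩
      · obtain rfl : T = y := by
          rw [popsBack_points_iff] at hT hy
          rw [hT.2.2.2, hy.2.2.2]
        exact lt_of_lt_of_le hxy (min_le_right _ _)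
      · exact absurd hT (hy T)
    have hbody : body.den σ = (Code.ite (.natEq (.succ (.succ (.reg 7))) (.reg 0))
        (.seq halt (.nset 9 (.succ (.reg 9)))) turn).den
        (record.den (((σ.setReal 2 x).setReal 3 y).setReal 4 1)) := by
      have : body.den σ = (Code.ite (.realLt (.const 1) (.reg 4)) arrive pop).den
        (nextEvent.den σ) := rfl
      rw [this, he]
      refine (if_pos ?_).trans ?_
      · simpa [Cond.Holds, RealExpr.eval, setReal_real] using lt_min_iff.1 hxy
      · have harr : ∀ τ : Mem, arrive.den τ = (Code.ite (.natEq (.succ (.succ (.reg 7))) (.reg 0))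
          (.seq halt (.nset 9 (.succ (.reg 9)))) turn).den
            (record.den (τ.setReal 4 ((1 : ℚ) : ℝ))) := fun _ => rfl
        rw [harr, Rat.cast_one, setReal_setReal]
    have hst := hs.record x y h.moves h.moves.le_one le_rfl (fun T hT => (hF T hT).le)
      (fun T hT => (hB T hT).le)
    have hhull := h.isHullList le_rfl (fun T hT => (hF T hT).le) (fun T hT => (hB T hT).le)
    have hrest : TipRests (passed w (σ.nat 7 + 1)) (vtx w (σ.nat 7 + 1)) (points σ) := by
      have e : passed w (σ.nat 7 + 1) = curve w '' Set.Icc 0 ((σ.nat 7 : ℕ) + 1) := by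
        rw [passed]
        push_cast
        rfl
      have h1 := subset_convexHull_passed w (σ.nat 7) le_rfl
      rw [along_one] at h1
      refine h.moves.rests hF hB ?_ (e ▸ h1) (vtx_mem_passed w _ le_rfl)
      rw [e]
      exact passed_subset w _ zero_le_one
    set ρ := record.den (((σ.setReal 2 x).setReal 3 y).setReal 4 1) with hρ
    have hn : ∀ r, ρ.nat r = if r = 10 then σ.nat 10 + 1 else σ.nat r := record_nat _
    have h0 : ρ.real 0 = σ.real 0 := by simp [hρ, record_real, setReal_real]
    have h1 : ρ.real 1 = 1 := by simp [hρ, record_real, setReal_real]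
    have hpts : points ρ = points σ := points_congr (by simp [hn]) (by simp [hn])
      (record_point _) (record_natArr _ (by decide) (by decide) (by decide))
    have h7 : ρ.nat 7 = σ.nat 7 := by simp [hn]
    have h3 : ρ.nat 3 = σ.nat 3 := by simp [hn]
    have h4 : ρ.nat 4 = σ.nat 4 := by simp [hn]
    have h10 : ρ.nat 10 = σ.nat 10 + 1 := by simp [hn]
    have h9 : ρ.nat 9 = b := by simpa [hn] using h.passes
    have h8 : ρ.nat 8 = 1 := by simpa [hn] using h.run
    have hp0 : pos σ ≤ σ.real 0 + 1 := by simpa [pos] using h.moves.le_one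
    by_cases hlast : ρ.nat 7 + 2 = n
    · have hfin : body.den σ = (Code.seq halt (.nset 9 (.succ (.reg 9)))).den ρ := by
        rw [hbody]
        exact if_pos (hlast.trans hst.env.count.symm)
      have hpos : pos (body.den σ) = σ.real 0 + 1 := by
        rw [hfin, ← h0, ← h1]
        rfl
      rw [hpos]
      refine ⟨Or.inr ?_, ?_, hp0, hhull⟩
      · rw [hfin]
        refine ⟨hst.halt_count, rfl, h1, ?_, Or.inl ⟨congrArg (· + 1) h9, hlast⟩, ?_⟩
        · show TipRests (passed w (ρ.nat 7 + 1)) (vtx w (ρ.nat 7 + 1)) (points ρ)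
          rw [h7, hpts]
          exact hrest
        · show ρ.nat 10 ≤ B
          omega
      · have : measure n (body.den σ) = 0 := by
          rw [hfin]
          rfl
        omega
    · have hfin : body.den σ = turn.den ρ := by
        rw [hbody]
        exact if_neg fun e => hlast (e.trans hst.env.count)
      have ht := hst.turn (b := b) (B := B) hv hw (by omega) h8 h9 h1
        (by rw [h7, hpts]; exact hrest) (by omega)
      rw [← hfin, h0, h7, h3, h4] at ht
      rw [ht.2.2, hμ]
      exact ⟨ht.1, ht.2.1, hp0, hhull⟩
  · -- a pop is due on this edge
    have hbody : body.den σ = (Code.ite (.realLe (.reg 2) (.reg 3)) popFront popBack).den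
        (record.den (((σ.setReal 2 x).setReal 3 y).setReal 4 (min x y))) := by
      have : body.den σ = (Code.ite (.realLt (.const 1) (.reg 4)) arrive pop).den
        (nextEvent.den σ) := rfl
      rw [this, he]
      refine (if_neg ?_).trans ?_
      · simpa only [Cond.Holds, RealExpr.eval, setReal_real, if_true, Rat.cast_one] using hxy
      · simp only [pop, Code.list, Code.den]
    set ρ := record.den (((σ.setReal 2 x).setReal 3 y).setReal 4 (min x y)) with hρ
    have hn : ∀ r, ρ.nat r = if r = 10 then σ.nat 10 + 1 else σ.nat r := record_nat _
    have h0 : ρ.real 0 = σ.real 0 := by simp [hρ, record_real, setReal_real]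
    have h1 : ρ.real 1 = min x y := by simp [hρ, record_real, setReal_real]
    have h2 : ρ.real 2 = x := by simp [hρ, record_real, setReal_real]
    have h3 : ρ.real 3 = y := by simp [hρ, record_real, setReal_real]
    have hpts : points ρ = points σ := points_congr (by simp [hn]) (by simp [hn])
      (record_point _) (record_natArr _ (by decide) (by decide) (by decide))
    have n7 : ρ.nat 7 = σ.nat 7 := by simp [hn]
    have n3 : ρ.nat 3 = σ.nat 3 := by simp [hn]
    have n4 : ρ.nat 4 = σ.nat 4 := by simp [hn]
    have n10 : ρ.nat 10 = σ.nat 10 + 1 := by simp [hn]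
    have n9 : ρ.nat 9 = b := by simpa [hn] using h.passes
    have n8 : ρ.nat 8 = 1 := by simpa [hn] using h.run
    by_cases hle : x ≤ y
    · rw [min_eq_left hle] at hxy hρ h1
      have hp : PopsFront (vtx w (σ.nat 7)) (vtx w (σ.nat 7 + 1)) (points σ) x := by
        rcases hx with hx | ⟨rfl, -⟩
        · exact hx
        · norm_num at hxy
      have hF : ∀ T, PopsFront (vtx w (σ.nat 7)) (vtx w (σ.nat 7 + 1)) (points σ) T → x ≤ T := by
        intro T hT
        rw [popsFront_points_iff] at hT hp
        rw [hT.2.2.2, hp.2.2.2]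
      have hB : ∀ T, PopsBack (vtx w (σ.nat 7)) (vtx w (σ.nat 7 + 1)) (points σ) T → x ≤ T := by
        intro T hT
        rcases hy with hy | ⟨-, hy⟩
        · rw [popsBack_points_iff] at hT hy
          rw [hT.2.2.2, ← hy.2.2.2]
          exact hle
        · exact absurd hT (hy T)
      obtain ⟨m1, m2, m3, m4⟩ := h.moves.popFront hp hB
      have hst := hs.record x y h.moves m1 m3 hF hB
      rw [← hρ] at hst
      have hlen := (popsFront_points_iff.1 hp).1
      obtain ⟨hst', hpts'⟩ := hst.popFront (by omega)
      have hfin : body.den σ = popFront.den ρ := by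
        rw [hbody]
        exact if_pos (by simpa [Cond.Holds, RealExpr.eval, h2, h3] using hle)
      have hpos : pos (body.den σ) = σ.real 0 + x := by
        rw [hfin, ← h0, ← h1]
        rfl
      rw [hpos, hfin]
      refine ⟨Or.inl ⟨hst', n8, n9, ?_, ?_⟩, ?_, by simpa [pos] using m1,
        h.isHullList m3 hF hB⟩
      · rw [hpts', hpts]
        show TipMoves (passed w (ρ.nat 7)) (vtx w (ρ.nat 7)) (vtx w (ρ.nat 7 + 1)) _ (ρ.real 1)
        rw [n7, h1]
        exact m4
      · show ρ.nat 10 + 2 * (n - ρ.nat 7) + (ρ.nat 4 - (ρ.nat 3 + 1)) ≤ B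
        omega
      · have : measure n (popFront.den ρ) =
          if ρ.nat 8 = 0 then 0 else 2 * (n - ρ.nat 7) + (ρ.nat 4 - (ρ.nat 3 + 1)) := rfl
        rw [this, n8, if_neg one_ne_zero]
        omega
    · rw [not_le] at hle
      rw [min_eq_right hle.le] at hxy hρ h1
      have hp : PopsBack (vtx w (σ.nat 7)) (vtx w (σ.nat 7 + 1)) (points σ) y := by
        rcases hy with hy | ⟨rfl, -⟩
        · exact hy
        · norm_num at hxy
      have hB : ∀ T, PopsBack (vtx w (σ.nat 7)) (vtx w (σ.nat 7 + 1)) (points σ) T → y ≤ T := by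
        intro T hT
        rw [popsBack_points_iff] at hT hp
        rw [hT.2.2.2, hp.2.2.2]
      have hF : ∀ T, PopsFront (vtx w (σ.nat 7)) (vtx w (σ.nat 7 + 1)) (points σ) T → y ≤ T := by
        intro T hT
        rcases hx with hx | ⟨-, hx⟩
        · rw [popsFront_points_iff] at hT hx
          rw [hT.2.2.2, ← hx.2.2.2]
          exact hle.le
        · exact absurd hT (hx T)
      obtain ⟨m1, m2, m3, m4⟩ := h.moves.popBack hp hF
      have hst := hs.record x y h.moves m1 m3 hF hB
      rw [← hρ] at hst
      have hlen := (popsBack_points_iff.1 hp).1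
      obtain ⟨hst', hpts'⟩ := hst.popBack (by omega)
      have hfin : body.den σ = popBack.den ρ := by
        rw [hbody]
        exact if_neg (by simpa [Cond.Holds, RealExpr.eval, h2, h3] using hle)
      have hpos : pos (body.den σ) = σ.real 0 + y := by
        rw [hfin, ← h0, ← h1]
        rfl
      rw [hpos, hfin]
      refine ⟨Or.inl ⟨hst', n8, n9, ?_, ?_⟩, ?_, by simpa [pos] using m1,
        h.isHullList m3 hF hB⟩
      · rw [hpts', hpts]
        show TipMoves (passed w (ρ.nat 7)) (vtx w (ρ.nat 7)) (vtx w (ρ.nat 7 + 1)) _ (ρ.real 1)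
        rw [n7, h1]
        exact m4
      · show ρ.nat 10 + 2 * (n - ρ.nat 7) + (ρ.nat 4 - 1 - ρ.nat 3) ≤ B
        omega
      · have : measure n (popBack.den ρ) =
          if ρ.nat 8 = 0 then 0 else 2 * (n - ρ.nat 7) + (ρ.nat 4 - 1 - ρ.nat 3) := rfl
        rw [this, n8, if_neg one_ne_zero]
        omega

end Grow

/-! ### The passage of a chain -/

section MaintainsHull

variable {n : ℕ} {v : Fin n → ℂ} {γ γ' : ℝ → ℂ} {ℓ S : ℝ} {K K' : ℕ} {tr : List Mem}
  {A lo hi : ℕ}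

lemma MaintainsHull.embed (h : MaintainsHull v γ ℓ S K tr A lo hi) (hK : K ≤ K')
    (pre post : List Mem) : MaintainsHull v γ ℓ S K' (pre ++ (tr ++ post)) A lo hi := by
  obtain ⟨⟨m, τ, pos, σ, h0, hm, hle, hτ, hσ, hh, hS⟩, hl⟩ := h
  refine ⟨⟨m, fun j => pre.length + τ j, pos, σ, h0, hm, hle, fun j hj => ?_, fun j hj => ?_, hh,
    hS⟩, hl⟩
  · have := hτ j hj
    simp only
    omega
  · obtain ⟨h1, h2⟩ := hσ j hj
    refine ⟨?_, h2⟩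
    obtain ⟨hlt, -⟩ := List.getElem?_eq_some_iff.1 h1
    show (pre ++ (tr ++ post))[pre.length + τ j]? = _
    rw [List.getElem?_append_right (by omega), Nat.add_sub_cancel_left,
      List.getElem?_append_left hlt, h1]

lemma MaintainsHull.congr (h : MaintainsHull v γ ℓ S K tr A lo hi) (hS0 : 0 ≤ S) (hSℓ : S ≤ ℓ)
    (hγ : ∀ s ∈ Set.Icc 0 ℓ, γ s = γ' s) : MaintainsHull v γ' ℓ S K tr A lo hi := by
  obtain ⟨⟨m, τ, pos, σ, h0, hm, hle, hτ, hσ, hh, hS⟩, hl⟩ := h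
  have himage : ∀ s ≤ ℓ, γ '' Set.Icc 0 s = γ' '' Set.Icc 0 s := fun s hs =>
    Set.image_congr fun x hx => hγ x ⟨hx.1, hx.2.trans hs⟩
  have hmono : ∀ i j, i ≤ j → j ≤ m → pos i ≤ pos j := by
    intro i j hij
    induction j, hij using Nat.le_induction with
    | base => exact fun _ => le_rfl
    | succ j hij ih => exact fun hj => (ih (by omega)).trans (hle j (by omega))
  refine ⟨⟨m, τ, pos, σ, h0, hm, hle, hτ, hσ, fun j hj s hs => ?_, ?_⟩, ?_⟩
  · have h1 : 0 ≤ s := h0 ▸ (hmono 0 j (Nat.zero_le _) hj.le).trans hs.1.le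
    have h2 : s ≤ ℓ := hs.2.le.trans ((hmono (j + 1) m hj le_rfl).trans (hm ▸ hSℓ))
    rw [← hγ s ⟨h1, h2⟩, ← himage s h2]
    exact hh j hj s hs
  · rw [← hγ S ⟨hS0, hSℓ⟩, ← himage S hSℓ]
    exact hS
  · refine hl.imp_right fun ⟨S', h1, h2, h3⟩ => ⟨S', h1, h2, fun s hs => ?_⟩
    rw [← hγ s ⟨hS0.trans hs.1.le, hs.2.trans h2⟩, ← himage S hSℓ]
    exact h3 s hs

end MaintainsHull

namespace Grow

variable {n : ℕ} {v w : Fin n → ℂ} {I : ℕ → ℕ} {c : ℕ} {L₀ : ℕ → Entry} {b B : ℕ} {σ ρ : Mem}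

lemma State.deque (h : State v w I c L₀ ρ) (hw : Order v w I) (ha : Agree σ ρ) :
    ((∀ i ∈ σ.deque 3 3 4, i < n) ∧ (σ.deque 3 3 4).map (vtx v) = points ρ) ∧
    ((∀ i ∈ σ.deque 4 5 6, i < n) ∧ (σ.deque 4 5 6).map (vtx v) = points ρ) := by
  have e3 : σ.deque 3 3 4 = slice (ρ.natArr 3) (ρ.nat 3) (ρ.nat 4) := by
    rw [deque_eq_slice, ha.natArr, ha.nat 3 (by decide), ha.nat 4 (by decide)]
  have e4 : σ.deque 4 5 6 = slice (ρ.natArr 3) (ρ.nat 3) (ρ.nat 4) := by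
    rw [deque_eq_slice, ha.natArr, ha.nat 5 (by decide), ha.nat 6 (by decide), h.arr_eq, h.lo_eq,
      h.hi_eq]
  have key : (∀ i ∈ slice (ρ.natArr 3) (ρ.nat 3) (ρ.nat 4), i < n) ∧
      (slice (ρ.natArr 3) (ρ.nat 3) (ρ.nat 4)).map (vtx v) = points ρ := by
    constructor
    · intro i hi
      obtain ⟨x, hx, hx', rfl⟩ := exists_of_mem_slice hi
      obtain ⟨j, hj, e⟩ := h.entries x hx hx'
      rw [e]
      have := h.edge_lt
      exact (hw j (by omega)).1
    · rw [points, h.env.point, slice, slice, List.map_map]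
      rfl
  rw [e3, e4]
  exact ⟨key, key⟩

/-- The passage of the chain `w`, started at its first vertex. -/
theorem Running.exec (h : Running v w I c L₀ b B ρ) (hv : IsSimpleChain w) (hw : Order v w I)
    (ha : Agree σ ρ) (h0 : pos ρ = 0) : ∃ tr σ' m, Exec (.loop (.natLt 12 8) body.compile) σ tr σ' ∧
      tr.length ≤ (measure n ρ + 1) * (body.cost + 1) ∧ Agree σ' (body.den^[m] ρ) ∧
      Halted v w I c L₀ b B (body.den^[m] ρ) ∧ ∀ A lo hi, (A, lo, hi) ∈ [(3, 3, 4), (4, 5, 6)] →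
        MaintainsHull v (curve w) (lastParam n) (pos (body.den^[m] ρ)) (body.cost + 1) tr
          A lo hi := by
  have hstate : ∀ σ, Running v w I c L₀ b B σ ∨ Halted v w I c L₀ b B σ → State v w I c L₀ σ :=
    fun σ h => h.elim (fun h => h.state) (fun h => h.state)
  have hrun : ∀ σ, Running v w I c L₀ b B σ ∨ Halted v w I c L₀ b B σ → σ.nat 12 < σ.nat 8 →
      Running v w I c L₀ b B σ := by
    rintro σ (h | h) hlt
    · exact h
    · have := h.run
      omega
  obtain ⟨m, hm, hlt, hnot, hinv⟩ := exists_rounds (f := body.den) (a := 12) (b := 8)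
    (I := fun σ => Running v w I c L₀ b B σ ∨ Halted v w I c L₀ b B σ) (μ := measure n)
    (fun σ hσ hlt => ⟨((hrun σ hσ hlt).step hv hw).1, ((hrun σ hσ hlt).step hv hw).2.1⟩)
    (Or.inl h)
  obtain ⟨tr, σ', he, hl, ha', τ, s, hτ0, hs, hτ⟩ := exec_loop body_valid (a := 12) (b := 8)
    (by decide) (by decide) m ha hlt hnot
  have hfin : Halted v w I c L₀ b B (body.den^[m] ρ) := by
    rcases hinv m le_rfl with h | h
    · exact absurd (by rw [h.run, h.state.env.zero]; exact one_pos) hnot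
    · exact h
  have hstep : ∀ j < m, pos (body.den^[j] ρ) ≤ pos (body.den^[j + 1] ρ) ∧
      ∀ s ∈ Set.Ioo (pos (body.den^[j] ρ)) (pos (body.den^[j + 1] ρ)),
        IsHullList (curve w s :: points (body.den^[j] ρ)) (curve w '' Set.Icc 0 s) := by
    intro j hj
    rw [Function.iterate_succ_apply']
    exact ((hrun _ (hinv j hj.le) (hlt j hj)).step hv hw).2.2
  have hpos : pos (body.den^[m] ρ) = (((body.den^[m] ρ).nat 7 + 1 : ℕ) : ℝ) := by
    rw [pos, hfin.arrived, hfin.state.edge_eq]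
    push_cast
    rfl
  have hmain : ∀ A lo hi, (∀ {σ ρ : Mem}, State v w I c L₀ ρ → Agree σ ρ →
      (∀ i ∈ σ.deque A lo hi, i < n) ∧ (σ.deque A lo hi).map (vtx v) = points ρ) →
        MaintainsHull v (curve w) (lastParam n) (pos (body.den^[m] ρ)) (body.cost + 1) tr
          A lo hi := by
    intro A lo hi hd
    refine ⟨⟨m, τ, fun j => pos (body.den^[j] ρ), s, h0, rfl, fun j hj => (hstep j hj).1, hτ,
      fun j hj => ⟨(hs j hj).1, (hd (hstate _ (hinv j hj)) (hs j hj).2).1⟩, fun j hj t ht => ?_,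
      ?_⟩, ?_⟩
    · rw [(hd (hstate _ (hinv j hj.le)) (hs j hj.le).2).2]
      exact (hstep j hj).2 t ht
    · rw [(hd (hstate _ (hinv m le_rfl)) (hs m le_rfl).2).2, hpos, curve_nat]
      exact hfin.rests.isHullList
    · rw [hpos]
      rcases hfin.outcome with ⟨-, hk⟩ | ⟨-, hk, δ, hδ, hδ1, hE⟩
      · left
        rw [lastParam_eq (by omega)]
        congr 1
        omega
      · right
        refine ⟨_, lt_add_of_pos_right _ hδ, ?_, fun t ht => ?_⟩
        · exact (add_le_add_right hδ1 _).trans (add_one_le_lastParam hk)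
        · have := hE (t - ((body.den^[m] ρ).nat 7 + 1 : ℕ)) ⟨by linarith [ht.1], by linarith [ht.2]⟩
          rw [← curve_along w _ (by linarith [ht.1]) (by linarith [ht.2])] at this
          rw [show t = (((body.den^[m] ρ).nat 7 + 1 : ℕ) : ℝ) +
            (t - (((body.den^[m] ρ).nat 7 + 1 : ℕ) : ℝ)) by ring]
          exact this
  refine ⟨tr, σ', m, he, hl.trans (Nat.mul_le_mul_right _ (by omega)), ha', hfin,
    fun A lo hi hA => ?_⟩
  simp only [List.mem_cons, Prod.mk.injEq, List.not_mem_nil, or_false] at hA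
  rcases hA with ⟨rfl, rfl, rfl⟩ | ⟨rfl, rfl, rfl⟩
  · exact hmain _ _ _ fun h1 h2 => (h1.deque hw h2).1
  · exact hmain _ _ _ fun h1 h2 => (h1.deque hw h2).2

/-- A passage ends before the last vertex only if there is a point without butterfly. -/
lemma Halted.complete (h : Halted v w I c L₀ b B σ)
    (hb : ∀ s ∈ Set.Icc 0 (lastParam n), (butterfly w s).Nonempty) : σ.nat 9 = b + 1 := by
  rcases h.outcome with h | ⟨-, hk, δ, hδ, hδ1, hE⟩
  · exact h.1
  · have hmem := hE δ ⟨hδ, le_rfl⟩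
    have hle := add_one_le_lastParam hk
    have hle' : (((σ.nat 7 + 1 : ℕ) : ℝ)) + δ ≤ lastParam n := by linarith
    rw [← curve_along w _ hδ.le hδ1] at hmem
    exact absurd hmem (curve_notMem_convexHull_of_butterfly (by linarith) hle'
      (hb _ ⟨by positivity, hle'⟩))

lemma Halted.leavesHulls (h : Halted v w I c L₀ b B σ) (h9 : σ.nat 9 = b + 1) :
    LeavesHulls w (n - 1) := by
  rcases h.outcome with h' | h'
  · have := h.state.leaves
    rwa [show n - 1 = σ.nat 7 + 1 by omega]
  · omega

lemma Halted.pos_eq_iff (h : Halted v w I c L₀ b B σ) :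
    pos σ = lastParam n ↔ σ.nat 9 = b + 1 := by
  have hn := h.state.edge_lt
  rw [pos, h.arrived, h.state.edge_eq, lastParam_eq (by omega)]
  have : ((σ.nat 7 : ℕ) : ℝ) + 1 = ((n - 1 : ℕ) : ℝ) ↔ σ.nat 7 + 1 = n - 1 := by
    exact_mod_cast Iff.rfl
  rw [this]
  rcases h.outcome with h' | h' <;> omega

end Grow

lemma Code.iterate_frame (C : Code) (σ : Mem) (m : ℕ) :
    (∀ r, (0, r) ∉ C.writes → (C.den^[m] σ).nat r = σ.nat r) ∧
    (∀ r, (1, r) ∉ C.writes → (C.den^[m] σ).real r = σ.real r) ∧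
    (∀ r, (2, r) ∉ C.writes → (C.den^[m] σ).natArr r = σ.natArr r) ∧
    (∀ r, (3, r) ∉ C.writes → (C.den^[m] σ).realArr r = σ.realArr r) := by
  induction m with
  | zero => simp
  | succ m ih =>
    obtain ⟨h1, h2, h3, h4⟩ := ih
    rw [Function.iterate_succ_apply']
    exact ⟨fun r hr => (C.den_nat _ hr).trans (h1 r hr), fun r hr => (C.den_real _ hr).trans (h2 r hr),
      fun r hr => (C.den_natArr _ hr).trans (h3 r hr),
      fun r hr => (C.den_realArr _ hr).trans (h4 r hr)⟩

namespace Grow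

/-- Writes the order of the passage into the array `5`: the entry at the position in the register
`13` is the number in the register `14`, and `e` is the next such number. -/
def fill (e : NatExpr) : Code := .list [.nput 5 (.reg 13) (.reg 14), .nset 14 e,
  .nset 13 (.succ (.reg 13))]

/-- Start a passage at its first vertex. -/
def init : Code := .list [.nset 3 (.reg 0), .nset 4 (.succ (.reg 0)), .nset 5 (.reg 0),
  .nset 6 (.succ (.reg 0)), .nput 3 (.reg 0) (.arr 5 (.const 0)),
  .nput 4 (.reg 0) (.arr 5 (.const 0)), .nset 7 (.const 0), .nset 8 (.const 1),
  .rset 0 (.const 0), .rset 1 (.const 0)]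

/-- A passage of the chain, in the order that begins with `first` and continues with `e`. -/
def passage (first e : NatExpr) : Prog :=
  .seq (Code.list [.nset 13 (.const 0), .nset 14 first]).compile
    (.seq (.loop (.natLt 13 0) (fill e).compile)
      (.seq init.compile (.loop (.natLt 12 8) body.compile)))

variable {n : ℕ} {v w : Fin n → ℂ} {I : ℕ → ℕ} {σ ρ : Mem}

lemma fill_den (e : NatExpr) (σ : Mem) : (fill e).den σ =
    (((σ.setNatArr 5 (σ.nat 13) (σ.nat 14)).setNat 14
      (e.eval (σ.setNatArr 5 (σ.nat 13) (σ.nat 14)))).setNat 13 (σ.nat 13 + 1)) := by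
  simp [fill, Code.list, Code.den, NatExpr.eval, setNat_nat, setNatArr_nat]

lemma iterate_fill {e : NatExpr} (he : ∀ σ : Mem, ∀ j, σ.nat 14 = I j → e.eval σ = I (j + 1))
    (h13 : ρ.nat 13 = 0) (h14 : ρ.nat 14 = I 0) (m : ℕ) :
    ((fill e).den^[m] ρ).nat 13 = m ∧ ((fill e).den^[m] ρ).nat 14 = I m ∧
      ∀ j < m, ((fill e).den^[m] ρ).natArr 5 j = I j := by
  induction m with
  | zero => exact ⟨h13, h14, fun j hj => absurd hj (by omega)⟩
  | succ m ih =>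
    obtain ⟨h1, h2, h3⟩ := ih
    rw [Function.iterate_succ_apply', fill_den]
    refine ⟨by simp [setNat_nat, h1], ?_, fun j hj => ?_⟩
    · simp only [setNat_nat, if_true, Nat.reduceEqDiff, if_false]
      exact he _ _ h2
    · simp only [setNat_natArr, setNatArr_natArr, if_true, h1]
      rcases (by omega : j < m ∨ j = m) with hj | rfl
      · rw [Function.update_of_ne hj.ne]
        exact h3 j hj
      · rw [Function.update_self, h2]

/-- At the beginning of a passage the deque consists of the first vertex, at the position `n`: at
most `n` vertices are pushed on either side, so the position of the front remains a natural number.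
-/
lemma init_spec (hρ : Env v I ρ) (hv : IsSimpleChain w) (hw : Order v w I) (hn : 2 ≤ n)
    (h43 : ρ.natArr 4 = ρ.natArr 3) :
    Running v w I (ρ.nat 10) ρ.log (ρ.nat 9) (ρ.nat 10 + 2 * n + 1) (init.den ρ) ∧
      pos (init.den ρ) = 0 ∧ measure n (init.den ρ) = 2 * n + 1 := by
  have h0 := hρ.count
  have hnat : ∀ r, (init.den ρ).nat r = if r = 8 then 1 else if r = 7 then 0 else
      if r = 6 then n + 1 else if r = 5 then n else if r = 4 then n + 1 else if r = 3 then n else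
        ρ.nat r := by
    intro r
    simp [init, Code.list, Code.den, setNat_nat, setNatArr_nat, setReal_nat, NatExpr.eval, h0]
  have hreal : ∀ r, (init.den ρ).real r = if r = 1 then 0 else if r = 0 then 0 else ρ.real r := by
    intro r
    simp [init, Code.list, Code.den, setNat_real, setNatArr_real, setReal_real, RealExpr.eval]
  have harr : ∀ A, (init.den ρ).natArr A = if A = 4 then Function.update (ρ.natArr 4) n (I 0) else
      if A = 3 then Function.update (ρ.natArr 3) n (I 0) else ρ.natArr A := by
    intro A
    simp [init, Code.list, Code.den, setNat_natArr, setNatArr_natArr, setReal_natArr, NatExpr.eval,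
      setNat_nat, setNatArr_nat, h0, hρ.order 0 (by omega)]
  have henv : Env v I (init.den ρ) := hρ.den (by decide)
  have hlog : (init.den ρ).log = ρ.log := by
    funext x
    simp only [Mem.log]
    rw [harr 6, harr 7, harr 8]
    rfl
  have hmem : (init.den ρ).natArr 3 n = I 0 := by simp [harr]
  have hpts : points (init.den ρ) = [vtx w 0] := by
    rw [points, hnat 3, hnat 4]
    simp only [Nat.reduceEqDiff, if_true, if_false]
    rw [slice_cons _ (Nat.lt_succ_self n), hmem, henv.point, (hw 0 (by omega)).2]
    simp [slice]
  have hpassed : passed w 0 = {vtx w 0} := by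
    simp only [passed, Nat.cast_zero, Set.Icc_self, Set.image_singleton]
    rw [← Nat.cast_zero, curve_nat]
  have hne : vtx w 0 ≠ vtx w 1 := fun e => hv.edge_ne_zero (k := 0) (by omega)
    (sub_eq_zero.2 e.symm)
  have hm : TipMoves (passed w 0) (vtx w 0) (vtx w (0 + 1)) [vtx w 0] 0 := by
    rw [hpassed]
    exact tipMoves_singleton hne
  refine ⟨⟨⟨henv, ?_, ?_, ?_, ?_, ?_, ?_, ?_, ?_, ?_, ?_⟩, ?_, ?_, ?_, ?_⟩, ?_, ?_⟩
  · simp [hnat]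
  · simp [hnat]
  · rw [harr, harr]
    simp only [Nat.reduceEqDiff, if_true, if_false, h43]
  · simp [hnat, hreal]
  · simp [hnat]
    omega
  · simp [hnat]
  · simp [hnat]
  · intro x hx hx'
    simp [hnat] at hx hx'
    refine ⟨0, Nat.zero_le _, ?_⟩
    obtain rfl : x = n := by omega
    exact hmem
  · have : (init.den ρ).nat 7 = 0 := by simp [hnat]
    rw [this]
    exact leavesHulls_succ (fun j hj => absurd hj (by omega)) hm
  · rw [hlog]
    have h10 : (init.den ρ).nat 10 = ρ.nat 10 := by simp [hnat]
    have hp : (init.den ρ).real 0 + (init.den ρ).real 1 = 0 := by simp [hreal]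
    rw [h10, hp]
    exact ⟨le_rfl, fun _ _ => rfl, fun x h h' => absurd h' (by omega), by simp [logEnd]⟩
  · simp [hnat]
  · simp [hnat]
  · have h7 : (init.den ρ).nat 7 = 0 := by simp [hnat]
    have h1 : (init.den ρ).real 1 = 0 := by simp [hreal]
    rw [h7, h1, hpts]
    exact hm
  · simp [hnat]
  · simp [pos, hreal]
  · simp [measure, hnat]

/-- A bound for the number of steps of a passage, per vertex. -/
def passageCost (first e : NatExpr) : ℕ :=
  (Code.list [.nset 13 (.const 0), .nset 14 first]).cost + 2 * ((fill e).cost + 1) + init.cost +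
    3 * (body.cost + 1)

/-- The registers that a passage leaves unchanged. -/
def Untouched (σ ρ : Mem) : Prop :=
  (∀ r, r ∈ [0, 1, 2, 12, 15] → σ.nat r = ρ.nat r) ∧ σ.real 5 = ρ.real 5 ∧ σ.point = ρ.point

set_option maxRecDepth 4000 in
/-- A passage runs in linear time and ends in a halted state. Each round of its loop passes one
event in constantly many steps, and between two events both copies of the deque hold the hull. -/
theorem exec_passage {first e : NatExpr} (hval : first.Valid = true ∧ e.Valid = true)
    (h0 : ρ.nat 0 = n) (h12 : ρ.nat 12 = 0) (hp : ρ.point = vtx v)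
    (hfirst : first.eval (ρ.setNat 13 0) = I 0)
    (he : ∀ σ : Mem, ∀ j, σ.nat 14 = I j → e.eval σ = I (j + 1)) (hv : IsSimpleChain w)
    (hw : Order v w I) (hn : 2 ≤ n) (h43 : ρ.natArr 4 = ρ.natArr 3) (ha : Agree σ ρ) :
    ∃ tr σ' ρ', Exec (passage first e) σ tr σ' ∧ tr.length ≤ passageCost first e * n ∧
      Agree σ' ρ' ∧ Halted v w I (ρ.nat 10) ρ.log (ρ.nat 9) (ρ.nat 10 + 2 * n + 1) ρ' ∧
      Untouched ρ' ρ ∧ ∀ A lo hi, (A, lo, hi) ∈ [(3, 3, 4), (4, 5, 6)] →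
        MaintainsHull v (curve w) (lastParam n) (pos ρ') (body.cost + 1) tr A lo hi := by
  set ρ₁ := (Code.list [.nset 13 (.const 0), .nset 14 first]).den ρ with hρ₁
  obtain ⟨tr₁, σ₁, e1, l1, a1⟩ := (Code.list [.nset 13 (.const 0), .nset 14 first]).exec_compile ha
    (by simp [Code.list, Code.Valid, hval.1, numVars, NatExpr.Valid])
  rw [← hρ₁] at a1
  have hρ₁' : ρ₁ = (ρ.setNat 13 0).setNat 14 (I 0) := by
    rw [← hfirst]
    rfl
  have hwr : ∀ x, x ≠ (2, 5) → x ≠ (0, 13) → x ≠ (0, 14) → x ∉ (fill e).writes := by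
    intro x h1 h2 h3
    simp [fill, Code.list, Code.writes, h1, h2, h3]
  have hf := (fill e).iterate_frame ρ₁
  obtain ⟨k1, k2, k3⟩ := iterate_fill (ρ := ρ₁) he (by simp [hρ₁', setNat_nat])
    (by simp [hρ₁', setNat_nat]) n
  have hnat : ∀ r, r ≠ 13 → r ≠ 14 → ∀ m, ((fill e).den^[m] ρ₁).nat r = ρ.nat r := by
    intro r h1 h2 m
    rw [(hf m).1 r (hwr _ (by simp) (by simp [h1]) (by simp [h2])), hρ₁']
    simp [setNat_nat, h1, h2]
  obtain ⟨tr₂, σ₂, e2, l2, a2, -⟩ := exec_loop (C := fill e) (a := 13) (b := 0)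
    (by simp [fill, Code.list, Code.Valid, hval.2, numVars, NatExpr.Valid]) (by decide)
    (by decide) n a1
    (fun j hj => by
      rw [(iterate_fill (ρ := ρ₁) he (by simp [hρ₁', setNat_nat])
        (by simp [hρ₁', setNat_nat]) j).1, hnat 0 (by simp) (by simp), h0]
      exact hj)
    (by rw [k1, hnat 0 (by simp) (by simp), h0]; exact lt_irrefl n)
  set ρ₂ := (fill e).den^[n] ρ₁ with hρ₂
  have hreal : ∀ r, ρ₂.real r = ρ.real r := by
    intro r
    rw [(hf n).2.1 r (hwr _ (by simp) (by simp) (by simp)), hρ₁']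
    rfl
  have hnatArr : ∀ A, A ≠ 5 → ρ₂.natArr A = ρ.natArr A := by
    intro A hA
    rw [(hf n).2.2.1 A (hwr _ (by simp [hA]) (by simp) (by simp)), hρ₁']
    rfl
  have hrealArr : ∀ A, ρ₂.realArr A = ρ.realArr A := by
    intro A
    rw [(hf n).2.2.2 A (hwr _ (by simp) (by simp) (by simp)), hρ₁']
    rfl
  have hpoint : ρ₂.point = ρ.point := by
    funext i
    simp only [Mem.point, hrealArr]
  have hlog : ρ₂.log = ρ.log := by
    funext x
    simp only [Mem.log, hrealArr, hnatArr 6 (by simp), hnatArr 7 (by simp), hnatArr 8 (by simp)]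
  have henv : Env v I ρ₂ := ⟨(hnat 0 (by simp) (by simp) n).trans h0,
    (hnat 12 (by simp) (by simp) n).trans h12, hpoint.trans hp, k3⟩
  obtain ⟨r1, r2, r3⟩ := init_spec henv hv hw hn
    (by rw [hnatArr 4 (by simp), hnatArr 3 (by simp), h43])
  rw [hlog, hnat 10 (by simp) (by simp), hnat 9 (by simp) (by simp)] at r1
  obtain ⟨tr₃, σ₃, e3, l3, a3⟩ := init.exec_compile a2 (by decide)
  obtain ⟨tr₄, σ₄, m, e4, l4, a4, hh, hM⟩ := r1.exec hv hw a3 r2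
  refine ⟨_, σ₄, _, .seq e1 (.seq e2 (.seq e3 e4)), ?_, a4, hh, ⟨fun r hr => ?_, ?_, ?_⟩,
    fun A lo hi hA => ?_⟩
  · simp only [List.length_append]
    rw [r3] at l4
    have h1 : (n + 1) * ((fill e).cost + 1) ≤ 2 * ((fill e).cost + 1) * n := by nlinarith
    have h2 : (2 * n + 1 + 1) * (body.cost + 1) ≤ 3 * (body.cost + 1) * n := by nlinarith
    have h3 : (Code.list [.nset 13 (.const 0), .nset 14 first]).cost + init.cost ≤
      ((Code.list [.nset 13 (.const 0), .nset 14 first]).cost + init.cost) * n :=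
      Nat.le_mul_of_pos_right _ (by omega)
    have h4 : passageCost first e * n =
      ((Code.list [.nset 13 (.const 0), .nset 14 first]).cost + init.cost) * n +
        2 * ((fill e).cost + 1) * n + 3 * (body.cost + 1) * n := by
      rw [passageCost]
      ring
    omega
  · simp only [List.mem_cons, List.not_mem_nil, or_false] at hr
    rw [(body.iterate_frame _ m).1 r, init.den_nat, hnat r]
    all_goals rcases hr with rfl | rfl | rfl | rfl | rfl <;> decide
  · rw [(body.iterate_frame _ m).2.1 5 (by decide), init.den_real _ (by decide), hreal]
  · funext i
    simp only [Mem.point]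
    rw [(body.iterate_frame _ m).2.2.2 0 (by decide), (body.iterate_frame _ m).2.2.2 1 (by decide),
      init.den_realArr _ (by decide), init.den_realArr _ (by decide), hrealArr, hrealArr]
  · have := (hM A lo hi hA).embed le_rfl (tr₁ ++ (tr₂ ++ tr₃)) []
    simpa only [List.append_assoc, List.append_nil] using this

end Grow

/-! ### Motions with fixed wings -/

section Wings

variable {n : ℕ} (v : Fin n → ℂ) (k i j : ℕ)

/-- The first coordinate of the vertex `i`, relative to the vertex `k` and the direction of the
edge `k`, times the length of this edge. -/
noncomputable def dotEdge : ℝ := ((vtx v i).re - (vtx v k).re) * ((vtx v (k + 1)).re - (vtx v k).re) +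
  ((vtx v i).im - (vtx v k).im) * ((vtx v (k + 1)).im - (vtx v k).im)

/-- The second coordinate, in the same sense. -/
noncomputable def crossEdge : ℝ := orient (vtx v k) (vtx v (k + 1)) (vtx v i)

/-- The square of the length of the edge `k`. -/
noncomputable def sqEdge : ℝ := dotEdge v k (k + 1)

/-- For a vertex `i` before and a vertex `j` after the point at the parameter `t` of the edge `k`
this is positive if the vector of the frame for `j` is to the left of that for `i`. -/
noncomputable def comparison (t : ℝ) : ℝ :=
  (crossEdge v k i * dotEdge v k j - dotEdge v k i * crossEdge v k j) +
    t * (sqEdge v k * (crossEdge v k j - crossEdge v k i))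

/-- The numerator of the angular velocity of the bisector, if the vertices `i` and `j` support the
wing-lines: `quadA t² + quadB t + quadC`. -/
noncomputable def quadA : ℝ := sqEdge v k * sqEdge v k * (crossEdge v k i + crossEdge v k j)

/-- The linear coefficient of the numerator of the angular velocity; see `quadA`. -/
noncomputable def quadB : ℝ :=
  -2 * (sqEdge v k * (crossEdge v k i * dotEdge v k j + crossEdge v k j * dotEdge v k i))

/-- The constant coefficient of the numerator of the angular velocity; see `quadA`. -/
noncomputable def quadC : ℝ :=
  crossEdge v k i * (dotEdge v k j * dotEdge v k j + crossEdge v k j * crossEdge v k j) +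
    crossEdge v k j * (dotEdge v k i * dotEdge v k i + crossEdge v k i * crossEdge v k i)

variable {v k i j} {t : ℝ}

lemma frame_eq (h0 : 0 ≤ t) (h1 : t ≤ 1) : frame v k i (k + t) =
    (if i ≤ k then -1 else 1) * ⟨dotEdge v k i - t * sqEdge v k, crossEdge v k i⟩ := by
  rw [frame, curve_add v k h0 h1]
  congr 1
  apply Complex.ext
  · simp [dotEdge, sqEdge]
    ring
  · simp [crossEdge, orient]
    ring

lemma sqEdge_pos (hv : IsSimpleChain v) (hk : k + 1 < n) : 0 < sqEdge v k := by
  have := Complex.normSq_pos.2 (hv.edge_ne_zero hk)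
  rw [Complex.normSq_apply] at this
  simpa [sqEdge, dotEdge] using this

/-- The arguments of the frame can be compared by cross products. -/
lemma arg_frame_le (hv : IsSimpleChain v) (hk : k + 1 < n) {s : ℝ}
    (hs : s ∈ Set.Icc (k : ℝ) (k + 1)) (hb : (butterfly v s).Nonempty) (hi : i < n) (hj : j < n)
    (h : 0 ≤ ((starRingEnd ℂ) (frame v k i s) * frame v k j s).im) (his : (i : ℝ) ≠ s)
    (hjs : (j : ℝ) ≠ s) : (frame v k i s).arg ≤ (frame v k j s).arg := by
  obtain ⟨φ, hφ⟩ := exists_isEdgeAngle v k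
  obtain ⟨θ, hθ⟩ := hb
  obtain ⟨m, ω, -, hω⟩ := exists_arg_window hφ hv hk hs hθ
  have h1 := abs_lt.1 (hω i hi)
  have h2 := abs_lt.1 (hω j hj)
  have e : ((starRingEnd ℂ) (frame v k i s) * frame v k j s).im =
      ‖frame v k i s‖ * ‖frame v k j s‖ *
        Real.sin ((frame v k j s).arg - (frame v k i s).arg) := by
    rw [Real.sin_sub]
    have a1 := Complex.norm_mul_cos_arg (frame v k i s)
    have a2 := Complex.norm_mul_sin_arg (frame v k i s)
    have a3 := Complex.norm_mul_cos_arg (frame v k j s)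
    have a4 := Complex.norm_mul_sin_arg (frame v k j s)
    simp only [Complex.mul_im, Complex.conj_re, Complex.conj_im, ← a1, ← a2, ← a3, ← a4]
    ring
  rw [e] at h
  have hpos : 0 < ‖frame v k i s‖ * ‖frame v k j s‖ :=
    mul_pos (norm_pos_iff.2 (frame_ne_zero hv hk hs hi his))
      (norm_pos_iff.2 (frame_ne_zero hv hk hs hj hjs))
  by_contra hc
  have := Real.sin_neg_of_neg_of_neg_pi_lt
    (x := (frame v k j s).arg - (frame v k i s).arg) (by linarith) (by linarith)
  nlinarith

lemma natCast_ne_of_mem_Ioo (h : t ∈ Set.Ioo (0 : ℝ) 1) : (i : ℝ) ≠ k + t := by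
  intro e
  have h1 : (k : ℝ) < i := by linarith [h.1]
  have h2 : (i : ℝ) < ((k + 1 : ℕ) : ℝ) := by push_cast; linarith [h.2]
  have h1' : k < i := by exact_mod_cast h1
  have h2' : i < k + 1 := by exact_mod_cast h2
  omega

lemma mem_edge (h0 : 0 ≤ t) (h1 : t ≤ 1) : (k : ℝ) + t ∈ Set.Icc (k : ℝ) (k + 1) :=
  ⟨by linarith, by linarith⟩

lemma normSq_frame (h0 : 0 ≤ t) (h1 : t ≤ 1) : Complex.normSq (frame v k i (k + t)) =
    (dotEdge v k i - t * sqEdge v k) ^ 2 + crossEdge v k i ^ 2 := by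
  rw [frame_eq h0 h1, map_mul, Complex.normSq_apply ⟨_, _⟩]
  split_ifs <;> simp <;> ring

/-- The angular velocity of a vector of the frame is the constant cross product with the edge,
divided by the squared distance of the vertex from the point in the hole. -/
lemma hasDerivAt_arg_frame (hv : IsSimpleChain v) (hk : k + 1 < n) (ht : t ∈ Set.Ioo (0 : ℝ) 1)
    (hb : (butterfly v (k + t)).Nonempty) (hi : i < n) :
    HasDerivAt (fun s => (frame v k i s).arg)
      (sqEdge v k * crossEdge v k i / Complex.normSq (frame v k i (k + t))) (k + t) := by
  set ε : ℝ := if i ≤ k then -1 else 1 with hε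
  have hεc : ((if i ≤ k then -1 else 1 : ℂ)) = (ε : ℂ) := by
    rw [hε]
    split_ifs <;> simp
  set F : ℝ → ℂ := fun s => (ε : ℂ) *
    (((dotEdge v k i - (s - k) * sqEdge v k : ℝ) : ℂ) + (crossEdge v k i : ℂ) * Complex.I) with hF
  have hframe : ∀ s ∈ Set.Ioo (k : ℝ) (k + 1), frame v k i s = F s := by
    intro s hs
    have e : s = k + (s - k) := by ring
    conv_lhs => rw [e]
    rw [frame_eq (by linarith [hs.1]) (by linarith [hs.2]), hεc, hF]
    congr 1
    apply Complex.ext <;> simp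
  have hmem : (k : ℝ) + t ∈ Set.Ioo (k : ℝ) (k + 1) := ⟨by linarith [ht.1], by linarith [ht.2]⟩
  have hd : HasDerivAt F (ε * ((-sqEdge v k : ℝ) : ℂ)) (k + t) := by
    refine HasDerivAt.const_mul _ (HasDerivAt.add_const _ ?_)
    refine HasDerivAt.ofReal_comp ?_
    have := ((((hasDerivAt_id ((k : ℝ) + t)).sub_const (k : ℝ)).mul_const (sqEdge v k)).const_sub
      (dotEdge v k i))
    simpa using this
  have hslit : F (k + t) ∈ Complex.slitPlane := by
    rw [← hframe _ hmem]
    exact frame_mem_slitPlane hv hk (mem_edge ht.1.le ht.2.le) hb hi (natCast_ne_of_mem_Ioo ht)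
  have hlog := hd.clog_real hslit
  have him := Complex.imCLM.hasFDerivAt.comp_hasDerivAt _ hlog
  have hval : Complex.imCLM (ε * ((-sqEdge v k : ℝ) : ℂ) / F (k + t)) =
      sqEdge v k * crossEdge v k i / Complex.normSq (frame v k i (k + t)) := by
    rw [hframe _ hmem, Complex.imCLM_apply, Complex.div_im]
    have h1 : (F (k + t)).im = ε * crossEdge v k i := by simp [hF]
    have h2 : (ε * ((-sqEdge v k : ℝ) : ℂ)).re = ε * -sqEdge v k := by
      rw [Complex.re_ofReal_mul, Complex.ofReal_re]
    have h3 : (ε * ((-sqEdge v k : ℝ) : ℂ)).im = 0 := by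
      rw [Complex.im_ofReal_mul, Complex.ofReal_im, mul_zero]
    have h4 : ε * ε = 1 := by
      rw [hε]
      split_ifs <;> norm_num
    rw [h1, h2, h3, zero_mul, zero_div, zero_sub, ← neg_div]
    congr 1
    linear_combination (sqEdge v k * crossEdge v k i) * h4
  rw [← hval]
  refine him.congr_of_eventuallyEq ?_
  filter_upwards [Ioo_mem_nhds hmem.1 hmem.2] with s hs
  simp only [Function.comp_apply, Complex.imCLM_apply, Complex.log_im, hframe s hs]

lemma quad_eq (h0 : 0 ≤ t) (h1 : t ≤ 1) :
    quadA v k i j * (t * t) + quadB v k i j * t + quadC v k i j =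
      crossEdge v k i * Complex.normSq (frame v k j (k + t)) +
        crossEdge v k j * Complex.normSq (frame v k i (k + t)) := by
  rw [normSq_frame h0 h1, normSq_frame h0 h1, quadA, quadB, quadC]
  ring

lemma place_im_wing {φ : ℝ} (h : IsEdgeAngle v k φ) (hv : IsSimpleChain v) (hk : k + 1 < n)
    {s ω : ℝ} (hω : Real.cos ((frame v k i s).arg - ω) = 0) :
    (place v s (φ + ω) (vtx v i)).im = 0 := by
  have h1 := h.height_frame ω i s
  rw [height_eq_norm_mul_cos, hω, mul_zero] at h1
  have h2 := (mul_eq_zero.1 h1.symm).resolve_left (norm_pos_iff.2 (hv.edge_ne_zero hk)).ne'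
  rw [place_im]
  split_ifs at h2 <;> linarith

/-- A slide along a part of an edge is an elementary motion if the wings and the sign of the
angular velocity do not change. -/
theorem isElementary_of_sign (hv : IsSimpleChain v)
    (hb : ∀ s ∈ Set.Icc 0 (lastParam n), (butterfly v s).Nonempty) {θ : ℝ → ℝ} {φ : ℝ}
    (hcont : ContinuousOn θ (Set.Icc 0 (lastParam n))) (hφ : IsEdgeAngle v k φ)
    (hθ : ∀ s ∈ Set.Icc (k : ℝ) (k + 1), θ s = φ + (maxArg v k s + minArg v k s) / 2)
    (hk : k + 1 < n) {x y : ℝ} (hx : 0 ≤ x) (hxy : x ≤ y) (hy : y ≤ 1) (hi : i < n) (hj : j < n)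
    (hmax : ∀ t ∈ Set.Ioo x y, maxArg v k (k + t) = (frame v k i (k + t)).arg)
    (hmin : ∀ t ∈ Set.Ioo x y, minArg v k (k + t) = (frame v k j (k + t)).arg)
    (hsign : (∀ t ∈ Set.Ioo x y, 0 ≤ quadA v k i j * (t * t) + quadB v k i j * t + quadC v k i j) ∨
      (∀ t ∈ Set.Ioo x y, quadA v k i j * (t * t) + quadB v k i j * t + quadC v k i j ≤ 0)) :
    IsElementary v θ ⟨k, x, y, i, j⟩ := by
  have hN := sqEdge_pos hv hk
  have hIoo : ∀ s ∈ Set.Ioo (k + x : ℝ) (k + y), s - k ∈ Set.Ioo x y := fun s hs =>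
    ⟨by linarith [hs.1], by linarith [hs.2]⟩
  have h01 : ∀ t ∈ Set.Ioo x y, t ∈ Set.Ioo (0 : ℝ) 1 := fun t ht =>
    ⟨by linarith [ht.1], by linarith [ht.2]⟩
  have hmem : ∀ t ∈ Set.Ioo x y, (k : ℝ) + t ∈ Set.Icc 0 (lastParam n) := fun t ht =>
    Icc_edge_subset hk (mem_edge (h01 t ht).1.le (h01 t ht).2.le)
  have hderiv : ∀ s ∈ Set.Ioo (k + x : ℝ) (k + y), HasDerivAt θ
      (sqEdge v k * (quadA v k i j * ((s - k) * (s - k)) + quadB v k i j * (s - k) + quadC v k i j) /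
        (2 * (Complex.normSq (frame v k i s) * Complex.normSq (frame v k j s)))) s := by
    intro s hs
    obtain ⟨t, rfl⟩ : ∃ t, s = k + t := ⟨s - k, by ring⟩
    have ht := hIoo _ hs
    rw [add_sub_cancel_left] at ht ⊢
    have h1 := hasDerivAt_arg_frame hv hk (h01 t ht) (hb _ (hmem t ht)) hi
    have h2 := hasDerivAt_arg_frame hv hk (h01 t ht) (hb _ (hmem t ht)) hj
    have hne : ∀ l < n, Complex.normSq (frame v k l (k + t)) ≠ 0 := fun l hl e =>
      frame_ne_zero hv hk (mem_edge (h01 t ht).1.le (h01 t ht).2.le) hl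
        (natCast_ne_of_mem_Ioo (h01 t ht)) (Complex.normSq_eq_zero.1 e)
    have h3 := ((h1.add h2).div_const 2).const_add φ
    have hval : sqEdge v k * (quadA v k i j * (t * t) + quadB v k i j * t + quadC v k i j) /
        (2 * (Complex.normSq (frame v k i (k + t)) * Complex.normSq (frame v k j (k + t)))) =
        (sqEdge v k * crossEdge v k i / Complex.normSq (frame v k i (k + t)) +
          sqEdge v k * crossEdge v k j / Complex.normSq (frame v k j (k + t))) / 2 := by
      rw [quad_eq (h01 t ht).1.le (h01 t ht).2.le]
      have := hne i hi
      have := hne j hj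
      field_simp
    rw [hval]
    refine h3.congr_of_eventuallyEq ?_
    filter_upwards [Ioo_mem_nhds hs.1 hs.2] with r hr
    have hr' := hIoo r hr
    have e : r = k + (r - k) := by ring
    rw [hθ r ⟨by linarith [hr'.1], by linarith [hr'.2]⟩]
    congr 2
    have a1 := hmax _ hr'
    have a2 := hmin _ hr'
    rw [← e] at a1 a2
    simp only [Pi.add_apply, a1, a2]
  have hsub : Set.Icc (k + x : ℝ) (k + y) ⊆ Set.Icc 0 (lastParam n) := fun s hs =>
    Icc_edge_subset hk ⟨by linarith [hs.1], by linarith [hs.2]⟩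
  have hdiff : DifferentiableOn ℝ θ (interior (Set.Icc (k + x : ℝ) (k + y))) := by
    rw [interior_Icc]
    exact fun s hs => (hderiv s hs).differentiableAt.differentiableWithinAt
  have hden : ∀ s, 0 ≤ 2 * (Complex.normSq (frame v k i s) * Complex.normSq (frame v k j s)) :=
    fun s => by
      have := mul_nonneg (Complex.normSq_nonneg (frame v k i s))
        (Complex.normSq_nonneg (frame v k j s))
      linarith
  refine ⟨hk, hx, hxy, hy, hi, hj, ?_, ?_⟩
  · rcases hsign with h | h
    · left
      refine monotoneOn_of_deriv_nonneg (convex_Icc _ _) (hcont.mono hsub) hdiff fun s hs => ?_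
      rw [interior_Icc] at hs
      rw [(hderiv s hs).deriv]
      exact div_nonneg (mul_nonneg hN.le (h _ (hIoo s hs))) (hden s)
    · right
      refine antitoneOn_of_deriv_nonpos (convex_Icc _ _) (hcont.mono hsub) hdiff fun s hs => ?_
      rw [interior_Icc] at hs
      rw [(hderiv s hs).deriv]
      exact div_nonpos_of_nonpos_of_nonneg
        (mul_nonpos_of_nonneg_of_nonpos hN.le (h _ (hIoo s hs))) (hden s)
  · intro s hs
    simp only [Motion.start, Motion.finish] at hs ⊢
    obtain ⟨t, rfl⟩ : ∃ t, s = k + t := ⟨s - k, by ring⟩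
    have ht := hIoo _ hs
    rw [add_sub_cancel_left] at ht
    have hedge := mem_edge (k := k) (h01 t ht).1.le (h01 t ht).2.le
    refine ⟨_, _, isWedge_frame hφ hv hk hedge (hb _ (hmem t ht)), ?_,
      hv.vtx_ne hi (hmem t ht) (natCast_ne_of_mem_Ioo (h01 t ht)), ?_,
      hv.vtx_ne hj (hmem t ht) (natCast_ne_of_mem_Ioo (h01 t ht)), ?_⟩
    · rw [hθ _ hedge]
      ring
    · rw [show φ - Real.pi / 2 + maxArg v k (k + t) = φ + (maxArg v k (k + t) - Real.pi / 2) by ring]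
      refine place_im_wing hφ hv hk ?_
      rw [hmax t ht, sub_sub_cancel]
      simp
    · rw [show φ + Real.pi / 2 + minArg v k (k + t) = φ + (minArg v k (k + t) + Real.pi / 2) by ring]
      refine place_im_wing hφ hv hk ?_
      rw [hmin t ht, sub_add_cancel_left, Real.cos_neg]
      simp

end Wings

/-! ### Break points -/

/-- A quadratic polynomial has a fixed sign on an interval that contains neither of its roots. -/
lemma quadratic_sign {a b c r₁ r₂ x y : ℝ}
    (h : a = 0 ∧ r₁ = -c / b ∨ a ≠ 0 ∧ r₁ = (-b + √(b * b - 4 * a * c)) / (2 * a) ∧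
      r₂ = (-b - √(b * b - 4 * a * c)) / (2 * a))
    (h₁ : r₁ ∉ Set.Ioo x y) (h₂ : r₂ ∉ Set.Ioo x y) :
    (∀ t ∈ Set.Ioo x y, 0 ≤ a * (t * t) + b * t + c) ∨
      (∀ t ∈ Set.Ioo x y, a * (t * t) + b * t + c ≤ 0) := by
  by_contra hcon
  simp only [not_or, not_forall, not_le] at hcon
  obtain ⟨⟨t₁, ht₁, h1⟩, t₂, ht₂, h2⟩ := hcon
  obtain ⟨t, ht, h0⟩ := isPreconnected_Ioo.intermediate_value ht₁ ht₂
    (f := fun t => a * (t * t) + b * t + c) (by fun_prop) ⟨h1.le, h2.le⟩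
  simp only at h0
  rcases h with ⟨rfl, hr⟩ | ⟨ha, hr₁, hr₂⟩
  · by_cases hb : b = 0
    · subst hb
      simp only [zero_mul, zero_add] at h0 h1 h2
      linarith
    · refine h₁ ?_
      rw [hr, show -c / b = t by field_simp; linarith]
      exact ht
  · have hd : discrim a b c = √(b * b - 4 * a * c) * √(b * b - 4 * a * c) := by
      rw [Real.mul_self_sqrt, discrim]
      · ring
      · have : b * b - 4 * a * c = (2 * a * t + b) ^ 2 := by linear_combination (-4 * a) * h0
        rw [this]
        positivity
    rcases (quadratic_eq_zero_iff ha hd t).1 h0 with e | e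
    · exact h₁ (by rw [hr₁, ← e]; exact ht)
    · exact h₂ (by rw [hr₂, ← e]; exact ht)

/-- The sign of an affine function on an interval without its root is that at the midpoint. In the
case `b = 0` the function is constant and the root `-c / b` is without meaning. -/
lemma affine_sign {b c x y : ℝ} (h : -c / b ∉ Set.Ioo x y) :
    (0 ≤ c + (x + y) / 2 * b → ∀ t ∈ Set.Ioo x y, 0 ≤ c + t * b) ∧
      (¬ 0 ≤ c + (x + y) / 2 * b → ∀ t ∈ Set.Ioo x y, c + t * b ≤ 0) := by
  by_cases hb : b = 0
  · subst hb
    simp only [mul_zero, add_zero, not_le]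
    exact ⟨fun h _ _ => h, fun h _ _ => h.le⟩
  · have hr : ∀ t, c + t * b = b * (t - -c / b) := fun t => by
      field_simp
      ring
    simp only [hr]
    set r := -c / b
    have hpos : ∀ z, 0 ≤ b * z ↔ 0 < b ∧ 0 ≤ z ∨ b < 0 ∧ z ≤ 0 := by
      intro z
      rcases lt_or_gt_of_ne hb with hb | hb
      · simp only [hb, hb.not_gt, false_and, false_or, true_and]
        exact ⟨fun h => nonpos_of_mul_nonneg_right h hb, mul_nonneg_of_nonpos_of_nonpos hb.le⟩
      · simp [hb, hb.not_gt, mul_nonneg_iff_of_pos_left]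
    have hneg : ∀ z, b * z ≤ 0 ↔ 0 < b ∧ z ≤ 0 ∨ b < 0 ∧ 0 ≤ z := by
      intro z
      have := hpos (-z)
      rw [mul_neg] at this
      constructor
      · intro h
        rcases this.1 (by linarith) with h | h
        · exact Or.inl ⟨h.1, by linarith⟩
        · exact Or.inr ⟨h.1, by linarith⟩
      · intro h
        have := this.2 (by
          rcases h with h | h
          · exact Or.inl ⟨h.1, by linarith⟩
          · exact Or.inr ⟨h.1, by linarith⟩)
        linarith
    have hout : x < y → r ≤ x ∨ y ≤ r := by
      intro _
      by_contra hc
      push Not at hc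
      exact h ⟨hc.1, hc.2⟩
    constructor
    · intro hmid t ht
      rw [hpos] at hmid ⊢
      have hxy := ht.1.trans ht.2
      rcases hmid with ⟨h1, h2⟩ | ⟨h1, h2⟩ <;> rcases hout hxy with h3 | h3
      · exact Or.inl ⟨h1, by linarith [ht.1]⟩
      · linarith
      · linarith
      · exact Or.inr ⟨h1, by linarith [ht.2]⟩
    · intro hmid t ht
      rw [not_le] at hmid
      have hxy := ht.1.trans ht.2
      have := (hneg _).1 hmid.le
      rw [hneg]
      rcases this with ⟨h1, h2⟩ | ⟨h1, h2⟩ <;> rcases hout hxy with h3 | h3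
      · linarith
      · exact Or.inl ⟨h1, by linarith [ht.2]⟩
      · exact Or.inr ⟨h1, by linarith [ht.1]⟩
      · linarith

/-- The points `z₁` and `z₂` split the interval from `x` to `y` in such a way that neither `r₁` nor
`r₂` is inside of one of the parts. -/
structure Splits (x y r₁ r₂ z₁ z₂ : ℝ) : Prop where
  le₁ : x ≤ z₁
  le₂ : z₁ ≤ z₂
  le₃ : z₂ ≤ y
  notMem : ∀ r, r = r₁ ∨ r = r₂ → r ∉ Set.Ioo x z₁ ∧ r ∉ Set.Ioo z₁ z₂ ∧ r ∉ Set.Ioo z₂ y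

/-- Clamping `r₁` and `r₂` to the interval and sorting the results splits the interval. -/
lemma splits_clamp {x y : ℝ} (hxy : x ≤ y) (r₁ r₂ : ℝ) : Splits x y r₁ r₂
    (min (max x (min r₁ y)) (max x (min r₂ y))) (max (max x (min r₁ y)) (max x (min r₂ y))) := by
  have hx : ∀ r, x ≤ max x (min r y) := fun r => le_max_left _ _
  have hy : ∀ r, max x (min r y) ≤ y := fun r => max_le hxy (min_le_right _ _)
  refine ⟨le_min (hx _) (hx _), min_le_max, max_le (hy _) (hy _), fun r hr => ?_⟩
  set c₁ := max x (min r₁ y) with hc₁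
  set c₂ := max x (min r₂ y) with hc₂
  have hmid : r ∈ Set.Ioo x y → r = min c₁ c₂ ∨ r = max c₁ c₂ := by
    intro h
    have : r = c₁ ∨ r = c₂ := by
      rcases hr with rfl | rfl
      · exact Or.inl (by rw [hc₁, min_eq_left h.2.le, max_eq_right h.1.le])
      · exact Or.inr (by rw [hc₂, min_eq_left h.2.le, max_eq_right h.1.le])
    rcases this with e | e <;> rcases le_total c₁ c₂ with hle | hle
    · exact Or.inl (by rw [min_eq_left hle, e])
    · exact Or.inr (by rw [max_eq_left hle, e])
    · exact Or.inr (by rw [max_eq_right hle, e])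
    · exact Or.inl (by rw [min_eq_right hle, e])
  have h1 : min c₁ c₂ ≤ y := (min_le_left _ _).trans (hy r₁)
  have h2 : x ≤ max c₁ c₂ := (hx r₁).trans (le_max_left _ _)
  have h3 : x ≤ min c₁ c₂ := le_min (hx _) (hx _)
  have h4 : max c₁ c₂ ≤ y := max_le (hy _) (hy _)
  have h5 : min c₁ c₂ ≤ max c₁ c₂ := min_le_max
  refine ⟨fun h => ?_, fun h => ?_, fun h => ?_⟩
  · rcases hmid ⟨h.1, h.2.trans_le h1⟩ with e | e <;> linarith [h.1, h.2]
  · rcases hmid ⟨h3.trans_lt h.1, h.2.trans_le h4⟩ with e | e <;> linarith [h.1, h.2]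
  · rcases hmid ⟨h2.trans_lt h.1, h.2⟩ with e | e <;> linarith [h.1, h.2]

/-! ### The wings -/

section Tangents

variable {n : ℕ} {v : Fin n → ℂ} {k : ℕ}

/-- While the moving point is between the parameters `x` and `y` of the edge `k`, the tangents of
the part of the chain before it pass through the vertices `a` and `b`, and those of the part after
it through `a'` and `b'`. -/
structure Tangents (v : Fin n → ℂ) (k : ℕ) (x y : ℝ) (a b a' b' : ℕ) : Prop where
  le_a : a ≤ k
  le_b : b ≤ k
  lt_a : k < a'
  lt_b : k < b'
  before : ∀ t ∈ Set.Ioo x y, ∀ i ≤ k, 0 ≤ orient (curve v (k + t)) (vtx v a) (vtx v i) ∧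
    0 ≤ orient (curve v (k + t)) (vtx v i) (vtx v b)
  after : ∀ t ∈ Set.Ioo x y, ∀ i, k < i → i < n →
    0 ≤ orient (curve v (k + t)) (vtx v a') (vtx v i) ∧
    0 ≤ orient (curve v (k + t)) (vtx v i) (vtx v b')

lemma Tangents.mono {x y x' y' : ℝ} {a b a' b' : ℕ} (h : Tangents v k x y a b a' b')
    (hx : x ≤ x') (hy : y' ≤ y) : Tangents v k x' y' a b a' b' :=
  ⟨h.le_a, h.le_b, h.lt_a, h.lt_b, fun t ht => h.before t ⟨hx.trans_lt ht.1, ht.2.trans_le hy⟩,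
    fun t ht => h.after t ⟨hx.trans_lt ht.1, ht.2.trans_le hy⟩⟩

lemma cross_frame_same {i j : ℕ} (h : i ≤ k ↔ j ≤ k) (s : ℝ) :
    ((starRingEnd ℂ) (frame v k i s) * frame v k j s).im =
      Complex.normSq (vtx v (k + 1) - vtx v k) * orient (curve v s) (vtx v i) (vtx v j) := by
  rw [orient_eq, ← Complex.im_ofReal_mul, Complex.normSq_eq_conj_mul_self, frame, frame]
  congr 1
  by_cases hi : i ≤ k
  · simp only [hi, h.1 hi, if_true, map_mul, map_neg, map_one, Complex.conj_conj]
    ring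
  · have hj : ¬ j ≤ k := fun hj => hi (h.2 hj)
    simp only [hi, hj, if_false, map_mul, map_one, Complex.conj_conj]
    ring

lemma cross_frame_different {i j : ℕ} (hi : i ≤ k) (hj : k < j) {t : ℝ} (h0 : 0 ≤ t)
    (h1 : t ≤ 1) : ((starRingEnd ℂ) (frame v k i (k + t)) * frame v k j (k + t)).im =
      comparison v k i j t := by
  rw [frame_eq h0 h1, frame_eq h0 h1, if_pos hi, if_neg (by omega), comparison]
  simp
  ring

/-- Which of the tangents are the wing-lines is decided by comparisons. -/
theorem Tangents.wings (hv : IsSimpleChain v)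
    (hb : ∀ s ∈ Set.Icc 0 (lastParam n), (butterfly v s).Nonempty) (hk : k + 1 < n) {x y : ℝ}
    {a b a' b' : ℕ} (h : Tangents v k x y a b a' b') (ha : a' < n) (hb' : b' < n) (hx : 0 ≤ x)
    (hy : y ≤ 1) {t : ℝ} (ht : t ∈ Set.Ioo x y) :
    (0 ≤ comparison v k a a' t → minArg v k (k + t) = (frame v k a (k + t)).arg) ∧
    (comparison v k a a' t ≤ 0 → minArg v k (k + t) = (frame v k a' (k + t)).arg) ∧
    (0 ≤ comparison v k b b' t → maxArg v k (k + t) = (frame v k b' (k + t)).arg) ∧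
    (comparison v k b b' t ≤ 0 → maxArg v k (k + t) = (frame v k b (k + t)).arg) := by
  have h0 : t ∈ Set.Ioo (0 : ℝ) 1 := ⟨by linarith [ht.1], by linarith [ht.2]⟩
  have hs := mem_edge (k := k) h0.1.le h0.2.le
  have hle : ∀ i j, i < n → j < n →
      0 ≤ ((starRingEnd ℂ) (frame v k i (k + t)) * frame v k j (k + t)).im →
      (frame v k i (k + t)).arg ≤ (frame v k j (k + t)).arg := fun i j hi hj hc =>
    arg_frame_le hv hk hs (hb _ (Icc_edge_subset hk hs)) hi hj hc (natCast_ne_of_mem_Ioo h0)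
      (natCast_ne_of_mem_Ioo h0)
  have hflip : ∀ i j, ((starRingEnd ℂ) (frame v k j (k + t)) * frame v k i (k + t)).im =
      - ((starRingEnd ℂ) (frame v k i (k + t)) * frame v k j (k + t)).im := by
    intro i j
    simp only [Complex.mul_im, Complex.conj_re, Complex.conj_im]
    ring
  have hsq := Complex.normSq_nonneg (vtx v (k + 1) - vtx v k)
  have hle_a := h.le_a
  have hle_b := h.le_b
  have hlt_a := h.lt_a
  have hlt_b := h.lt_b
  have amin : ∀ i ≤ k, (frame v k a (k + t)).arg ≤ (frame v k i (k + t)).arg := fun i hi =>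
    hle a i (by omega) (by omega) (by
      rw [cross_frame_same (by omega)]
      exact mul_nonneg hsq (h.before t ht i hi).1)
  have bmax : ∀ i ≤ k, (frame v k i (k + t)).arg ≤ (frame v k b (k + t)).arg := fun i hi =>
    hle i b (by omega) (by omega) (by
      rw [cross_frame_same (by omega)]
      exact mul_nonneg hsq (h.before t ht i hi).2)
  have amin' : ∀ i, k < i → i < n → (frame v k a' (k + t)).arg ≤ (frame v k i (k + t)).arg :=
    fun i hi hin => hle a' i ha hin (by
      rw [cross_frame_same (by omega)]
      exact mul_nonneg hsq (h.after t ht i hi hin).1)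
  have bmax' : ∀ i, k < i → i < n → (frame v k i (k + t)).arg ≤ (frame v k b' (k + t)).arg :=
    fun i hi hin => hle i b' hin hb' (by
      rw [cross_frame_same (by omega)]
      exact mul_nonneg hsq (h.after t ht i hi hin).2)
  have hca := cross_frame_different (v := v) h.le_a h.lt_a h0.1.le h0.2.le
  have hcb := cross_frame_different (v := v) h.le_b h.lt_b h0.1.le h0.2.le
  refine ⟨fun hc => minArg_eq hk (by omega) fun i hi => ?_,
    fun hc => minArg_eq hk ha fun i hi => ?_, fun hc => maxArg_eq hk hb' fun i hi => ?_,
    fun hc => maxArg_eq hk (by omega) fun i hi => ?_⟩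
  · have h1 := hle a a' (by omega) ha (by rw [hca]; exact hc)
    rcases le_or_gt i k with hik | hik
    · exact amin i hik
    · exact h1.trans (amin' i hik hi)
  · have h1 := hle a' a ha (by omega) (by rw [hflip, hca]; linarith)
    rcases le_or_gt i k with hik | hik
    · exact h1.trans (amin i hik)
    · exact amin' i hik hi
  · have h1 := hle b b' (by omega) hb' (by rw [hcb]; exact hc)
    rcases le_or_gt i k with hik | hik
    · exact (bmax i hik).trans h1
    · exact bmax' i hik hi
  · have h1 := hle b' b hb' (by omega) (by rw [hflip, hcb]; linarith)
    rcases le_or_gt i k with hik | hik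
    · exact bmax i hik
    · exact (bmax' i hik hi).trans h1

end Tangents

/-! ### The program that merges the two passages -/

/-- The maximum, expressed by a square root. -/
def maxExpr (a b : RealExpr) : RealExpr :=
  .div (.add (.add a b) (.sqrt (.mul (.sub a b) (.sub a b)))) (.const 2)

/-- The minimum, expressed by a square root. -/
def minExpr (a b : RealExpr) : RealExpr :=
  .div (.sub (.add a b) (.sqrt (.mul (.sub a b) (.sub a b)))) (.const 2)

lemma eval_maxExpr (a b : RealExpr) (σ : Mem) :
    (maxExpr a b).eval σ = max (a.eval σ) (b.eval σ) := by
  simp only [maxExpr, RealExpr.eval, Real.sqrt_mul_self_eq_abs, Rat.cast_ofNat]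
  rw [div_eq_iff two_ne_zero]
  rcases le_total (a.eval σ) (b.eval σ) with h | h
  · rw [max_eq_right h, abs_of_nonpos (by linarith)]
    ring
  · rw [max_eq_left h, abs_of_nonneg (by linarith)]
    ring

lemma eval_minExpr (a b : RealExpr) (σ : Mem) :
    (minExpr a b).eval σ = min (a.eval σ) (b.eval σ) := by
  simp only [minExpr, RealExpr.eval, Real.sqrt_mul_self_eq_abs, Rat.cast_ofNat]
  rw [div_eq_iff two_ne_zero]
  rcases le_total (a.eval σ) (b.eval σ) with h | h
  · rw [min_eq_left h, abs_of_nonpos (by linarith)]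
    ring
  · rw [min_eq_right h, abs_of_nonneg (by linarith)]
    ring

namespace Merge

/-- The expression for `dotEdge`, with the edge in the register `20` and the vertex in the register
`w`. -/
def dotE (w : ℕ) : RealExpr := dotExpr (.reg 20) (.reg w) (.succ (.reg 20))

/-- The expression for `crossEdge`, with the same registers as in `dotE`. -/
def crossE (w : ℕ) : RealExpr := orientExpr (.reg 20) (.succ (.reg 20)) (.reg w)

/-- The expression for `sqEdge`. -/
def sqE : RealExpr := dotExpr (.reg 20) (.succ (.reg 20)) (.succ (.reg 20))

/-- The constant coefficient of `comparison`, for the vertices in the registers `i` and `j`. -/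
def constE (i j : ℕ) : RealExpr := .sub (.mul (crossE i) (dotE j)) (.mul (dotE i) (crossE j))

/-- The linear coefficient of `comparison`. -/
def slopeE (i j : ℕ) : RealExpr := .mul sqE (.sub (crossE j) (crossE i))

/-- The expression for `quadA`, for the vertices in the registers `i` and `j`. -/
def quadAE (i j : ℕ) : RealExpr := .mul (.mul sqE sqE) (.add (crossE i) (crossE j))

/-- The expression for `quadB`. -/
def quadBE (i j : ℕ) : RealExpr := .mul (.const (-2))
  (.mul sqE (.add (.mul (crossE i) (dotE j)) (.mul (crossE j) (dotE i))))

/-- The expression for `quadC`. -/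
def quadCE (i j : ℕ) : RealExpr := .add
  (.mul (crossE i) (.add (.mul (dotE j) (dotE j)) (.mul (crossE j) (crossE j))))
  (.mul (crossE j) (.add (.mul (dotE i) (dotE i)) (.mul (crossE i) (crossE i))))

/-- The zero of `c + b t`. -/
def rootE (c b : RealExpr) : RealExpr := .div (.sub (.const 0) c) b

/-- The square root of the discriminant of `a t² + b t + c`. -/
def discE (a b c : RealExpr) : RealExpr :=
  .sqrt (.sub (.mul b b) (.mul (.mul (.const 4) a) c))

/-- Put the numbers `e₁` and `e₂`, moved into the interval between the registers `x` and `y`, in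
increasing order into the registers `z₁` and `z₂`. -/
def breaks (e₁ e₂ : RealExpr) (x y z₁ z₂ : ℕ) : Code := .list [
  .rset 15 (maxExpr (.reg x) (minExpr e₁ (.reg y))),
  .rset 16 (maxExpr (.reg x) (minExpr e₂ (.reg y))),
  .rset z₁ (minExpr (.reg 15) (.reg 16)), .rset z₂ (maxExpr (.reg 15) (.reg 16))]

/-- Select the wings for the interval between the registers `x` and `y`. The registers `21`, `22`
contain the tangent vertices of the part of the chain before the moving point, and `23`, `24` those
of the part after it. -/
def chooseMin (x y : ℕ) : Code :=
  .ite (.realLe (.const 0) (.add (constE 21 23)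
      (.mul (.div (.add (.reg x) (.reg y)) (.const 2)) (slopeE 21 23))))
    (.nset 26 (.reg 21)) (.nset 26 (.reg 23))

/-- Select the wing on the other side, with the same registers as in `chooseMin`. -/
def chooseMax (x y : ℕ) : Code :=
  .ite (.realLe (.const 0) (.add (constE 22 24)
      (.mul (.div (.add (.reg x) (.reg y)) (.const 2)) (slopeE 22 24))))
    (.nset 25 (.reg 24)) (.nset 25 (.reg 22))

/-- The zeros of the angular velocity. -/
def turns (x y : ℕ) : Code :=
  .ite (.realEq (quadAE 25 26) (.const 0))
    (breaks (rootE (quadCE 25 26) (quadBE 25 26)) (rootE (quadCE 25 26) (quadBE 25 26)) x y 13 14)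
    (breaks
      (.div (.add (.sub (.const 0) (quadBE 25 26))
        (discE (quadAE 25 26) (quadBE 25 26) (quadCE 25 26))) (.mul (.const 2) (quadAE 25 26)))
      (.div (.sub (.sub (.const 0) (quadBE 25 26))
        (discE (quadAE 25 26) (quadBE 25 26) (quadCE 25 26))) (.mul (.const 2) (quadAE 25 26)))
      x y 13 14)

/-- Output the motion on the edge in the register `20` from the parameter in the register `x` to
that in the register `y`. -/
def emit (x y : ℕ) : Code := .list [.nput 0 (.reg 2) (.reg 20), .nput 1 (.reg 2) (.reg 25),
  .nput 2 (.reg 2) (.reg 26), .rput 2 (.reg 2) (.reg x), .rput 3 (.reg 2) (.reg y),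
  .nset 2 (.succ (.reg 2))]

/-- Output the motions between the parameters in the registers `x` and `y`. -/
def piece (x y : ℕ) : Code := .list [chooseMin x y, chooseMax x y, turns x y, emit x 13,
  emit 13 14, emit 14 y]

/-- The interval for the current entries of the logs of both passages, and its break points. -/
def prepare : Code := .list [.nset 20 (.arr 6 (.reg 16)), .nset 21 (.arr 7 (.reg 16)),
  .nset 22 (.arr 8 (.reg 16)), .nset 23 (.arr 7 (.pred (.reg 17))),
  .nset 24 (.arr 8 (.pred (.reg 17))),
  .rset 7 (minExpr (.arr 5 (.reg 16)) (.sub (.reg 5) (.arr 4 (.pred (.reg 17))))),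
  .rset 9 (.sub (.reg 6) (.arr 6 (.reg 16))), .rset 10 (.sub (.reg 7) (.arr 6 (.reg 16))),
  breaks (rootE (constE 21 23) (slopeE 21 23)) (rootE (constE 22 24) (slopeE 22 24)) 9 10 11 12]

/-- Go on to the next entry of the log that ends first. -/
def advance : Code := .list [.rset 6 (.reg 7),
  .ite (.realLe (.arr 5 (.reg 16)) (.sub (.reg 5) (.arr 4 (.pred (.reg 17)))))
    (.nset 16 (.succ (.reg 16))) (.nset 17 (.pred (.reg 17)))]

/-- One round of the merge: the registers `16` and `17` point to the current entry of the log of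
the passage from the first to the last vertex, and behind that of the opposite passage. The real
register `6` contains the position reached so far, and `5` the last position of the chain. -/
def body : Code := .list [prepare, piece 9 11, piece 11 12, piece 12 10, advance]

set_option maxRecDepth 4000 in
lemma body_valid : body.Valid = true := by decide

section Spec

variable {n : ℕ} {v : Fin n → ℂ} {σ : Mem}

lemma eval_constE (h : σ.point = vtx v) (i j : ℕ) : (constE i j).eval σ =
    crossEdge v (σ.nat 20) (σ.nat i) * dotEdge v (σ.nat 20) (σ.nat j) -
      dotEdge v (σ.nat 20) (σ.nat i) * crossEdge v (σ.nat 20) (σ.nat j) := by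
  simp only [crossEdge, dotEdge, ← h]
  rfl

lemma eval_slopeE (h : σ.point = vtx v) (i j : ℕ) : (slopeE i j).eval σ =
    sqEdge v (σ.nat 20) *
      (crossEdge v (σ.nat 20) (σ.nat j) - crossEdge v (σ.nat 20) (σ.nat i)) := by
  simp only [crossEdge, sqEdge, dotEdge, ← h]
  rfl

lemma eval_quadAE (h : σ.point = vtx v) (i j : ℕ) :
    (quadAE i j).eval σ = quadA v (σ.nat 20) (σ.nat i) (σ.nat j) := by
  simp only [quadA, crossEdge, sqEdge, dotEdge, ← h]
  rfl

lemma eval_quadBE (h : σ.point = vtx v) (i j : ℕ) :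
    (quadBE i j).eval σ = quadB v (σ.nat 20) (σ.nat i) (σ.nat j) := by
  have : (quadBE i j).eval σ = ((-2 : ℚ) : ℝ) * (sqE.eval σ * ((crossE i).eval σ * (dotE j).eval σ +
    (crossE j).eval σ * (dotE i).eval σ)) := rfl
  rw [this]
  simp only [quadB, crossEdge, sqEdge, dotEdge, ← h]
  push_cast
  rfl

lemma eval_quadCE (h : σ.point = vtx v) (i j : ℕ) :
    (quadCE i j).eval σ = quadC v (σ.nat 20) (σ.nat i) (σ.nat j) := by
  simp only [quadC, crossEdge, dotEdge, ← h]
  rfl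

lemma eval_rootE (c b : RealExpr) : (rootE c b).eval σ = -c.eval σ / b.eval σ := by
  simp [rootE, RealExpr.eval]

lemma breaks_den {e₁ e₂ : RealExpr} {x y z₁ z₂ : ℕ} (he : ∀ r z, e₂.eval (σ.setReal r z) = e₂.eval σ)
    (hx : x < 15) (hy : y < 15) (hz₁ : z₁ < 15) :
    ∃ c₁ c₂, (breaks e₁ e₂ x y z₁ z₂).den σ =
      (((σ.setReal 15 c₁).setReal 16 c₂).setReal z₁ (min c₁ c₂)).setReal z₂ (max c₁ c₂) ∧
      c₁ = max (σ.real x) (min (e₁.eval σ) (σ.real y)) ∧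
      c₂ = max (σ.real x) (min (e₂.eval σ) (σ.real y)) := by
  refine ⟨_, _, ?_, rfl, rfl⟩
  have hz₁' : 16 ≠ z₁ := by omega
  simp only [breaks, Code.list, Code.den, eval_maxExpr, eval_minExpr, RealExpr.eval, setReal_real,
    he, hx.ne, hy.ne, hz₁.ne', hz₁', if_true, if_false, Nat.reduceEqDiff]

/-- The program splits the interval at the zeros of the quadratic polynomial that has the sign of
the angular velocity of the bisecting line. Complex roots do no harm: the junk values only add a
break point. -/
lemma turns_den (h : σ.point = vtx v) {x y : ℕ} (hx : x < 15) (hy : y < 15)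
    (hxy : σ.real x ≤ σ.real y) : ∃ c₁ c₂ r₁ r₂ z₁ z₂, (turns x y).den σ =
      (((σ.setReal 15 c₁).setReal 16 c₂).setReal 13 z₁).setReal 14 z₂ ∧
      Splits (σ.real x) (σ.real y) r₁ r₂ z₁ z₂ ∧
      let a := quadA v (σ.nat 20) (σ.nat 25) (σ.nat 26)
      let b := quadB v (σ.nat 20) (σ.nat 25) (σ.nat 26)
      let c := quadC v (σ.nat 20) (σ.nat 25) (σ.nat 26)
      (a = 0 ∧ r₁ = -c / b ∨ a ≠ 0 ∧ r₁ = (-b + √(b * b - 4 * a * c)) / (2 * a) ∧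
        r₂ = (-b - √(b * b - 4 * a * c)) / (2 * a)) := by
  by_cases ha : quadA v (σ.nat 20) (σ.nat 25) (σ.nat 26) = 0
  · obtain ⟨c₁, c₂, e, h1, h2⟩ := breaks_den (σ := σ)
      (e₁ := rootE (quadCE 25 26) (quadBE 25 26)) (e₂ := rootE (quadCE 25 26) (quadBE 25 26))
      (fun _ _ => rfl) hx hy (z₁ := 13) (z₂ := 14) (by decide)
    refine ⟨c₁, c₂, _, -quadC v (σ.nat 20) (σ.nat 25) (σ.nat 26) /
      quadB v (σ.nat 20) (σ.nat 25) (σ.nat 26), _, _, Eq.trans (if_pos ?_) e, ?_,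
      Or.inl ⟨ha, rfl⟩⟩
    · rw [Cond.Holds, eval_quadAE h, ha]
      simp [RealExpr.eval]
    · rw [h1, h2, eval_rootE, eval_quadBE h, eval_quadCE h]
      exact splits_clamp hxy _ _
  · obtain ⟨c₁, c₂, e, h1, h2⟩ := breaks_den (σ := σ)
      (e₁ := .div (.add (.sub (.const 0) (quadBE 25 26))
        (discE (quadAE 25 26) (quadBE 25 26) (quadCE 25 26))) (.mul (.const 2) (quadAE 25 26)))
      (e₂ := .div (.sub (.sub (.const 0) (quadBE 25 26))
        (discE (quadAE 25 26) (quadBE 25 26) (quadCE 25 26))) (.mul (.const 2) (quadAE 25 26)))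
      (fun _ _ => rfl) hx hy (z₁ := 13) (z₂ := 14) (by decide)
    refine ⟨c₁, c₂, _, _, _, _, Eq.trans (if_neg ?_) e, ?_, Or.inr ⟨ha, rfl, rfl⟩⟩
    · rw [Cond.Holds, eval_quadAE h]
      simpa [RealExpr.eval] using ha
    · rw [h1, h2]
      simp only [RealExpr.eval, discE, eval_quadAE h, eval_quadBE h, eval_quadCE h]
      push_cast
      rw [zero_sub]
      exact splits_clamp hxy _ _

lemma emit_motions (σ : Mem) (x y : ℕ) : ((emit x y).den σ).motions =
    σ.motions ++ [⟨σ.nat 20, σ.real x, σ.real y, σ.nat 25, σ.nat 26⟩] := by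
  have hc : ((emit x y).den σ).nat 2 = σ.nat 2 + 1 := by
    simp [emit, Code.list, Code.den, setNat_nat, setNatArr_nat, setRealArr_nat, NatExpr.eval]
  rw [Mem.motions, hc, List.range_succ, List.map_append, Mem.motions]
  congr 1
  · refine List.map_congr_left fun i hi => ?_
    rw [List.mem_range] at hi
    simp [emit, Code.list, Code.den, setNatArr_nat, setRealArr_nat, NatExpr.eval,
      setNat_natArr, setNat_realArr, setNatArr_natArr, setNatArr_realArr, setRealArr_natArr,
      setRealArr_realArr, Function.update_of_ne hi.ne]
  · simp [emit, Code.list, Code.den, setNatArr_nat, setRealArr_nat, NatExpr.eval, RealExpr.eval,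
      setNat_natArr, setNat_realArr, setNatArr_natArr, setNatArr_realArr, setRealArr_natArr,
      setRealArr_realArr, setNatArr_real, setRealArr_real]

lemma emit_frame (σ : Mem) (x y : ℕ) : ((emit x y).den σ).real = σ.real ∧
    ∀ r, r ≠ 2 → ((emit x y).den σ).nat r = σ.nat r := by
  refine ⟨rfl, fun r hr => ?_⟩
  simp [emit, Code.list, Code.den, setNat_nat, setNatArr_nat, setRealArr_nat, hr]

end Spec

end Merge

/-- The motions of the list lead from the position `x` to the position `y`. -/
def Links : List Motion → ℝ → ℝ → Prop
  | [], x, y => x = y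
  | m :: M, x, y => m.start = x ∧ Links M m.finish y

lemma Links.append {M M' : List Motion} {x y z : ℝ} (h : Links M x y) (h' : Links M' y z) :
    Links (M ++ M') x z := by
  induction M generalizing x with
  | nil => exact (show x = y from h) ▸ h'
  | cons m M ih => exact ⟨h.1, ih h.2⟩

lemma Links.isChain {M : List Motion} {x y : ℝ} (h : Links M x y) (hne : M ≠ []) :
    M.head?.map Motion.start = some x ∧ M.getLast?.map Motion.finish = some y ∧
      M.IsChain (fun m m' => m.finish = m'.start) := by
  induction M generalizing x with
  | nil => exact absurd rfl hne
  | cons m M ih =>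
    obtain ⟨h1, h2⟩ := h
    refine ⟨by simp [h1], ?_⟩
    rcases M with _ | ⟨m', M⟩
    · exact ⟨congrArg some (show m.finish = y from h2), by simp⟩
    · obtain ⟨-, h4, h5⟩ := ih h2 (by simp)
      exact ⟨by simpa using h4, List.isChain_cons_cons.2 ⟨h2.1.symm, h5⟩⟩

namespace Merge

variable {n : ℕ} {v : Fin n → ℂ} {σ : Mem}

lemma chooseMin_den (h : σ.point = vtx v) (x y : ℕ) : ∃ j, (chooseMin x y).den σ = σ.setNat 26 j ∧
    (0 ≤ comparison v (σ.nat 20) (σ.nat 21) (σ.nat 23) ((σ.real x + σ.real y) / 2) ∧ j = σ.nat 21 ∨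
      ¬ 0 ≤ comparison v (σ.nat 20) (σ.nat 21) (σ.nat 23) ((σ.real x + σ.real y) / 2) ∧
        j = σ.nat 23) := by
  have hc : (Cond.realLe (.const 0) (.add (constE 21 23)
      (.mul (.div (.add (.reg x) (.reg y)) (.const 2)) (slopeE 21 23)))).Holds σ ↔
      0 ≤ comparison v (σ.nat 20) (σ.nat 21) (σ.nat 23) ((σ.real x + σ.real y) / 2) := by
    simp only [Cond.Holds, RealExpr.eval, eval_constE h, eval_slopeE h, comparison, Rat.cast_zero,
      Rat.cast_ofNat]
  by_cases hm : 0 ≤ comparison v (σ.nat 20) (σ.nat 21) (σ.nat 23) ((σ.real x + σ.real y) / 2)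
  · exact ⟨_, if_pos (hc.2 hm), Or.inl ⟨hm, rfl⟩⟩
  · exact ⟨_, if_neg fun h => hm (hc.1 h), Or.inr ⟨hm, rfl⟩⟩

lemma chooseMax_den (h : σ.point = vtx v) (x y : ℕ) : ∃ i, (chooseMax x y).den σ = σ.setNat 25 i ∧
    (0 ≤ comparison v (σ.nat 20) (σ.nat 22) (σ.nat 24) ((σ.real x + σ.real y) / 2) ∧ i = σ.nat 24 ∨
      ¬ 0 ≤ comparison v (σ.nat 20) (σ.nat 22) (σ.nat 24) ((σ.real x + σ.real y) / 2) ∧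
        i = σ.nat 22) := by
  have hc : (Cond.realLe (.const 0) (.add (constE 22 24)
      (.mul (.div (.add (.reg x) (.reg y)) (.const 2)) (slopeE 22 24)))).Holds σ ↔
      0 ≤ comparison v (σ.nat 20) (σ.nat 22) (σ.nat 24) ((σ.real x + σ.real y) / 2) := by
    simp only [Cond.Holds, RealExpr.eval, eval_constE h, eval_slopeE h, comparison, Rat.cast_zero,
      Rat.cast_ofNat]
  by_cases hm : 0 ≤ comparison v (σ.nat 20) (σ.nat 22) (σ.nat 24) ((σ.real x + σ.real y) / 2)
  · exact ⟨_, if_pos (hc.2 hm), Or.inl ⟨hm, rfl⟩⟩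
  · exact ⟨_, if_neg fun h => hm (hc.1 h), Or.inr ⟨hm, rfl⟩⟩

/-- On an interval on which both comparisons have a fixed sign, the wing-lines are chosen by the
signs at the midpoint, and three motions are output. -/
lemma piece_motions (h : σ.point = vtx v) {x y : ℕ} (hx : x < 13) (hy : y < 13)
    (hxy : σ.real x ≤ σ.real y) : ∃ i j r₁ r₂ z₁ z₂, ((piece x y).den σ).motions = σ.motions ++
      [⟨σ.nat 20, σ.real x, z₁, i, j⟩, ⟨σ.nat 20, z₁, z₂, i, j⟩, ⟨σ.nat 20, z₂, σ.real y, i, j⟩] ∧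
      Splits (σ.real x) (σ.real y) r₁ r₂ z₁ z₂ ∧
      (0 ≤ comparison v (σ.nat 20) (σ.nat 21) (σ.nat 23) ((σ.real x + σ.real y) / 2) ∧
          j = σ.nat 21 ∨
        ¬ 0 ≤ comparison v (σ.nat 20) (σ.nat 21) (σ.nat 23) ((σ.real x + σ.real y) / 2) ∧
          j = σ.nat 23) ∧
      (0 ≤ comparison v (σ.nat 20) (σ.nat 22) (σ.nat 24) ((σ.real x + σ.real y) / 2) ∧
          i = σ.nat 24 ∨
        ¬ 0 ≤ comparison v (σ.nat 20) (σ.nat 22) (σ.nat 24) ((σ.real x + σ.real y) / 2) ∧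
          i = σ.nat 22) ∧
      let a := quadA v (σ.nat 20) i j
      let b := quadB v (σ.nat 20) i j
      let c := quadC v (σ.nat 20) i j
      (a = 0 ∧ r₁ = -c / b ∨ a ≠ 0 ∧ r₁ = (-b + √(b * b - 4 * a * c)) / (2 * a) ∧
        r₂ = (-b - √(b * b - 4 * a * c)) / (2 * a)) := by
  obtain ⟨j, e1, h1⟩ := chooseMin_den h x y
  obtain ⟨i, e2, h2⟩ := chooseMax_den (σ := σ.setNat 26 j) h x y
  obtain ⟨c₁, c₂, r₁, r₂, z₁, z₂, e3, h3, h4⟩ := turns_den (σ := (σ.setNat 26 j).setNat 25 i) h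
    (by omega : x < 15) (by omega : y < 15) hxy
  set τ := (((((σ.setNat 26 j).setNat 25 i).setReal 15 c₁).setReal 16 c₂).setReal 13 z₁).setReal
    14 z₂ with hτ
  have hden : (piece x y).den σ = (emit 14 y).den ((emit 13 14).den ((emit x 13).den τ)) := by
    have : (piece x y).den σ = (emit 14 y).den ((emit 13 14).den ((emit x 13).den
      ((turns x y).den ((chooseMax x y).den ((chooseMin x y).den σ))))) := rfl
    rw [this, e1, e2, e3]
  have hτr : ∀ r < 13, τ.real r = σ.real r := by
    intro r hr
    simp only [hτ, setReal_real, setNat_real]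
    rw [if_neg (by omega), if_neg (by omega), if_neg (by omega), if_neg (by omega)]
  have h13 : τ.real 13 = z₁ := by simp [hτ, setReal_real]
  have h14 : τ.real 14 = z₂ := by simp [hτ, setReal_real]
  have h25 : τ.nat 25 = i := by simp [hτ, setReal_nat, setNat_nat]
  have h26 : τ.nat 26 = j := by simp [hτ, setReal_nat, setNat_nat]
  have h20 : τ.nat 20 = σ.nat 20 := by simp [hτ, setReal_nat, setNat_nat]
  refine ⟨i, j, r₁, r₂, z₁, z₂, ?_, h3, h1, h2, h4⟩
  have hm : τ.motions = σ.motions := rfl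
  rw [hden, emit_motions, emit_motions, emit_motions]
  simp only [(emit_frame _ _ _).1, (emit_frame _ _ _).2 20 (by decide),
    (emit_frame _ _ _).2 25 (by decide), (emit_frame _ _ _).2 26 (by decide), hτr x hx, hτr y hy,
    h13, h14, h25, h26, h20, hm, List.append_assoc, List.cons_append, List.nil_append]

lemma piece_frame (σ : Mem) (x y : ℕ) :
    (∀ r, r ≠ 2 → r ≠ 25 → r ≠ 26 → ((piece x y).den σ).nat r = σ.nat r) ∧
    (∀ r < 13, ((piece x y).den σ).real r = σ.real r) := by
  refine ⟨fun r h1 h2 h3 => (piece x y).den_nat σ ?_, fun r hr => (piece x y).den_real σ ?_⟩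
  · simp [piece, chooseMin, chooseMax, turns, breaks, emit, Code.list, Code.writes, h1, h2, h3]
  · simp [piece, chooseMin, chooseMax, turns, breaks, emit, Code.list, Code.writes]
    omega

/-- The bisecting line can be turned continuously, and on the edge `k` its normal angle is given
relative to `φ k` by the arguments of the frame. -/
structure Bisects (v : Fin n → ℂ) (θ : ℝ → ℝ) (φ : ℕ → ℝ) : Prop where
  simple : IsSimpleChain v
  nonempty : ∀ s ∈ Set.Icc 0 (lastParam n), (butterfly v s).Nonempty
  continuous : ContinuousOn θ (Set.Icc 0 (lastParam n))
  edge : ∀ k, k + 1 < n → IsEdgeAngle v k (φ k) ∧ ∀ s ∈ Set.Icc (k : ℝ) (k + 1),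
    θ s = φ k + (maxArg v k s + minArg v k s) / 2

/-- The three motions of an interval without a zero of a comparison are elementary: the wings pass
through fixed vertices, and the angular velocity of the bisecting line has a fixed sign on each
part. -/
theorem piece_correct {θ : ℝ → ℝ} {φ : ℕ → ℝ} (hθ : Bisects v θ φ) (h : σ.point = vtx v)
    {x y : ℕ} (hx : x < 13) (hy : y < 13) (hxy : σ.real x ≤ σ.real y) (hx0 : 0 ≤ σ.real x)
    (hy1 : σ.real y ≤ 1) (hk : σ.nat 20 + 1 < n) (ha : σ.nat 21 < n) (hb : σ.nat 22 < n)
    (ha' : σ.nat 23 < n) (hb' : σ.nat 24 < n)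
    (hT : σ.real x < σ.real y → Tangents v (σ.nat 20) (σ.real x) (σ.real y) (σ.nat 21) (σ.nat 22)
      (σ.nat 23) (σ.nat 24))
    (hrA : (rootE (constE 21 23) (slopeE 21 23)).eval σ ∉ Set.Ioo (σ.real x) (σ.real y))
    (hrB : (rootE (constE 22 24) (slopeE 22 24)).eval σ ∉ Set.Ioo (σ.real x) (σ.real y)) :
    ∃ M, ((piece x y).den σ).motions = σ.motions ++ M ∧ M.length = 3 ∧
      Links M (σ.nat 20 + σ.real x) (σ.nat 20 + σ.real y) ∧ ∀ m ∈ M, IsElementary v θ m := by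
  obtain ⟨i, j, r₁, r₂, z₁, z₂, e, hs, hj, hi, hr⟩ := piece_motions h hx hy hxy
  rw [eval_rootE, eval_constE h, eval_slopeE h] at hrA hrB
  obtain ⟨hA1, hA2⟩ := affine_sign hrA
  obtain ⟨hB1, hB2⟩ := affine_sign hrB
  have hmin : ∀ t ∈ Set.Ioo (σ.real x) (σ.real y),
      minArg v (σ.nat 20) (σ.nat 20 + t) = (frame v (σ.nat 20) j (σ.nat 20 + t)).arg := by
    intro t ht
    have hw := (hT (ht.1.trans ht.2)).wings hθ.simple hθ.nonempty hk ha' hb' hx0 hy1 ht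
    rcases hj with ⟨hc, rfl⟩ | ⟨hc, rfl⟩
    · exact hw.1 (hA1 hc t ht)
    · exact hw.2.1 (hA2 hc t ht)
  have hmax : ∀ t ∈ Set.Ioo (σ.real x) (σ.real y),
      maxArg v (σ.nat 20) (σ.nat 20 + t) = (frame v (σ.nat 20) i (σ.nat 20 + t)).arg := by
    intro t ht
    have hw := (hT (ht.1.trans ht.2)).wings hθ.simple hθ.nonempty hk ha' hb' hx0 hy1 ht
    rcases hi with ⟨hc, rfl⟩ | ⟨hc, rfl⟩
    · exact hw.2.2.1 (hB1 hc t ht)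
    · exact hw.2.2.2 (hB2 hc t ht)
  have hin : i < n := by rcases hi with ⟨-, rfl⟩ | ⟨-, rfl⟩ <;> assumption
  have hjn : j < n := by rcases hj with ⟨-, rfl⟩ | ⟨-, rfl⟩ <;> assumption
  have h1 := hs.le₁
  have h2 := hs.le₂
  have h3 := hs.le₃
  have hel : ∀ x' y', σ.real x ≤ x' → x' ≤ y' → y' ≤ σ.real y → r₁ ∉ Set.Ioo x' y' →
      r₂ ∉ Set.Ioo x' y' → IsElementary v θ ⟨σ.nat 20, x', y', i, j⟩ := by
    intro x' y' h1 h2 h3 h4 h5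
    have hsub : Set.Ioo x' y' ⊆ Set.Ioo (σ.real x) (σ.real y) := Set.Ioo_subset_Ioo h1 h3
    exact isElementary_of_sign hθ.simple hθ.nonempty hθ.continuous (hθ.edge _ hk).1
      (hθ.edge _ hk).2 hk (by linarith) h2 (by linarith) hin hjn (fun t ht => hmax t (hsub ht))
      (fun t ht => hmin t (hsub ht)) (quadratic_sign hr h4 h5)
  have hn1 := hs.notMem r₁ (Or.inl rfl)
  have hn2 := hs.notMem r₂ (Or.inr rfl)
  refine ⟨_, e, rfl, ⟨rfl, rfl, rfl, rfl⟩, ?_⟩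
  simp only [List.mem_cons, List.not_mem_nil, or_false, forall_eq_or_imp, forall_eq]
  exact ⟨hel _ _ le_rfl h1 (h2.trans h3) hn1.1 hn2.1, hel _ _ h1 h2 h3 hn1.2.1 hn2.2.1,
    hel _ _ (h1.trans h2) h3 le_rfl hn1.2.2 hn2.2.2⟩

end Merge

/-! ### Merging the two passages -/

/-- While both entries are valid, their tangents are those of the two parts of the chain. -/
lemma tangents_of_entries {n : ℕ} (hn : 2 ≤ n) {v : Fin n → ℂ} {f g : Entry} (hf : f.Correct v v id)
    (hg : g.Correct v (v ∘ Fin.rev) fun j => n - 1 - j) {s e : ℝ} (hs : f.first ≤ s)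
    (hs' : lastParam n - g.last ≤ s) (he : e ≤ f.last) (he' : e ≤ lastParam n - g.first)
    (hse : s < e) :
    Tangents v f.edge (s - f.edge) (e - f.edge) f.front f.back g.front g.back := by
  have hℓ := lastParam_eq (n := n) (by omega)
  have h1 := hf.le_first
  have h2 := hf.last_le
  have h3 := hg.le_first
  have h4 := hg.last_le
  have hk := hf.edge_lt
  have hk' := hg.edge_lt
  have e1 : f.edge + g.edge + 2 = n := by
    have a1 : ((n - 1 : ℕ) : ℝ) < ((f.edge + 1 + (g.edge + 1) : ℕ) : ℝ) := by
      push_cast [← hℓ]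
      linarith
    have a2 : ((f.edge + g.edge : ℕ) : ℝ) < ((n - 1 : ℕ) : ℝ) := by
      push_cast [← hℓ]
      linarith
    have a1' : n - 1 < f.edge + 1 + (g.edge + 1) := by exact_mod_cast a1
    have a2' : f.edge + g.edge < n - 1 := by exact_mod_cast a2
    omega
  obtain ⟨a, ha, ha'⟩ := hf.front_eq
  obtain ⟨b, hb, hb'⟩ := hf.back_eq
  obtain ⟨c, hc, hc'⟩ := hg.front_eq
  obtain ⟨d, hd, hd'⟩ := hg.back_eq
  simp only [id] at ha' hb'
  refine ⟨by omega, by omega, by omega, by omega, fun t ht i hi => ?_, fun t ht i hi hin => ?_⟩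
  · exact hf.tangent (f.edge + t) ⟨by linarith [ht.1], by linarith [ht.2]⟩ i hi
  · have hm : lastParam n - (f.edge + t) ∈ Set.Ioo g.first g.last :=
      ⟨by linarith [ht.2], by linarith [ht.1]⟩
    have := hg.tangent _ hm (n - 1 - i) (by omega)
    rw [curve_rev hn v ⟨by linarith [hm.1, (Nat.cast_nonneg g.edge : (0 : ℝ) ≤ g.edge)], by
      linarith [ht.1, (Nat.cast_nonneg f.edge : (0 : ℝ) ≤ f.edge)]⟩, sub_sub_cancel,
      vtx_rev v (by omega), show n - 1 - (n - 1 - i) = i by omega] at this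
    exact this

namespace Merge

variable {n : ℕ} {v : Fin n → ℂ} {σ : Mem}

lemma eval_root_congr {τ : Mem} (h : σ.point = vtx v) (h' : τ.point = vtx v) {i j : ℕ}
    (h20 : τ.nat 20 = σ.nat 20) (hi : τ.nat i = σ.nat i) (hj : τ.nat j = σ.nat j) :
    (rootE (constE i j) (slopeE i j)).eval τ = (rootE (constE i j) (slopeE i j)).eval σ := by
  rw [eval_rootE, eval_rootE, eval_constE h, eval_constE h', eval_slopeE h, eval_slopeE h', h20, hi,
    hj]

/-- The end of the interval in which the current entries of both logs are valid. -/
noncomputable def common (ℓ : ℝ) (f g : Entry) : ℝ := min f.last (ℓ - g.first)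

/-- The data of a round: two points of tangency from either log, the end of the common interval, and
the two break points at which a wing-line passes from one of the hulls to the other. -/
lemma prepare_spec (h : σ.point = vtx v) {f g : Entry} (hf : σ.log (σ.nat 16) = f)
    (hg : σ.log (σ.nat 17 - 1) = g) (hle : σ.real 6 ≤ common (σ.real 5) f g) :
    let τ := prepare.den σ
    τ.motions = σ.motions ∧ τ.point = vtx v ∧ τ.nat 20 = f.edge ∧ τ.nat 21 = f.front ∧
      τ.nat 22 = f.back ∧ τ.nat 23 = g.front ∧ τ.nat 24 = g.back ∧
      τ.real 9 = σ.real 6 - f.edgeReal ∧ τ.real 7 = common (σ.real 5) f g ∧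
      τ.real 10 = common (σ.real 5) f g - f.edgeReal ∧
      Splits (τ.real 9) (τ.real 10) ((rootE (constE 21 23) (slopeE 21 23)).eval τ)
        ((rootE (constE 22 24) (slopeE 22 24)).eval τ) (τ.real 11) (τ.real 12) := by
  subst hf hg
  set ρ := (Code.list [.nset 20 (.arr 6 (.reg 16)), .nset 21 (.arr 7 (.reg 16)),
    .nset 22 (.arr 8 (.reg 16)), .nset 23 (.arr 7 (.pred (.reg 17))),
    .nset 24 (.arr 8 (.pred (.reg 17))),
    .rset 7 (minExpr (.arr 5 (.reg 16)) (.sub (.reg 5) (.arr 4 (.pred (.reg 17))))),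
    .rset 9 (.sub (.reg 6) (.arr 6 (.reg 16))), .rset 10 (.sub (.reg 7) (.arr 6 (.reg 16)))]).den σ
    with hρ
  have hnat : ∀ r, ρ.nat r = if r = 24 then (σ.log (σ.nat 17 - 1)).back else
      if r = 23 then (σ.log (σ.nat 17 - 1)).front else if r = 22 then (σ.log (σ.nat 16)).back else
      if r = 21 then (σ.log (σ.nat 16)).front else if r = 20 then (σ.log (σ.nat 16)).edge else
        σ.nat r := by
    intro r
    simp [hρ, Code.list, Code.den, setReal_nat, setNat_nat, NatExpr.eval, Mem.log, setNat_natArr]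
  have hreal : ρ.real 9 = σ.real 6 - (σ.log (σ.nat 16)).edgeReal ∧
      ρ.real 7 = common (σ.real 5) (σ.log (σ.nat 16)) (σ.log (σ.nat 17 - 1)) ∧
      ρ.real 10 = common (σ.real 5) (σ.log (σ.nat 16)) (σ.log (σ.nat 17 - 1)) -
        (σ.log (σ.nat 16)).edgeReal := by
    simp [hρ, Code.list, Code.den, setReal_nat, setNat_nat, NatExpr.eval, Mem.log, setNat_realArr,
      setReal_real, setReal_realArr, RealExpr.eval, eval_minExpr, setNat_real, common]
  obtain ⟨h9, h7, h10⟩ := hreal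
  obtain ⟨c₁, c₂, e, e1, e2⟩ := breaks_den (σ := ρ)
    (e₁ := rootE (constE 21 23) (slopeE 21 23)) (e₂ := rootE (constE 22 24) (slopeE 22 24))
    (fun _ _ => rfl) (x := 9) (y := 10) (by decide) (by decide) (z₁ := 11) (z₂ := 12) (by decide)
  have hden : prepare.den σ =
      (((ρ.setReal 15 c₁).setReal 16 c₂).setReal 11 (min c₁ c₂)).setReal 12 (max c₁ c₂) := e
  have hle' : ρ.real 9 ≤ ρ.real 10 := by
    rw [h9, h10]
    linarith
  intro τ
  have hτ : τ = (((ρ.setReal 15 c₁).setReal 16 c₂).setReal 11 (min c₁ c₂)).setReal 12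
    (max c₁ c₂) := hden
  have hn : τ.nat = ρ.nat := by rw [hτ]; rfl
  have t9 : τ.real 9 = ρ.real 9 := by simp [hτ, setReal_real]
  have t7 : τ.real 7 = ρ.real 7 := by simp [hτ, setReal_real]
  have t10 : τ.real 10 = ρ.real 10 := by simp [hτ, setReal_real]
  have t11 : τ.real 11 = min c₁ c₂ := by simp [hτ, setReal_real]
  have t12 : τ.real 12 = max c₁ c₂ := by simp [hτ, setReal_real]
  have tp : τ.point = vtx v := by
    rw [← h, hτ]
    rfl
  have tm : τ.motions = σ.motions := by
    rw [hτ]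
    rfl
  refine ⟨tm, tp, ?_, ?_, ?_, ?_, ?_, t9.trans h9, t7.trans h7, t10.trans h10, ?_⟩
  · simp [hn, hnat]
  · simp [hn, hnat]
  · simp [hn, hnat]
  · simp [hn, hnat]
  · simp [hn, hnat]
  · have r1 : (rootE (constE 21 23) (slopeE 21 23)).eval τ =
      (rootE (constE 21 23) (slopeE 21 23)).eval ρ := by rw [hτ]; rfl
    have r2 : (rootE (constE 22 24) (slopeE 22 24)).eval τ =
      (rootE (constE 22 24) (slopeE 22 24)).eval ρ := by rw [hτ]; rfl
    rw [t9, t10, t11, t12, r1, r2, e1, e2]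
    exact splits_clamp hle' _ _

lemma prepare_frame (σ : Mem) : (∀ r, r ∉ [20, 21, 22, 23, 24] →
    (prepare.den σ).nat r = σ.nat r) ∧ (∀ r < 7, (prepare.den σ).real r = σ.real r) := by
  refine ⟨fun r hr => prepare.den_nat σ ?_, fun r hr => prepare.den_real σ ?_⟩
  · simpa [prepare, breaks, Code.list, Code.writes] using hr
  · simp [prepare, breaks, Code.list, Code.writes]
    omega

lemma piece_point (σ : Mem) (x y : ℕ) : ((piece x y).den σ).point = σ.point := by
  funext i
  simp only [Mem.point]
  rw [(piece x y).den_realArr, (piece x y).den_realArr] <;>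
    simp [piece, chooseMin, chooseMax, turns, breaks, emit, Code.list, Code.writes]

/-- The log whose current entry ends first is advanced. The second log is read backwards, as it
records the passage in the opposite direction. -/
lemma advance_spec (σ : Mem) : (advance.den σ).motions = σ.motions ∧
    (advance.den σ).real 6 = σ.real 7 ∧
    (σ.realArr 5 (σ.nat 16) ≤ σ.real 5 - σ.realArr 4 (σ.nat 17 - 1) ∧
        (advance.den σ).nat 16 = σ.nat 16 + 1 ∧ (advance.den σ).nat 17 = σ.nat 17 ∨
      ¬ σ.realArr 5 (σ.nat 16) ≤ σ.real 5 - σ.realArr 4 (σ.nat 17 - 1) ∧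
        (advance.den σ).nat 16 = σ.nat 16 ∧ (advance.den σ).nat 17 = σ.nat 17 - 1) := by
  by_cases h : σ.realArr 5 (σ.nat 16) ≤ σ.real 5 - σ.realArr 4 (σ.nat 17 - 1)
  · have e : advance.den σ = (σ.setReal 6 (σ.real 7)).setNat 16 (σ.nat 16 + 1) := if_pos h
    rw [e]
    exact ⟨rfl, rfl, Or.inl ⟨h, rfl, rfl⟩⟩
  · have e : advance.den σ = (σ.setReal 6 (σ.real 7)).setNat 17 (σ.nat 17 - 1) := if_neg h
    rw [e]
    exact ⟨rfl, rfl, Or.inr ⟨h, rfl, rfl⟩⟩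

/-- One round of the merge outputs nine motions, which lead from the current position to the end
of the validity of the current entries. -/
theorem body_motions {θ : ℝ → ℝ} {φ : ℕ → ℝ} (hn : 2 ≤ n) (hθ : Bisects v θ φ)
    (h : σ.point = vtx v) (h5 : σ.real 5 = lastParam n) {f g : Entry}
    (hf : σ.log (σ.nat 16) = f) (hg : σ.log (σ.nat 17 - 1) = g) (cf : f.Correct v v id)
    (cg : g.Correct v (v ∘ Fin.rev) fun j => n - 1 - j) (hs : f.first ≤ σ.real 6)
    (hs' : lastParam n - g.last ≤ σ.real 6) (hle : σ.real 6 ≤ common (lastParam n) f g) :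
    (∃ M, (body.den σ).motions = σ.motions ++ M ∧ M.length = 9 ∧
      Links M (σ.real 6) (common (lastParam n) f g) ∧ ∀ m ∈ M, IsElementary v θ m) ∧
    (body.den σ).real 6 = common (lastParam n) f g ∧
    (f.last ≤ lastParam n - g.first ∧ (body.den σ).nat 16 = σ.nat 16 + 1 ∧
        (body.den σ).nat 17 = σ.nat 17 ∨
      ¬ f.last ≤ lastParam n - g.first ∧ (body.den σ).nat 16 = σ.nat 16 ∧
        (body.den σ).nat 17 = σ.nat 17 - 1) := by
  obtain ⟨p1, p2, p20, p21, p22, p23, p24, p9, p7, p10, psp⟩ := prepare_spec h hf hg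
    (by rw [h5]; exact hle)
  obtain ⟨pf1, pf2⟩ := prepare_frame σ
  rw [h5] at p7 p10
  set ρ₀ := prepare.den σ with hρ₀
  set ρ₁ := (piece 9 11).den ρ₀ with hρ₁
  set ρ₂ := (piece 11 12).den ρ₁ with hρ₂
  set ρ₃ := (piece 12 10).den ρ₂ with hρ₃
  have hden : body.den σ = advance.den ρ₃ := rfl
  obtain ⟨n1, r1⟩ := piece_frame ρ₀ 9 11
  obtain ⟨n2, r2⟩ := piece_frame ρ₁ 11 12
  obtain ⟨n3, r3⟩ := piece_frame ρ₂ 12 10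
  have q1 : ρ₁.point = vtx v := (piece_point _ _ _).trans p2
  have q2 : ρ₂.point = vtx v := (piece_point _ _ _).trans q1
  have hn2 : ∀ r, r ≠ 2 → r ≠ 25 → r ≠ 26 → ρ₂.nat r = ρ₀.nat r := fun r a b c =>
    (n2 r a b c).trans (n1 r a b c)
  have hr2 : ∀ r < 13, ρ₂.real r = ρ₀.real r := fun r hr => (r2 r hr).trans (r1 r hr)
  have hk := cf.edge_lt
  have hk' := cg.edge_lt
  obtain ⟨a, ha, ha'⟩ := cf.front_eq
  obtain ⟨b, hb, hb'⟩ := cf.back_eq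
  obtain ⟨c, hc, hc'⟩ := cg.front_eq
  obtain ⟨d, hd, hd'⟩ := cg.back_eq
  simp only [id] at ha' hb'
  have e0 := cf.edgeReal_eq
  have f1 := cf.le_first
  have f2 := cf.last_le
  have hcf : common (lastParam n) f g ≤ f.last := min_le_left _ _
  have hcg : common (lastParam n) f g ≤ lastParam n - g.first := min_le_right _ _
  have hT : ∀ x y, ρ₀.real 9 ≤ x → y ≤ ρ₀.real 10 → x < y →
      Tangents v (ρ₀.nat 20) x y (ρ₀.nat 21) (ρ₀.nat 22) (ρ₀.nat 23) (ρ₀.nat 24) := by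
    intro x y hx hy hxy
    rw [p20, p21, p22, p23, p24]
    rw [p9, e0] at hx
    rw [p10, e0] at hy
    exact (tangents_of_entries hn cf cg hs hs' hcf hcg (by linarith)).mono hx hy
  have s1 := psp.le₁
  have s2 := psp.le₂
  have s3 := psp.le₃
  have h0 : 0 ≤ ρ₀.real 9 := by rw [p9, e0]; linarith
  have h1 : ρ₀.real 10 ≤ 1 := by rw [p10, e0]; linarith
  have hA := psp.notMem _ (Or.inl rfl)
  have hB := psp.notMem _ (Or.inr rfl)
  obtain ⟨M₁, m1, l1, k1, d1⟩ := piece_correct hθ p2 (x := 9) (y := 11) (by decide) (by decide) s1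
    h0 (by linarith) (by omega) (by omega) (by omega) (by omega) (by omega)
    (fun hlt => hT _ _ le_rfl (by linarith) hlt) hA.1 hB.1
  obtain ⟨M₂, m2, l2, k2, d2⟩ := piece_correct (σ := ρ₁) hθ q1 (x := 11) (y := 12) (by decide)
    (by decide)
    (by rw [r1 11 (by decide), r1 12 (by decide)]; exact s2)
    (by rw [r1 11 (by decide)]; linarith) (by rw [r1 12 (by decide)]; linarith)
    (by rw [n1 20 (by decide) (by decide) (by decide)]; omega)
    (by rw [n1 21 (by decide) (by decide) (by decide)]; omega)
    (by rw [n1 22 (by decide) (by decide) (by decide)]; omega)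
    (by rw [n1 23 (by decide) (by decide) (by decide)]; omega)
    (by rw [n1 24 (by decide) (by decide) (by decide)]; omega)
    (by
      rw [r1 11 (by decide), r1 12 (by decide), n1 20 (by decide) (by decide) (by decide),
        n1 21 (by decide) (by decide) (by decide), n1 22 (by decide) (by decide) (by decide),
        n1 23 (by decide) (by decide) (by decide), n1 24 (by decide) (by decide) (by decide)]
      exact fun hlt => hT _ _ s1 s3 hlt)
    (by
      rw [eval_root_congr p2 q1 (n1 20 (by decide) (by decide) (by decide))
        (n1 21 (by decide) (by decide) (by decide)) (n1 23 (by decide) (by decide) (by decide)),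
        r1 11 (by decide), r1 12 (by decide)]
      exact hA.2.1)
    (by
      rw [eval_root_congr p2 q1 (n1 20 (by decide) (by decide) (by decide))
        (n1 22 (by decide) (by decide) (by decide)) (n1 24 (by decide) (by decide) (by decide)),
        r1 11 (by decide), r1 12 (by decide)]
      exact hB.2.1)
  obtain ⟨M₃, m3, l3, k3, d3⟩ := piece_correct (σ := ρ₂) hθ q2 (x := 12) (y := 10) (by decide)
    (by decide)
    (by rw [hr2 12 (by decide), hr2 10 (by decide)]; exact s3)
    (by rw [hr2 12 (by decide)]; linarith) (by rw [hr2 10 (by decide)]; linarith)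
    (by rw [hn2 20 (by decide) (by decide) (by decide)]; omega)
    (by rw [hn2 21 (by decide) (by decide) (by decide)]; omega)
    (by rw [hn2 22 (by decide) (by decide) (by decide)]; omega)
    (by rw [hn2 23 (by decide) (by decide) (by decide)]; omega)
    (by rw [hn2 24 (by decide) (by decide) (by decide)]; omega)
    (by
      rw [hr2 12 (by decide), hr2 10 (by decide), hn2 20 (by decide) (by decide) (by decide),
        hn2 21 (by decide) (by decide) (by decide), hn2 22 (by decide) (by decide) (by decide),
        hn2 23 (by decide) (by decide) (by decide), hn2 24 (by decide) (by decide) (by decide)]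
      exact fun hlt => hT _ _ (s1.trans s2) le_rfl hlt)
    (by
      rw [eval_root_congr p2 q2 (hn2 20 (by decide) (by decide) (by decide))
        (hn2 21 (by decide) (by decide) (by decide)) (hn2 23 (by decide) (by decide) (by decide)),
        hr2 12 (by decide), hr2 10 (by decide)]
      exact hA.2.2)
    (by
      rw [eval_root_congr p2 q2 (hn2 20 (by decide) (by decide) (by decide))
        (hn2 22 (by decide) (by decide) (by decide)) (hn2 24 (by decide) (by decide) (by decide)),
        hr2 12 (by decide), hr2 10 (by decide)]
      exact hB.2.2)
  rw [r1 11 (by decide), r1 12 (by decide), n1 20 (by decide) (by decide) (by decide)] at k2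
  rw [hr2 12 (by decide), hr2 10 (by decide), hn2 20 (by decide) (by decide) (by decide)] at k3
  have hr3 : ∀ r < 13, ρ₃.real r = ρ₀.real r := fun r hr => (r3 r hr).trans (hr2 r hr)
  have hn3 : ∀ r, r ≠ 2 → r ≠ 25 → r ≠ 26 → ρ₃.nat r = ρ₀.nat r := fun r a b c =>
    (n3 r a b c).trans (hn2 r a b c)
  obtain ⟨hadv, hadv6, hadv'⟩ := advance_spec ρ₃
  rw [← hden] at hadv hadv6 hadv'
  have hlog : ρ₃.realArr 4 = σ.realArr 4 ∧ ρ₃.realArr 5 = σ.realArr 5 := by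
    have e : ρ₃ = (Code.list [prepare, piece 9 11, piece 11 12, piece 12 10]).den σ := rfl
    rw [e]
    constructor <;> refine Code.den_realArr σ ?_ <;>
      simp [prepare, piece, chooseMin, chooseMax, turns, breaks, emit, Code.list, Code.writes]
  refine ⟨⟨M₁ ++ (M₂ ++ M₃), ?_, ?_, ?_, ?_⟩, ?_, ?_⟩
  · rw [hadv, m3, m2, m1, p1]
    simp only [List.append_assoc]
  · simp only [List.length_append, l1, l2, l3]
  · have := k1.append (k2.append k3)
    rwa [p20, p9, p10, e0, add_sub_cancel, add_sub_cancel] at this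
  · intro m hm
    simp only [List.mem_append] at hm
    rcases hm with hm | hm | hm
    · exact d1 m hm
    · exact d2 m hm
    · exact d3 m hm
  · rw [hadv6, hr3 7 (by decide), p7]
  · rw [hlog.1, hlog.2, hn3 16 (by decide) (by decide) (by decide),
      hn3 17 (by decide) (by decide) (by decide), hr3 5 (by decide), pf1 16 (by decide),
      pf1 17 (by decide), pf2 5 (by decide), h5] at hadv'
    subst hf hg
    exact hadv'

end Merge

/-- The correctness of a log depends on its own entries only. -/
lemma LogCorrect.congr {n : ℕ} {v w : Fin n → ℂ} {I : ℕ → ℕ} {c : ℕ} {L₀ L L' : ℕ → Entry} {N : ℕ}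
    {pos : ℝ} (h : LogCorrect v w I c L₀ L N pos) (hL : ∀ x < N, L' x = L x) :
    LogCorrect v w I c L' L' N pos := by
  have hc := h.le
  have hend : ∀ x, c ≤ x → x ≤ N → logEnd L' c x = logEnd L c x := by
    intro x hx hxN
    unfold logEnd
    split_ifs with hxc
    · rfl
    · rw [hL _ (by omega)]
  refine ⟨hc, fun _ _ => rfl, fun x hx hxN => ?_, ?_⟩
  · rw [hL x hxN, hend x hx hxN.le]
    exact h.correct x hx hxN
  · rw [hend N hc le_rfl]
    exact h.pos_eq

namespace Merge

variable {n : ℕ} {v : Fin n → ℂ} {θ : ℝ → ℝ} {φ : ℕ → ℝ} {L : ℕ → Entry} {A N : ℕ} {σ ρ : Mem}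

variable (v L A N) in
/-- Both passages have come to the end, and the entries of their logs are those from `0` to `A` and
from `A` to `N`. -/
structure Logs : Prop where
  fwd : LogCorrect v v id 0 L L A (lastParam n)
  bwd : LogCorrect v (v ∘ Fin.rev) (fun j => n - 1 - j) A L L N (lastParam n)

variable (v θ L A N) in
/-- The invariant of the merge. -/
structure Merging (σ : Mem) : Prop where
  point : σ.point = vtx v
  length : σ.real 5 = lastParam n
  limit : σ.nat 18 = A
  log : σ.log = L
  fwd_le : σ.nat 16 ≤ A
  lt_bwd : A < σ.nat 17
  bwd_le : σ.nat 17 ≤ N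
  le_pos : logEnd L 0 (σ.nat 16) ≤ σ.real 6
  pos_le : σ.nat 16 < A → σ.real 6 ≤ (L (σ.nat 16)).last
  le_pos' : lastParam n - (L (σ.nat 17 - 1)).last ≤ σ.real 6
  pos_le' : σ.real 6 ≤ lastParam n - (L (σ.nat 17 - 1)).first
  links : Links σ.motions 0 (σ.real 6)
  elementary : ∀ m ∈ σ.motions, IsElementary v θ m
  count : σ.motions.length + 9 * ((A - σ.nat 16) + (σ.nat 17 - A)) ≤ 9 * N

set_option maxRecDepth 4000 in
lemma body_frame (σ : Mem) : (body.den σ).point = σ.point ∧ (body.den σ).real 5 = σ.real 5 ∧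
    (body.den σ).nat 18 = σ.nat 18 ∧ (body.den σ).nat 1 = σ.nat 1 ∧
    (body.den σ).log = σ.log := by
  refine ⟨?_, body.den_real σ (by decide), body.den_nat σ (by decide), body.den_nat σ (by decide),
    ?_⟩
  · funext i
    simp only [Mem.point]
    rw [body.den_realArr σ (by decide), body.den_realArr σ (by decide)]
  · funext x
    simp only [Mem.log]
    rw [body.den_realArr σ (by decide), body.den_realArr σ (by decide),
      body.den_realArr σ (by decide), body.den_natArr σ (by decide), body.den_natArr σ (by decide),
      body.den_natArr σ (by decide)]

/-- A round of the merge preserves the invariant and advances one of the logs. -/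
theorem Merging.step (hn : 2 ≤ n) (hθ : Bisects v θ φ) (hL : Logs v L A N)
    (h : Merging v θ L A N σ) (hlt : σ.nat 16 < σ.nat 18) :
    Merging v θ L A N (body.den σ) ∧
      (A - (body.den σ).nat 16) + ((body.den σ).nat 17 - A) <
        (A - σ.nat 16) + (σ.nat 17 - A) := by
  have hA := h.lt_bwd
  have hN := h.bwd_le
  rw [h.limit] at hlt
  obtain ⟨cf, hf⟩ := hL.fwd.correct _ (Nat.zero_le _) hlt
  obtain ⟨cg, hg⟩ := hL.bwd.correct (σ.nat 17 - 1) (by omega) (by omega)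
  obtain ⟨b1, b2, b3, -, b5⟩ := body_frame σ
  have hlog := h.log
  obtain ⟨⟨M, m1, m2, m3, m4⟩, r6, hadv⟩ := body_motions hn hθ h.point h.length
    (congrFun hlog _) (congrFun hlog _) cf cg (hf ▸ h.le_pos) h.le_pos'
    (le_min (h.pos_le hlt) h.pos_le')
  have hle : σ.real 6 ≤ common (lastParam n) (L (σ.nat 16)) (L (σ.nat 17 - 1)) :=
    le_min (h.pos_le hlt) h.pos_le'
  have hmotions : ∀ m ∈ (body.den σ).motions, IsElementary v θ m := by
    intro m hm
    rw [m1, List.mem_append] at hm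
    exact hm.elim (h.elementary m) (m4 m)
  have hlinks : Links (body.den σ).motions 0 ((body.den σ).real 6) := by
    rw [m1, r6]
    exact h.links.append m3
  have hlen : (body.den σ).motions.length = σ.motions.length + 9 := by
    rw [m1, List.length_append, m2]
  have hcount := h.count
  rcases hadv with ⟨hc, h16, h17⟩ | ⟨hc, h16, h17⟩
  · have e : common (lastParam n) (L (σ.nat 16)) (L (σ.nat 17 - 1)) = (L (σ.nat 16)).last :=
      min_eq_left hc
    rw [e] at r6
    refine ⟨⟨b1.trans h.point, b2.trans h.length, b3.trans h.limit, b5.trans hlog, ?_, ?_, ?_, ?_,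
      fun hlt' => ?_, ?_, ?_, hlinks, hmotions, ?_⟩, ?_⟩
    · omega
    · omega
    · omega
    · rw [h16, r6, logEnd, if_neg (by omega), Nat.add_sub_cancel]
    · rw [h16] at hlt' ⊢
      obtain ⟨ck, hk⟩ := hL.fwd.correct _ (Nat.zero_le _) hlt'
      rw [logEnd, if_neg (by omega), Nat.add_sub_cancel] at hk
      rw [r6, ← hk]
      exact ck.first_le
    · rw [h17, r6, ← e]
      exact h.le_pos'.trans hle
    · rw [h17, r6]
      exact hc
    · rw [hlen]
      omega
    · omega
  · have e : common (lastParam n) (L (σ.nat 16)) (L (σ.nat 17 - 1)) =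
        lastParam n - (L (σ.nat 17 - 1)).first := min_eq_right (not_le.1 hc).le
    -- the earliest entry of the backward passage begins at the last vertex, which no entry of the
    -- forward passage exceeds
    have hlt' : A < σ.nat 17 - 1 := by
      refine lt_of_le_of_ne (by omega) fun heq => ?_
      rw [← heq, logEnd, if_pos rfl] at hg
      have h1 := (not_le.1 hc).trans_le cf.last_le
      rw [← heq, hg, sub_zero] at h1
      have h2 : (((L (σ.nat 16)).edge + 1 : ℕ) : ℝ) ≤ ((n - 1 : ℕ) : ℝ) := by
        exact_mod_cast Nat.le_sub_one_of_lt cf.edge_lt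
      rw [lastParam_eq (by omega)] at h1
      push_cast at h2
      linarith
    obtain ⟨ck, -⟩ := hL.bwd.correct (σ.nat 17 - 1 - 1) (by omega) (by omega)
    rw [logEnd, if_neg (by omega)] at hg
    refine ⟨⟨b1.trans h.point, b2.trans h.length, b3.trans h.limit, b5.trans hlog, ?_, ?_, ?_, ?_,
      fun _ => ?_, ?_, ?_, hlinks, hmotions, ?_⟩, ?_⟩
    · omega
    · omega
    · omega
    · rw [h16, r6]
      exact h.le_pos.trans hle
    · rw [h16, r6]
      exact min_le_left _ _
    · rw [h17, r6, e, hg]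
    · rw [h17, r6, e, hg]
      linarith [ck.first_le]
    · rw [hlen]
      omega
    · omega

/-- When the merge is over, the motions thread the chain. -/
lemma Merging.threadsBy (hn : 2 ≤ n) (hθ : ContinuousOn θ (Set.Icc 0 (lastParam n)))
    (hw : ∀ s ∈ Set.Icc 0 (lastParam n), ∃ α β, IsWedge v s α β ∧ θ s = (α + β) / 2)
    (hL : Logs v L A N) (h : Merging v θ L A N σ) (hlt : ¬ σ.nat 16 < σ.nat 18) :
    σ.motions.length ≤ 9 * N ∧ ThreadsBy v σ.motions := by
  have h16 : σ.nat 16 = A := by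
    have := h.fwd_le
    have := h.limit
    omega
  have hA := h.lt_bwd
  have hN := h.bwd_le
  obtain ⟨cg, -⟩ := hL.bwd.correct (σ.nat 17 - 1) (by omega) (by omega)
  have hpos : σ.real 6 = lastParam n := by
    refine le_antisymm (h.pos_le'.trans ?_) ?_
    · linarith [cg.le_first, (Nat.cast_nonneg (L (σ.nat 17 - 1)).edge : (0 : ℝ) ≤ _)]
    · rw [hL.fwd.pos_eq, ← h16]
      exact h.le_pos
  have hℓ := lastParam_pos hn
  have hlinks := hpos ▸ h.links
  have hne : σ.motions ≠ [] := fun he => by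
    rw [he] at hlinks
    exact hℓ.ne (show (0 : ℝ) = _ from hlinks)
  obtain ⟨h1, h2, h3⟩ := hlinks.isChain hne
  exact ⟨by have := h.count; omega, h1, h2, h3, θ, hθ, hw, h.elementary⟩

/-- The state in which the merge begins. -/
lemma Merging.init (hn : 2 ≤ n) (hL : Logs v L A N) (hp : σ.point = vtx v)
    (h5 : σ.real 5 = lastParam n) (h18 : σ.nat 18 = A) (hlog : σ.log = L) (h16 : σ.nat 16 = 0)
    (h17 : σ.nat 17 = N) (h6 : σ.real 6 = 0) (h2 : σ.nat 2 = 0) : Merging v θ L A N σ := by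
  have hℓ := lastParam_pos hn
  have hA : A < N := lt_of_le_of_ne hL.bwd.le fun e => by
    have := hL.bwd.pos_eq
    rw [logEnd, if_pos e.symm] at this
    linarith
  have hA0 : 0 < A := Nat.pos_of_ne_zero fun e => by
    have := hL.fwd.pos_eq
    rw [logEnd, if_pos e] at this
    linarith
  have hend := hL.bwd.pos_eq
  rw [logEnd, if_neg (by omega)] at hend
  have hm : σ.motions = [] := by rw [Mem.motions, h2]; rfl
  obtain ⟨cf, hf⟩ := hL.fwd.correct 0 le_rfl hA0
  obtain ⟨cg, -⟩ := hL.bwd.correct (N - 1) (by omega) (by omega)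
  rw [logEnd, if_pos rfl] at hf
  refine ⟨hp, h5, h18, hlog, ?_, ?_, ?_, ?_, fun _ => ?_, ?_, ?_, ?_, ?_, ?_⟩
  · omega
  · omega
  · omega
  · rw [h16, h6, logEnd, if_pos rfl]
  · rw [h16, h6, ← hf]
    exact cf.first_le
  · rw [h17, h6, hend, sub_self]
  · rw [h17, h6, hend]
    linarith [cg.first_le]
  · rw [hm, h6]
    rfl
  · simp [hm]
  · rw [hm, List.length_nil]
    omega

/-- The loop that merges the logs. -/
theorem Merging.exec (hn : 2 ≤ n) (hθ : Bisects v θ φ) (hL : Logs v L A N)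
    (h : Merging v θ L A N ρ) (ha : Agree σ ρ) :
    ∃ tr σ' ρ', Exec (.loop (.natLt 16 18) body.compile) σ tr σ' ∧
      tr.length ≤ (N + 1) * (body.cost + 1) ∧ Agree σ' ρ' ∧ ρ'.nat 1 = ρ.nat 1 ∧
      Merging v θ L A N ρ' ∧ ¬ ρ'.nat 16 < ρ'.nat 18 := by
  obtain ⟨m, hm, hlt, hnot, hinv⟩ := exists_rounds (f := body.den) (a := 16) (b := 18)
    (I := fun σ => Merging v θ L A N σ ∧ σ.nat 1 = ρ.nat 1)
    (μ := fun σ => (A - σ.nat 16) + (σ.nat 17 - A))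
    (fun σ hσ hlt => ⟨⟨(hσ.1.step hn hθ hL hlt).1, (body_frame σ).2.2.2.1.trans hσ.2⟩,
      (hσ.1.step hn hθ hL hlt).2⟩) ⟨h, rfl⟩
  obtain ⟨tr, σ', he, hl, ha', -⟩ := exec_loop body_valid (a := 16) (b := 18)
    (by decide) (by decide) m ha hlt hnot
  refine ⟨tr, σ', _, he, hl.trans (Nat.mul_le_mul_right _ ?_), ha', (hinv m le_rfl).2,
    (hinv m le_rfl).1, hnot⟩
  have := h.bwd_le
  have := h.lt_bwd
  omega

end Merge

namespace Grow

lemma Halted.pos_mem {n : ℕ} {v w : Fin n → ℂ} {I : ℕ → ℕ} {c : ℕ} {L₀ : ℕ → Entry} {b B : ℕ}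
    {σ : Mem} (h : Halted v w I c L₀ b B σ) : pos σ ∈ Set.Icc 0 (lastParam n) := by
  have hn := h.state.edge_lt
  rw [pos, h.arrived, h.state.edge_eq]
  exact ⟨by positivity, add_one_le_lastParam hn⟩

end Grow

/-! ### The program -/

/-- Between the passages: save the length of the first log and the position reached. -/
def save : Code := .list [.nset 15 (.reg 10), .rset 5 (.add (.reg 0) (.reg 1))]

/-- After the passages: answer, and prepare the merge. The merge is limited to `0` entries if the
answer is no. -/
def decision : Code := .list [.ite (.natEq (.reg 9) (.const 2))
    (.list [.nset 1 (.const 1), .nset 18 (.reg 15)])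
    (.list [.nset 1 (.const 0), .nset 18 (.const 0)]),
  .nset 16 (.const 0), .nset 17 (.reg 10), .rset 6 (.const 0)]

/-- The passage from the first to the last vertex. -/
def forward : Prog := Grow.passage (.const 0) (.succ (.reg 14))

/-- The passage from the last to the first vertex. -/
def backward : Prog := Grow.passage (.pred (.reg 0)) (.pred (.reg 14))

/-- The program for the threading problem. -/
def threading : Prog := .seq forward (.seq save.compile (.seq backward (.seq decision.compile
  (.loop (.natLt 16 18) Merge.body.compile))))

/-- The number of steps per vertex, which also bounds the steps between two events and the number of
motions per vertex. -/
def threadingCost : ℕ := Grow.passageCost (.const 0) (.succ (.reg 14)) + save.cost +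
  Grow.passageCost (.pred (.reg 0)) (.pred (.reg 14)) + decision.cost +
  6 * (Merge.body.cost + 1) + (Grow.body.cost + 1) + 45

lemma threadingCost_bound {n l₁ l₂ l₃ l₄ l₅ : ℕ} (hn : 1 ≤ n)
    (h : l₁ + l₂ + l₃ ≤ (Grow.passageCost (.const 0) (.succ (.reg 14)) + save.cost +
      Grow.passageCost (.pred (.reg 0)) (.pred (.reg 14))) * n)
    (h₄ : l₄ ≤ decision.cost) (h₅ : l₅ ≤ (5 * n + 1) * (Merge.body.cost + 1)) :
    l₁ + (l₂ + (l₃ + (l₄ + l₅))) ≤ threadingCost * n := by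
  rw [threadingCost]
  revert h h₄ h₅
  generalize Grow.passageCost (.const 0) (.succ (.reg 14)) + save.cost +
    Grow.passageCost (.pred (.reg 0)) (.pred (.reg 14)) = a
  generalize decision.cost = b
  generalize Merge.body.cost + 1 = c
  generalize Grow.body.cost + 1 = d
  intro h h₄ h₅
  nlinarith [Nat.mul_le_mul_left b hn, Nat.mul_le_mul_left c hn, Nat.zero_le (d * n)]

lemma le_threadingCost : Grow.body.cost + 1 ≤ threadingCost ∧ 9 * 5 ≤ threadingCost := by
  rw [threadingCost]
  generalize Grow.body.cost + 1 = d
  generalize Grow.passageCost (.const 0) (.succ (.reg 14)) + save.cost +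
    Grow.passageCost (.pred (.reg 0)) (.pred (.reg 14)) + decision.cost +
    6 * (Merge.body.cost + 1) = a
  omega

lemma inputMem_point {n : ℕ} (v : Fin n → ℂ) : (inputMem v).point = vtx v := by
  funext i
  apply Complex.ext <;> simp [Mem.point, inputMem]

lemma Agree.motions {σ ρ : Mem} (h : Agree σ ρ) : σ.motions = ρ.motions := by
  rw [Mem.motions, Mem.motions, h.nat 2 (by decide), h.natArr, h.realArr]

/-- Both passages, one after the other. -/
theorem exec_passages {n : ℕ} {v : Fin n → ℂ} (hn : 2 ≤ n) (hv : IsSimpleChain v) :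
    ∃ tr₁ σ₁ tr₂ σ₂ tr₃ σ₃ ρ₁ ρ₃, Exec forward (inputMem v) tr₁ σ₁ ∧ Exec save.compile σ₁ tr₂ σ₂ ∧
      Exec backward σ₂ tr₃ σ₃ ∧ tr₁.length + tr₂.length + tr₃.length ≤
        (Grow.passageCost (.const 0) (.succ (.reg 14)) + save.cost +
          Grow.passageCost (.pred (.reg 0)) (.pred (.reg 14))) * n ∧
      Grow.Halted v v id 0 (inputMem v).log 0 (2 * n + 1) ρ₁ ∧
      Grow.Halted v (v ∘ Fin.rev) (fun j => n - 1 - j) (ρ₁.nat 10) ρ₁.log (ρ₁.nat 9)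
        (ρ₁.nat 10 + 2 * n + 1) ρ₃ ∧ Agree σ₃ ρ₃ ∧ ρ₃.nat 15 = ρ₁.nat 10 ∧ ρ₃.nat 2 = 0 ∧
      ρ₃.real 5 = Grow.pos ρ₁ ∧ ρ₃.point = vtx v ∧
      MaintainsHull v (curve v) (lastParam n) (Grow.pos ρ₁) (Grow.body.cost + 1) tr₁ 3 3 4 ∧
      MaintainsHull v (curve (v ∘ Fin.rev)) (lastParam n) (Grow.pos ρ₃) (Grow.body.cost + 1) tr₃
        4 5 6 := by
  have hid : Grow.Order v v id := fun j hj => ⟨hj, rfl⟩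
  have hrev : Grow.Order v (v ∘ Fin.rev) (fun j => n - 1 - j) := fun j hj =>
    ⟨show n - 1 - j < n by omega, vtx_rev v hj⟩
  obtain ⟨tr₁, σ₁, ρ₁, e1, l1, a1, h1, u1, m1⟩ := Grow.exec_passage (v := v) (w := v) (I := id)
    (first := .const 0) (e := .succ (.reg 14)) (by decide) (ρ := inputMem v) (by simp [inputMem])
    (by simp [inputMem]) (inputMem_point v) rfl (fun σ j h => congrArg Nat.succ h) hv hid hn rfl
    (Agree.refl _)
  obtain ⟨tr₂, σ₂, e2, l2, a2⟩ := save.exec_compile a1 (by decide)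
  obtain ⟨u0, -, up⟩ := u1
  have hs : save.den ρ₁ = (ρ₁.setNat 15 (ρ₁.nat 10)).setReal 5 (Grow.pos ρ₁) := rfl
  have hs0 : (save.den ρ₁).nat 0 = n := by
    rw [hs, setReal_nat, setNat_nat, if_neg (by decide), u0 0 (by decide)]
    simp [inputMem]
  obtain ⟨tr₃, σ₃, ρ₃, e3, l3, a3, h3, u3, m3⟩ := Grow.exec_passage (v := v) (w := v ∘ Fin.rev)
    (I := fun j => n - 1 - j) (first := .pred (.reg 0)) (e := .pred (.reg 14)) (by decide)
    (ρ := save.den ρ₁) hs0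
    (by
      rw [hs, setReal_nat, setNat_nat, if_neg (by decide), u0 12 (by decide)]
      simp [inputMem])
    ((show (save.den ρ₁).point = ρ₁.point from rfl).trans (up.trans (inputMem_point v)))
    (congrArg (· - 1) hs0)
    (fun σ j h => by
      show σ.nat 14 - 1 = _
      rw [h]
      omega) (hv.rev hn) hrev hn h1.state.arr_eq a2
  obtain ⟨u0', u5, up'⟩ := u3
  have hsave : save.cost ≤ save.cost * n := Nat.le_mul_of_pos_right _ (by omega)
  refine ⟨tr₁, σ₁, tr₂, σ₂, tr₃, σ₃, ρ₁, ρ₃, e1, e2, e3, ?_, ?_, h3, a3, u0' 15 (by decide), ?_, u5,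
    up'.trans (up.trans (inputMem_point v)), m1 _ _ _ (by simp), m3 _ _ _ (by simp)⟩
  · rw [add_mul, add_mul]
    omega
  · simpa [inputMem] using h1
  · rw [u0' 2 (by decide), hs, setReal_nat, setNat_nat, if_neg (by decide), u0 2 (by decide)]
    simp [inputMem]

lemma decision_den {σ : Mem} (h : σ.nat 9 = 2) : decision.den σ =
    ((((σ.setNat 1 1).setNat 18 (σ.nat 15)).setNat 16 0).setNat 17 (σ.nat 10)).setReal 6 0 := by
  simp [decision, Code.list, Code.den, Cond.Holds, NatExpr.eval, RealExpr.eval, h, setNat_nat]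

lemma decision_den' {σ : Mem} (h : σ.nat 9 ≠ 2) : decision.den σ =
    ((((σ.setNat 1 0).setNat 18 0).setNat 16 0).setNat 17 (σ.nat 10)).setReal 6 0 := by
  simp [decision, Code.list, Code.den, Cond.Holds, NatExpr.eval, RealExpr.eval, h, setNat_nat]

/-- The logs of two passages that both reach the other end are merged. -/
lemma exec_merge {n : ℕ} {v : Fin n → ℂ} (hn : 2 ≤ n) (hv : IsSimpleChain v)
    (hb : ∀ s ∈ Set.Icc 0 (lastParam n), (butterfly v s).Nonempty) {L : ℕ → Entry} {A N : ℕ}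
    (hL : Merge.Logs v L A N) {σ ρ : Mem} (ha : Agree σ ρ) (hp : ρ.point = vtx v)
    (h5 : ρ.real 5 = lastParam n) (h18 : ρ.nat 18 = A) (hlog : ρ.log = L) (h16 : ρ.nat 16 = 0)
    (h17 : ρ.nat 17 = N) (h6 : ρ.real 6 = 0) (h2 : ρ.nat 2 = 0) :
    ∃ tr σ', Exec (.loop (.natLt 16 18) Merge.body.compile) σ tr σ' ∧
      tr.length ≤ (N + 1) * (Merge.body.cost + 1) ∧ σ'.answer = ρ.nat 1 ∧
      σ'.motions.length ≤ 9 * N ∧ ThreadsBy v σ'.motions := by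
  obtain ⟨θ, φ, hθ, hφ⟩ := exists_bisector hn hv hb
  obtain ⟨tr, σ', ρ', he, hl, ha', h1, hm, hnot⟩ := Merge.Merging.exec (θ := θ) (φ := φ) hn
    ⟨hv, hb, hθ, hφ⟩ hL (Merge.Merging.init hn hL hp h5 h18 hlog h16 h17 h6 h2) ha
  refine ⟨tr, σ', he, hl, (ha'.nat 1 (by decide)).trans h1, ?_⟩
  rw [ha'.motions]
  exact hm.threadsBy hn hθ (fun s hs => exists_wedge_of_bisector hn hv hb hφ hs) hL hnot

end Threading

open Threading

theorem mainTheorem4 :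
    ∃ (P : Threading.Prog) (K : ℕ), ∀ (n : ℕ) (v : Fin n → ℂ), 2 ≤ n →
      Threading.IsSimpleChain v →
      ∃ (tr : List Threading.Mem) (σ : Threading.Mem),
        Threading.Exec P (Threading.inputMem v) tr σ ∧
        tr.length ≤ K * n ∧
        (Threading.Threadable (Threading.chainSet v) → σ.answer = 1) ∧
        (¬ Threading.Threadable (Threading.chainSet v) → σ.answer = 0) ∧
        (∃ S₁ S₂ : ℝ,
          Threading.MaintainsHull v (Threading.curve v)
            (Threading.lastParam n) S₁ K tr 3 3 4 ∧
          Threading.MaintainsHull v (fun s => Threading.curve v (Threading.lastParam n - s))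
            (Threading.lastParam n) S₂ K tr 4 5 6 ∧
          (σ.answer = 1 ↔ S₁ = Threading.lastParam n ∧ S₂ = Threading.lastParam n)) ∧
        (Threading.Threadable (Threading.chainSet v) →
          σ.motions.length ≤ K * n ∧ Threading.ThreadsBy v σ.motions) := by
  refine ⟨threading, threadingCost, fun n v hn hv => ?_⟩
  obtain ⟨tr₁, σ₁, tr₂, σ₂, tr₃, σ₃, ρ₁, ρ₃, e1, e2, e3, hlen, h1, h3, a3, h15, h2, h5, hp, m1, m3⟩ :=
    exec_passages hn hv
  obtain ⟨tr₄, σ₄, e4, l4, a4⟩ := decision.exec_compile a3 (by decide)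
  have hN : ρ₃.nat 10 ≤ 5 * n := by
    have := h1.budget
    have := h3.budget
    omega
  have hb : Threadable (chainSet v) ↔ ρ₃.nat 9 = 2 := by
    constructor
    · intro h
      have c1 := h1.complete fun s hs => h.butterfly_nonempty hn hv hs
      have c3 := h3.complete fun s hs => by
        have hs' : lastParam n - s ∈ Set.Icc 0 (lastParam n) :=
          ⟨by linarith [hs.2], by linarith [hs.1]⟩
        obtain ⟨θ, hθ⟩ := h.butterfly_nonempty hn hv hs'
        have := mem_butterfly_rev hn hs' hθ
        rw [sub_sub_cancel] at this
        exact ⟨_, this⟩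
      omega
    · intro h
      have o1 := h1.outcome
      have o3 := h3.outcome
      have c1 : ρ₁.nat 9 = 0 + 1 := by omega
      have c3 : ρ₃.nat 9 = ρ₁.nat 9 + 1 := by omega
      exact threadable_of_butterfly_nonempty hn hv fun s hs =>
        butterfly_nonempty_of_leavesHulls hn hv (h1.leavesHulls c1) (h3.leavesHulls c3) hs
  have hpos : ρ₃.nat 9 = 2 ↔ Grow.pos ρ₁ = lastParam n ∧ Grow.pos ρ₃ = lastParam n := by
    rw [h1.pos_eq_iff, h3.pos_eq_iff]
    have o1 := h1.outcome
    have o3 := h3.outcome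
    omega
  have hloop : ∃ tr σ', Exec (.loop (.natLt 16 18) Merge.body.compile) σ₄ tr σ' ∧
      tr.length ≤ (5 * n + 1) * (Merge.body.cost + 1) ∧
      σ'.answer = (if ρ₃.nat 9 = 2 then 1 else 0) ∧
      (ρ₃.nat 9 = 2 → σ'.motions.length ≤ 9 * (5 * n) ∧ ThreadsBy v σ'.motions) := by
    by_cases h9 : ρ₃.nat 9 = 2
    · have hT := hb.2 h9
      obtain ⟨p1, p3⟩ := hpos.1 h9
      have hL : Merge.Logs v ρ₃.log (ρ₁.nat 10) (ρ₃.nat 10) := by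
        have b3 := h3.state.log
        have b1 := h1.state.log.congr b3.old
        rw [show ρ₁.real 0 + ρ₁.real 1 = lastParam n from p1] at b1
        have b3' := b3.congr (L' := ρ₃.log) fun _ _ => rfl
        rw [show ρ₃.real 0 + ρ₃.real 1 = lastParam n from p3] at b3'
        exact ⟨b1, b3'⟩
      rw [decision_den h9] at a4
      obtain ⟨tr, σ', he, hl, k1, k2, k3⟩ := exec_merge hn hv
        (fun s hs => hT.butterfly_nonempty hn hv hs) hL a4 hp
        (by simpa [setReal_real, setNat_real] using h5.trans p1)
        (by simpa [setReal_nat, setNat_nat] using h15) rfl (by simp [setReal_nat, setNat_nat])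
        (by simp [setReal_nat, setNat_nat]) (by simp [setReal_real])
        (by simpa [setReal_nat, setNat_nat] using h2)
      refine ⟨tr, σ', he, hl.trans (Nat.mul_le_mul_right _ (by omega)), ?_, fun _ =>
        ⟨k2.trans (Nat.mul_le_mul_left _ hN), k3⟩⟩
      simp [k1, h9, setReal_nat, setNat_nat]
    · rw [decision_den' h9] at a4
      obtain ⟨tr, σ', he, hl, ha, -⟩ := exec_loop Merge.body_valid (a := 16) (b := 18) (by decide)
        (by decide) 0 a4 (fun j hj => absurd hj (Nat.not_lt_zero j))
        (by simp [setReal_nat, setNat_nat])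
      refine ⟨tr, σ', he, hl.trans (Nat.mul_le_mul_right _ (by omega)), ?_, fun h => absurd h h9⟩
      rw [if_neg h9]
      exact (ha.nat 1 (by decide)).trans (by simp [setReal_nat, setNat_nat])
  obtain ⟨tr₅, σ₅, e5, l5, hans, hmot⟩ := hloop
  refine ⟨tr₁ ++ (tr₂ ++ (tr₃ ++ (tr₄ ++ tr₅))), σ₅, .seq e1 (.seq e2 (.seq e3 (.seq e4 e5))), ?_,
    fun h => ?_, fun h => ?_, ⟨Grow.pos ρ₁, Grow.pos ρ₃, ?_, ?_, ?_⟩, fun h => ?_⟩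
  · simp only [List.length_append]
    exact threadingCost_bound (by omega) hlen l4 l5
  · rw [hans, if_pos (hb.1 h)]
  · rw [hans, if_neg fun h9 => h (hb.2 h9)]
  · exact m1.embed le_threadingCost.1 [] _
  · have := (m3.congr h3.pos_mem.1 h3.pos_mem.2 fun s hs => curve_rev hn v hs).embed le_threadingCost.1
      (tr₁ ++ tr₂) (tr₄ ++ tr₅)
    simpa only [List.append_assoc] using this
  · rw [hans, ← hpos]
    split_ifs with h9 <;> simp [h9]
  · obtain ⟨k1, k2⟩ := hmot (hb.1 h)
    refine ⟨k1.trans ?_, k2⟩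
    rw [← mul_assoc]
    exact Nat.mul_le_mul_right n le_threadingCost.2
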